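/- \textbf{Setting.} Let $f,\mathbf h\in\mathbb C[x,y,z]$ and $\tilde f_1,\tilde f_2\in\mathbb C[X,Y,Z,W]$ be given by one of the following rows, with positive integer parameters ($e\ge 2$ in type IIA). The last column is a system of weights $\omega$ of $(X,Y,Z,W)$ for which $\tilde f_1,\tilde f_2$ are weighted homogeneous. IIA: $f=x^3+xy^{2e}+z^p$; $\mathbf h=-y^{e+1}z+z^p+x^3+x^2y^e$; $(XY-W^2,\ XW+Y^e+Z^p)$; $\omega=(p(2e-1),3p,3e,p(e+1))$. IIB: $f=x^{2p}+y^2+yz^q$; $\mathbf h=-x^{p+1}z+y^2+yz^q+x^pz^q$; $(XY-W^2,\ X^p+YZ+Z^q)$; $\omega=(2q,2p(q-1),2p,pq+q-p)$. IIB$^\sharp$: $f=x^{2p}+y^2+yz^q$; $\mathbf h=-x^{p+1}z+y^2+yz^q+x^py$; $(XY-ZW,\ X^p+YW+Z^q)$; $\omega=(2q,pq+p-q,2p,pq+q-p)$. III: $f=x^3y+xy^{2e+1}+z^p$; $\mathbf h=-y^{e+1}z+z^p+x^3y+x^2y^{e+1}$; $(XY-W^2,\ (X+Y^e)W+Z^p)$;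 $\omega=(2ep,2p,3e+1,(e+1)p)$. IV$_1$: $f=x^3+xy^{2e}+yz^q$; $\mathbf h=-y^{e+1}z+x^3+yz^q+x^2y^e$; $(XY-W^2,\ XW+Y^eZ+Z^q)$; $\omega=((2e-1)q+1,3(q-1),3e,eq+q-1)$. IV$_2$: $f=x^{2e+1}+xy^2+yz^q$; $\mathbf h=-x^{e+1}z+xy^2+yz^q+x^ez^q$; $(XY-W^2,\ X^eW+YZ+Z^q)$; $\omega=(q+1,(2e+1)(q-1),2e+1,eq+q-e)$. IV$_2^\sharp$: $f=x^{2e+1}+xy^2+yz^q$; $\mathbf h=-x^{e+1}z+xy^2+yz^q+x^{e+1}y$; $(XY-ZW,\ X^eW+YW+Z^q)$; $\omega=(q+1,e(q+1),2e+1,eq+q-e)$. For a polynomial in $n$ variables whose $n$ exponent vectors are the rows of an integer matrix $E$, ordered so that $d:=\det E>0$, the canonical system of weights $(w_1,\dots,w_n;d)$ is the solution of $Ew=d(1,\dots,1)^T$. A system of weights is reduced if $\gcd(w_1,\dots,w_n)=1$. Let $(w_1,w_2,w_3;d)$ be the canonical system of $f$, let $G_f\subset(\mathbb C^*)^3$ be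 the group of diagonal transformations fixing every monomial of $f$, and let $G_0\subset G_f$ be generated by $(e^{2\pi i w_1/d},e^{2\pi i w_2/d},e^{2\pi i w_3/d})$. Assume $[G_f:G_0]=2$ and $d-w_1-w_2-w_3>0$. \textbf{Gabrielov numbers.} A triple $(\gamma_1,\gamma_2,\gamma_3)$ is the triple of Gabrielov numbers of $\mathbf h$ if a holomorphic change of coordinates at $0\in\mathbb C^3$ transforms $\mathbf h-xyz$, up to a nonzero constant factor, into $x^{\gamma_1}+y^{\gamma_2}+z^{\gamma_3}-xyz$. The numbers $(\gamma_1,\gamma_2;\gamma_3,\gamma_4)$ are the Gabrielov numbers of $(\tilde f_1,\tilde f_2)$ if, after a holomorphic change of coordinates at $0\in\mathbb C^4$, the germ $\tilde f_1=\tilde f_2-ZW=0$ is given by the equations $XY-Z^{\gamma_1}-W^{\gamma_2}=0$, $X^{\gamma_3}+Y^{\gamma_4}-ZW=0$ (the two pairs of equations differ by an invertible $2\times2$ matrix of holomorphic germs). \textbf{Dolgachev numbers.} An orbit of a $\mathbb C^*$-action is exceptional if its isotropy group is nontrivial. The Dolgachev numbers $(\alpha_1,\alpha_2,\alpha_3)$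 of $(\tilde f_1,\tilde f_2)$ are the orders of the isotropy groups of the exceptional orbits in $\{\tilde f_1=\tilde f_2=0\}\setminus\{0\}$, exactly three in number, of the $\mathbb C^*$-action given by its reduced system of weights. Let $\Delta$ be the convex hull of $0$ and the exponents of $\mathbf h$. If $\Delta$ has exactly two 2-dimensional faces not containing $0$, let $\mathbf h_1,\mathbf h_2$ be the sums of the terms of $\mathbf h$ on them, numbered so that the canonical system of weights of $\mathbf h_2$ is a system of weights of $f$. Let $\mathbb C^*$ act on $V_i=\{\mathbf h_i=0\}$ by the canonical system of weights of $\mathbf h_i$. If $V_i$ contains a coordinate hyperplane, the principal orbits are the exceptional orbits in $V_i\setminus\{0\}$ outside it; otherwise they are the exceptional orbits in $V_i\setminus\{0\}$ outside the singular locus of $V_i$. The Dolgachev numbers $(\alpha_1,\alpha_2;\alpha_3,\alpha_4)$ of $\mathbf h$ are the orders of the isotropy groups of the principal orbits of $\mathbf h_1$ (exactly two, giving $\alpha_1,\alpha_2$) and of $\mathbf h_2$ (exactly two, giving $\alpha_3,\alpha_4$). Dolgachev numbers are taken up to order within $\{\alpha_1,\alpha_2,\alpha_3\}$, respectively within $\{\alpha_1,\alpha_2\}$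 and within $\{\alpha_3,\alpha_4\}$. \textbf{Theorem.} (1) If the system of weights $\omega$ is reduced, then the Gabrielov numbers of $\mathbf h$ and the Dolgachev numbers of $(\tilde f_1,\tilde f_2)$ exist and coincide. (2) If the canonical systems of weights of the parts of $\mathbf h$ on the faces of $\Delta$ not containing $0$ are reduced, then the Gabrielov numbers $(\gamma_1,\gamma_2;\gamma_3,\gamma_4)$ of $(\tilde f_1,\tilde f_2)$ and the Dolgachev numbers $(\alpha_1,\alpha_2;\alpha_3,\alpha_4)$ of $\mathbf h$ exist and coincide. -/

import Mathlib

open MvPolynomial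

noncomputable section

/-! ### Weights, symmetry groups, Newton polytope -/

/-- `(w; d)` is a system of weights of `p`: the weights are positive integers and `p` is weighted
homogeneous of degree `d`. -/
def IsWeights {n : ℕ} (p : MvPolynomial (Fin n) ℂ) (w : Fin n → ℕ) (d : ℕ) : Prop :=
  (∀ i, 0 < w i) ∧ IsWeightedHomogeneous w p d

/-- A system of weights is reduced if its greatest common divisor is one.  (The degree of a
non-constant weighted homogeneous polynomial is a combination of the weights, so it need not
be listed.) -/
def IsReducedWeights {n : ℕ} (w : Fin n → ℕ) : Prop := Finset.univ.gcd w = 1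

/-- `(w; d)` is the canonical system of weights of the invertible polynomial `p`: the monomials of
`p` are the rows of an `n × n` matrix `E` (ordered so that `det E > 0`), `d = det E`, and `w` is
the solution of `E w = d • (1, …, 1)`. -/
def IsCanonicalWeights {n : ℕ} (p : MvPolynomial (Fin n) ℂ) (w : Fin n → ℕ) (d : ℕ) : Prop :=
  ∃ E : Matrix (Fin n) (Fin n) ℕ,
    (∀ m : Fin n →₀ ℕ, m ∈ p.support ↔ ∃ i, ∀ j, m j = E i j) ∧
    0 < d ∧ (E.map (Nat.cast : ℕ → ℤ)).det = d ∧ ∀ i, ∑ j, E i j * w j = d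

/-- The group `G_p` of diagonal transformations fixing every monomial of `p`. -/
def diagonalSymmetries {n : ℕ} (p : MvPolynomial (Fin n) ℂ) : Subgroup (Fin n → ℂˣ) where
  carrier := {t | ∀ m ∈ p.support, ∏ j, t j ^ m j = 1}
  one_mem' := by intro m _; simp
  mul_mem' := by
    intro s t hs ht m hm
    simp only [Pi.mul_apply, mul_pow, Finset.prod_mul_distrib]
    rw [hs m hm, ht m hm, one_mul]
  inv_mem' := by
    intro t ht m hm
    simp only [Pi.inv_apply, inv_pow, Finset.prod_inv_distrib]
    rw [ht m hm, inv_one]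

/-- The exponential grading operator `(exp (2πi w₁/d), …, exp (2πi wₙ/d))`. -/
def gradingOperator {n : ℕ} (w : Fin n → ℕ) (d : ℕ) : Fin n → ℂˣ := fun j =>
  Units.mk0 (Complex.exp (2 * Real.pi * Complex.I * ((w j : ℂ) / (d : ℂ)))) (Complex.exp_ne_zero _)

/-- The exponent of a monomial as a point of `ℝⁿ`. -/
def exponentPoint {n : ℕ} (m : Fin n →₀ ℕ) : Fin n → ℝ := fun j => (m j : ℝ)

/-- The Newton polytope at infinity: the convex hull of the support together with the origin. -/
def newtonPolytope {n : ℕ} (p : MvPolynomial (Fin n) ℂ) : Set (Fin n → ℝ) :=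
  convexHull ℝ (insert 0 (exponentPoint '' (p.support : Set (Fin n →₀ ℕ))))

/-- `F` is a face of codimension one of the Newton polytope at infinity that does not contain the
origin.  A supporting hyperplane of such a face misses the origin, where the polytope lies, so it
is `{q | u ⬝ q = 1}` for some `u` with `u ⬝ q ≤ 1` on the polytope; a subset of this hyperplane
has dimension `n - 1` exactly if it spans `ℝⁿ`. -/
def IsOuterFacet {n : ℕ} (p : MvPolynomial (Fin n) ℂ) (F : Set (Fin n → ℝ)) : Prop :=
  ∃ u : Fin n → ℝ, (∀ q ∈ newtonPolytope p, ∑ j, u j * q j ≤ 1) ∧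
    F = {q ∈ newtonPolytope p | ∑ j, u j * q j = 1} ∧ Submodule.span ℝ F = ⊤

open Classical in
/-- The sum of those terms of `p` whose exponents lie on `F`. -/
def facePart {n : ℕ} (p : MvPolynomial (Fin n) ℂ) (F : Set (Fin n → ℝ)) :
    MvPolynomial (Fin n) ℂ :=
  ∑ m ∈ p.support with exponentPoint m ∈ F, monomial m (coeff m p)

/-! ### `ℂ*`-actions, exceptional orbits and Dolgachev numbers -/

/-- The action `t • (x₁, …, xₙ) = (t ^ w₁ x₁, …, t ^ wₙ xₙ)` of `ℂ*` on `ℂⁿ`. -/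
def weightAct {n : ℕ} (w : Fin n → ℕ) (t : ℂˣ) (x : Fin n → ℂ) : Fin n → ℂ :=
  fun j => (t : ℂ) ^ w j * x j

/-- The orbit of a point under the action with weights `w`. -/
def weightOrbit {n : ℕ} (w : Fin n → ℕ) (x : Fin n → ℂ) : Set (Fin n → ℂ) :=
  {y | ∃ t : ℂˣ, y = weightAct w t x}

/-- The isotropy group of a point under the action with weights `w`. -/
def isotropyGroup {n : ℕ} (w : Fin n → ℕ) (x : Fin n → ℂ) : Subgroup ℂˣ where
  carrier := {t | weightAct w t x = x}
  one_mem' := by ext j; simp [weightAct]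
  mul_mem' := by
    intro s t hs ht
    ext j
    have h1 := congrFun hs j
    have h2 := congrFun ht j
    simp only [weightAct] at h1 h2 ⊢
    rw [Units.val_mul, mul_pow, mul_assoc, h2, h1]
  inv_mem' := by
    intro t ht
    ext j
    have h1 := congrFun ht j
    simp only [weightAct] at h1 ⊢
    nth_rewrite 1 [← h1]
    rw [← mul_assoc, ← mul_pow]
    simp

/-- The invariant set `S` contains exactly `k` exceptional orbits (orbits with non-trivial
isotropy group), and the orders of their isotropy groups are `α 0, …, α (k - 1)`, in some order. -/
def HasExceptionalOrders {n k : ℕ} (w : Fin n → ℕ) (S : Set (Fin n → ℂ)) (α : Fin k → ℕ) : Prop :=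
  ∃ x : Fin k → (Fin n → ℂ),
    (∀ i, x i ∈ S ∧ isotropyGroup w (x i) ≠ ⊥ ∧ Nat.card (isotropyGroup w (x i)) = α i) ∧
    (∀ i j, weightOrbit w (x i) = weightOrbit w (x j) → i = j) ∧
    (∀ y ∈ S, isotropyGroup w y ≠ ⊥ → ∃ i, y ∈ weightOrbit w (x i))

/-- `α` lists the Dolgachev numbers of the weighted homogeneous pair `(f₁, f₂)` in `ℂ⁴`: the orders
of the three isotropic points of the quotient of `{f₁ = f₂ = 0} \ {0}` by the `ℂ*`-action with the
reduced system of weights. -/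
def PairHasDolgachevNumbers (f₁ f₂ : MvPolynomial (Fin 4) ℂ) (α : Fin 3 → ℕ) : Prop :=
  ∃ (w : Fin 4 → ℕ) (d₁ d₂ : ℕ), IsReducedWeights w ∧ IsWeights f₁ w d₁ ∧ IsWeights f₂ w d₂ ∧
    HasExceptionalOrders w {x | x ≠ 0 ∧ eval x f₁ = 0 ∧ eval x f₂ = 0} α

/-- The hypersurface `{p = 0}` contains the coordinate hyperplane `{x j = 0}`. -/
def ContainsHyperplane {n : ℕ} (p : MvPolynomial (Fin n) ℂ) (j : Fin n) : Prop :=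
  ∀ x : Fin n → ℂ, x j = 0 → eval x p = 0

/-- The points of `{p = 0}` on which principal exceptional orbits may lie: if the hypersurface
contains a coordinate hyperplane, the points outside it, and otherwise the points outside the
singular locus. -/
def principalPart {n : ℕ} (p : MvPolynomial (Fin n) ℂ) : Set (Fin n → ℂ) :=
  {x | x ≠ 0 ∧ eval x p = 0 ∧
    (∀ j, ContainsHyperplane p j → x j ≠ 0) ∧
    ((¬ ∃ j, ContainsHyperplane p j) → ∃ i, eval x (pderiv i p) ≠ 0)}

/-- `(α₁, α₂; α₃, α₄)` are the Dolgachev numbers of `h`, where `f` is the invertible polynomial to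
which `h` belongs.  The Newton polytope at infinity of `h` has exactly two faces `F₁`, `F₂` that do
not contain the origin; the canonical system of weights of the part of `h` on `F₂` is a system of
weights of `f`; `α₁, α₂` (respectively `α₃, α₄`) are the orders of the isotropy groups of the
principal exceptional orbits of the part of `h` on `F₁` (respectively `F₂`). -/
def HasDolgachevNumbers (f h : MvPolynomial (Fin 3) ℂ) (α : Fin 4 → ℕ) : Prop :=
  ∃ (F₁ F₂ : Set (Fin 3 → ℝ)) (w₁ w₂ : Fin 3 → ℕ) (d₁ d₂ : ℕ),
    F₁ ≠ F₂ ∧ (∀ F, IsOuterFacet h F ↔ F = F₁ ∨ F = F₂) ∧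
    IsCanonicalWeights (facePart h F₁) w₁ d₁ ∧ IsWeights (facePart h F₁) w₁ d₁ ∧
    IsCanonicalWeights (facePart h F₂) w₂ d₂ ∧ IsWeights (facePart h F₂) w₂ d₂ ∧
    IsWeights f w₂ d₂ ∧
    HasExceptionalOrders w₁ (principalPart (facePart h F₁)) ![α 0, α 1] ∧
    HasExceptionalOrders w₂ (principalPart (facePart h F₂)) ![α 2, α 3]

/-! ### Gabrielov numbers -/

/-- The germ of `Φ` at the origin is a holomorphic change of coordinates fixing the origin. -/
def IsCoordinateChange {n : ℕ} (Φ : (Fin n → ℂ) → (Fin n → ℂ)) : Prop :=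
  AnalyticAt ℂ Φ 0 ∧ Φ 0 = 0 ∧ Function.Bijective (fderiv ℂ Φ 0)

/-- `(γ₁, γ₂, γ₃)` are Gabrielov numbers of `h`: a holomorphic change of coordinates at the origin
transforms `h - xyz`, up to a non-zero constant factor, into `x ^ γ₁ + y ^ γ₂ + z ^ γ₃ - xyz`. -/
def HasGabrielovNumbers (h : MvPolynomial (Fin 3) ℂ) (γ : Fin 3 → ℕ) : Prop :=
  ∃ (Φ : (Fin 3 → ℂ) → (Fin 3 → ℂ)) (c : ℂ), IsCoordinateChange Φ ∧ c ≠ 0 ∧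
    ∀ᶠ v in nhds (0 : Fin 3 → ℂ),
      eval (Φ v) (h - X 0 * X 1 * X 2) =
        c * (v 0 ^ γ 0 + v 1 ^ γ 1 + v 2 ^ γ 2 - v 0 * v 1 * v 2)

/-- `(γ₁, γ₂; γ₃, γ₄)` are Gabrielov numbers of the pair `(f₁, f₂)`; the variables are
`(X, Y, Z, W)`.  After a holomorphic change of coordinates at the origin, the germ
`f₁ = f₂ - ZW = 0` is given by `XY - Z ^ γ₁ - W ^ γ₂ = X ^ γ₃ + Y ^ γ₄ - ZW = 0`, that is, the two
pairs of equations differ by an invertible matrix of holomorphic germs. -/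
def PairHasGabrielovNumbers (f₁ f₂ : MvPolynomial (Fin 4) ℂ) (γ : Fin 4 → ℕ) : Prop :=
  ∃ (Φ : (Fin 4 → ℂ) → (Fin 4 → ℂ)) (M : (Fin 4 → ℂ) → Matrix (Fin 2) (Fin 2) ℂ),
    IsCoordinateChange Φ ∧ (∀ i j, AnalyticAt ℂ (fun v => M v i j) 0) ∧ (M 0).det ≠ 0 ∧
    ∀ᶠ v in nhds (0 : Fin 4 → ℂ),
      ![eval (Φ v) f₁, eval (Φ v) (f₂ - X 2 * X 3)] =
        (M v).mulVec
          ![v 0 * v 1 - v 2 ^ γ 0 - v 3 ^ γ 1, v 0 ^ γ 2 + v 1 ^ γ 3 - v 2 * v 3]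

/-! ### The virtual singularities and their duals -/

/-- The seven types of virtual singularities with their integer parameters.  In terms of the
customary exponents the parameters are: `IIA p e`: `p₁ = p`, `p₂ = 3`, `p₃ = 6e`;
`IIB p q` and `IIBsharp p q`: `p₁ = 2p`, `p₂ = 2`, `p₃ = 2q`; `III p e`: `p₁ = p`, `q₂ = 2`,
`q₃ = 2e`; `IV1 e q`: `p₁ = 3`, `p₂ = 6e`, `p₃ = 6eq`; `IV2 e q` and `IV2sharp e q`:
`p₁ = 2e + 1`, `p₂ = 2p₁`, `p₃ = 2p₁q`. -/
inductive VirtualType where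
  | IIA (p e : ℕ)
  | IIB (p q : ℕ)
  | IIBsharp (p q : ℕ)
  | III (p e : ℕ)
  | IV1 (e q : ℕ)
  | IV2 (e q : ℕ)
  | IV2sharp (e q : ℕ)

namespace VirtualType

/-- The parameters are positive; for `IIA`, moreover `e ≥ 2` (for `e = 1` the part of `h` on the
first face has an isolated singularity). -/
def ParametersValid : VirtualType → Prop
  | IIA p e => 1 ≤ p ∧ 2 ≤ e
  | IIB p q => 1 ≤ p ∧ 1 ≤ q
  | IIBsharp p q => 1 ≤ p ∧ 1 ≤ q
  | III p e => 1 ≤ p ∧ 1 ≤ e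
  | IV1 e q => 1 ≤ e ∧ 1 ≤ q
  | IV2 e q => 1 ≤ e ∧ 1 ≤ q
  | IV2sharp e q => 1 ≤ e ∧ 1 ≤ q

/-- The invertible polynomial `f(x, y, z)`. -/
def f : VirtualType → MvPolynomial (Fin 3) ℂ
  | IIA p e => X 0 ^ 3 + X 0 * X 1 ^ (2 * e) + X 2 ^ p
  | IIB p q => X 0 ^ (2 * p) + X 1 ^ 2 + X 1 * X 2 ^ q
  | IIBsharp p q => X 0 ^ (2 * p) + X 1 ^ 2 + X 1 * X 2 ^ q
  | III p e => X 0 ^ 3 * X 1 + X 0 * X 1 ^ (2 * e + 1) + X 2 ^ p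
  | IV1 e q => X 0 ^ 3 + X 0 * X 1 ^ (2 * e) + X 1 * X 2 ^ q
  | IV2 e q => X 0 ^ (2 * e + 1) + X 0 * X 1 ^ 2 + X 1 * X 2 ^ q
  | IV2sharp e q => X 0 ^ (2 * e + 1) + X 0 * X 1 ^ 2 + X 1 * X 2 ^ q

/-- The polynomial `h(x, y, z)` defining the virtual singularity. -/
def h : VirtualType → MvPolynomial (Fin 3) ℂ
  | IIA p e => -(X 1 ^ (e + 1) * X 2) + X 2 ^ p + X 0 ^ 3 + X 0 ^ 2 * X 1 ^ e
  | IIB p q => -(X 0 ^ (p + 1) * X 2) + X 1 ^ 2 + X 1 * X 2 ^ q + X 0 ^ p * X 2 ^ q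
  | IIBsharp p q => -(X 0 ^ (p + 1) * X 2) + X 1 ^ 2 + X 1 * X 2 ^ q + X 0 ^ p * X 1
  | III p e =>
      -(X 1 ^ (e + 1) * X 2) + X 2 ^ p + X 0 ^ 3 * X 1 + X 0 ^ 2 * X 1 ^ (e + 1)
  | IV1 e q => -(X 1 ^ (e + 1) * X 2) + X 0 ^ 3 + X 1 * X 2 ^ q + X 0 ^ 2 * X 1 ^ e
  | IV2 e q => -(X 0 ^ (e + 1) * X 2) + X 0 * X 1 ^ 2 + X 1 * X 2 ^ q + X 0 ^ e * X 2 ^ q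
  | IV2sharp e q =>
      -(X 0 ^ (e + 1) * X 2) + X 0 * X 1 ^ 2 + X 1 * X 2 ^ q + X 0 ^ (e + 1) * X 1

/-- The first equation of the dual complete intersection, in the variables `(X, Y, Z, W)`. -/
def dual₁ : VirtualType → MvPolynomial (Fin 4) ℂ
  | IIBsharp _ _ => X 0 * X 1 - X 2 * X 3
  | IV2sharp _ _ => X 0 * X 1 - X 2 * X 3
  | _ => X 0 * X 1 - X 3 ^ 2

/-- The second equation of the dual complete intersection, in the variables `(X, Y, Z, W)`. -/
def dual₂ : VirtualType → MvPolynomial (Fin 4) ℂ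
  | IIA p e => X 0 * X 3 + X 1 ^ e + X 2 ^ p
  | IIB p q => X 0 ^ p + X 1 * X 2 + X 2 ^ q
  | IIBsharp p q => X 0 ^ p + X 1 * X 3 + X 2 ^ q
  | III p e => (X 0 + X 1 ^ e) * X 3 + X 2 ^ p
  | IV1 e q => X 0 * X 3 + X 1 ^ e * X 2 + X 2 ^ q
  | IV2 e q => X 0 ^ e * X 3 + X 1 * X 2 + X 2 ^ q
  | IV2sharp e q => X 0 ^ e * X 3 + X 1 * X 3 + X 2 ^ q

/-- The system of weights of `(X, Y, Z, W)` for the dual complete intersection, normalized so that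
the degrees of its two equations are the canonical degrees of the two face parts of `h`. -/
def dualWeights : VirtualType → Fin 4 → ℕ
  | IIA p e => ![p * (2 * e - 1), 3 * p, 3 * e, p * (e + 1)]
  | IIB p q => ![2 * q, 2 * p * (q - 1), 2 * p, p * q + q - p]
  | IIBsharp p q => ![2 * q, p * q + p - q, 2 * p, p * q + q - p]
  | III p e => ![2 * e * p, 2 * p, 3 * e + 1, (e + 1) * p]
  | IV1 e q => ![(2 * e - 1) * q + 1, 3 * (q - 1), 3 * e, e * q + q - 1]
  | IV2 e q => ![q + 1, (2 * e + 1) * (q - 1), 2 * e + 1, e * q + q - e]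
  | IV2sharp e q => ![q + 1, e * (q + 1), 2 * e + 1, e * q + q - e]

/-- The standing assumptions on a virtual singularity: `[G_f : G₀] = 2`, where `G₀` is generated by
the exponential grading operator, and the Gorenstein parameter `d - w₁ - w₂ - w₃` of `f` is
positive (its sign does not depend on the normalization of the weights). -/
def IsAdmissible (c : VirtualType) : Prop :=
  c.ParametersValid ∧
    ∃ (w : Fin 3 → ℕ) (d : ℕ), IsCanonicalWeights c.f w d ∧ IsWeights c.f w d ∧
      (Subgroup.zpowers (gradingOperator w d)).relIndex (diagonalSymmetries c.f) = 2 ∧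
      w 0 + w 1 + w 2 < d

end VirtualType

end

noncomputable section

/-! ### Analytic implicit functions -/

open scoped ContDiff in
theorem exists_analytic_implicit {E U W : Type*} [NormedAddCommGroup E] [NormedSpace ℂ E]
    [CompleteSpace E] [NormedAddCommGroup U] [NormedSpace ℂ U] [FiniteDimensional ℂ U]
    [NormedAddCommGroup W] [NormedSpace ℂ W] [FiniteDimensional ℂ W]
    (hdim : Module.finrank ℂ U = Module.finrank ℂ W)
    {f : E × U → W} {v₀ : E} {u₀ : U} (hf : AnalyticAt ℂ f (v₀, u₀)) (h0 : f (v₀, u₀) = 0)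
    (L : U → W) (hL : ∀ h, HasDerivAt (fun t : ℂ => f (v₀, u₀ + t • h)) (L h) 0)
    (hinj : ∀ h, L h = 0 → h = 0) :
    ∃ u : E → U, AnalyticAt ℂ u v₀ ∧ u v₀ = u₀ ∧ ∀ᶠ v in nhds v₀, f (v, u v) = 0 := by
  have : CompleteSpace U := FiniteDimensional.complete ℂ U
  have : CompleteSpace W := FiniteDimensional.complete ℂ W
  have cdf : ContDiffAt ℂ ω f (v₀, u₀) := hf.contDiffAt
  have pn : (ω : WithTop ℕ∞) ≠ 0 := by simp
  set D : U →L[ℂ] W := fderiv ℂ f (v₀, u₀) ∘L .inr ℂ E U with hD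
  have hDL : ∀ h, D h = L h := by
    intro h
    have h1 : HasDerivAt (fun t : ℂ => ((v₀, u₀ + t • h) : E × U)) ((0, h) : E × U) 0 := by
      have h2 : HasDerivAt (fun t : ℂ => u₀ + t • h) h 0 := by
        simpa using ((hasDerivAt_id (0 : ℂ)).smul_const h).const_add u₀
      exact (hasDerivAt_const (0 : ℂ) v₀).prodMk h2
    have h3 : HasFDerivAt f (fderiv ℂ f (v₀, u₀)) (v₀, u₀ + (0 : ℂ) • h) := by
      simpa using hf.differentiableAt.hasFDerivAt
    have h4 := h3.comp_hasDerivAt (0 : ℂ) h1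
    have := h4.unique (hL h)
    simpa [hD] using this
  have hker : Function.Injective D := by
    rw [injective_iff_map_eq_zero]
    intro h hh
    exact hinj h (by rw [← hDL, hh])
  have hbij : Function.Bijective (D : U →ₗ[ℂ] W) :=
    ⟨hker, (LinearMap.injective_iff_surjective_of_finrank_eq_finrank hdim).1 hker⟩
  have hinv : D.IsInvertible :=
    ⟨(LinearEquiv.ofBijective (D : U →ₗ[ℂ] W) hbij).toContinuousLinearEquiv, by ext; rfl⟩
  refine ⟨cdf.implicitFunction pn hinv, (cdf.contDiffAt_implicitFunction pn hinv).analyticAt,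
    cdf.implicitFunction_apply_self pn hinv, ?_⟩
  filter_upwards [cdf.eventually_apply_implicitFunction pn hinv] with v hv
  rw [hv, h0]

/-! ### Coordinate changes -/

theorem hasFDerivAt_mulVec_self {m n : ℕ} {a : (Fin n → ℂ) → Matrix (Fin m) (Fin n) ℂ}
    (ha : ∀ i j, AnalyticAt ℂ (fun v => a v i j) 0) :
    HasFDerivAt (fun v => (a v).mulVec v) (Matrix.mulVecLin (a 0)).toContinuousLinearMap 0 := by
  rw [hasFDerivAt_pi']
  intro i
  have h1 : ∀ j, HasFDerivAt (fun v : Fin n → ℂ => a v i j * v j)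
      (a 0 i j • (ContinuousLinearMap.proj j : (Fin n → ℂ) →L[ℂ] ℂ)) 0 := by
    intro j
    have h2 := (ha i j).differentiableAt.hasFDerivAt.mul
      (ContinuousLinearMap.proj (R := ℂ) (φ := fun _ : Fin n => ℂ) j).hasFDerivAt
    convert! h2 using 1
    ext v
    simp
  have h3 := HasFDerivAt.fun_sum (u := Finset.univ) fun j _ => h1 j
  convert! h3 using 1
  ext v
  simp [Matrix.mulVec, dotProduct]

theorem isCoordinateChange_mulVec {n : ℕ} {a : (Fin n → ℂ) → Matrix (Fin n) (Fin n) ℂ}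
    (ha : ∀ i j, AnalyticAt ℂ (fun v => a v i j) 0) (hdet : (a 0).det ≠ 0) :
    IsCoordinateChange fun v => (a v).mulVec v := by
  refine ⟨?_, by simp, ?_⟩
  · rw [analyticAt_pi_iff]
    intro i
    simp only [Matrix.mulVec, dotProduct]
    have := fun j => (ha i j).mul
      ((ContinuousLinearMap.proj (R := ℂ) (φ := fun _ : Fin n => ℂ) j).analyticAt 0)
    exact Finset.analyticAt_fun_sum _ fun j _ => this j
  · rw [(hasFDerivAt_mulVec_self ha).fderiv]
    have hu : IsUnit (a 0) := (Matrix.isUnit_iff_isUnit_det _).2 (isUnit_iff_ne_zero.2 hdet)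
    exact ⟨Matrix.mulVec_injective_iff_isUnit.2 hu, Matrix.mulVec_surjective_iff_isUnit.2 hu⟩

theorem isCoordinateChange_of_eq_mulVec {n : ℕ} {Φ : (Fin n → ℂ) → Fin n → ℂ}
    (a : (Fin n → ℂ) → Matrix (Fin n) (Fin n) ℂ)
    (ha : ∀ i j, AnalyticAt ℂ (fun v => a v i j) 0) (hdet : (a 0).det ≠ 0)
    (hΦ : ∀ v i, Φ v i = ∑ j, a v i j * v j) : IsCoordinateChange Φ := by
  have : Φ = fun v => (a v).mulVec v := by
    funext v i
    rw [hΦ]; rfl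
  rw [this]
  exact isCoordinateChange_mulVec ha hdet

theorem IsCoordinateChange.continuousAt {n : ℕ} {Φ : (Fin n → ℂ) → Fin n → ℂ}
    (h : IsCoordinateChange Φ) : Filter.Tendsto Φ (nhds 0) (nhds 0) := by
  have := h.1.continuousAt.tendsto
  rwa [h.2.1] at this

theorem isCoordinateChange_id {n : ℕ} : IsCoordinateChange (fun v : Fin n → ℂ => v) :=
  ⟨analyticAt_id, rfl, by simpa using Function.bijective_id⟩

theorem IsCoordinateChange.comp {n : ℕ} {Φ Ψ : (Fin n → ℂ) → Fin n → ℂ}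
    (hΦ : IsCoordinateChange Φ) (hΨ : IsCoordinateChange Ψ) :
    IsCoordinateChange fun v => Φ (Ψ v) := by
  have h1 : AnalyticAt ℂ Φ (Ψ 0) := by rw [hΨ.2.1]; exact hΦ.1
  refine ⟨h1.comp hΨ.1, by simp [hΨ.2.1, hΦ.2.1], ?_⟩
  have : fderiv ℂ (fun v => Φ (Ψ v)) 0 = (fderiv ℂ Φ 0).comp (fderiv ℂ Ψ 0) := by
    have := fderiv_comp (0 : Fin n → ℂ) h1.differentiableAt hΨ.1.differentiableAt
    rw [hΨ.2.1] at this
    exact this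
  rw [this]
  exact hΦ.2.2.comp hΨ.2.2

theorem IsCoordinateChange.exists_rightInverse {n : ℕ} {Φ : (Fin n → ℂ) → Fin n → ℂ}
    (hΦ : IsCoordinateChange Φ) :
    ∃ Ψ : (Fin n → ℂ) → Fin n → ℂ, IsCoordinateChange Ψ ∧ ∀ᶠ v in nhds 0, Φ (Ψ v) = v := by
  have hd := hΦ.1.differentiableAt.hasFDerivAt
  obtain ⟨Ψ, h1, h2, h3⟩ := exists_analytic_implicit (E := Fin n → ℂ) (U := Fin n → ℂ)
    (W := Fin n → ℂ) rfl (f := fun p => Φ p.2 - p.1) (v₀ := 0) (u₀ := 0)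
    (by
      have : AnalyticAt ℂ Φ ((0 : (Fin n → ℂ) × (Fin n → ℂ)).2) := hΦ.1
      exact (this.comp (f := fun p : (Fin n → ℂ) × (Fin n → ℂ) => p.2) analyticAt_snd).sub
        analyticAt_fst)
    (by simp [hΦ.2.1]) (fun h => fderiv ℂ Φ 0 h)
    (by
      intro h
      have h1 : HasDerivAt (fun t : ℂ => 0 + t • h) h 0 := by
        simpa using ((hasDerivAt_id (0 : ℂ)).smul_const h)
      have h3 : HasFDerivAt Φ (fderiv ℂ Φ 0) (0 + (0 : ℂ) • h) := by simpa using hd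
      simpa [Function.comp_def] using h3.comp_hasDerivAt (0 : ℂ) h1)
    (by
      intro h hh
      exact hΦ.2.2.1 (by simpa using hh))
  have h4 : ∀ᶠ v in nhds 0, Φ (Ψ v) = v := by
    filter_upwards [h3] with v hv
    exact sub_eq_zero.1 hv
  refine ⟨Ψ, ⟨h1, h2, ?_⟩, h4⟩
  have h5 : HasFDerivAt Φ (fderiv ℂ Φ 0) (Ψ 0) := by rw [h2]; exact hd
  have h6 := h5.comp 0 h1.differentiableAt.hasFDerivAt
  have h7 : (fderiv ℂ Φ 0).comp (fderiv ℂ Ψ 0) = ContinuousLinearMap.id ℂ _ :=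
    h6.unique ((hasFDerivAt_id (0 : Fin n → ℂ)).congr_of_eventuallyEq h4)
  have hinj : Function.Injective (fderiv ℂ Ψ 0) := by
    intro a b hab
    have := congrArg (fderiv ℂ Φ 0) hab
    have ea := DFunLike.congr_fun h7 a
    have eb := DFunLike.congr_fun h7 b
    simp only [ContinuousLinearMap.comp_apply, ContinuousLinearMap.id_apply] at ea eb
    rw [← ea, ← eb, this]
  exact ⟨hinj, (LinearMap.injective_iff_surjective
    (f := (fderiv ℂ Ψ 0 : (Fin n → ℂ) →ₗ[ℂ] (Fin n → ℂ)))).1 hinj⟩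

/-! ### Equivalence of germs of functions and of pairs of equations -/

/-- `F` is right equivalent to a non-zero constant multiple of `G`. -/
def GermEquiv {n : ℕ} (F G : (Fin n → ℂ) → ℂ) : Prop :=
  ∃ (Φ : (Fin n → ℂ) → Fin n → ℂ) (c : ℂ), IsCoordinateChange Φ ∧ c ≠ 0 ∧
    ∀ᶠ v in nhds 0, F (Φ v) = c * G v

theorem GermEquiv.trans {n : ℕ} {F G H : (Fin n → ℂ) → ℂ} (h₁ : GermEquiv F G)
    (h₂ : GermEquiv G H) : GermEquiv F H := by
  obtain ⟨Φ, c, hΦ, hc, h⟩ := h₁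
  obtain ⟨Ψ, d, hΨ, hd, h'⟩ := h₂
  refine ⟨fun v => Φ (Ψ v), c * d, hΦ.comp hΨ, mul_ne_zero hc hd, ?_⟩
  filter_upwards [hΨ.continuousAt.eventually h, h'] with v h1 h2
  rw [h1, h2, mul_assoc]

theorem GermEquiv.symm {n : ℕ} {F G : (Fin n → ℂ) → ℂ} (h : GermEquiv F G) : GermEquiv G F := by
  obtain ⟨Φ, c, hΦ, hc, h⟩ := h
  obtain ⟨Ψ, hΨ, hi⟩ := hΦ.exists_rightInverse
  refine ⟨Ψ, c⁻¹, hΨ, inv_ne_zero hc, ?_⟩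
  filter_upwards [hΨ.continuousAt.eventually h, hi] with v h1 h2
  rw [h2] at h1
  rw [h1, inv_mul_cancel_left₀ hc]

theorem GermEquiv.of_change {n : ℕ} {F G : (Fin n → ℂ) → ℂ} {Φ : (Fin n → ℂ) → Fin n → ℂ}
    (hΦ : IsCoordinateChange Φ) (h : ∀ᶠ v in nhds 0, F (Φ v) = G v) : GermEquiv F G :=
  ⟨Φ, 1, hΦ, one_ne_zero, by simpa using h⟩

/-- The germs of complete intersections defined by the pairs `F` and `G` are isomorphic. -/
def PairEquiv {n : ℕ} (F G : (Fin n → ℂ) → Fin 2 → ℂ) : Prop :=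
  ∃ (Φ : (Fin n → ℂ) → Fin n → ℂ) (M : (Fin n → ℂ) → Matrix (Fin 2) (Fin 2) ℂ),
    IsCoordinateChange Φ ∧ (∀ i j, AnalyticAt ℂ (fun v => M v i j) 0) ∧ (M 0).det ≠ 0 ∧
    ∀ᶠ v in nhds 0, F (Φ v) = (M v).mulVec (G v)

theorem AnalyticAt.comp_change {n : ℕ} {f : (Fin n → ℂ) → ℂ} {Φ : (Fin n → ℂ) → Fin n → ℂ}
    (hf : AnalyticAt ℂ f 0) (hΦ : IsCoordinateChange Φ) : AnalyticAt ℂ (fun v => f (Φ v)) 0 := by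
  have : AnalyticAt ℂ f (Φ 0) := by rw [hΦ.2.1]; exact hf
  exact this.comp hΦ.1

theorem PairEquiv.trans {n : ℕ} {F G H : (Fin n → ℂ) → Fin 2 → ℂ} (h₁ : PairEquiv F G)
    (h₂ : PairEquiv G H) : PairEquiv F H := by
  obtain ⟨Φ, M, hΦ, hM, hc, h⟩ := h₁
  obtain ⟨Ψ, N, hΨ, hN, hd, h'⟩ := h₂
  refine ⟨fun v => Φ (Ψ v), fun v => M (Ψ v) * N v, hΦ.comp hΨ, ?_, ?_, ?_⟩
  · intro i j
    have : (fun v => (M (Ψ v) * N v) i j) = fun v => M (Ψ v) i 0 * N v 0 j + M (Ψ v) i 1 * N v 1 j := by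
      funext v
      simp [Matrix.mul_apply, Fin.sum_univ_two]
    rw [this]
    exact (((hM i 0).comp_change hΨ).mul (hN 0 j)).add (((hM i 1).comp_change hΨ).mul (hN 1 j))
  · rw [Matrix.det_mul, hΨ.2.1]
    exact mul_ne_zero hc hd
  · filter_upwards [hΨ.continuousAt.eventually h, h'] with v h1 h2
    rw [h1, h2, Matrix.mulVec_mulVec]

theorem PairEquiv.symm {n : ℕ} {F G : (Fin n → ℂ) → Fin 2 → ℂ} (h : PairEquiv F G) :
    PairEquiv G F := by
  obtain ⟨Φ, M, hΦ, hM, hc, h⟩ := h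
  obtain ⟨Ψ, hΨ, hi⟩ := hΦ.exists_rightInverse
  have hdet : AnalyticAt ℂ (fun v => (M (Ψ v)).det) 0 := by
    have : (fun v => (M (Ψ v)).det) =
        fun v => M (Ψ v) 0 0 * M (Ψ v) 1 1 - M (Ψ v) 0 1 * M (Ψ v) 1 0 := by
      funext v
      exact Matrix.det_fin_two _
    rw [this]
    exact (((hM 0 0).comp_change hΨ).mul ((hM 1 1).comp_change hΨ)).sub
      (((hM 0 1).comp_change hΨ).mul ((hM 1 0).comp_change hΨ))
  have hdet0 : (M (Ψ 0)).det ≠ 0 := by rw [hΨ.2.1]; exact hc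
  refine ⟨Ψ, fun v => (M (Ψ v))⁻¹, hΨ, ?_, ?_, ?_⟩
  · have hinv := hdet.inv hdet0
    have key : ∀ i j, AnalyticAt ℂ (fun v => (M (Ψ v)).adjugate i j) 0 := by
      intro i j
      have a := fun i j => (hM i j).comp_change hΨ
      fin_cases i <;> fin_cases j <;> simp [Matrix.adjugate_fin_two] <;>
        first | exact a _ _ | exact (a _ _).neg
    intro i j
    have e : (fun v => ((M (Ψ v))⁻¹) i j) =
        fun v => ((M (Ψ v)).det)⁻¹ * (M (Ψ v)).adjugate i j := by
      funext v
      simp [Matrix.inv_def]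
    rw [e]
    exact hinv.mul (key i j)
  · have : IsUnit (M (Ψ 0)).det := isUnit_iff_ne_zero.2 hdet0
    exact ((Matrix.isUnit_nonsing_inv_det_iff).2 this).ne_zero
  · filter_upwards [hΨ.continuousAt.eventually h, hi, hdet.continuousAt.eventually_ne hdet0]
      with v h1 h2 h3
    rw [h2] at h1
    rw [h1, Matrix.mulVec_mulVec, Matrix.nonsing_inv_mul _ (isUnit_iff_ne_zero.2 h3),
      Matrix.one_mulVec]

/-! ### Logarithms of units -/

theorem exists_analytic_log {E : Type*} [NormedAddCommGroup E] [NormedSpace ℂ E] {f : E → ℂ}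
    {v₀ : E} (hf : AnalyticAt ℂ f v₀) (h0 : f v₀ ≠ 0) :
    ∃ l : E → ℂ, AnalyticAt ℂ l v₀ ∧ ∀ᶠ v in nhds v₀, Complex.exp (l v) = f v := by
  have h1 : AnalyticAt ℂ (fun v => (f v₀)⁻¹ * f v) v₀ := analyticAt_const.mul hf
  refine ⟨fun v => Complex.log (f v₀) + Complex.log ((f v₀)⁻¹ * f v),
    analyticAt_const.add (h1.clog (by simp [h0])), ?_⟩
  filter_upwards [hf.continuousAt.eventually_ne h0] with v hv
  rw [Complex.exp_add, Complex.exp_log h0, Complex.exp_log (mul_ne_zero (inv_ne_zero h0) hv)]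
  field_simp

/-! ### Second order remainder of a power -/

/-- The polynomial `Q` in `(a + δ) ^ (n + 2) = a ^ (n + 2) + (n + 2) a ^ (n + 1) δ + δ ^ 2 Q`. -/
def powRem : ℕ → ℂ → ℂ → ℂ
  | 0, _, _ => 1
  | n + 1, a, δ => (n + 2) * a ^ (n + 1) + (a + δ) * powRem n a δ

theorem add_pow_eq_powRem (n : ℕ) (a δ : ℂ) :
    (a + δ) ^ (n + 2) = a ^ (n + 2) + (n + 2) * a ^ (n + 1) * δ + δ ^ 2 * powRem n a δ := by
  induction n with
  | zero => simp [powRem]; ring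
  | succ n ih => rw [pow_succ, ih, powRem]; push_cast; ring

theorem powRem_zero_zero (n : ℕ) : powRem n 0 0 = 0 ^ n := by
  cases n <;> simp [powRem]

theorem AnalyticAt.powRem {E : Type*} [NormedAddCommGroup E] [NormedSpace ℂ E] {f g : E → ℂ}
    {v : E} (hf : AnalyticAt ℂ f v) (hg : AnalyticAt ℂ g v) (n : ℕ) :
    AnalyticAt ℂ (fun x => powRem n (f x) (g x)) v := by
  induction n with
  | zero => exact analyticAt_const
  | succ n ih => simp only [_root_.powRem]; fun_prop

/-! ### Normal forms of complete intersections in four variables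

The monomials are written in terms of `R = z ^ r` and `S = z ^ s`, where the exponent of the pure
power of `z` in the normal form is `2 * r + s + 2`. -/

/-- The monomials spanning the admissible first equations. -/
def pairGen (rx sx ry sy rz sz rw sw : ℕ) (x y z w : ℂ) : Fin 14 → ℂ :=
  ![x * y, x ^ (rx + sx + 2), y ^ (ry + sy + 2), x * z ^ (rz + sz + 1), y * z ^ (rz + sz + 1),
    x * w ^ (rw + sw + 1), y * w ^ (rw + sw + 1), z ^ (2 * rz + sz + 2), w ^ (2 * rw + sw + 2),
    z ^ (rz + sz + 1) * w ^ (rw + sw + 1), x ^ 2 * z, x ^ 2 * w, y ^ 2 * z, y ^ 2 * w]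

/-- The shift of the first variable `x`. -/
def shiftX (ry sy rz sz rw sw : ℕ) (y z w : ℂ) (u : Fin 14 → ℂ) : ℂ :=
  u 4 * y ^ (ry + sy + 1) + u 5 * z ^ (rz + sz + 1) + u 6 * w ^ (rw + sw + 1) + u 7 * (y * z) +
    u 8 * (y * w)

/-- The shift of the second variable `y`. -/
def shiftY (rx sx rz sz rw sw : ℕ) (x z w : ℂ) (u : Fin 14 → ℂ) : ℂ :=
  u 9 * x ^ (rx + sx + 1) + u 10 * z ^ (rz + sz + 1) + u 11 * w ^ (rw + sw + 1) + u 12 * (x * z) +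
    u 13 * (x * w)

/-- The coefficients of the equation comparing the transformed first equation with its target. -/
def pairRow {R : Type*} [CommRing R] (z w Rx Sx Ry Sy Rz Sz Rw Sw g₁ g₂ Qz Qw : R)
    (N M u u' : Fin 14 → R) : Fin 14 → R :=
  ![u 0 * (1 + u 4 * u 9 * (Rx * Sx) * (Ry * Sy) + u 4 * u 12 * (Ry * Sy) * z +
        u 4 * u 13 * (Ry * Sy) * w + u 7 * u 9 * (Rx * Sx) * z + u 7 * u 12 * z ^ 2 +
        (u 7 * u 13 + u 8 * u 12) * z * w + u 8 * u 9 * (Rx * Sx) * w + u 8 * u 13 * w ^ 2) -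
      u 1 * Qz * (2 * u' 5 * u' 6 * (Rx * Sx) * (Ry * Sy) + 2 * u' 5 * u' 8 * (Rx * Sx) * w +
        2 * u' 6 * u' 7 * (Ry * Sy) * w + 2 * u' 7 * u' 8 * w ^ 2) -
      u 2 * Qw * (2 * u' 10 * u' 11 * (Rx * Sx) * (Ry * Sy) + 2 * u' 10 * u' 13 * (Rx * Sx) * z +
        2 * u' 11 * u' 12 * (Ry * Sy) * z + 2 * u' 12 * u' 13 * z ^ 2) -
      N 0 - u 3 * M 9 * (Rx * Sx) * (Ry * Sy) * (Rz * Sz) * (Rw * Sw),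
    u 0 * u 9 - u 1 * Qz * u' 5 ^ 2 * (Rx * Sx) - u 2 * Qw * u' 10 ^ 2 * (Rx * Sx) - N 1 -
      u 3 * M 7 * Rx * (Rz * Sz) * (Rw * Sw),
    u 0 * u 4 - u 1 * Qz * u' 6 ^ 2 * (Ry * Sy) - u 2 * Qw * u' 11 ^ 2 * (Ry * Sy) - N 2 -
      u 3 * M 8 * Ry * (Rz * Sz) * (Rw * Sw),
    u 0 * (u 10 + u 5 * u 9 * (Rx * Sx) + u 5 * u 12 * z + u 5 * u 13 * w) -
      u 1 * g₁ * Rz * (Rx * Sx * u' 5 + w * u' 7) -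
      u 2 * Qw * (2 * u' 9 * u' 10 * (Rx * Sx) + 2 * u' 9 * u' 12 * z) - N 3 -
      u 3 * (M 3 * (Rx * Sx) * (Rw * Sw) + M 10 * z * (Rw * Sw)),
    u 0 * (u 5 + u 4 * u 10 * (Ry * Sy) + u 7 * u 10 * z + u 8 * u 10 * w) -
      u 1 * g₁ * Rz * (Ry * Sy * u' 6 + w * u' 8) -
      u 2 * Qw * (2 * u' 9 * u' 11 * (Ry * Sy) + 2 * u' 9 * u' 13 * z) - N 4 -
      u 3 * (M 5 * (Ry * Sy) * (Rw * Sw) + M 11 * z * (Rw * Sw)),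
    u 0 * (u 11 + u 6 * u 9 * (Rx * Sx) + u 6 * u 12 * z + u 6 * u 13 * w) -
      u 1 * Qz * (2 * u' 4 * u' 5 * (Rx * Sx) + 2 * u' 4 * u' 7 * w) -
      u 2 * g₂ * Rw * (Rx * Sx * u' 10 + z * u' 12) - N 5 -
      u 3 * (M 4 * (Rx * Sx) * (Rz * Sz) + M 12 * w * (Rz * Sz)),
    u 0 * (u 6 + u 4 * u 11 * (Ry * Sy) + u 7 * u 11 * z + u 8 * u 11 * w) -
      u 1 * Qz * (2 * u' 4 * u' 6 * (Ry * Sy) + 2 * u' 4 * u' 8 * w) -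
      u 2 * g₂ * Rw * (Ry * Sy * u' 11 + z * u' 13) - N 6 -
      u 3 * (M 6 * (Ry * Sy) * (Rz * Sz) + M 13 * w * (Rz * Sz)),
    u 0 * u 5 * u 10 * Sz - u 1 - u 2 * Qw * u' 9 ^ 2 * Sz - N 7 - u 3 * M 1 * Sz * (Rw * Sw),
    u 0 * u 6 * u 11 * Sw - u 2 - u 1 * Qz * u' 4 ^ 2 * Sw - N 8 - u 3 * M 2 * Sw * (Rz * Sz),
    u 0 * (u 5 * u 11 + u 6 * u 10) - u 1 * g₁ * Rz * u' 4 - u 2 * g₂ * Rw * u' 9 - N 9 -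
      u 3 * M 0,
    u 0 * u 12 - u 2 * Qw * (2 * u' 10 * u' 12 * (Rx * Sx) + u' 12 ^ 2 * z) - N 10,
    u 0 * u 13 - u 1 * Qz * (2 * u' 5 * u' 7 * (Rx * Sx) + u' 7 ^ 2 * w) - N 11,
    u 0 * u 7 - u 2 * Qw * (2 * u' 11 * u' 13 * (Ry * Sy) + u' 13 ^ 2 * z) - N 12,
    u 0 * u 8 - u 1 * Qz * (2 * u' 6 * u' 8 * (Ry * Sy) + u' 8 ^ 2 * w) - N 13]

theorem pairRow_identity (rx sx ry sy rz sz rw sw : ℕ) (x y z w : ℂ) (N M u u' : Fin 14 → ℂ)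
    {δz δw : ℂ} (hz : shiftX rw sw rx sx ry sy w x y u' = δz)
    (hw : shiftY rz sz rx sx ry sy z x y u' = δw) :
    u 0 * (x + shiftX ry sy rz sz rw sw y z w u) * (y + shiftY rx sx rz sz rw sw x z w u) -
        u 1 * (z + δz) ^ (2 * rz + sz + 2) - u 2 * (w + δw) ^ (2 * rw + sw + 2) =
      ∑ j, N j * pairGen rx sx ry sy rz sz rw sw x y z w j +
        u 3 * z ^ (rz + sz) * w ^ (rw + sw) *
          ∑ j, M j * pairGen rz sz rw sw rx sx ry sy z w x y j +
        ∑ j, pairRow z w (x ^ rx) (x ^ sx) (y ^ ry) (y ^ sy) (z ^ rz) (z ^ sz) (w ^ rw) (w ^ sw)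
          (2 * rz + sz + 2) (2 * rw + sw + 2) (powRem (2 * rz + sz) z δz)
          (powRem (2 * rw + sw) w δw) N M u u' j * pairGen rx sx ry sy rz sz rw sw x y z w j := by
  rw [add_pow_eq_powRem, add_pow_eq_powRem]
  generalize powRem (2 * rz + sz) z δz = Qz
  generalize powRem (2 * rw + sw) w δw = Qw
  subst hz hw
  simp only [Fin.sum_univ_succ, Fin.sum_univ_zero, pairGen, pairRow, shiftX, shiftY]
  simp only [Matrix.cons_val_zero, Matrix.cons_val_succ, Fin.succ_zero_eq_one, Fin.succ_one_eq_two,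
    Fin.isValue, Matrix.cons_val]
  have e (x : ℂ) (r s : ℕ) : x ^ (2 * r + s) = (x ^ r) ^ 2 * x ^ s := by ring
  simp only [pow_add, pow_one, e, Nat.cast_add, Nat.cast_mul, Nat.cast_ofNat]
  generalize x ^ rx = Rx
  generalize x ^ sx = Sx
  generalize y ^ ry = Ry
  generalize y ^ sy = Sy
  generalize z ^ rz = Rz
  generalize z ^ sz = Sz
  generalize w ^ rw = Rw
  generalize w ^ sw = Sw
  simp
  ring

theorem coupled_linear_zero {X Y Z W U V α β ζ ω k₁ k₂ k₃ k₄ l₁ l₂ l₃ l₄ : ℂ}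
    (hX : X = 0 ∨ X = 1) (hY : Y = 0 ∨ Y = 1) (hZ : Z = 0 ∨ Z = 1) (hW : W = 0 ∨ W = 1)
    (hXYZW : X * Y * (Z * W) = 0) (hU : U ≠ 0) (hV : V ≠ 0)
    (hα : X * Y * α = 0) (hβ : X * Y * β = 0) (hζ : Z * W * ζ = 0) (hω : Z * W * ω = 0)
    {a₁ b₁ a₂ b₂ z₁ w₁ z₂ w₂ : ℂ}
    (h₁ : U * b₁ + U * β * X * a₁ - k₁ * X * z₁ - k₂ * ω * W * X * w₁ = 0)
    (h₂ : U * a₁ + U * α * Y * b₁ - k₁ * Y * z₂ - k₂ * ω * W * Y * w₂ = 0)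
    (h₃ : U * b₂ + U * β * X * a₂ - k₃ * ζ * Z * X * z₁ - k₄ * X * w₁ = 0)
    (h₄ : U * a₂ + U * α * Y * b₂ - k₃ * ζ * Z * Y * z₂ - k₄ * Y * w₂ = 0)
    (h₅ : V * w₁ + V * ω * Z * z₁ - l₁ * Z * a₁ - l₂ * β * Y * Z * b₁ = 0)
    (h₆ : V * z₁ + V * ζ * W * w₁ - l₁ * W * a₂ - l₂ * β * Y * W * b₂ = 0)
    (h₇ : V * w₂ + V * ω * Z * z₂ - l₃ * α * X * Z * a₁ - l₄ * Z * b₁ = 0)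
    (h₈ : V * z₂ + V * ζ * W * w₂ - l₃ * α * X * W * a₂ - l₄ * W * b₂ = 0) :
    (a₁ = 0 ∧ b₁ = 0 ∧ a₂ = 0 ∧ b₂ = 0) ∧ z₁ = 0 ∧ w₁ = 0 ∧ z₂ = 0 ∧ w₂ = 0 := by
  rcases hX with rfl | rfl <;> rcases hY with rfl | rfl <;> rcases hZ with rfl | rfl <;>
    rcases hW with rfl | rfl <;>
    simp only [one_mul, zero_mul, mul_one, mul_zero, sub_zero, add_zero, mul_eq_zero, hU, hV,
      false_or, one_ne_zero] at * <;> subst_vars <;>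
    simp_all

/-- The conditions on the constant coefficients of a pair of equations under which the pair has
the expected normal form.  The arguments `Rx`, `Sx`, … stand for `0 ^ rx`, `0 ^ sx`, …. -/
structure PairCoeff (Rx Sx Ry Sy Rz Sz Rw Sw : ℂ) (N : Fin 14 → ℂ) : Prop where
  ne0 : N 0 ≠ 0
  ne7 : N 7 ≠ 0
  ne8 : N 8 ≠ 0
  z3 : Rz * Sz * N 3 = 0
  z4 : Rz * Sz * N 4 = 0
  w5 : Rw * Sw * N 5 = 0
  w6 : Rw * Sw * N 6 = 0
  zw9 : Rz * Sz * (Rw * Sw) * N 9 = 0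
  y1 : Sx * (Ry * Sy) * N 1 = 0
  x2 : Sy * (Rx * Sx) * N 2 = 0
  sz : Sz * ((N 3 * N 0 - Rx * Sx * N 1 * N 4) * (N 4 * N 0 - Ry * Sy * N 2 * N 3)) = 0
  sw : Sw * ((N 5 * N 0 - Rx * Sx * N 1 * N 6) * (N 6 * N 0 - Ry * Sy * N 2 * N 5)) = 0

/-- The solution of the equations `pairRow = 0` at the origin. -/
def pairBase (X Y Rz Rw g₁ g₂ : ℂ) (N M : Fin 14 → ℂ) : Fin 14 → ℂ :=
  let U := N 0
  let β₁ := (N 3 - X * (N 1 / U) * N 4) / U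
  let α₁ := (N 4 - Y * (N 2 / U) * N 3) / U
  let β₂ := (N 5 - X * (N 1 / U) * N 6) / U
  let α₂ := (N 6 - Y * (N 2 / U) * N 5) / U
  ![U, -N 7, -N 8,
    (U * (α₁ * β₂ + α₂ * β₁) + N 7 * g₁ * Rz * (M 2 / M 0) + N 8 * g₂ * Rw * (M 1 / M 0) - N 9) /
      M 0,
    N 2 / U, α₁, α₂, N 12 / U, N 13 / U, N 1 / U, β₁, β₂, N 10 / U, N 11 / U]

/-- The vanishing products at a solution of the equations at the origin. -/
structure PairBaseFacts (Rx Sx Ry Sy Rz Sz Rw Sw : ℂ) (u : Fin 14 → ℂ) : Prop where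
  ne0 : u 0 ≠ 0
  ne1 : u 1 ≠ 0
  ne2 : u 2 ≠ 0
  z5 : Rz * Sz * u 5 = 0
  z10 : Rz * Sz * u 10 = 0
  w6 : Rw * Sw * u 6 = 0
  w11 : Rw * Sw * u 11 = 0
  y9 : Sx * (Ry * Sy) * u 9 = 0
  x4 : Sy * (Rx * Sx) * u 4 = 0
  zw3 : Rz * Sz * (Rw * Sw) * u 3 = 0
  sz : Sz * (u 5 * u 10) = 0
  sw : Sw * (u 6 * u 11) = 0

theorem pairBaseFacts {Rx Sx Ry Sy Rz Sz Rw Sw g₁ g₂ : ℂ} {N M : Fin 14 → ℂ}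
    (hN : PairCoeff Rx Sx Ry Sy Rz Sz Rw Sw N) (hM : PairCoeff Rz Sz Rw Sw Rx Sx Ry Sy M) :
    PairBaseFacts Rx Sx Ry Sy Rz Sz Rw Sw (pairBase (Rx * Sx) (Ry * Sy) Rz Rw g₁ g₂ N M) := by
  have h0 := hN.ne0
  have m0 := hM.ne0
  constructor
  · simpa [pairBase] using h0
  · simpa [pairBase] using hN.ne7
  · simpa [pairBase] using hN.ne8
  · simp only [pairBase, Matrix.cons_val]
    field_simp
    linear_combination N 0 * hN.z4 - Ry * Sy * N 2 * hN.z3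
  · simp only [pairBase, Matrix.cons_val]
    field_simp
    linear_combination N 0 * hN.z3 - Rx * Sx * N 1 * hN.z4
  · simp only [pairBase, Matrix.cons_val]
    field_simp
    linear_combination N 0 * hN.w6 - Ry * Sy * N 2 * hN.w5
  · simp only [pairBase, Matrix.cons_val]
    field_simp
    linear_combination N 0 * hN.w5 - Rx * Sx * N 1 * hN.w6
  · simp only [pairBase, Matrix.cons_val]
    rw [mul_div_assoc', hN.y1, zero_div]
  · simp only [pairBase, Matrix.cons_val]
    rw [mul_div_assoc', hN.x2, zero_div]
  · simp only [pairBase, Matrix.cons_val]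
    have a5 : Rz * Sz * ((N 4 - Ry * Sy * (N 2 / N 0) * N 3) / N 0) = 0 := by
      field_simp
      linear_combination N 0 * hN.z4 - Ry * Sy * N 2 * hN.z3
    have a10 : Rz * Sz * ((N 3 - Rx * Sx * (N 1 / N 0) * N 4) / N 0) = 0 := by
      field_simp
      linear_combination N 0 * hN.z3 - Rx * Sx * N 1 * hN.z4
    generalize (N 4 - Ry * Sy * (N 2 / N 0) * N 3) / N 0 = α₁ at *
    generalize (N 3 - Rx * Sx * (N 1 / N 0) * N 4) / N 0 = β₁ at *
    generalize (N 6 - Ry * Sy * (N 2 / N 0) * N 5) / N 0 = α₂ at *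
    generalize (N 5 - Rx * Sx * (N 1 / N 0) * N 6) / N 0 = β₂ at *
    field_simp
    linear_combination (norm := ring_nf) (N 0 * β₂ * Rw * Sw * M 0) * a5 +
      (N 0 * α₂ * Rw * Sw * M 0) * a10 - M 0 * hN.zw9 + Rw * g₂ * Rz * N 8 * hM.y1 + N 7 * g₁ * Rz * Rw * hM.x2
  · have h := hN.sz
    simp only [pairBase, Matrix.cons_val]
    field_simp
    linear_combination h
  · have h := hN.sw
    simp only [pairBase, Matrix.cons_val]
    field_simp
    linear_combination h

theorem pairRow_base {Rx Sx Ry Sy Rz Sz Rw Sw g₁ g₂ g₃ g₄ : ℂ} {N M : Fin 14 → ℂ}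
    (hN : PairCoeff Rx Sx Ry Sy Rz Sz Rw Sw N) (hM : PairCoeff Rz Sz Rw Sw Rx Sx Ry Sy M) :
    pairRow 0 0 Rx Sx Ry Sy Rz Sz Rw Sw g₁ g₂ (Rz * Sz) (Rw * Sw) N M
      (pairBase (Rx * Sx) (Ry * Sy) Rz Rw g₁ g₂ N M)
      (pairBase (Rz * Sz) (Rw * Sw) Rx Ry g₃ g₄ M N) = 0 := by
  have f := pairBaseFacts (g₁ := g₁) (g₂ := g₂) hN hM
  have f' := pairBaseFacts (g₁ := g₃) (g₂ := g₄) hM hN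
  set u := pairBase (Rx * Sx) (Ry * Sy) Rz Rw g₁ g₂ N M with hu
  set u' := pairBase (Rz * Sz) (Rw * Sw) Rx Ry g₃ g₄ M N with hu'
  have h0 := hN.ne0
  have m0 := hM.ne0
  have e0 : u 0 = N 0 := by simp [hu, pairBase]
  have e1 : u 1 = - N 7 := by simp [hu, pairBase]
  have e2 : u 2 = - N 8 := by simp [hu, pairBase]
  have e4 : N 0 * u 4 = N 2 := by simp [hu, pairBase]; field_simp
  have e9 : N 0 * u 9 = N 1 := by simp [hu, pairBase]; field_simp
  have e5 : N 0 * u 5 = N 4 - Ry * Sy * u 4 * N 3 := by simp [hu, pairBase]; field_simp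
  have e10 : N 0 * u 10 = N 3 - Rx * Sx * u 9 * N 4 := by simp [hu, pairBase]; field_simp
  have e6 : N 0 * u 6 = N 6 - Ry * Sy * u 4 * N 5 := by simp [hu, pairBase]; field_simp
  have e11 : N 0 * u 11 = N 5 - Rx * Sx * u 9 * N 6 := by simp [hu, pairBase]; field_simp
  have e7 : N 0 * u 7 = N 12 := by simp [hu, pairBase]; field_simp
  have e8 : N 0 * u 8 = N 13 := by simp [hu, pairBase]; field_simp
  have e12 : N 0 * u 12 = N 10 := by simp [hu, pairBase]; field_simp
  have e13 : N 0 * u 13 = N 11 := by simp [hu, pairBase]; field_simp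
  have e3 : u 3 * M 0 = N 0 * (u 5 * u 11 + u 6 * u 10) + N 7 * g₁ * Rz * u' 4 +
      N 8 * g₂ * Rw * u' 9 - N 9 := by
    simp [hu, hu', pairBase]; field_simp
  clear_value u u'
  obtain ⟨-, -, -, z5, z10, w6, w11, y9, x4, zw3, sz, sw⟩ := f
  obtain ⟨-, -, -, x5, x10, y6, y11, w9, z4, xy3, sx, sy⟩ := f'
  funext j
  fin_cases j <;> simp [pairRow, e0, e1, e2]
  · linear_combination N 0 * u 4 * Rx * y9 + 2 * N 7 * (Rz * Sz) * u' 6 * (Ry * Sy) * x5 + 2 * N 8 * (Rw * Sw) * u' 11 * (Ry * Sy) * x10 - u 3 * (Rz * Sz) * (Rw * Sw) * hM.zw9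
  · linear_combination e9 + N 7 * (Rz * Sz) * u' 5 * x5 + N 8 * (Rw * Sw) * u' 10 * x10 - M 7 * Rx * zw3
  · linear_combination e4 + N 7 * (Rz * Sz) * u' 6 * y6 + N 8 * (Rw * Sw) * u' 11 * y11 - M 8 * Ry * zw3
  · linear_combination e10 + Rx * Sx * u 9 * e5 - Rx * u 4 * N 3 * y9 + N 7 * g₁ * Rz * x5 + 2 * N 8 * (Rw * Sw) * u' 9 * x10 - u 3 * (Rw * Sw) * hM.z3
  · linear_combination e5 + Ry * Sy * u 4 * e10 - Ry * u 9 * N 4 * x4 + N 7 * g₁ * Rz * y6 + 2 * N 8 * (Rw * Sw) * u' 9 * y11 - u 3 * (Rw * Sw) * hM.w5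
  · linear_combination e11 + Rx * Sx * u 9 * e6 - Rx * u 4 * N 5 * y9 + 2 * N 7 * (Rz * Sz) * u' 4 * x5 + N 8 * g₂ * Rw * x10 - u 3 * (Rz * Sz) * hM.z4
  · linear_combination e6 + Ry * Sy * u 4 * e11 - Ry * u 9 * N 6 * x4 + 2 * N 7 * (Rz * Sz) * u' 4 * y6 + N 8 * g₂ * Rw * y11 - u 3 * (Rz * Sz) * hM.w6
  · linear_combination N 0 * sz + N 8 * u' 9 * w9 - u 3 * hM.y1
  · linear_combination N 0 * sw + N 7 * u' 4 * z4 - u 3 * hM.x2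
  · linear_combination -e3
  · linear_combination e12 + 2 * N 8 * (Rw * Sw) * u' 12 * x10
  · linear_combination e13 + 2 * N 7 * (Rz * Sz) * u' 7 * x5
  · linear_combination e7 + 2 * N 8 * (Rw * Sw) * u' 13 * y11
  · linear_combination e8 + 2 * N 7 * (Rz * Sz) * u' 8 * y6

/-- The derivative of the equations at the origin in the direction `(h, h')`. -/
def pairRowDeriv (Rx Sx Ry Sy Rz Sz Rw Sw g₁ g₂ : ℂ) (N M u u' h h' : Fin 14 → ℂ) (j : Fin 14) : ℂ :=
  (Polynomial.derivative (pairRow 0 0 (Polynomial.C Rx) (Polynomial.C Sx) (Polynomial.C Ry)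
    (Polynomial.C Sy) (Polynomial.C Rz) (Polynomial.C Sz) (Polynomial.C Rw) (Polynomial.C Sw)
    (Polynomial.C g₁) (Polynomial.C g₂) (Polynomial.C (Rz * Sz)) (Polynomial.C (Rw * Sw))
    (fun i => Polynomial.C (N i)) (fun i => Polynomial.C (M i))
    (fun i => Polynomial.C (u i) + Polynomial.C (h i) * Polynomial.X)
    (fun i => Polynomial.C (u' i) + Polynomial.C (h' i) * Polynomial.X) j)).eval 0

theorem hasDerivAt_pairRow (Rx Sx Ry Sy Rz Sz Rw Sw g₁ g₂ : ℂ) (N M u u' h h' : Fin 14 → ℂ) :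
    HasDerivAt (fun t : ℂ => pairRow 0 0 Rx Sx Ry Sy Rz Sz Rw Sw g₁ g₂ (Rz * Sz) (Rw * Sw) N M
      (u + t • h) (u' + t • h')) (pairRowDeriv Rx Sx Ry Sy Rz Sz Rw Sw g₁ g₂ N M u u' h h') 0 := by
  rw [hasDerivAt_pi]
  intro j
  convert! Polynomial.hasDerivAt _ _ using 1
  funext t
  fin_cases j <;> simp [pairRow, mul_comm t]

theorem pairRowDeriv_eq_zero {Rx Sx Ry Sy Rz Sz Rw Sw g₁ g₂ : ℂ} {N M u u' h h' : Fin 14 → ℂ}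
    (hM : PairCoeff Rz Sz Rw Sw Rx Sx Ry Sy M)
    (hu : PairBaseFacts Rx Sx Ry Sy Rz Sz Rw Sw u)
    (hu' : PairBaseFacts Rz Sz Rw Sw Rx Sx Ry Sy u')
    (hd : pairRowDeriv Rx Sx Ry Sy Rz Sz Rw Sw g₁ g₂ N M u u' h h' = 0) :
    h 0 = 0 ∧ u 0 * h 9 = h 3 * M 7 * Rx * (Rz * Sz * (Rw * Sw)) ∧
      u 0 * h 4 = h 3 * M 8 * Ry * (Rz * Sz * (Rw * Sw)) ∧
      Rz * Sz * (Rw * Sw) * (h 3 * M 0 + u 1 * g₁ * Rz * h' 4 + u 2 * g₂ * Rw * h' 9) = 0 := by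
  have d := fun j => congrFun hd j
  clear hd
  have d0 := d 0
  have d1 := d 1
  have d2 := d 2
  have d9 := d 9
  clear d
  simp [pairRowDeriv, pairRow, Polynomial.derivative_pow] at d0 d1 d2 d9
  obtain ⟨-, -, -, z5, z10, w6, w11, y9, x4, zw3, sz, sw⟩ := hu
  obtain ⟨-, -, -, x5, x10, y6, y11, w9, z4, xy3, sx, sy⟩ := hu'
  have h0 : h 0 = 0 := by
    linear_combination d0 - (h 0 * u 4 + u 0 * h 4) * Rx * y9 - (u 0 * h 9) * Ry * x4 +
      (h 1 * (Rz * Sz) * 2 * u' 6 * (Ry * Sy) + u 1 * (Rz * Sz) * 2 * h' 6 * (Ry * Sy)) * x5 +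
      u 1 * (Rz * Sz) * 2 * h' 5 * (Rx * Sx) * y6 +
      (h 2 * (Rw * Sw) * 2 * u' 11 * (Ry * Sy) + u 2 * (Rw * Sw) * 2 * h' 11 * (Ry * Sy)) * x10 +
      u 2 * (Rw * Sw) * 2 * h' 10 * (Rx * Sx) * y11 +
      h 3 * (Rz * Sz) * (Rw * Sw) * hM.zw9
  rw [h0] at d1 d2 d9
  refine ⟨h0, ?_, ?_, ?_⟩
  · linear_combination d1 + (h 1 * (Rz * Sz) * u' 5 + u 1 * (Rz * Sz) * 2 * h' 5) * x5 +
      (h 2 * (Rw * Sw) * u' 10 + u 2 * (Rw * Sw) * 2 * h' 10) * x10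
  · linear_combination d2 + (h 1 * (Rz * Sz) * u' 6 + u 1 * (Rz * Sz) * 2 * h' 6) * y6 +
      (h 2 * (Rw * Sw) * u' 11 + u 2 * (Rw * Sw) * 2 * h' 11) * y11
  · linear_combination -(Rz * Sz * (Rw * Sw)) * d9 + u 0 * (Rw * Sw) * h 11 * z5 +
      u 0 * (Rw * Sw) * h 6 * z10 + u 0 * (Rz * Sz) * h 5 * w11 + u 0 * (Rz * Sz) * h 10 * w6 -
      h 1 * g₁ * Rz * Rw * z4 - h 2 * g₂ * Rw * Rz * w9

theorem pairRowDeriv_eq_zero_middle {Rx Sx Ry Sy Rz Sz Rw Sw g₁ g₂ : ℂ}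
    {N M u u' h h' : Fin 14 → ℂ} (hM : PairCoeff Rz Sz Rw Sw Rx Sx Ry Sy M)
    (hu' : PairBaseFacts Rz Sz Rw Sw Rx Sx Ry Sy u')
    (hd : pairRowDeriv Rx Sx Ry Sy Rz Sz Rw Sw g₁ g₂ N M u u' h h' = 0)
    (h0 : h 0 = 0) (h4 : h 4 = 0) (h9 : h 9 = 0) (h4' : h' 4 = 0) (h9' : h' 9 = 0) :
    u 0 * h 10 + u 0 * u 9 * (Rx * Sx) * h 5 - u 1 * g₁ * Rz * (Rx * Sx) * h' 5 -
        2 * u 2 * u' 9 * (Rw * Sw) * (Rx * Sx) * h' 10 = 0 ∧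
      u 0 * h 5 + u 0 * u 4 * (Ry * Sy) * h 10 - u 1 * g₁ * Rz * (Ry * Sy) * h' 6 -
        2 * u 2 * u' 9 * (Rw * Sw) * (Ry * Sy) * h' 11 = 0 ∧
      u 0 * h 11 + u 0 * u 9 * (Rx * Sx) * h 6 - 2 * u 1 * u' 4 * (Rz * Sz) * (Rx * Sx) * h' 5 -
        u 2 * g₂ * Rw * (Rx * Sx) * h' 10 = 0 ∧
      u 0 * h 6 + u 0 * u 4 * (Ry * Sy) * h 11 - 2 * u 1 * u' 4 * (Rz * Sz) * (Ry * Sy) * h' 6 -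
        u 2 * g₂ * Rw * (Ry * Sy) * h' 11 = 0 := by
  have d := fun j => congrFun hd j
  clear hd
  have d3 := d 3
  have d4 := d 4
  have d5 := d 5
  have d6 := d 6
  clear d
  simp [pairRowDeriv, pairRow, h0, h4, h9, h4', h9'] at d3 d4 d5 d6
  obtain ⟨-, -, -, x5, x10, y6, y11, w9, z4, xy3, sx, sy⟩ := hu'
  refine ⟨?_, ?_, ?_, ?_⟩
  · linear_combination d3 + h 1 * g₁ * Rz * x5 + h 2 * (Rw * Sw) * 2 * u' 9 * x10 +
      h 3 * (Rw * Sw) * hM.z3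
  · linear_combination d4 + h 1 * g₁ * Rz * y6 + h 2 * (Rw * Sw) * 2 * u' 9 * y11 +
      h 3 * (Rw * Sw) * hM.w5
  · linear_combination d5 + h 2 * g₂ * Rw * x10 + h 1 * (Rz * Sz) * 2 * u' 4 * x5 +
      h 3 * (Rz * Sz) * hM.z4
  · linear_combination d6 + h 2 * g₂ * Rw * y11 + h 1 * (Rz * Sz) * 2 * u' 4 * y6 +
      h 3 * (Rz * Sz) * hM.w6

theorem pairRowDeriv_eq_zero_last {Rx Sx Ry Sy Rz Sz Rw Sw g₁ g₂ : ℂ}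
    {N M u u' h h' : Fin 14 → ℂ} (hM : PairCoeff Rz Sz Rw Sw Rx Sx Ry Sy M)
    (hu : PairBaseFacts Rx Sx Ry Sy Rz Sz Rw Sw u)
    (hu' : PairBaseFacts Rz Sz Rw Sw Rx Sx Ry Sy u')
    (hd : pairRowDeriv Rx Sx Ry Sy Rz Sz Rw Sw g₁ g₂ N M u u' h h' = 0)
    (h0 : h 0 = 0) (h4 : h 4 = 0) (h9 : h 9 = 0) (h5 : h 5 = 0) (h10 : h 10 = 0) (h6 : h 6 = 0)
    (h11 : h 11 = 0) (h4' : h' 4 = 0) (h9' : h' 9 = 0) (h5' : h' 5 = 0) (h10' : h' 10 = 0)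
    (h6' : h' 6 = 0) (h11' : h' 11 = 0) : h = 0 := by
  have d := fun j => congrFun hd j
  clear hd
  have d7 := d 7
  have d8 := d 8
  have d9 := d 9
  have d10 := d 10
  have d11 := d 11
  have d12 := d 12
  have d13 := d 13
  clear d
  simp [pairRowDeriv, pairRow, Polynomial.derivative_pow, h0, h4, h9, h4', h9', h5, h10, h6, h11,
    h5', h10', h6', h11'] at d7 d8 d9 d10 d11 d12 d13
  have hu0 := hu.ne0
  obtain ⟨-, -, -, x5, x10, y6, y11, w9, z4, xy3, sx, sy⟩ := hu'
  have e1 : h 1 = 0 := by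
    linear_combination -d7 - h 2 * u' 9 * w9 - h 3 * hM.y1
  have e2 : h 2 = 0 := by
    linear_combination -d8 - h 1 * u' 4 * z4 - h 3 * hM.x2
  rw [e1, e2] at d9
  have e3 : h 3 = 0 := by simpa [hM.ne0] using d9
  have e12 : u 0 * h 12 = 0 := by
    linear_combination d10 + (h 2 * (Rw * Sw) * 2 * u' 12 + u 2 * (Rw * Sw) * 2 * h' 12) * x10
  have e13 : u 0 * h 13 = 0 := by
    linear_combination d11 + (h 1 * (Rz * Sz) * 2 * u' 7 + u 1 * (Rz * Sz) * 2 * h' 7) * x5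
  have e7 : u 0 * h 7 = 0 := by
    linear_combination d12 + (h 2 * (Rw * Sw) * 2 * u' 13 + u 2 * (Rw * Sw) * 2 * h' 13) * y11
  have e8 : u 0 * h 8 = 0 := by
    linear_combination d13 + (h 1 * (Rz * Sz) * 2 * u' 8 + u 1 * (Rz * Sz) * 2 * h' 8) * y6
  simp only [mul_eq_zero, hu0, false_or] at e12 e13 e7 e8
  funext j
  fin_cases j <;> simp [*]

theorem pairRowDeriv_injective {Rx Sx Ry Sy Rz Sz Rw Sw g₁ g₂ g₃ g₄ : ℂ}
    {N M u u' : Fin 14 → ℂ}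
    (hX : Rx * Sx = 0 ∨ Rx * Sx = 1) (hY : Ry * Sy = 0 ∨ Ry * Sy = 1)
    (hZ : Rz * Sz = 0 ∨ Rz * Sz = 1) (hW : Rw * Sw = 0 ∨ Rw * Sw = 1)
    (hall : Rx * Sx * (Ry * Sy) * (Rz * Sz * (Rw * Sw)) = 0)
    (hN : PairCoeff Rx Sx Ry Sy Rz Sz Rw Sw N) (hM : PairCoeff Rz Sz Rw Sw Rx Sx Ry Sy M)
    (hu : PairBaseFacts Rx Sx Ry Sy Rz Sz Rw Sw u)
    (hu' : PairBaseFacts Rz Sz Rw Sw Rx Sx Ry Sy u') {h h' : Fin 14 → ℂ}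
    (hd : pairRowDeriv Rx Sx Ry Sy Rz Sz Rw Sw g₁ g₂ N M u u' h h' = 0)
    (hd' : pairRowDeriv Rz Sz Rw Sw Rx Sx Ry Sy g₃ g₄ M N u' u h' h = 0) : h = 0 ∧ h' = 0 := by
  obtain ⟨h0, a9, a4, a3⟩ := pairRowDeriv_eq_zero hM hu hu' hd
  obtain ⟨h0', b9, b4, b3⟩ := pairRowDeriv_eq_zero hN hu' hu hd'
  have hU := hu.ne0
  have hV := hu'.ne0
  have k3 : h 3 * (Rz * Sz * (Rw * Sw)) = 0 := by
    have : (u' 0 * M 0) * (h 3 * (Rz * Sz * (Rw * Sw))) = 0 := by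
      linear_combination u' 0 * a3 - Rz * Sz * (Rw * Sw) * u 1 * g₁ * Rz * b4 -
        Rz * Sz * (Rw * Sw) * u 2 * g₂ * Rw * b9 -
        (u 1 * g₁ * Rz * h' 3 * N 8 * Rw + u 2 * g₂ * Rw * h' 3 * N 7 * Rz) * hall
    simpa [hV, hM.ne0] using this
  have k3' : h' 3 * (Rx * Sx * (Ry * Sy)) = 0 := by
    have : (u 0 * N 0) * (h' 3 * (Rx * Sx * (Ry * Sy))) = 0 := by
      linear_combination u 0 * b3 - Rx * Sx * (Ry * Sy) * u' 1 * g₃ * Rx * a4 -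
        Rx * Sx * (Ry * Sy) * u' 2 * g₄ * Ry * a9 -
        (u' 1 * g₃ * Rx * h 3 * M 8 * Ry + u' 2 * g₄ * Ry * h 3 * M 7 * Rx) * hall
    simpa [hU, hN.ne0] using this
  have h9 : h 9 = 0 := by
    have : u 0 * h 9 = 0 := by linear_combination a9 + M 7 * Rx * k3
    simpa [hU] using this
  have h4 : h 4 = 0 := by
    have : u 0 * h 4 = 0 := by linear_combination a4 + M 8 * Ry * k3
    simpa [hU] using this
  have h9' : h' 9 = 0 := by
    have : u' 0 * h' 9 = 0 := by linear_combination b9 + N 7 * Rz * k3'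
    simpa [hV] using this
  have h4' : h' 4 = 0 := by
    have : u' 0 * h' 4 = 0 := by linear_combination b4 + N 8 * Rw * k3'
    simpa [hV] using this
  obtain ⟨m1, m2, m3, m4⟩ := pairRowDeriv_eq_zero_middle hM hu' hd h0 h4 h9 h4' h9'
  obtain ⟨m5, m6, m7, m8⟩ := pairRowDeriv_eq_zero_middle hN hu hd' h0' h4' h9' h4 h9
  obtain ⟨⟨h5, h10, h6, h11⟩, h5', h10', h6', h11'⟩ := coupled_linear_zero (α := u 4) (β := u 9)
    (ζ := u' 4) (ω := u' 9) (k₁ := u 1 * g₁ * Rz) (k₂ := 2 * u 2) (k₃ := 2 * u 1)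
    (k₄ := u 2 * g₂ * Rw) (l₁ := u' 1 * g₃ * Rx) (l₂ := 2 * u' 2) (l₃ := 2 * u' 1)
    (l₄ := u' 2 * g₄ * Ry) hX hY hZ hW hall hU hV (by linear_combination Ry * hu.x4)
    (by linear_combination Rx * hu.y9) (by linear_combination Rw * hu'.x4)
    (by linear_combination Rz * hu'.y9) m1 m2 m3 m4
    (by linear_combination m5) (by linear_combination m6) (by linear_combination m7)
    (by linear_combination m8)
  exact ⟨pairRowDeriv_eq_zero_last hM hu hu' hd h0 h4 h9 h5 h10 h6 h11 h4' h9' h5' h10' h6' h11',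
    pairRowDeriv_eq_zero_last hN hu' hu hd' h0' h4' h9' h5' h10' h6' h11' h4 h9 h5 h10 h6 h11⟩

@[fun_prop]
theorem analyticAt_apply {n : ℕ} (i : Fin n) (p : Fin n → ℂ) :
    AnalyticAt ℂ (fun v : Fin n → ℂ => v i) p :=
  (ContinuousLinearMap.proj (R := ℂ) (φ := fun _ : Fin n => ℂ) i).analyticAt p

@[fun_prop]
theorem AnalyticAt.fst_prod {E F G : Type*} [NormedAddCommGroup E] [NormedSpace ℂ E]
    [NormedAddCommGroup F] [NormedSpace ℂ F] [NormedAddCommGroup G] [NormedSpace ℂ G]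
    {f : E → F × G} {p : E} (hf : AnalyticAt ℂ f p) : AnalyticAt ℂ (fun x => (f x).1) p :=
  (analyticAt_fst (p := f p)).comp hf

@[fun_prop]
theorem AnalyticAt.snd_prod {E F G : Type*} [NormedAddCommGroup E] [NormedSpace ℂ E]
    [NormedAddCommGroup F] [NormedSpace ℂ F] [NormedAddCommGroup G] [NormedSpace ℂ G]
    {f : E → F × G} {p : E} (hf : AnalyticAt ℂ f p) : AnalyticAt ℂ (fun x => (f x).2) p :=
  (analyticAt_snd (p := f p)).comp hf

theorem AnalyticAt.pairRow {E : Type*} [NormedAddCommGroup E] [NormedSpace ℂ E] {p : E}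
    {z w Rx Sx Ry Sy Rz Sz Rw Sw Qz Qw : E → ℂ} {N M u u' : E → Fin 14 → ℂ} (g₁ g₂ : ℂ)
    (hz : AnalyticAt ℂ z p) (hw : AnalyticAt ℂ w p) (hRx : AnalyticAt ℂ Rx p)
    (hSx : AnalyticAt ℂ Sx p) (hRy : AnalyticAt ℂ Ry p) (hSy : AnalyticAt ℂ Sy p)
    (hRz : AnalyticAt ℂ Rz p) (hSz : AnalyticAt ℂ Sz p) (hRw : AnalyticAt ℂ Rw p)
    (hSw : AnalyticAt ℂ Sw p) (hQz : AnalyticAt ℂ Qz p) (hQw : AnalyticAt ℂ Qw p)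
    (hN : ∀ j, AnalyticAt ℂ (fun x => N x j) p) (hM : ∀ j, AnalyticAt ℂ (fun x => M x j) p)
    (hu : ∀ j, AnalyticAt ℂ (fun x => u x j) p) (hu' : ∀ j, AnalyticAt ℂ (fun x => u' x j) p) :
    AnalyticAt ℂ (fun x => pairRow (z x) (w x) (Rx x) (Sx x) (Ry x) (Sy x) (Rz x) (Sz x) (Rw x)
      (Sw x) g₁ g₂ (Qz x) (Qw x) (N x) (M x) (u x) (u' x)) p := by
  rw [analyticAt_pi_iff]
  intro j
  fin_cases j <;> simp only [_root_.pairRow, Fin.reduceFinMk, Matrix.cons_val] <;> fun_prop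

theorem zero_pow_mul_self (r s : ℕ) : (0 : ℂ) ^ r * 0 ^ s = 0 ∨ (0 : ℂ) ^ r * 0 ^ s = 1 := by
  rw [← pow_add]
  rcases Nat.eq_zero_or_pos (r + s) with h | h
  · right; rw [h, pow_zero]
  · left; exact zero_pow h.ne'

theorem zero_pow_two_mul_add (r s : ℕ) : (0 : ℂ) ^ (2 * r + s) = 0 ^ r * 0 ^ s := by
  rcases r with _ | r
  · simp
  · simp

/-- The left hand side of the system solved in the construction of the normal form. -/
def pairSystem (rx sx ry sy rz sz rw sw : ℕ) (N M : (Fin 4 → ℂ) → Fin 14 → ℂ) (v : Fin 4 → ℂ)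
    (u u' : Fin 14 → ℂ) : Fin 14 → ℂ :=
  pairRow (v 2) (v 3) (v 0 ^ rx) (v 0 ^ sx) (v 1 ^ ry) (v 1 ^ sy) (v 2 ^ rz) (v 2 ^ sz) (v 3 ^ rw)
    (v 3 ^ sw) (2 * rz + sz + 2) (2 * rw + sw + 2)
    (powRem (2 * rz + sz) (v 2) (shiftX rw sw rx sx ry sy (v 3) (v 0) (v 1) u'))
    (powRem (2 * rw + sw) (v 3) (shiftY rz sz rx sx ry sy (v 2) (v 0) (v 1) u')) (N v) (M v) u u'

/-- The exchange of the first two and the last two coordinates. -/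
def swapPairs (v : Fin 4 → ℂ) : Fin 4 → ℂ := ![v 2, v 3, v 0, v 1]

theorem pairSystem_zero (rx sx ry sy rz sz rw sw : ℕ) (N M : (Fin 4 → ℂ) → Fin 14 → ℂ)
    (u u' : Fin 14 → ℂ) :
    pairSystem rx sx ry sy rz sz rw sw N M 0 u u' =
      pairRow (0 : ℂ) 0 (0 ^ rx) (0 ^ sx) (0 ^ ry) (0 ^ sy) (0 ^ rz) (0 ^ sz) (0 ^ rw) (0 ^ sw)
        (2 * rz + sz + 2) (2 * rw + sw + 2) (0 ^ rz * 0 ^ sz) (0 ^ rw * 0 ^ sw) (N 0) (M 0) u u' := by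
  have h1 : shiftX rw sw rx sx ry sy 0 0 0 u' = 0 := by simp [shiftX]
  have h2 : shiftY rz sz rx sx ry sy 0 0 0 u' = 0 := by simp [shiftY]
  simp [pairSystem, h1, h2, powRem_zero_zero, zero_pow_two_mul_add]

theorem analyticAt_pairSystem (rx sx ry sy rz sz rw sw : ℕ) {N M : (Fin 4 → ℂ) → Fin 14 → ℂ}
    (hN : ∀ j, AnalyticAt ℂ (fun v => N v j) 0) (hM : ∀ j, AnalyticAt ℂ (fun v => M v j) 0)
    {E : Type*} [NormedAddCommGroup E] [NormedSpace ℂ E] {p : E} {V : E → Fin 4 → ℂ}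
    {u u' : E → Fin 14 → ℂ} (hV : AnalyticAt ℂ V p) (hV0 : V p = 0)
    (hu : ∀ j, AnalyticAt ℂ (fun x => u x j) p) (hu' : ∀ j, AnalyticAt ℂ (fun x => u' x j) p) :
    AnalyticAt ℂ (fun x => pairSystem rx sx ry sy rz sz rw sw N M (V x) (u x) (u' x)) p := by
  have hVi : ∀ i, AnalyticAt ℂ (fun x => V x i) p := (analyticAt_pi_iff).1 hV
  have hN' : ∀ j, AnalyticAt ℂ (fun x => N (V x) j) p := fun j =>
    AnalyticAt.comp (g := fun v => N v j) (by rw [hV0]; exact hN j) hV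
  have hM' : ∀ j, AnalyticAt ℂ (fun x => M (V x) j) p := fun j =>
    AnalyticAt.comp (g := fun v => M v j) (by rw [hV0]; exact hM j) hV
  unfold pairSystem
  refine AnalyticAt.pairRow _ _ (hVi 2) (hVi 3) ((hVi 0).pow _) ((hVi 0).pow _) ((hVi 1).pow _)
    ((hVi 1).pow _) ((hVi 2).pow _) ((hVi 2).pow _) ((hVi 3).pow _) ((hVi 3).pow _)
    ((hVi 2).powRem ?_ _) ((hVi 3).powRem ?_ _) hN' hM' hu hu'
  · unfold shiftX; fun_prop
  · unfold shiftY; fun_prop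

theorem exists_pairSystem_solution {rx sx ry sy rz sz rw sw : ℕ} {N M : (Fin 4 → ℂ) → Fin 14 → ℂ}
    (hN : ∀ j, AnalyticAt ℂ (fun v => N v j) 0) (hM : ∀ j, AnalyticAt ℂ (fun v => M v j) 0)
    (hall : rx + sx + (ry + sy) + (rz + sz + (rw + sw)) ≠ 0)
    (cN : PairCoeff (0 ^ rx) (0 ^ sx) (0 ^ ry) (0 ^ sy) (0 ^ rz) (0 ^ sz) (0 ^ rw) (0 ^ sw) (N 0))
    (cM : PairCoeff (0 ^ rz) (0 ^ sz) (0 ^ rw) (0 ^ sw) (0 ^ rx) (0 ^ sx) (0 ^ ry) (0 ^ sy)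
      (M 0)) :
    ∃ u u' : (Fin 4 → ℂ) → Fin 14 → ℂ, (∀ j, AnalyticAt ℂ (fun v => u v j) 0) ∧
      (∀ j, AnalyticAt ℂ (fun v => u' v j) 0) ∧
      PairBaseFacts (0 ^ rx) (0 ^ sx) (0 ^ ry) (0 ^ sy) (0 ^ rz) (0 ^ sz) (0 ^ rw) (0 ^ sw) (u 0) ∧
      PairBaseFacts (0 ^ rz) (0 ^ sz) (0 ^ rw) (0 ^ sw) (0 ^ rx) (0 ^ sx) (0 ^ ry) (0 ^ sy)
        (u' 0) ∧
      ∀ᶠ v in nhds 0, pairSystem rx sx ry sy rz sz rw sw N M v (u v) (u' v) = 0 ∧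
        pairSystem rz sz rw sw rx sx ry sy (fun v => M (swapPairs v)) (fun v => N (swapPairs v))
          (swapPairs v) (u' v) (u v) = 0 := by
  have hswap : AnalyticAt ℂ swapPairs 0 := by
    rw [analyticAt_pi_iff]
    intro i
    fin_cases i <;> simp only [swapPairs, Fin.reduceFinMk, Matrix.cons_val] <;> fun_prop
  have hswap0 : swapPairs 0 = 0 := by
    funext i; fin_cases i <;> simp [swapPairs]
  set b := pairBase (0 ^ rx * 0 ^ sx) (0 ^ ry * 0 ^ sy) (0 ^ rz) (0 ^ rw) (2 * rz + sz + 2)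
    (2 * rw + sw + 2) (N 0) (M 0) with hb
  set b' := pairBase (0 ^ rz * 0 ^ sz) (0 ^ rw * 0 ^ sw) (0 ^ rx) (0 ^ ry) (2 * rx + sx + 2)
    (2 * ry + sy + 2) (M 0) (N 0) with hb'
  have fb := pairBaseFacts (g₁ := 2 * rz + sz + 2) (g₂ := 2 * rw + sw + 2) cN cM
  have fb' := pairBaseFacts (g₁ := 2 * rx + sx + 2) (g₂ := 2 * ry + sy + 2) cM cN
  rw [← hb] at fb
  rw [← hb'] at fb'
  have hsN : ∀ j, AnalyticAt ℂ (fun v => N (swapPairs v) j) 0 := fun j =>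
    AnalyticAt.comp (g := fun v => N v j) (by rw [hswap0]; exact hN j) hswap
  have hsM : ∀ j, AnalyticAt ℂ (fun v => M (swapPairs v) j) 0 := fun j =>
    AnalyticAt.comp (g := fun v => M v j) (by rw [hswap0]; exact hM j) hswap
  let f : (Fin 4 → ℂ) × ((Fin 14 → ℂ) × (Fin 14 → ℂ)) → (Fin 14 → ℂ) × (Fin 14 → ℂ) := fun p =>
    (pairSystem rx sx ry sy rz sz rw sw N M p.1 p.2.1 p.2.2,
      pairSystem rz sz rw sw rx sx ry sy (fun v => M (swapPairs v)) (fun v => N (swapPairs v))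
        (swapPairs p.1) p.2.2 p.2.1)
  have f0 : ∀ u u', f (0, (u, u')) = (pairRow (0 : ℂ) 0 (0 ^ rx) (0 ^ sx) (0 ^ ry) (0 ^ sy) (0 ^ rz)
        (0 ^ sz) (0 ^ rw) (0 ^ sw) (2 * rz + sz + 2) (2 * rw + sw + 2) (0 ^ rz * 0 ^ sz)
        (0 ^ rw * 0 ^ sw) (N 0) (M 0) u u',
      pairRow (0 : ℂ) 0 (0 ^ rz) (0 ^ sz) (0 ^ rw) (0 ^ sw) (0 ^ rx) (0 ^ sx) (0 ^ ry) (0 ^ sy)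
        (2 * rx + sx + 2) (2 * ry + sy + 2) (0 ^ rx * 0 ^ sx) (0 ^ ry * 0 ^ sy) (M 0) (N 0)
        u' u) := by
    intro u u'
    simp only [f, hswap0, pairSystem_zero]
  obtain ⟨s, hs, hs0, hsol⟩ := exists_analytic_implicit (f := f) (v₀ := 0) (u₀ := (b, b')) rfl
    (by
      refine AnalyticAt.prod ?_ ?_
      · exact analyticAt_pairSystem _ _ _ _ _ _ _ _ hN hM analyticAt_fst rfl
          (fun j => by fun_prop) (fun j => by fun_prop)
      · refine analyticAt_pairSystem _ _ _ _ _ _ _ _ hsM hsN ?_ hswap0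
          (fun j => by fun_prop) (fun j => by fun_prop)
        exact AnalyticAt.comp (g := swapPairs) hswap analyticAt_fst)
    (by
      rw [f0, hb, hb', pairRow_base cN cM, pairRow_base cM cN]; rfl)
    (fun h => (pairRowDeriv (0 ^ rx) (0 ^ sx) (0 ^ ry) (0 ^ sy) (0 ^ rz) (0 ^ sz) (0 ^ rw) (0 ^ sw)
        (2 * rz + sz + 2) (2 * rw + sw + 2) (N 0) (M 0) b b' h.1 h.2,
      pairRowDeriv (0 ^ rz) (0 ^ sz) (0 ^ rw) (0 ^ sw) (0 ^ rx) (0 ^ sx) (0 ^ ry) (0 ^ sy)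
        (2 * rx + sx + 2) (2 * ry + sy + 2) (M 0) (N 0) b' b h.2 h.1))
    (by
      intro h
      have : (fun t : ℂ => f (0, (b, b') + t • h)) = fun t : ℂ => f (0, (b + t • h.1, b' + t • h.2)) :=
        rfl
      rw [this]
      simp only [f0]
      exact (hasDerivAt_pairRow _ _ _ _ _ _ _ _ _ _ _ _ _ _ _ _).prodMk
        (hasDerivAt_pairRow _ _ _ _ _ _ _ _ _ _ _ _ _ _ _ _))
    (by
      rintro ⟨h, h'⟩ hh
      rw [Prod.mk_eq_zero] at hh ⊢
      refine pairRowDeriv_injective (zero_pow_mul_self _ _) (zero_pow_mul_self _ _)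
        (zero_pow_mul_self _ _) (zero_pow_mul_self _ _) ?_ cN cM fb fb' hh.1 hh.2
      rw [← pow_add, ← pow_add, ← pow_add, ← pow_add, ← pow_add, ← pow_add, ← pow_add]
      exact zero_pow hall)
  refine ⟨fun v => (s v).1, fun v => (s v).2, ?_, ?_, ?_, ?_, ?_⟩
  · intro j
    have : AnalyticAt ℂ (fun v => (s v).1) 0 := (analyticAt_fst (p := s 0)).comp hs
    exact analyticAt_pi_iff.1 this j
  · intro j
    have : AnalyticAt ℂ (fun v => (s v).2) 0 := (analyticAt_snd (p := s 0)).comp hs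
    exact analyticAt_pi_iff.1 this j
  · simpa [hs0] using fb
  · simpa [hs0] using fb'
  · filter_upwards [hsol] with v hv
    exact Prod.mk_eq_zero.1 hv

/-- The pair of equations `xy = z ^ a + w ^ b`, `zw = x ^ c + y ^ d`. -/
def pairNormalForm (a b c d : ℕ) (v : Fin 4 → ℂ) : Fin 2 → ℂ :=
  ![v 0 * v 1 - v 2 ^ a - v 3 ^ b, v 2 * v 3 - v 0 ^ c - v 1 ^ d]

/-- The pair of equations with coefficient functions `N` and `M`. -/
def pairGerm (rx sx ry sy rz sz rw sw : ℕ) (N M : (Fin 4 → ℂ) → Fin 14 → ℂ) (v : Fin 4 → ℂ) :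
    Fin 2 → ℂ :=
  ![∑ j, N v j * pairGen rx sx ry sy rz sz rw sw (v 0) (v 1) (v 2) (v 3) j, ∑ j, M v j *
    pairGen rz sz rw sw rx sx ry sy (v 2) (v 3) (v 0) (v 1) j]

theorem inv_add_inv_mul_ne_one {a b c d : ℕ} (h : a + b + (c + d) ≠ 0) :
    (1 - (1 / (a + 2 : ℂ) + 1 / (b + 2)) * (1 / (c + 2) + 1 / (d + 2))) ≠ 0 := by
  have key : (a + b + 4) * (c + d + 4) < (a + 2) * (b + 2) * ((c + 2) * (d + 2)) := by
    have h1 : a + b + 4 ≤ (a + 2) * (b + 2) := by nlinarith [Nat.zero_le (a * b)]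
    have h2 : c + d + 4 ≤ (c + 2) * (d + 2) := by nlinarith [Nat.zero_le (c * d)]
    rcases Nat.eq_zero_or_pos (a + b) with h0 | h0
    · have h3 : c + d + 4 < (c + 2) * (d + 2) := by
        have : 0 < c + d := by omega
        nlinarith [Nat.zero_le (c * d)]
      exact Nat.mul_lt_mul_of_le_of_lt h1 h3 (by omega)
    · have h3 : a + b + 4 < (a + 2) * (b + 2) := by nlinarith [Nat.zero_le (a * b)]
      exact Nat.mul_lt_mul_of_lt_of_le h3 h2 (by omega)
  have e : ∀ n : ℕ, (n + 2 : ℂ) ≠ 0 := fun n => by exact_mod_cast (by omega : n + 2 ≠ 0)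
  have ha := e a; have hb := e b; have hc := e c; have hd := e d
  intro h0
  field_simp at h0
  have h1 : ((a + 2) * (b + 2) * ((c + 2) * (d + 2)) : ℂ) = (a + b + 4) * (c + d + 4) := by
    linear_combination h0
  exact key.ne' (by exact_mod_cast h1)

theorem div_eq_add_mul_div {p q s t k : ℂ} (hk : k ≠ 0) (e : k = 1 - t * s) :
    (p + s * q) / k = p + s * ((q + t * p) / k) := by
  field_simp
  rw [e]
  ring

theorem exp_mul_pow_eq {x A E : ℂ} {a : ℂ} {n : ℕ} (l : ℂ) (hl : Complex.exp l = A)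
    (h : (n : ℂ) * a = l - E) : (Complex.exp a * x) ^ n = Complex.exp (-E) * (A * x ^ n) := by
  rw [mul_pow, ← Complex.exp_nat_mul, h, ← hl, sub_eq_add_neg, Complex.exp_add]
  ring

theorem pairEquiv_pairGerm {rx sx ry sy rz sz rw sw : ℕ} {N M : (Fin 4 → ℂ) → Fin 14 → ℂ}
    (hN : ∀ j, AnalyticAt ℂ (fun v => N v j) 0) (hM : ∀ j, AnalyticAt ℂ (fun v => M v j) 0)
    (hall : rx + sx + (ry + sy) + (rz + sz + (rw + sw)) ≠ 0)
    (cN : PairCoeff (0 ^ rx) (0 ^ sx) (0 ^ ry) (0 ^ sy) (0 ^ rz) (0 ^ sz) (0 ^ rw) (0 ^ sw) (N 0))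
    (cM : PairCoeff (0 ^ rz) (0 ^ sz) (0 ^ rw) (0 ^ sw) (0 ^ rx) (0 ^ sx) (0 ^ ry) (0 ^ sy) (M 0)) :
    PairEquiv (pairNormalForm (2 * rz + sz + 2) (2 * rw + sw + 2) (2 * rx + sx + 2) (2 * ry + sy +
      2)) (pairGerm rx sx ry sy rz sz rw sw N M) := by
  obtain ⟨u, u', hu, hu', fu, fu', hsol⟩ := exists_pairSystem_solution hN hM hall cN cM
  obtain ⟨lU, aU, eU⟩ := exists_analytic_log (hu 0) fu.ne0
  obtain ⟨lA, aA, eA⟩ := exists_analytic_log (hu 1) fu.ne1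
  obtain ⟨lB, aB, eB⟩ := exists_analytic_log (hu 2) fu.ne2
  obtain ⟨lV, aV, eV⟩ := exists_analytic_log (hu' 0) fu'.ne0
  obtain ⟨lC, aC, eC⟩ := exists_analytic_log (hu' 1) fu'.ne1
  obtain ⟨lD, aD, eD⟩ := exists_analytic_log (hu' 2) fu'.ne2
  have hk := inv_add_inv_mul_ne_one (a := 2 * rz + sz) (b := 2 * rw + sw) (c := 2 * rx + sx)
    (d := 2 * ry + sy) (by omega)
  have e : ∀ n : ℕ, (n + 2 : ℂ) ≠ 0 := fun n => by exact_mod_cast (by omega : n + 2 ≠ 0)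
  have ha := e (2 * rz + sz); have hb := e (2 * rw + sw)
  have hc := e (2 * rx + sx); have hd := e (2 * ry + sy)
  set g₁ : ℂ := ((2 * rz + sz : ℕ) : ℂ) + 2
  set g₂ : ℂ := ((2 * rw + sw : ℕ) : ℂ) + 2
  set g₃ : ℂ := ((2 * rx + sx : ℕ) : ℂ) + 2
  set g₄ : ℂ := ((2 * ry + sy : ℕ) : ℂ) + 2
  set k := 1 - (1 / g₁ + 1 / g₂) * (1 / g₃ + 1 / g₄)
  let P : (Fin 4 → ℂ) → ℂ := fun v => lU v - lC v / g₃ - lD v / g₄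
  let Q : (Fin 4 → ℂ) → ℂ := fun v => lV v - lA v / g₁ - lB v / g₂
  let E₁ : (Fin 4 → ℂ) → ℂ := fun v => (P v + (1 / g₃ + 1 / g₄) * Q v) / k
  let E₂ : (Fin 4 → ℂ) → ℂ := fun v => (Q v + (1 / g₁ + 1 / g₂) * P v) / k
  have hE₁ : AnalyticAt ℂ E₁ 0 := by fun_prop
  have hE₂ : AnalyticAt ℂ E₂ 0 := by fun_prop
  have hEP : ∀ v, E₁ v = P v + (1 / g₃ + 1 / g₄) * E₂ v :=
    fun v => div_eq_add_mul_div hk rfl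
  have hEQ : ∀ v, E₂ v = Q v + (1 / g₁ + 1 / g₂) * E₁ v :=
    fun v => div_eq_add_mul_div hk (by simp only [k]; ring)
  let a₀ : (Fin 4 → ℂ) → ℂ := fun v => (lC v - E₂ v) / g₃
  let a₁ : (Fin 4 → ℂ) → ℂ := fun v => (lD v - E₂ v) / g₄
  let a₂ : (Fin 4 → ℂ) → ℂ := fun v => (lA v - E₁ v) / g₁
  let a₃ : (Fin 4 → ℂ) → ℂ := fun v => (lB v - E₁ v) / g₂
  have ha₀ : AnalyticAt ℂ a₀ 0 := by fun_prop
  have ha₁ : AnalyticAt ℂ a₁ 0 := by fun_prop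
  have ha₂ : AnalyticAt ℂ a₂ 0 := by fun_prop
  have ha₃ : AnalyticAt ℂ a₃ 0 := by fun_prop
  let δx : (Fin 4 → ℂ) → ℂ := fun v => shiftX ry sy rz sz rw sw (v 1) (v 2) (v 3) (u v)
  let δy : (Fin 4 → ℂ) → ℂ := fun v => shiftY rx sx rz sz rw sw (v 0) (v 2) (v 3) (u v)
  let δz : (Fin 4 → ℂ) → ℂ := fun v => shiftX rw sw rx sx ry sy (v 3) (v 0) (v 1) (u' v)
  let δw : (Fin 4 → ℂ) → ℂ := fun v => shiftY rz sz rx sx ry sy (v 2) (v 0) (v 1) (u' v)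
  refine ⟨fun v => ![Complex.exp (a₀ v) * (v 0 + δx v), Complex.exp (a₁ v) * (v 1 + δy v),
    Complex.exp (a₂ v) * (v 2 + δz v), Complex.exp (a₃ v) * (v 3 + δw v)], fun v => !![Complex.exp
    (-E₁ v), Complex.exp (-E₁ v) * (u v 3 * v 2 ^ (rz + sz) * v 3 ^ (rw + sw)); Complex.exp (-E₂ v)
    * (u' v 3 * v 0 ^ (rx + sx) * v 1 ^ (ry + sy)), Complex.exp (-E₂ v)], ?_, ?_, ?_, ?_⟩
  · refine isCoordinateChange_of_eq_mulVec (fun v =>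
      !![Complex.exp (a₀ v), Complex.exp (a₀ v) * (u v 4 * v 1 ^ (ry + sy) + u v 7 * v 2 + u v 8 *
        v 3), Complex.exp (a₀ v) * (u v 5 * v 2 ^ (rz + sz)), Complex.exp (a₀ v) * (u v 6 *
        v 3 ^ (rw + sw)); Complex.exp (a₁ v) * (u v 9 * v 0 ^ (rx + sx) + u v 12 * v 2 + u v 13 *
        v 3), Complex.exp (a₁ v), Complex.exp (a₁ v) * (u v 10 * v 2 ^ (rz + sz)), Complex.exp (a₁
        v) * (u v 11 * v 3 ^ (rw + sw)); Complex.exp (a₂ v) * (u' v 5 * v 0 ^ (rx + sx)),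
        Complex.exp (a₂ v) * (u' v 6 * v 1 ^ (ry + sy)), Complex.exp (a₂ v), Complex.exp (a₂ v) *
        (u' v 4 * v 3 ^ (rw + sw) + u' v 7 * v 0 + u' v 8 * v 1); Complex.exp (a₃ v) * (u' v 10 *
        v 0 ^ (rx + sx)), Complex.exp (a₃ v) * (u' v 11 * v 1 ^ (ry + sy)), Complex.exp (a₃ v) *
        (u' v 9 * v 2 ^ (rz + sz) + u' v 12 * v 0 + u' v 13 * v 1), Complex.exp (a₃ v)]) ?_ ?_ ?_
    · intro i j
      fin_cases i <;> fin_cases j <;> simp <;> fun_prop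
    · have z5 : u 0 5 * 0 ^ (rz + sz) = 0 := by rw [pow_add, mul_comm]; exact fu.z5
      have z10 : u 0 10 * 0 ^ (rz + sz) = 0 := by rw [pow_add, mul_comm]; exact fu.z10
      have w6 : u 0 6 * 0 ^ (rw + sw) = 0 := by rw [pow_add, mul_comm]; exact fu.w6
      have w11 : u 0 11 * 0 ^ (rw + sw) = 0 := by rw [pow_add, mul_comm]; exact fu.w11
      have x5 : u' 0 5 * 0 ^ (rx + sx) = 0 := by rw [pow_add, mul_comm]; exact fu'.z5
      have x10 : u' 0 10 * 0 ^ (rx + sx) = 0 := by rw [pow_add, mul_comm]; exact fu'.z10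
      have y6 : u' 0 6 * 0 ^ (ry + sy) = 0 := by rw [pow_add, mul_comm]; exact fu'.w6
      have y11 : u' 0 11 * 0 ^ (ry + sy) = 0 := by rw [pow_add, mul_comm]; exact fu'.w11
      have xy : u 0 4 * 0 ^ (ry + sy) * (u 0 9 * 0 ^ (rx + sx)) = 0 := by
        rw [pow_add, pow_add]; linear_combination u 0 4 * 0 ^ rx * fu.y9
      have zw : u' 0 4 * 0 ^ (rw + sw) * (u' 0 9 * 0 ^ (rz + sz)) = 0 := by
        rw [pow_add, pow_add]; linear_combination u' 0 4 * 0 ^ rz * fu'.y9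
      have : (Complex.exp (a₀ 0) * Complex.exp (a₁ 0) * (Complex.exp (a₂ 0) * Complex.exp (a₃ 0)))
          ≠ 0 := mul_ne_zero (mul_ne_zero (Complex.exp_ne_zero _) (Complex.exp_ne_zero _))
            (mul_ne_zero (Complex.exp_ne_zero _) (Complex.exp_ne_zero _))
      convert! this using 1
      rw [Matrix.det_succ_row_zero]
      simp [Fin.sum_univ_succ, Matrix.det_fin_three, Matrix.submatrix, Fin.succAbove, z5, z10, w6,
        w11, x5, x10, y6, y11]
      linear_combination (-(Complex.exp (a₀ 0) * Complex.exp (a₁ 0) * (Complex.exp (a₂ 0) *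
        Complex.exp (a₃ 0)))) * (xy + zw - u' 0 4 * 0 ^ (rw + sw) * (u' 0 9 * 0 ^ (rz + sz)) * xy)
    · intro v i
      fin_cases i <;> simp [Fin.sum_univ_succ, δx, δy, δz, δw, shiftX, shiftY] <;> ring
  · intro i j
    fin_cases i <;> fin_cases j <;> simp <;> fun_prop
  · have h3 : u 0 3 * 0 ^ (rz + sz) * 0 ^ (rw + sw) = 0 := by
      rw [pow_add, pow_add]; linear_combination fu.zw3
    simp [Matrix.det_fin_two, h3]
  · filter_upwards [hsol, eU, eA, eB, eV, eC, eD] with v hv eU eA eB eV eC eD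
    have i₁ := pairRow_identity rx sx ry sy rz sz rw sw (v 0) (v 1) (v 2) (v 3) (N v) (M v) (u v)
      (u' v) (δz := δz v) (δw := δw v) rfl rfl
    have i₂ := pairRow_identity rz sz rw sw rx sx ry sy (v 2) (v 3) (v 0) (v 1) (M v) (N v) (u' v)
      (u v) (δz := δx v) (δw := δy v) rfl rfl
    have n₁ : ∀ j, pairSystem rx sx ry sy rz sz rw sw N M v (u v) (u' v) j = 0 := fun j => by
      rw [hv.1]; rfl
    have n₂ : ∀ j, pairSystem rz sz rw sw rx sx ry sy (fun v => M (swapPairs v))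
        (fun v => N (swapPairs v)) (swapPairs v) (u' v) (u v) j = 0 := fun j => by
      rw [hv.2]; rfl
    have hss : swapPairs (swapPairs v) = v := by
      funext i; fin_cases i <;> simp [swapPairs]
    simp only [pairSystem, hss] at n₁ n₂
    simp only [swapPairs, Matrix.cons_val] at n₂
    have s₁ : ∀ (G : Fin 14 → ℂ), ∑ j, pairRow (v 2) (v 3) (v 0 ^ rx) (v 0 ^ sx) (v 1 ^ ry)
        (v 1 ^ sy) (v 2 ^ rz) (v 2 ^ sz) (v 3 ^ rw) (v 3 ^ sw) (2 * rz + sz + 2) (2 * rw + sw + 2)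
        (powRem (2 * rz + sz) (v 2) (δz v)) (powRem (2 * rw + sw) (v 3) (δw v)) (N v) (M v) (u v)
        (u' v) j * G j = 0 := fun G => Finset.sum_eq_zero fun j _ => by rw [n₁ j, zero_mul]
    have s₂ : ∀ (G : Fin 14 → ℂ), ∑ j, pairRow (v 0) (v 1) (v 2 ^ rz) (v 2 ^ sz) (v 3 ^ rw)
        (v 3 ^ sw) (v 0 ^ rx) (v 0 ^ sx) (v 1 ^ ry) (v 1 ^ sy) (2 * rx + sx + 2) (2 * ry + sy + 2)
        (powRem (2 * rx + sx) (v 0) (δx v)) (powRem (2 * ry + sy) (v 1) (δy v)) (M v) (N v) (u' v)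
        (u v) j * G j = 0 := fun G => Finset.sum_eq_zero fun j _ => by rw [n₂ j, zero_mul]
    rw [s₁, add_zero] at i₁
    rw [s₂, add_zero] at i₂
    have p₀ : (Complex.exp (a₀ v) * (v 0 + δx v)) ^ (2 * rx + sx + 2) =
        Complex.exp (-E₂ v) * (u' v 1 * (v 0 + δx v) ^ (2 * rx + sx + 2)) :=
      exp_mul_pow_eq _ eC (by
        have : ((2 * rx + sx + 2 : ℕ) : ℂ) = g₃ := by simp [g₃]
        rw [this]; exact mul_div_cancel₀ _ hc)
    have p₁ : (Complex.exp (a₁ v) * (v 1 + δy v)) ^ (2 * ry + sy + 2) =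
        Complex.exp (-E₂ v) * (u' v 2 * (v 1 + δy v) ^ (2 * ry + sy + 2)) :=
      exp_mul_pow_eq _ eD (by
        have : ((2 * ry + sy + 2 : ℕ) : ℂ) = g₄ := by simp [g₄]
        rw [this]; exact mul_div_cancel₀ _ hd)
    have p₂ : (Complex.exp (a₂ v) * (v 2 + δz v)) ^ (2 * rz + sz + 2) =
        Complex.exp (-E₁ v) * (u v 1 * (v 2 + δz v) ^ (2 * rz + sz + 2)) :=
      exp_mul_pow_eq _ eA (by
        have : ((2 * rz + sz + 2 : ℕ) : ℂ) = g₁ := by simp [g₁]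
        rw [this]; exact mul_div_cancel₀ _ ha)
    have p₃ : (Complex.exp (a₃ v) * (v 3 + δw v)) ^ (2 * rw + sw + 2) =
        Complex.exp (-E₁ v) * (u v 2 * (v 3 + δw v) ^ (2 * rw + sw + 2)) :=
      exp_mul_pow_eq _ eB (by
        have : ((2 * rw + sw + 2 : ℕ) : ℂ) = g₂ := by simp [g₂]
        rw [this]; exact mul_div_cancel₀ _ hb)
    have q₁ : Complex.exp (a₀ v) * Complex.exp (a₁ v) = Complex.exp (-E₁ v) * u v 0 := by
      rw [← eU, ← Complex.exp_add, ← Complex.exp_add]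
      congr 1
      simp only [a₀, a₁]
      rw [hEP v]
      simp only [P]
      ring
    have q₂ : Complex.exp (a₂ v) * Complex.exp (a₃ v) = Complex.exp (-E₂ v) * u' v 0 := by
      rw [← eV, ← Complex.exp_add, ← Complex.exp_add]
      congr 1
      simp only [a₂, a₃]
      rw [hEQ v]
      simp only [Q]
      ring
    funext i
    fin_cases i
    · simp [pairNormalForm, pairGerm, p₂, p₃]
      linear_combination (v 0 + δx v) * (v 1 + δy v) * q₁ + Complex.exp (-E₁ v) * i₁
    · simp [pairNormalForm, pairGerm, p₀, p₁]
      linear_combination (v 2 + δz v) * (v 3 + δw v) * q₂ + Complex.exp (-E₂ v) * i₂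

theorem isCoordinateChange_of_leftInverse {n : ℕ} {Φ Ψ : (Fin n → ℂ) → Fin n → ℂ}
    (H : ∀ i, AnalyticAt ℂ (fun v => Φ v i) 0 ∧ Φ 0 i = 0 ∧
      AnalyticAt ℂ (fun v => Ψ v i) 0 ∧ ∀ v, Ψ (Φ v) i = v i) : IsCoordinateChange Φ := by
  have h0 : Φ 0 = 0 := funext fun i => (H i).2.1
  have h (v) : Ψ (Φ v) = v := funext fun i => (H i).2.2.2 v
  have aΦ : AnalyticAt ℂ Φ 0 := analyticAt_pi_iff.2 fun i => (H i).1
  have aΨ : AnalyticAt ℂ Ψ (Φ 0) := by rw [h0]; exact analyticAt_pi_iff.2 fun i => (H i).2.2.1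
  refine ⟨aΦ, h0, ?_⟩
  have h6 := aΨ.differentiableAt.hasFDerivAt.comp 0 aΦ.differentiableAt.hasFDerivAt
  have h7 : (fderiv ℂ Ψ (Φ 0)).comp (fderiv ℂ Φ 0) = ContinuousLinearMap.id ℂ _ :=
    h6.unique ((hasFDerivAt_id (0 : Fin n → ℂ)).congr_of_eventuallyEq
      (Filter.Eventually.of_forall h))
  have hinj : Function.Injective (fderiv ℂ Φ 0) := by
    intro a b hab
    have ea := DFunLike.congr_fun h7 a
    have eb := DFunLike.congr_fun h7 b
    simp only [ContinuousLinearMap.comp_apply, ContinuousLinearMap.id_apply] at ea eb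
    rw [← ea, ← eb, hab]
  exact ⟨hinj, (LinearMap.injective_iff_surjective
    (f := (fderiv ℂ Φ 0 : (Fin n → ℂ) →ₗ[ℂ] (Fin n → ℂ)))).1 hinj⟩

theorem pairHasGabrielovNumbers_of_pairGerm {f₁ f₂ : MvPolynomial (Fin 4) ℂ}
    (rx sx ry sy rz sz rw sw : ℕ) {γ : Fin 4 → ℕ}
    (hγ : γ = ![2 * rz + sz + 2, 2 * rw + sw + 2, 2 * rx + sx + 2, 2 * ry + sy + 2])
    (hall : rx + sx + (ry + sy) + (rz + sz + (rw + sw)) ≠ 0)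
    {Φ : (Fin 4 → ℂ) → Fin 4 → ℂ} (hΦ : IsCoordinateChange Φ)
    (T : (Fin 4 → ℂ) → Matrix (Fin 2) (Fin 2) ℂ) (hT : ∀ i j, AnalyticAt ℂ (fun v => T v i j) 0)
    (hT0 : (T 0).det ≠ 0) (N M : (Fin 4 → ℂ) → Fin 14 → ℂ)
    (hNM : ∀ j, AnalyticAt ℂ (fun v => (N v j, M v j)) 0)
    (hc : PairCoeff (0 ^ rx) (0 ^ sx) (0 ^ ry) (0 ^ sy) (0 ^ rz) (0 ^ sz) (0 ^ rw) (0 ^ sw) (N 0) ∧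
      PairCoeff (0 ^ rz) (0 ^ sz) (0 ^ rw) (0 ^ sw) (0 ^ rx) (0 ^ sx) (0 ^ ry) (0 ^ sy) (M 0))
    (h : ∀ v, T v 0 0 * eval (Φ v) f₁ + T v 0 1 * eval (Φ v) (f₂ - X 2 * X 3) =
      ∑ j, N v j * pairGen rx sx ry sy rz sz rw sw (v 0) (v 1) (v 2) (v 3) j ∧
      T v 1 0 * eval (Φ v) f₁ + T v 1 1 * eval (Φ v) (f₂ - X 2 * X 3) =
      ∑ j, M v j * pairGen rz sz rw sw rx sx ry sy (v 2) (v 3) (v 0) (v 1) j) :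
    PairHasGabrielovNumbers f₁ f₂ γ := by
  have e₁ := pairEquiv_pairGerm (fun j => analyticAt_fst.comp (hNM j))
    (fun j => analyticAt_snd.comp (hNM j)) hall hc.1 hc.2
  have e₂ : PairEquiv (pairGerm rx sx ry sy rz sz rw sw N M)
      (fun v => ![eval (Φ v) f₁, eval (Φ v) (f₂ - X 2 * X 3)]) := by
    refine ⟨fun v => v, T, isCoordinateChange_id, hT, hT0, Filter.Eventually.of_forall fun v => ?_⟩
    funext i
    fin_cases i
    · simpa [pairGerm, Matrix.mulVec, dotProduct, Fin.sum_univ_two] using (h v).1.symm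
    · simpa [pairGerm, Matrix.mulVec, dotProduct, Fin.sum_univ_two] using (h v).2.symm
  have e₃ : PairEquiv (fun v => ![eval v f₁, eval v (f₂ - X 2 * X 3)])
      (fun v => ![eval (Φ v) f₁, eval (Φ v) (f₂ - X 2 * X 3)]) :=
    ⟨Φ, fun _ => 1, hΦ, fun _ _ => analyticAt_const, by simp,
      Filter.Eventually.of_forall fun v => by simp⟩
  obtain ⟨Ψ, S, hΨ, hS, hS0, h⟩ := e₃.trans (e₁.trans e₂).symm
  refine ⟨Ψ, fun v => !![S v 0 0, -S v 0 1; S v 1 0, -S v 1 1], hΨ, ?_, ?_, ?_⟩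
  · intro i j
    fin_cases i <;> fin_cases j
    exacts [hS 0 0, (hS 0 1).neg, hS 1 0, (hS 1 1).neg]
  · rw [Matrix.det_fin_two] at hS0 ⊢
    change S 0 0 0 * -S 0 1 1 - -S 0 0 1 * S 0 1 0 ≠ 0
    intro h0
    apply hS0
    linear_combination -h0
  · filter_upwards [h] with v hv
    rw [hv, hγ]
    funext i
    fin_cases i <;> simp [pairNormalForm, Matrix.mulVec, dotProduct, Fin.sum_univ_two] <;> ring

/-! ### Expansions of powers with analytic coefficients -/

/-- The quotient `((a + δ) ^ n - a ^ n) / δ`. -/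
def powQuot : ℕ → ℂ → ℂ → ℂ
  | 0, _, _ => 0
  | n + 1, a, δ => a ^ n + (a + δ) * powQuot n a δ

theorem add_pow_eq_powQuot (n : ℕ) (a δ : ℂ) : (a + δ) ^ n = a ^ n + δ * powQuot n a δ := by
  induction n with
  | zero => simp [powQuot]
  | succ n ih => rw [pow_succ, ih, powQuot]; ring

@[simp]
theorem powQuot_zero_zero (n : ℕ) : powQuot (n + 2) 0 0 = 0 := by
  simp [powQuot]

/-- The polynomial `R` in `powRem n a δ = δ ^ n + a * R`. -/
def powRemTail : ℕ → ℂ → ℂ → ℂ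
  | 0, _, _ => 0
  | n + 1, a, δ => (n + 2) * a ^ n + powRem n a δ + δ * powRemTail n a δ

theorem powRem_eq_tail (n : ℕ) (a δ : ℂ) : powRem n a δ = δ ^ n + a * powRemTail n a δ := by
  induction n with
  | zero => simp [powRem, powRemTail]
  | succ n ih => rw [powRem, powRemTail, ih]; ring

theorem powQuot_eq_powRem (n : ℕ) (a δ : ℂ) :
    powQuot (n + 2) a δ = (n + 2) * a ^ (n + 1) + δ * powRem n a δ := by
  induction n with
  | zero => simp [powQuot, powRem]; ring
  | succ n ih => rw [powQuot, ih, powRem]; push_cast; ring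

/-- The quotient `((a + b) ^ (n + 1) - a ^ (n + 1) - b ^ (n + 1)) / (a * b)`. -/
def powMix {R : Type*} [CommRing R] : ℕ → R → R → R
  | 0, _, _ => 0
  | n + 1, a, b => a ^ n + b ^ n + (a + b) * powMix n a b

theorem add_pow_eq_powMix {R : Type*} [CommRing R] (n : ℕ) (a b : R) :
    (a + b) ^ (n + 1) = a ^ (n + 1) + b ^ (n + 1) + a * b * powMix n a b := by
  induction n with
  | zero => simp [powMix]
  | succ n ih => rw [pow_succ, ih, powMix]; ring

attribute [simp] VirtualType.f VirtualType.h VirtualType.dual₁ VirtualType.dual₂ pairGen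

section Analytic

variable {E : Type*} [NormedAddCommGroup E] [NormedSpace ℂ E] {f g : E → ℂ} {v : E} {n : ℕ}

@[fun_prop]
theorem AnalyticAt.powQuot (hf : AnalyticAt ℂ f v) (hg : AnalyticAt ℂ g v) :
    AnalyticAt ℂ (fun x => powQuot n (f x) (g x)) v := by
  induction n with
  | zero => exact analyticAt_const
  | succ n ih => simp only [_root_.powQuot]; fun_prop

@[fun_prop]
theorem AnalyticAt.powRem_fun (hf : AnalyticAt ℂ f v) (hg : AnalyticAt ℂ g v) :
    AnalyticAt ℂ (fun x => _root_.powRem n (f x) (g x)) v := hf.powRem hg n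

@[fun_prop]
theorem AnalyticAt.powRemTail (hf : AnalyticAt ℂ f v) (hg : AnalyticAt ℂ g v) :
    AnalyticAt ℂ (fun x => powRemTail n (f x) (g x)) v := by
  induction n with
  | zero => exact analyticAt_const
  | succ n ih => simp only [_root_.powRemTail]; fun_prop

@[fun_prop]
theorem AnalyticAt.powMix (hf : AnalyticAt ℂ f v) (hg : AnalyticAt ℂ g v) :
    AnalyticAt ℂ (fun x => powMix n (f x) (g x)) v := by
  induction n with
  | zero => exact analyticAt_const
  | succ n ih => simp only [_root_.powMix]; fun_prop

theorem exists_analyticAt_eq (f : E → ℂ) (h : AnalyticAt ℂ f 0) :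
    ∃ g : E → ℂ, AnalyticAt ℂ g 0 ∧ ∀ x, g x = f x := ⟨f, h, fun _ => rfl⟩

theorem exists_add_pow_two (n : ℕ) (f g : E → ℂ)
    (h : AnalyticAt ℂ (fun x => (f x, g x)) 0) :
    ∃ Q : E → ℂ, AnalyticAt ℂ Q 0 ∧ (f 0 = 0 → g 0 = 0 → Q 0 = 0 ^ n) ∧ ∀ x,
      (f x + g x) ^ (n + 2) = f x ^ (n + 2) + (n + 2) * f x ^ (n + 1) * g x + g x ^ 2 * Q x :=
  ⟨fun x => powRem n (f x) (g x), h.fst_prod.powRem h.snd_prod n,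
    fun h1 h2 => by simp only [h1, h2, powRem_zero_zero], fun x => add_pow_eq_powRem n _ _⟩

theorem exists_add_pow_three (n : ℕ) (f g : E → ℂ)
    (h : AnalyticAt ℂ (fun x => (f x, g x)) 0) :
    ∃ R : E → ℂ, AnalyticAt ℂ R 0 ∧ ∀ x, (f x + g x) ^ (n + 3) =
      f x ^ (n + 3) + (n + 3) * f x ^ (n + 2) * g x + g x ^ (n + 3) + f x * g x ^ 2 * R x :=
  ⟨fun x => powRemTail (n + 1) (f x) (g x), h.fst_prod.powRemTail h.snd_prod, fun x => by
    rw [add_pow_eq_powRem (n + 1), powRem_eq_tail]; push_cast; ring⟩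

theorem exists_powQuot_eq (n : ℕ) (f g : E → ℂ)
    (h : AnalyticAt ℂ (fun x => (f x, g x)) 0) :
    ∃ R : E → ℂ, AnalyticAt ℂ R 0 ∧ ∀ x, powQuot (n + 3) (f x) (g x) =
      g x ^ (n + 2) + (n + 3) * f x ^ (n + 2) + f x * g x * R x :=
  ⟨fun x => powRemTail (n + 1) (f x) (g x), h.fst_prod.powRemTail h.snd_prod, fun x => by
    rw [powQuot_eq_powRem (n + 1), powRem_eq_tail]; push_cast; ring⟩

theorem exists_add_pow_mix (n : ℕ) (f g : E → ℂ)
    (h : AnalyticAt ℂ (fun x => (f x, g x)) 0) :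
    ∃ R : E → ℂ, AnalyticAt ℂ R 0 ∧ (n ≠ 1 → f 0 = 0 → g 0 = 0 → R 0 = 0) ∧ ∀ x,
      (f x + g x) ^ (n + 1) = f x ^ (n + 1) + g x ^ (n + 1) + f x * g x * R x :=
  ⟨fun x => powMix n (f x) (g x), h.fst_prod.powMix h.snd_prod, fun h h1 h2 => by
    simp only [h1, h2]
    rcases n with _ | _ | n
    · rfl
    · exact absurd rfl h
    · simp [powMix], fun x => add_pow_eq_powMix n _ _⟩

theorem exists_add_pow_quot (n : ℕ) (f g : E → ℂ)
    (h : AnalyticAt ℂ (fun x => (f x, g x)) 0) :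
    ∃ R : E → ℂ, AnalyticAt ℂ R 0 ∧ (n ≠ 1 → f 0 = 0 → g 0 = 0 → R 0 = 0) ∧ ∀ x,
      (f x + g x) ^ n = f x ^ n + g x * R x :=
  ⟨fun x => powQuot n (f x) (g x), h.fst_prod.powQuot h.snd_prod, fun h h1 h2 => by
    simp only [h1, h2]
    rcases n with _ | _ | n
    · rfl
    · exact absurd rfl h
    · simp [powQuot], fun x => add_pow_eq_powQuot n _ _⟩

end Analytic

abbrev HasTriGabrielov (c : VirtualType) (γ : Fin 3 → ℕ) : Prop :=
  HasGabrielovNumbers c.h γ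

abbrev HasPairGabrielov (c : VirtualType) (γ : Fin 4 → ℕ) : Prop :=
  PairHasGabrielovNumbers c.dual₁ c.dual₂ γ

abbrev HasPairDolgachev (c : VirtualType) (α : Fin 3 → ℕ) : Prop :=
  PairHasDolgachevNumbers c.dual₁ c.dual₂ α

abbrev HasTypeDolgachev (c : VirtualType) (α : Fin 4 → ℕ) : Prop :=
  HasDolgachevNumbers c.f c.h α

abbrev FacetsReduced (h : MvPolynomial (Fin 3) ℂ) : Prop :=
  ∀ (F : Set (Fin 3 → ℝ)) (w : Fin 3 → ℕ) (d : ℕ), IsOuterFacet h F →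
    IsCanonicalWeights (facePart h F) w d → IsReducedWeights w

theorem pairGabrielov_IIA {n e : ℕ} :
    HasPairGabrielov (.IIA (n + 3) (e + 2)) ![2 * n + 4, 2, n + 3, e + 2] := by
  obtain ⟨R, hR, eR⟩ := exists_powQuot_eq n
    (fun v : Fin 4 → ℂ => v 0) (fun v => v 2) (by fun_prop)
  refine pairHasGabrielovNumbers_of_pairGerm 0 (n + 1) 0 e (n + 1) 0 0 0 ?_ (by omega)
    (Φ := fun v => ![v 0, v 1, v 2 + v 0, v 3 + powQuot (n + 3) (v 0) (v 2)])
    ?_ (fun _ => 1) (fun _ _ => analyticAt_const) (by simp)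
    (fun v => ![1, -((n + 3) ^ 2 * v 0 ^ (n + 1)), 0, -(2 * (n + 3) * v 0 ^ (n + 1) + 2 * v 2 *
      R v), 0, -(2 * (n + 3) * v 0 ^ (n + 1) + 2 * v 2 * R v), 0, -1, -1, -2, -(v 2 * R v ^ 2 + 2 *
      (n + 3) * v 0 ^ (n + 1) * R v), 0, 0, 0])
    (fun v => ![-1, 0, 0, 0, 0, 0, 0, 1, 1, 0, 0, 0, 0, 0]) ?_ ?_ ?_
  · funext i; fin_cases i <;> simp <;> ring
  · refine isCoordinateChange_of_leftInverse (Ψ := fun v => ![v 0, v 1, v 2 - v 0, v 3 -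
      powQuot (n + 3) (v 0) (v 2 - v 0)]) fun i => ⟨?_, ?_, ?_, fun v => ?_⟩ <;>
    fin_cases i <;> simp <;> first | fun_prop | ring
  · intro j; fin_cases j <;> simp <;> fun_prop
  · constructor <;> constructor <;> simp
  · intro v
    constructor <;> simp [Fin.sum_univ_succ]
    · rw [eR]
      ring
    · rw [add_comm (v 2), add_pow_eq_powQuot (n + 3)]
      ring

theorem pairGabrielov_IIA_two {k : ℕ} :
    HasPairGabrielov (.IIA 2 (k + 3)) ![2, 2, 2, k + 3] := by
  obtain ⟨Q, hQ, Q0, eQ⟩ := exists_add_pow_two (k + 1)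
    (fun v : Fin 4 → ℂ => v 1) (fun v => 4 * (v 3 + v 2 + v 0)) (by fun_prop)
  simp at Q0
  refine pairHasGabrielovNumbers_of_pairGerm 0 0 0 (k + 1) 0 0 0 0 ?_ (by omega)
    (Φ := fun v => ![v 0, v 1 + 4 * (v 3 + v 2 + v 0), v 2 + v 0, v 3 + (v 2 + 2 * v 0)])
    ?_ (fun v => !![1, -2; 0, 1]) ?_ ?_
    (fun v => ![1 - 8 * (k + 3) * v 1 ^ (k + 1), -2 - 32 * Q v, -2, -64 * Q v, -8 * (k + 3) *
      v 1 ^ (k + 1), -64 * Q v, -8 * (k + 3) * v 1 ^ (k + 1), -1 - 32 * Q v, -1 - 32 * Q v, -64 *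
      Q v, 0, 0, 0, 0])
    (fun v => ![-1 + 32 * Q v, 16 * Q v, 16 * Q v, 32 * Q v, 32 * Q v, 4 * (k + 3), 4 * (k + 3), 1 +
      16 * Q v, 1, 4 * (k + 3), 0, 0, 0, 0]) ?_ ?_ ?_
  · funext i; fin_cases i <;> simp
  · refine isCoordinateChange_of_leftInverse (Ψ := fun v => ![v 0, v 1 - 4 * (v 3 - v 0), v 2 - v 0,
      v 3 - (v 2 - v 0 + 2 * v 0)]) fun i => ⟨?_, ?_, ?_, fun v => ?_⟩ <;>
    fin_cases i <;> simp <;> first | fun_prop | ring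
  · intro i j; fin_cases i <;> fin_cases j <;> simp <;> fun_prop
  · simp [Matrix.det_fin_two]
  · intro j; fin_cases j <;> simp <;> fun_prop
  · constructor <;> constructor <;> simp [Q0]
  · intro v
    constructor <;> simp [Fin.sum_univ_succ]
    · rw [show k + 3 = k + 1 + 2 from rfl, eQ]
      push_cast
      ring
    · rw [show k + 3 = k + 1 + 2 from rfl, eQ]
      push_cast
      ring

theorem powMix_mem_pow {R : Type*} [CommRing R] {I : Ideal R} {a b : R} (ha : a ∈ I) (hb : b ∈ I)
    (n : ℕ) : powMix (n + 1) a b ∈ I ^ n := by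
  induction n with
  | zero => simp
  | succ n ih =>
    rw [powMix]
    refine add_mem (add_mem (Ideal.pow_mem_pow ha _) (Ideal.pow_mem_pow hb _)) ?_
    rw [pow_succ']
    exact Ideal.mul_mem_mul (add_mem ha hb) ih

theorem map_powMix {R S : Type*} [CommRing R] [CommRing S] (φ : R →+* S) (n : ℕ) (a b : R) :
    φ (powMix n a b) = powMix n (φ a) (φ b) := by
  induction n with
  | zero => simp [powMix]
  | succ n ih => simp [powMix, ih]

theorem sup_pow_add_add_one_le {R : Type*} [CommRing R] (I J : Ideal R) (n m : ℕ) :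
    (I ⊔ J) ^ (n + m + 1) ≤ I ^ (n + 1) ⊔ J ^ (m + 1) := by
  rw [← Ideal.add_eq_sup, ← Ideal.add_eq_sup, add_pow, Ideal.sum_eq_sup]
  apply Finset.sup_le
  intro i _
  by_cases hn : n + 1 ≤ i
  · exact (Ideal.mul_le_left.trans (Ideal.mul_le_left.trans ((Ideal.pow_le_pow_right hn).trans
      le_sup_left)))
  · exact (Ideal.mul_le_left.trans (Ideal.mul_le_right.trans ((Ideal.pow_le_pow_right (by
      omega)).trans le_sup_right)))

theorem exists_powMix_mul_split (n : ℕ) : ∃ A B : ℂ → ℂ → ℂ,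
    (∀ {E : Type} [NormedAddCommGroup E] [NormedSpace ℂ E] {f g : E → ℂ} {v : E}, AnalyticAt ℂ f v →
      AnalyticAt ℂ g v → AnalyticAt ℂ (fun x => A (f x) (g x)) v ∧ AnalyticAt ℂ (fun x => B (f x) (g
      x)) v) ∧
    ∀ x y, powMix (n + 2) x y * (x + y) ^ (n + 2) =
      x ^ (n + 2) * A x y + y ^ (n + 2) * B x y := by
  let a : MvPolynomial (Fin 2) ℂ := X 0
  let b : MvPolynomial (Fin 2) ℂ := X 1
  let I := Ideal.span {a} ⊔ Ideal.span {b}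
  have ha : a ∈ I := Ideal.mem_sup_left (Ideal.mem_span_singleton_self a)
  have hb : b ∈ I := Ideal.mem_sup_right (Ideal.mem_span_singleton_self b)
  have h1 : powMix (n + 2) a b * (a + b) ^ (n + 2) ∈ I ^ ((n + 1) + (n + 1) + 1) := by
    have : (n + 1) + (n + 1) + 1 = (n + 1) + (n + 2) := by omega
    rw [this, pow_add]
    exact Ideal.mul_mem_mul (powMix_mem_pow ha hb (n + 1)) (Ideal.pow_mem_pow (add_mem ha hb) _)
  have h2 := sup_pow_add_add_one_le _ _ _ _ h1
  rw [Ideal.span_singleton_pow, Ideal.span_singleton_pow] at h2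
  obtain ⟨s, hs, t, ht, hst⟩ := Submodule.mem_sup.1 h2
  obtain ⟨A, rfl⟩ := Ideal.mem_span_singleton.1 hs
  obtain ⟨B, rfl⟩ := Ideal.mem_span_singleton.1 ht
  have key : ∀ P : MvPolynomial (Fin 2) ℂ, ∀ {E : Type} [NormedAddCommGroup E] [NormedSpace ℂ E]
      {f g : E → ℂ} {v : E}, AnalyticAt ℂ f v → AnalyticAt ℂ g v →
      AnalyticAt ℂ (fun x => eval ![f x, g x] P) v := by
    intro P E _ _ f g v hf hg
    have := AnalyticAt.aeval_mvPolynomial (f := fun (x : E) => ![f x, g x]) (z := v)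
      (by intro i; fin_cases i <;> simpa) P
    simpa [aeval_eq_eval] using this
  refine ⟨fun x y => eval ![x, y] A, fun x y => eval ![x, y] B, fun hf hg => ⟨key A hf hg,
    key B hf hg⟩, fun x y => ?_⟩
  have := congrArg (eval ![x, y]) hst
  simp [a, b, map_powMix] at this
  exact this.symm

theorem pairGabrielov_III {n k : ℕ} :
    HasPairGabrielov (.III (n + 3) (k + 2)) ![2 * n + 4, 2, n + 3, (k + 2) * (n + 3)] := by
  obtain ⟨R, hR, eR⟩ := exists_powQuot_eq n
    (fun v : Fin 4 → ℂ => v 0 + v 1 ^ (k + 2)) (fun v => v 2) (by fun_prop)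
  obtain ⟨l, hl, -, el⟩ := exists_add_pow_mix (n + 1)
    (fun v : Fin 4 → ℂ => v 0) (fun v => v 1 ^ (k + 2)) (by fun_prop)
  obtain ⟨A₀, B₀, hAB, eAB⟩ := exists_powMix_mul_split n
  obtain ⟨m, hm, em⟩ : ∃ m : (Fin 4 → ℂ) → ℂ, AnalyticAt ℂ m 0 ∧ ∀ v,
      m v = powMix (n + 2) (v 0) (v 1 ^ (k + 2)) := ⟨_, by fun_prop, fun _ => rfl⟩
  obtain ⟨A, hA, eA⟩ : ∃ A : (Fin 4 → ℂ) → ℂ, AnalyticAt ℂ A 0 ∧ ∀ v,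
      A v = A₀ (v 0) (v 1 ^ (k + 2)) := ⟨_, (hAB (by fun_prop) (by fun_prop)).1, fun _ => rfl⟩
  obtain ⟨B, hB, eB⟩ : ∃ B : (Fin 4 → ℂ) → ℂ, AnalyticAt ℂ B 0 ∧ ∀ v,
      B v = B₀ (v 0) (v 1 ^ (k + 2)) := ⟨_, (hAB (by fun_prop) (by fun_prop)).2, fun _ => rfl⟩
  have eS : ∀ v : Fin 4 → ℂ, m v * (v 0 + v 1 ^ (k + 2)) ^ (n + 2) = v 0 ^ (n + 2) * A v +
    (v 1 ^ (k + 2)) ^ (n + 2) * B v := fun v => by rw [em, eA, eB, eAB]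
  have eM : ∀ v : Fin 4 → ℂ, (v 0 + v 1 ^ (k + 2)) ^ (n + 3) = v 0 ^ (n + 3) + (v 1 ^ (k +
    2)) ^ (n + 3) + v 0 * v 1 ^ (k + 2) * m v := fun v => by rw [em, add_pow_eq_powMix]
  refine pairHasGabrielovNumbers_of_pairGerm 0 (n + 1) 0 ((k + 2) * (n + 2) + k) (n + 1) 0 0 0 ?_
    (by omega)
    (Φ := fun v => ![v 0, v 1, v 2 + (v 0 + v 1 ^ (k + 2)), v 3 + powQuot (n + 3) (v 0 + v 1 ^ (k +
      2)) (v 2)])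
    ?_ (fun v => !![1, 0; -(v 1 ^ (k + 1) * m v), 1]) ?_ ?_
    (fun v => ![1 - ((n + 3) ^ 2 * (v 0 + v 1 ^ (k + 2)) ^ (n + 1) + 2 * (n + 3) * (v 2 * R v)) *
      v 1 ^ (k + 1) * m v - 2 * v 1 ^ (k + 1) * v 2 ^ 2 * R v ^ 2, -((n + 3) ^ 2 * (v 0 + v 1 ^ (k +
      2)) ^ (n + 1) + 2 * (n + 3) * (v 2 * R v)), -((n + 3) ^ 2 * (v 0 + v 1 ^ (k + 2)) ^ (n + 1) +
      2 * (n + 3) * (v 2 * R v)), -(2 * ((n + 3) * (v 0 + v 1 ^ (k + 2)) ^ (n + 1) + v 2 * R v)),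
      -(2 * ((n + 3) * (v 0 + v 1 ^ (k + 2)) ^ (n + 1) + v 2 * R v) * v 1 ^ (k + 1)), -(2 * ((n +
      3) * (v 0 + v 1 ^ (k + 2)) ^ (n + 1) + v 2 * R v)), -(2 * ((n + 3) * (v 0 + v 1 ^ (k +
      2)) ^ (n + 1) + v 2 * R v) * v 1 ^ (k + 1)), -1, -1, -2, -(v 2 * R v ^ 2), 0, -(v 2 *
      R v ^ 2 * (v 1 ^ (k + 1)) ^ 2), 0])
    (fun v => ![-1 + (v 1 ^ (k + 1) * m v) * (2 * v 2 ^ (n + 1) + 2 * (v 0 + v 1 ^ (k + 2)) * R v),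
      (v 1 ^ (k + 1) * m v) * (v 2 ^ (n + 1) + 2 * (v 0 + v 1 ^ (k + 2)) * R v), (v 1 ^ (k + 1) *
      m v), (n + 3) * (v 1 ^ (k + 1) * A v) * (2 * v 2 ^ (n + 1) + 2 * (v 0 + v 1 ^ (k + 2)) * R v),
      2 * (n + 3) * (v 1 ^ (k + 1) * A v), (n + 3) * B v * (2 * v 2 ^ (n + 1) + 2 * (v 0 +
      v 1 ^ (k + 2)) * R v), 2 * (n + 3) * B v, 1 + (n + 3) ^ 2 * (v 1 ^ (k + 1) * A v) *
      (v 0 ^ (n + 1) + v 1 ^ (k + 2) * l v), 1 + (n + 3) ^ 2 * B v * v 1 ^ (k + 1) * ((v 1 ^ (k +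
      2)) ^ (n + 1) + v 0 * l v), (n + 3) ^ 2 * (A v + B v), R v ^ 2 * (v 1 ^ (k + 1) * m v) *
      (v 0 + v 1 ^ (k + 2)), R v ^ 2 * (v 1 ^ (k + 1) * m v) * (v 0 + v 1 ^ (k + 2)) * v 1 ^ (k +
      1), 0, 0]) ?_ ?_ ?_
  · funext i; fin_cases i <;> simp <;> ring
  · refine isCoordinateChange_of_leftInverse (Ψ := fun v => ![v 0, v 1, v 2 - (v 0 + v 1 ^ (k + 2)),
      v 3 - powQuot (n + 3) (v 0 + v 1 ^ (k + 2)) (v 2 - (v 0 + v 1 ^ (k + 2)))]) fun i => ⟨?_, ?_,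
      ?_, fun v => ?_⟩ <;>
    fin_cases i <;> simp <;> first | fun_prop | ring
  · intro i j; fin_cases i <;> fin_cases j <;> simp <;> fun_prop
  · simp [Matrix.det_fin_two]
  · intro j; fin_cases j <;> simp <;> fun_prop
  · constructor <;> constructor <;> simp
  · intro v
    constructor <;> simp [Fin.sum_univ_succ]
    · rw [eR]
      linear_combination (-(((n + 3) ^ 2 * (v 0 + v 1 ^ (k + 2)) ^ (n + 1) + 2 * (n + 3) * (v 2 *
        R v)))) * eM v
    · rw [add_comm (v 2), add_pow_eq_powQuot (n + 3), eR]
      linear_combination eM v + v 1 ^ (k + 1) * (n + 3) * (2 * v 3 + 2 * v 2 ^ (n + 2) + 2 * (v 0 +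
        v 1 ^ (k + 2)) * v 2 * R v + (n + 3) * (v 0 + v 1 ^ (k + 2)) ^ (n + 2)) * eS v + (n +
        3) ^ 2 * v 1 ^ (k + 1) * (v 0 ^ (n + 2) * A v + (v 1 ^ (k + 2)) ^ (n + 2) * B v) * el v

theorem pairGabrielov_III_two {k : ℕ} :
    HasPairGabrielov (.III 2 (k + 2)) ![2, 2, 2, 2 * (k + 2)] := by
  obtain ⟨E, hE, E0, eE⟩ := exists_add_pow_quot (k + 2)
    (fun v : Fin 4 → ℂ => v 1) (fun v => 4 * (v 3 + v 2 + v 0)) (by fun_prop)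
  simp at E0
  refine pairHasGabrielovNumbers_of_pairGerm 0 0 (k+1) 0 0 0 0 0 ?_ (by omega)
    (Φ := fun v => ![v 0, v 1 + 4 * (v 3 + v 2 + v 0), v 2 + (v 0 + (v 1 + 4 * (v 3 + v 2 +
      v 0)) ^ (k + 2)), v 3 + (v 2 + 2 * (v 0 + (v 1 + 4 * (v 3 + v 2 + v 0)) ^ (k + 2)))])
    ?_ (fun v => !![1, -2; 0, 1]) ?_ ?_
    (fun v => ![-(12 * v 1 ^ (k + 1) * (1 + 4 * E v)) + 1, -(2 * (24 * E v * (1 + 2 * E v) + 1)),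
      -(6 * v 1 ^ (k + 1)), -(64 * E v * (1 + 3 * E v)), 0, -(64 * E v * (1 + 3 * E v)), 0, -(16 *
      E v * (1 + 6 * E v)) - 1, -(16 * E v * (1 + 6 * E v)) - 1, -(32 * E v * (1 + 6 * E v)), 0, 0,
      -(4 * v 1 ^ k * (1 + 12 * E v)), -(4 * v 1 ^ k * (1 + 12 * E v))])
    (fun v => ![32 * E v ^ 2 - 1, 16 * E v ^ 2, 16 * E v ^ 2, 8 * E v * (1 + 4 * E v), 8 * E v *
      (1 + 4 * E v), 8 * E v, 8 * E v, 8 * E v * (1 + 2 * E v) + 1, 1, 2 * (1 + 4 * E v), 0, 0, 0,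
      0])
      ?_ ?_ ?_
  · funext i; fin_cases i <;> simp <;> ring
  · refine isCoordinateChange_of_leftInverse (Ψ := fun v => ![v 0, v 1 - 4 * (v 3 - v 0 - 2 *
      v 1 ^ (k + 2)), v 2 - (v 0 + v 1 ^ (k + 2)), v 3 - (v 2 - (v 0 + v 1 ^ (k + 2)) + 2 * (v 0 +
      v 1 ^ (k + 2)))]) fun i => ⟨?_, ?_, ?_, fun v => ?_⟩ <;>
    fin_cases i <;> simp <;> first | fun_prop | ring
  · intro i j; fin_cases i <;> fin_cases j <;> simp <;> fun_prop
  · simp [Matrix.det_fin_two]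
  · intro j; fin_cases j <;> simp <;> fun_prop
  · constructor <;> constructor <;> simp [E0]
  · intro v
    constructor <;> simp [Fin.sum_univ_succ]
    · linear_combination (-(2 * (12 * E v * (v 3 + v 2 + v 0) + 2 * v 3 + 2 * v 2 + 6 * v 0 + 3 *
        v 1 ^ (k + 2) + 3 * ((v 1 + 4 * (v 3 + v 2 + v 0)) ^ (k + 2))))) * eE v
    · linear_combination (4 * E v * (v 3 + v 2 + v 0) + 2 * v 0 + v 1 ^ (k + 2) + ((v 1 + 4 * (v 3 +
        v 2 + v 0)) ^ (k + 2))) * eE v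

theorem pairGabrielov_IIB {n k : ℕ} :
    HasPairGabrielov (.IIB (n + 3) (k + 2)) ![2 * k + 2, 2, n + 3, n + 3] := by
  obtain ⟨Q, hQ, Q0, eQ⟩ := exists_add_pow_two (n + 1)
    (fun v : Fin 4 → ℂ => v 0 + v 1) (fun v => 2 * (v 3 + v 2 ^ (k + 1))) (by fun_prop)
  simp at Q0
  obtain ⟨R, hR, R0, eR⟩ := exists_add_pow_mix (n + 2)
    (fun v : Fin 4 → ℂ => v 0) (fun v => v 1) (by fun_prop)
  simp at R0
  obtain ⟨R1, hR1, -, eR1⟩ := exists_add_pow_mix (n + 1)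
    (fun v : Fin 4 → ℂ => v 0) (fun v => v 1) (by fun_prop)
  refine pairHasGabrielovNumbers_of_pairGerm 0 (n+1) 0 (n+1) k 0 0 0 ?_ (by omega)
    (Φ := fun v => ![v 0 + v 1 + 2 * (v 3 + v 2 ^ (k + 1)), v 1, v 2, v 3 + (v 1 + v 2 ^ (k + 1))])
    ?_ (fun v => !![4 * R1 v * v 2 ^ k * (v 2 ^ (k + 1) * (n + 3) + n * v 3 + 3 * v 3) + 2 * R v *
      v 2 ^ k + 1, -(2 * v 2 ^ k); -(2 * R1 v * (v 2 ^ (k + 1) * (n + 3) + n * v 3 + 3 * v 3)) -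
      R v, 1]) ?_ ?_
    (fun v => ![1, -(2 * v 2 ^ k), -(2 * v 2 ^ k), 0, 0, 0, 0, -(4 * R1 v * v 2 ^ (2 * k + 1) * (n +
      3)) - 2 * v 2 ^ k * (R v + 4 * Q v) - 1, -(2 * v 2 ^ k * (2 * R1 v * v 3 * (n + 3) + R v + 4 *
      Q v)) - 1, -(4 * v 2 ^ k * (3 * R1 v * (v 2 ^ (k + 1) * (n + 3) + n * v 3 + 3 * v 3) + R v +
      4 * Q v)), -(4 * v 0 ^ n * v 2 ^ (2 * k) * (n + 3)), -(4 * v 0 ^ n * v 2 ^ k * (n + 3)), -(4 *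
      v 1 ^ n * v 2 ^ (2 * k) * (n + 3)), -(4 * v 1 ^ n * v 2 ^ k * (n + 3))])
    (fun v => ![6 * R1 v * v 2 ^ k * (v 2 ^ (k + 1) * (n + 3) + n * v 3 + 3 * v 3) + 2 * v 2 ^ k *
      (R v + 4 * Q v) - 1, v 2 ^ k * (2 * R1 v * v 2 ^ (k + 1) * (n + 3) + R v + 4 * Q v), 2 *
      R1 v * v 3 * (n + 3) + R v + 4 * Q v, 2 * v 2 ^ k * (n + 3), 2 * (n + 3), 2 * v 2 ^ k * (n +
      3), 2 * (n + 3), 1, 1, 0, 0, 0, 0, 0]) ?_ ?_ ?_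
  · funext i; fin_cases i <;> simp <;> ring
  · refine isCoordinateChange_of_leftInverse (Ψ := fun v => ![v 0 - v 1 - 2 * (v 3 - v 1), v 1, v 2,
      v 3 - (v 1 + v 2 ^ (k + 1))]) fun i => ⟨?_, ?_, ?_, fun v => ?_⟩ <;>
    fin_cases i <;> simp <;> first | fun_prop | ring
  · intro i j; fin_cases i <;> fin_cases j <;> simp <;> fun_prop
  · simp [Matrix.det_fin_two, R0]
  · intro j; fin_cases j <;> simp <;> fun_prop
  · constructor <;> constructor <;> simp [Q0, R0]
  · intro v
    constructor <;> simp [Fin.sum_univ_succ]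
    · linear_combination (norm := (push_cast; ring1)) (-(2 * v 2 ^ k)) * eQ v + (-(2 * v 2 ^ k)) *
        eR v + (-(4 * v 2 ^ k * (v 2 ^ (k + 1) * (n + 3) + n * v 3 + 3 * v 3))) * eR1 v
    · linear_combination (norm := (push_cast; ring1)) eQ v + eR v + (2 * (v 2 ^ (k + 1) * (n + 3) +
        n * v 3 + 3 * v 3)) * eR1 v

theorem pairGabrielov_IIB_two {k : ℕ} :
    HasPairGabrielov (.IIB 2 (k + 3)) ![2 * k + 4, 2, 2, 2] := by
  obtain ⟨E, hE, E0, eE⟩ := exists_add_pow_quot (k + 2)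
    (fun v : Fin 4 → ℂ => v 2) (fun v => 4 * v 0 + 4 * v 1 + 6 * v 3) (by fun_prop)
  simp at E0
  refine pairHasGabrielovNumbers_of_pairGerm 0 0 0 0 (k+1) 0 0 0 ?_ (by omega)
    (Φ := fun v => ![v 0 + v 1 + 2 * (v 3 + (v 2 + (4 * v 0 + 4 * v 1 + 6 * v 3)) ^ (k + 2)), v 1,
      (v 2 + (4 * v 0 + 4 * v 1 + 6 * v 3)), v 3 + (v 1 + (v 2 + (4 * v 0 + 4 * v 1 + 6 *
      v 3)) ^ (k + 2))])
    ?_ (fun v => !![1, 0; -2, 1]) ?_ ?_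
    (fun v => ![1 - 32 * E v ^ 2, -(16 * E v ^ 2), -(16 * E v ^ 2), -(8 * E v), -(8 * E v), -(8 *
      E v * (1 + 6 * E v)), -(8 * E v * (1 + 6 * E v)), -1, -(12 * E v * (1 + 3 * E v)) - 1, -(2 *
      (1 + 6 * E v)), 0, 0, 0, 0])
    (fun v => ![12 * v 2 ^ (k + 1) * (1 + 6 * E v) - 1, 6 * v 2 ^ (k + 1), 72 * E v * (1 + 3 * E v),
      0, 72 * E v * (1 + 4 * E v), 0, 72 * E v * (1 + 4 * E v), 16 * E v * (6 * E v + 1) + 1, 16 *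
      E v * (6 * E v + 1) + 1, 32 * E v * (6 * E v + 1), 4 * v 2 ^ k * (12 * E v + 1), 4 * v 2 ^ k *
      (12 * E v + 1), 0, 0]) ?_ ?_ ?_
  · funext i; fin_cases i <;> simp <;> ring
  · refine isCoordinateChange_of_leftInverse (Ψ := fun v => ![v 0 - v 1 - 2 * (v 3 - v 1), v 1,
      v 2 - (4 * (v 0 - v 1 - 2 * (v 3 - v 1)) + 4 * v 1 + 6 * (v 3 - v 1 - v 2 ^ (k + 2))), v 3 -
      (v 1 + v 2 ^ (k + 2))]) fun i => ⟨?_, ?_, ?_, fun v => ?_⟩ <;>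
    fin_cases i <;> simp <;> first | fun_prop | ring
  · intro i j; fin_cases i <;> fin_cases j <;> simp <;> fun_prop
  · simp [Matrix.det_fin_two]
  · intro j; fin_cases j <;> simp <;> fun_prop
  · constructor <;> constructor <;> simp [E0]
  · intro v
    constructor <;> simp [Fin.sum_univ_succ]
    · linear_combination (-(2 * E v * (2 * v 0 + 2 * v 1 + 3 * v 3)) - 2 * v 3 - v 2 ^ (k + 2) -
        ((v 2 + (4 * v 0 + 4 * v 1 + 6 * v 3)) ^ (k + 2))) * eE v
    · linear_combination (2 * (6 * E v * (2 * v 0 + 2 * v 1 + 3 * v 3) + 6 * v 3 + 2 * v 0 + 2 *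
        v 1 + 3 * v 2 ^ (k + 2) + 3 * ((v 2 + (4 * v 0 + 4 * v 1 + 6 * v 3)) ^ (k + 2)))) * eE v

theorem pairGabrielov_IIBsharp {n k : ℕ} :
    HasPairGabrielov (.IIBsharp (n + 3) (k + 3)) ![k + 3, n + 3, n + 3, k + 3] := by
  obtain ⟨R, hR, eR⟩ := exists_add_pow_three n
    (fun v : Fin 4 → ℂ => v 3) (fun v => v 0) (by fun_prop)
  obtain ⟨S, hS, eS⟩ := exists_add_pow_three n
    (fun v : Fin 4 → ℂ => v 0) (fun v => v 3) (by fun_prop)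
  obtain ⟨R1, hR1, eR1⟩ := exists_add_pow_three (k)
    (fun v : Fin 4 → ℂ => v 2) (fun v => v 1) (by fun_prop)
  obtain ⟨S1, hS1, eS1⟩ := exists_add_pow_three (k)
    (fun v : Fin 4 → ℂ => v 1) (fun v => v 2) (by fun_prop)
  refine pairHasGabrielovNumbers_of_pairGerm 0 (n+1) 0 (k+1) 0 (k+1) 0 (n+1) ?_ (by omega)
    (Φ := fun v => ![v 0 + v 3, v 1, v 2 + v 1, v 3])
    ?_ (fun v => !![1, -1; 0, 1]) ?_ ?_
    (fun v => ![1, -1, -1, 0, -k - 3, -n - 3, 0, -1, -1, 0, 0, -R v, -R1 v, 0])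
    (fun v => ![-1, 1, 1, 0, n + 3, k + 3, 0, 1, 1, 0, 0, S1 v, S v, 0]) ?_ ?_ ?_
  · funext i; fin_cases i <;> simp <;> ring
  · refine isCoordinateChange_of_leftInverse (Ψ := fun v => ![v 0 - v 3, v 1, v 2 - v 1, v 3]) fun i
      => ⟨?_, ?_, ?_, fun v => ?_⟩ <;>
    fin_cases i <;> simp <;> first | fun_prop | ring
  · intro i j; fin_cases i <;> fin_cases j <;> simp <;> fun_prop
  · simp [Matrix.det_fin_two]
  · intro j; fin_cases j <;> simp <;> fun_prop
  · constructor <;> constructor <;> simp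
  · intro v
    constructor <;> simp [Fin.sum_univ_succ]
    · linear_combination (-1) * eR v + (-1) * eR1 v
    · linear_combination eS v + eS1 v

theorem pairGabrielov_IIBsharp_two_left {k : ℕ} :
    HasPairGabrielov (.IIBsharp 2 (k + 3)) ![k + 3, 2, 2, k + 3] := by
  obtain ⟨Q, hQ, Q0, eQ⟩ := exists_add_pow_two (k + 1)
    (fun v : Fin 4 → ℂ => v 2 + v 1) (fun v => 3 * (v 0 + v 3)) (by fun_prop)
  simp at Q0
  obtain ⟨R1, hR1, eR1⟩ := exists_add_pow_three (k)
    (fun v : Fin 4 → ℂ => v 2) (fun v => v 1) (by fun_prop)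
  obtain ⟨S1, hS1, eS1⟩ := exists_add_pow_three (k)
    (fun v : Fin 4 → ℂ => v 1) (fun v => v 2) (by fun_prop)
  obtain ⟨M, hM, -, eM⟩ := exists_add_pow_mix (k + 1)
    (fun v : Fin 4 → ℂ => v 2) (fun v => v 1) (by fun_prop)
  refine pairHasGabrielovNumbers_of_pairGerm 0 0 0 (k+1) 0 (k+1) 0 0 ?_ (by omega)
    (Φ := fun v => ![v 0 + v 3, v 1 + v 0 + 2 * v 3, v 2 + v 1 + 3 * (v 0 + v 3), v 3])
    ?_ (fun v => !![1, -1; 0, 1]) ?_ ?_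
    (fun v => ![-(3 * v 1 ^ (k + 1) * (k + 3)) - 3 * M v * v 2 * (k + 3) + 1, -(9 * Q v), -1, -(3 *
      (k + 3)), -k - 3, -(18 * Q v), -(3 * M v * v 2 * (k + 3)), -1, -1 - 9 * Q v, -(3 * (k + 3)),
      0, 0, -R1 v, -(3 * v 1 ^ k * (k + 3))])
    (fun v => ![3 * v 2 ^ (k + 1) * (k + 3) + 3 * M v * v 1 * (k + 3) - 1, 1, 9 * Q v, 3 * M v *
      v 1 * (k + 3), 18 * Q v, k + 3, 3 * (k + 3), 1 + 9 * Q v, 1, 3 * (k + 3), 3 * v 2 ^ k * (k +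
      3), S1 v, 0, 0]) ?_ ?_ ?_
  · funext i; fin_cases i <;> simp <;> ring
  · refine isCoordinateChange_of_leftInverse (Ψ := fun v => ![v 0 - v 3, v 1 - (v 0 - v 3) - 2 *
      v 3, v 2 - (v 1 - (v 0 - v 3) - 2 * v 3) - 3 * v 0, v 3]) fun i => ⟨?_, ?_, ?_, fun v => ?_⟩
      <;>
    fin_cases i <;> simp <;> first | fun_prop | ring
  · intro i j; fin_cases i <;> fin_cases j <;> simp <;> fun_prop
  · simp [Matrix.det_fin_two]
  · intro j; fin_cases j <;> simp <;> fun_prop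
  · constructor <;> constructor <;> simp [Q0]
  · intro v
    constructor <;> simp [Fin.sum_univ_succ]
    · linear_combination (norm := (push_cast; ring1)) (-1) * eQ v + (-1) * eR1 v + (-(3 * (k * v 0 +
        k * v 3 + 3 * v 0 + 3 * v 3))) * eM v
    · linear_combination (norm := (push_cast; ring1)) eQ v + eS1 v + (3 * (k * v 0 + k * v 3 + 3 *
        v 0 + 3 * v 3)) * eM v

theorem pairGabrielov_IIBsharp_two_right {n : ℕ} :
    HasPairGabrielov (.IIBsharp (n + 3) 2) ![2, n + 3, n + 3, 2] := by
  obtain ⟨Q, hQ, Q0, eQ⟩ := exists_add_pow_two (n + 1)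
    (fun v : Fin 4 → ℂ => v 0 + v 3) (fun v => 3 * (v 1 + v 2)) (by fun_prop)
  simp at Q0
  obtain ⟨R1, hR1, eR1⟩ := exists_add_pow_three n
    (fun v : Fin 4 → ℂ => v 3) (fun v => v 0) (by fun_prop)
  obtain ⟨S1, hS1, eS1⟩ := exists_add_pow_three n
    (fun v : Fin 4 → ℂ => v 0) (fun v => v 3) (by fun_prop)
  obtain ⟨M, hM, -, eM⟩ := exists_add_pow_mix (n + 1)
    (fun v : Fin 4 → ℂ => v 0) (fun v => v 3) (by fun_prop)
  refine pairHasGabrielovNumbers_of_pairGerm 0 (n+1) 0 0 0 0 0 (n+1) ?_ (by omega)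
    (Φ := fun v => ![v 0 + v 3 + 3 * (v 1 + v 2), v 1, v 2 + v 1, v 3 + 2 * v 1 + v 2])
    ?_ (fun v => !![1, -1; 0, 1]) ?_ ?_
    (fun v => ![-(3 * v 0 ^ (n + 1) * (n + 3)) - 3 * M v * v 3 * (n + 3) + 1, -1, -(9 * Q v), -(3 *
      M v * v 3 * (n + 3)), -(18 * Q v), -n - 3, -(3 * (n + 3)), -1 - 9 * Q v, -1, -(3 * (n + 3)),
      -(3 * v 0 ^ n * (n + 3)), -R1 v, 0, 0])
    (fun v => ![3 * v 3 ^ (n + 1) * (n + 3) + 3 * M v * v 0 * (n + 3) - 1, 9 * Q v, 1, 3 * (n + 3),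
      n + 3, 18 * Q v, 3 * M v * v 0 * (n + 3), 1, 9 * Q v + 1, 3 * (n + 3), 0, 0, S1 v, 3 *
      v 3 ^ n * (n + 3)]) ?_ ?_ ?_
  · funext i; fin_cases i <;> simp <;> ring
  · refine isCoordinateChange_of_leftInverse (Ψ := fun v => ![v 0 - (v 3 - 2 * v 1 - (v 2 - v 1)) -
      3 * v 2, v 1, v 2 - v 1, v 3 - 2 * v 1 - (v 2 - v 1)]) fun i => ⟨?_, ?_, ?_, fun v => ?_⟩ <;>
    fin_cases i <;> simp <;> first | fun_prop | ring
  · intro i j; fin_cases i <;> fin_cases j <;> simp <;> fun_prop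
  · simp [Matrix.det_fin_two]
  · intro j; fin_cases j <;> simp <;> fun_prop
  · constructor <;> constructor <;> simp [Q0]
  · intro v
    constructor <;> simp [Fin.sum_univ_succ]
    · linear_combination (norm := (push_cast; ring1)) (-1) * eQ v + (-1) * eR1 v + (-(3 * (n * v 1 +
        n * v 2 + 3 * v 1 + 3 * v 2))) * eM v
    · linear_combination (norm := (push_cast; ring1)) eQ v + eS1 v + (3 * (n * v 1 + n * v 2 + 3 *
        v 1 + 3 * v 2)) * eM v

theorem pairGabrielov_IV1 {k n : ℕ} :
    HasPairGabrielov (.IV1 (k + 2) (n + 3)) ![2 * n + 4, 2, n + 3, 3 * k + 5] := by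
  obtain ⟨R, hR, eR⟩ := exists_powQuot_eq n
    (fun v : Fin 4 → ℂ => v 0) (fun v => v 2) (by fun_prop)
  refine pairHasGabrielovNumbers_of_pairGerm 0 (n+1) (k+1) (k+1) (n+1) 0 0 0 ?_ (by omega)
    (Φ := fun v => ![v 0, v 1, v 2 + v 0, v 3 + (powQuot (n + 3) (v 0) (v 2) + v 1 ^ (k + 2))])
    ?_ (fun v => !![1, 0; -v 1 ^ (k + 1), 1]) ?_ ?_
    (fun v => ![-(2 * v 0 ^ (n + 1) * v 1 ^ (k + 1) * (n + 3)) + 1 - 2 * R v * v 1 ^ (k + 1) * v 2,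
      -(v 0 ^ (n + 1) * (n ^ 2 + 6 * n + 9)), -1, -(2 * R v * v 2), 0, -(2 * R v * v 2), 0, -1, -1,
      -2, -(2 * v 0 ^ n * (v 2 ^ (n + 1) * (n + 3) + R v * v 0 * (n + 3))) - R v ^ 2 * v 2, -(2 *
      v 0 ^ n * (n + 3)), -(2 * v 1 ^ k * v 2 ^ (n + 1)), -(2 * v 1 ^ k)])
    (fun v => ![2 * v 1 ^ (k + 1) * (v 2 ^ (n + 1) + R v * v 0) - 1, 0, 0, 2 * R v * v 0 *
      v 1 ^ (k + 1) * (n + 3), 2 * v 1 ^ (k + 1) * (n + 3), 2 * R v * v 0, 2, v 0 ^ (n + 1) *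
      v 1 ^ (k + 1) * (n ^ 2 + 6 * n + 9) + 1, 1, 2 * (n + 3), v 1 ^ (k + 1) * (2 * v 0 ^ (n + 1) *
      v 2 ^ n * (n + 3) + R v * (2 * v 2 ^ (n + 1) + R v * v 0)), v 1 ^ k * v 2 ^ n * (v 2 ^ (n +
      2) + 2 * v 1 ^ (k + 2)), 0, v 1 ^ k]) ?_ ?_ ?_
  · funext i; fin_cases i <;> simp <;> ring
  · refine isCoordinateChange_of_leftInverse (Ψ := fun v => ![v 0, v 1, v 2 - v 0, v 3 -
      (powQuot (n + 3) (v 0) (v 2 - v 0) + v 1 ^ (k + 2))]) fun i => ⟨?_, ?_, ?_, fun v => ?_⟩ <;>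
    fin_cases i <;> simp <;> first | fun_prop | ring
  · intro i j; fin_cases i <;> fin_cases j <;> simp <;> fun_prop
  · simp [Matrix.det_fin_two]
  · intro j; fin_cases j <;> simp <;> fun_prop
  · constructor <;> constructor <;> simp
  · intro v
    constructor <;> simp [Fin.sum_univ_succ]
    · linear_combination (-(v 0 ^ (n + 2) * (n + 3)) - 2 * v 3 - 2 * v 1 ^ (k + 2) - v 2 ^ (n + 2) -
        R v * v 0 * v 2 - (powQuot (n + 3) (v 0) (v 2))) * eR v
    · linear_combination add_pow_eq_powQuot (n + 3) (v 0) (v 2) + (v 1 ^ (k + 1) * (v 0 ^ (n + 2) *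
        (n + 3) + 2 * v 3 + 2 * v 1 ^ (k + 2) + v 2 ^ (n + 2) + R v * v 0 * v 2 + (powQuot (n +
        3) (v 0) (v 2)))) * eR v

theorem pairGabrielov_IV1_two {k : ℕ} :
    HasPairGabrielov (.IV1 (k + 2) 2) ![2, 2, 2, 3 * k + 5] := by
  obtain ⟨E, hE, E0, eE⟩ := exists_add_pow_quot (k + 2)
    (fun v : Fin 4 → ℂ => v 1) (fun v => 4 * (v 3 + v 2 + v 0)) (by fun_prop)
  simp at E0
  refine pairHasGabrielovNumbers_of_pairGerm 0 0 (k+1) (k+1) 0 0 0 0 ?_ (by omega)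
    (Φ := fun v => ![v 0, v 1 + 4 * (v 3 + v 2 + v 0), v 2 + v 0, v 3 + (2 * v 0 + v 2 + ((v 1 + 4 *
      (v 3 + v 2 + v 0)) ^ (k + 2)))])
    ?_ (fun v => !![2 * v 1 ^ (k + 1) + 1, -2; -v 1 ^ (k + 1), 1]) ?_ ?_
    (fun v => ![-(8 * E v * v 1 ^ k * (4 * E v * (2 * v 3 + 2 * v 2 + v 0) + 6 * v 3 + 6 * v 2 + 4 *
      v 0 + 2 * v 1 ^ (k + 2) + v 1)) - 4 * v 1 ^ (k + 1) * (1 + 2 * v 1 ^ (k + 1)) + 1, -(2 * (4 *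
      E v * (3 + 2 * E v) + 1)), -(2 * v 1 ^ (k + 1)) - 1, -(32 * E v * (1 + E v)), -(2 * v 1 ^ k *
      v 2 * (8 * E v * (1 + 2 * E v) + 1)), -(32 * E v * (1 + E v)), -(2 * v 3 * v 1 ^ k * (8 *
      E v * (1 + 2 * E v) + 1)), -(8 * E v * (1 + 2 * E v)) - 1, -(8 * E v * (1 + 2 * E v)) - 1,
      -(4 * (v 1 ^ (k + 1) * (8 * E v * (1 + 2 * E v) + 1) + 4 * E v * (1 + 2 * E v))), 0, 0, -(2 *
      v 1 ^ k * (2 * v 1 ^ (k + 1) * (1 + 4 * E v) + 1 + 4 * E v)), -(2 * v 1 ^ k * (2 * v 1 ^ (k +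
      1) * (1 + 4 * E v) + 1 + 4 * E v))])
    (fun v => ![2 * v 1 ^ (k + 1) * (8 * E v * (1 + 2 * E v) + 1) - 1, 0, 0, 4 * E v * (2 *
      v 1 ^ (k + 1) * (3 + 4 * E v) + 1), 4 * E v * (2 * v 1 ^ (k + 1) * (3 + 4 * E v) + 1), 2 *
      (1 + 4 * E v), 2 * (1 + 4 * E v), 16 * E v * v 1 ^ (k + 1) * (1 + E v) + 1 + 4 * E v, 1, 4 *
      (1 + 2 * E v), 0, v 1 ^ k * (8 * E v * (1 + 2 * E v) + 1), 0, v 1 ^ k * (8 * E v * (1 + 2 *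
      E v) + 1)])
      ?_ ?_ ?_
  · funext i; fin_cases i <;> simp <;> ring
  · refine isCoordinateChange_of_leftInverse (Ψ := fun v => ![v 0, v 1 - 4 * (v 3 - v 0 - v 1 ^ (k +
      2)), v 2 - v 0, v 3 - (v 0 + v 2 + v 1 ^ (k + 2))]) fun i => ⟨?_, ?_, ?_, fun v => ?_⟩ <;>
    fin_cases i <;> simp <;> first | fun_prop | ring
  · intro i j; fin_cases i <;> fin_cases j <;> simp <;> fun_prop
  · simp [Matrix.det_fin_two]
  · intro j; fin_cases j <;> simp <;> fun_prop
  · constructor <;> constructor <;> simp [E0]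
  · intro v
    constructor <;> simp [Fin.sum_univ_succ]
    · linear_combination (-(v 1 ^ (k + 1) * (8 * E v * (v 3 + v 2 + v 0) + 4 * v 3 + 8 * v 0 + 4 *
        v 2 + 2 * v 1 ^ (k + 2) + v 1 + 2 * ((v 1 + 4 * (v 3 + v 2 + v 0)) ^ (k + 2)))) - 4 * E v *
        (v 3 + v 2 + v 0) - 2 * v 3 - 6 * v 0 - 2 * v 2 - ((v 1 + 4 * (v 3 + v 2 + v 0)) ^ (k +
        2))) * eE v
    · linear_combination (v 1 ^ (k + 1) * (4 * E v * (v 3 + v 2 + v 0) + 2 * v 3 + 4 * v 0 + 2 *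
        v 2 + v 1 ^ (k + 2) + ((v 1 + 4 * (v 3 + v 2 + v 0)) ^ (k + 2))) + v 0) * eE v

theorem pairGabrielov_IV1_one {n : ℕ} :
    HasPairGabrielov (.IV1 1 (n + 3)) ![2 * n + 4, 2, n + 3, 2] := by
  obtain ⟨R, hR, eR⟩ := exists_powQuot_eq n
    (fun v : Fin 4 → ℂ => (v 0 + (v 1 + 2 * v 3))) (fun v => (v 2 + (2 * v 1 + v 3))) (by fun_prop)
  obtain ⟨T, hT, T0, eT⟩ := exists_add_pow_quot (n + 2)
    (fun v : Fin 4 → ℂ => v 2) (fun v => 2 * v 1 + v 3) (by fun_prop)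
  simp at T0
  obtain ⟨S, hS, S0, eS⟩ := exists_add_pow_quot (n + 2)
    (fun v : Fin 4 → ℂ => v 0) (fun v => v 1 + 2 * v 3) (by fun_prop)
  simp at S0
  obtain ⟨Q, hQ, Q0, eQ⟩ := exists_add_pow_two (n + 1)
    (fun v : Fin 4 → ℂ => v 0) (fun v => v 1 + 2 * v 3) (by fun_prop)
  simp at Q0
  obtain ⟨G, hG, G0, eG⟩ : ∃ G : (Fin 4 → ℂ) → ℂ, AnalyticAt ℂ G 0 ∧ G 0 = 0 ∧ ∀ v, G v =
      2 * T v + (n + 3) * S v + R v * ((v 2 + (2 * v 1 + v 3)) + 2 * v 0) :=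
    ⟨_, by fun_prop, by simp [T0, S0], fun _ => rfl⟩
  obtain ⟨H, hH, H0, eH⟩ : ∃ H : (Fin 4 → ℂ) → ℂ, AnalyticAt ℂ H 0 ∧ H 0 = 0 ∧ ∀ v, H v =
      T v + 2 * (n + 3) * S v + R v * (2 * (v 2 + (2 * v 1 + v 3)) + v 0) :=
    ⟨_, by fun_prop, by simp [T0, S0], fun _ => rfl⟩
  have eGH : ∀ v : Fin 4 → ℂ, powQuot (n + 3) (v 0 + (v 1 + 2 * v 3)) (v 2 + (2 * v 1 + v 3)) =
    v 2 ^ (n + 2) + (n + 3) * v 0 ^ (n + 2) + v 0 * v 2 * R v + v 1 * G v + v 3 * H v := by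
    intro v
    linear_combination eR v + eT v + (n + 3) * eS v - v 1 * eG v - v 3 * eH v
  refine pairHasGabrielovNumbers_of_pairGerm 0 (n+1) 0 0 (n+1) 0 0 0 ?_ (by omega)
    (Φ := fun v => ![(v 0 + (v 1 + 2 * v 3)), v 1, (v 2 + (2 * v 1 + v 3)) + (v 0 + (v 1 + 2 *
      v 3)), v 3 + (powQuot (n + 3) (v 0 + (v 1 + 2 * v 3)) (v 2 + (2 * v 1 + v 3)) + v 1)])
    ?_ (fun v => !![1, 0; -1, 1]) ?_ ?_
    (fun v => ![-(2 * v 0 ^ (n + 1) * (G v * (n + 3) + n + 3)) - 2 * R v * v 2 * (G v + 1) + 1,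
      -(v 0 ^ (n + 1) * (n ^ 2 + 6 * n + 9)), -(G v * (G v + 2)), -(2 * R v * v 2), -(2 * (G v +
      1)), -(2 * R v * v 2 * (1 + H v)), -(2 * (G v * (1 + H v) + H v)), -1, -(H v * (2 + H v)) - 1,
      -(2 * (1 + H v)), -(2 * v 0 ^ n * (v 2 ^ (n + 1) * (n + 3) + R v * v 0 * (n + 3))) - R v ^ 2 *
      v 2, -(2 * v 0 ^ n * (H v * (n + 3) + n + 3)), 0, 0])
    (fun v => ![2 * v 2 ^ (n + 1) * (1 + H v) + 2 * R v * v 0 * (1 + H v) - 1, v 2 ^ (n + 1), H v *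
      (2 + H v) + 4 * Q v, 2 * R v * v 0 * (n + 3), 2 * (H v * (n + 3) + 2 * n + 6), 2 * R v * v 0 *
      (G v + 1), 2 * (G v * (1 + H v) + 2 * Q v + H v), v 0 ^ (n + 1) * (n ^ 2 + 6 * n + 9) + 1,
      G v * (G v + 2) + 1 + Q v, 2 * G v * (n + 3) + 3 * n + 9, 2 * v 0 ^ (n + 1) * v 2 ^ n * (n +
      3) + R v * (2 * v 2 ^ (n + 1) + R v * v 0), 2 * v 2 ^ n * (G v + 1), 0, 0]) ?_ ?_ ?_
  · funext i; fin_cases i <;> simp <;> ring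
  · refine isCoordinateChange_of_leftInverse (Ψ := fun v => ![v 0 - (v 1 + 2 * (v 3 - (powQuot (n +
      3) (v 0) (v 2 - v 0) + v 1))), v 1, v 2 - v 0 - (2 * v 1 + (v 3 - (powQuot (n + 3) (v 0) (v 2
      - v 0) + v 1))), v 3 - (powQuot (n + 3) (v 0) (v 2 - v 0) + v 1)]) fun i => ⟨?_, ?_, ?_,
      fun v => ?_⟩ <;>
    fin_cases i <;> simp <;> first | fun_prop | ring
  · intro i j; fin_cases i <;> fin_cases j <;> simp <;> fun_prop
  · simp [Matrix.det_fin_two]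
  · intro j; fin_cases j <;> simp <;> fun_prop
  · constructor <;> constructor <;> simp [G0, H0, Q0]
  · intro v
    constructor <;> simp [Fin.sum_univ_succ]
    · linear_combination (norm := (push_cast; ring1)) (-(v 0 ^ (n + 2) * (n + 3)) - 2 * v 3 - 2 *
        v 1 - v 2 ^ (n + 2) - R v * v 0 * v 2 - G v * v 1 - H v * v 3 - (powQuot (n + 3) (v 0 +
        (v 1 + 2 * v 3)) (v 2 + (2 * v 1 + v 3)))) * eGH v
    · linear_combination (norm := (push_cast; ring1)) add_pow_eq_powQuot (n + 3) (v 0 + (v 1 + 2 *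
        v 3)) (v 2 + (2 * v 1 + v 3)) + (v 0 ^ (n + 2) * (n + 3) + 2 * v 3 + 2 * v 1 + v 2 ^ (n +
        2) + R v * v 0 * v 2 + G v * v 1 + H v * v 3 + (powQuot (n + 3) (v 0 + (v 1 + 2 *
        v 3)) (v 2 + (2 * v 1 + v 3)))) * eGH v + eQ v

theorem pairGabrielov_IV2 {k j : ℕ} :
    HasPairGabrielov (.IV2 (k + 2) (j + 3)) ![2 * j + 4, 2, (k + 2) * (j + 3), k + 3] := by
  obtain ⟨Q, hQ, -, eQ⟩ := exists_add_pow_two (k)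
    (fun v : Fin 4 → ℂ => v 0 + v 1) (fun v => 2 * (v 3 + (v 2 + v 0 ^ (k + 2)) ^ (j + 2))) (by
      fun_prop)
  obtain ⟨M, hM, -, eM⟩ := exists_add_pow_mix (k + 1)
    (fun v : Fin 4 → ℂ => v 0) (fun v => v 1) (by fun_prop)
  obtain ⟨N, hN, -, eN⟩ := exists_add_pow_mix (k)
    (fun v : Fin 4 → ℂ => v 0) (fun v => v 1) (by fun_prop)
  obtain ⟨R, hR, -, eR⟩ := exists_add_pow_mix (j + 1)
    (fun v : Fin 4 → ℂ => v 2) (fun v => v 0 ^ (k + 2)) (by fun_prop)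
  obtain ⟨S, hS, -, eS⟩ := exists_add_pow_two (j)
    (fun v : Fin 4 → ℂ => v 0 ^ (k + 2)) (fun v => v 2) (by fun_prop)
  obtain ⟨La, hLa, La0, eLa⟩ : ∃ La : (Fin 4 → ℂ) → ℂ, AnalyticAt ℂ La 0 ∧ La 0 = 0 ∧ ∀ v, La v =
      M v * (v 1 + (v 3 + (v 2 + v 0 ^ (k + 2)) ^ (j + 2))) + 2 * (k + 2) * (v 3 + (v 2 + v 0 ^ (k +
        2)) ^ (j + 2)) * v 0 ^ k + 2 * (k + 2) * (v 3 + (v 2 + v 0 ^ (k + 2)) ^ (j + 2)) * N v *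
        (v 1 + (v 3 + (v 2 + v 0 ^ (k + 2)) ^ (j + 2))) + v 0 ^ (k + 1) :=
    ⟨_, by fun_prop, by simp, fun _ => rfl⟩
  obtain ⟨H, hH, H0, eH⟩ : ∃ H : (Fin 4 → ℂ) → ℂ, AnalyticAt ℂ H 0 ∧ H 0 = 0 ∧ ∀ v, H v =
      4 * Q v * (v 1 + (v 3 + (v 2 + v 0 ^ (k + 2)) ^ (j + 2))) + 2 * (k + 2) * (v 0 ^ (k + 1) +
        v 1 ^ (k + 1)) + La v :=
    ⟨_, by fun_prop, by simp [La0], fun _ => rfl⟩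
  have eF : ∀ v : Fin 4 → ℂ, ((v 0 + v 1 + 2 * (v 3 + (v 2 + v 0 ^ (k + 2)) ^ (j + 2))) ^ (k + 2) *
    (v 1 + (v 3 + (v 2 + v 0 ^ (k + 2)) ^ (j + 2))) + v 1 * (v 2 + v 0 ^ (k + 2)) + (v 2 +
    v 0 ^ (k + 2)) ^ (j + 3) - (v 2 + v 0 ^ (k + 2)) * (v 1 + (v 3 + (v 2 + v 0 ^ (k + 2)) ^ (j +
    2)))) =
      La v * (v 0 * v 1 - (v 3 + (v 2 + v 0 ^ (k + 2)) ^ (j + 2)) ^ 2) + (-(v 2 * v 3) + v 1 ^ (k +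
        3) + (2 * (k + 2) + 1) * v 1 ^ (k + 2) * (v 3 + (v 2 + v 0 ^ (k + 2)) ^ (j + 2)) + (v 3 +
        (v 2 + v 0 ^ (k + 2)) ^ (j + 2)) ^ 2 * H v + v 0 ^ (k + 2) * (v 2 + v 0 ^ (k + 2)) ^ (j +
        2))
        := by
    intro v
    linear_combination (v 1 + (v 3 + (v 2 + v 0 ^ (k + 2)) ^ (j + 2))) * eQ v + (v 1 + (v 3 + (v 2 +
      v 0 ^ (k + 2)) ^ (j + 2))) * eM v + 2 * (k + 2) * (v 3 + (v 2 + v 0 ^ (k + 2)) ^ (j + 2)) *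
      (v 1 + (v 3 + (v 2 + v 0 ^ (k + 2)) ^ (j + 2))) * eN v - (v 0 * v 1) * eLa v - (v 3 + (v 2 +
      v 0 ^ (k + 2)) ^ (j + 2)) ^ 2 * eH v
  refine pairHasGabrielovNumbers_of_pairGerm (k+1) ((k+2)*(j+1)) 0 (k+1) (j+1) 0 0 0 ?_ (by omega)
    (Φ := fun v => ![(v 0 + v 1 + 2 * (v 3 + (v 2 + v 0 ^ (k + 2)) ^ (j + 2))), v 1, (v 2 +
      v 0 ^ (k + 2)), v 1 + (v 3 + (v 2 + v 0 ^ (k + 2)) ^ (j + 2))])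
    ?_ (fun v => !![2 * La v * v 2 ^ (j + 1) + 1, -(2 * v 2 ^ (j + 1)); -La v, 1]) ?_ ?_
    (fun v => ![-(2 * v 0 ^ (k + 1) * v 1 ^ (k + 1) * v 2 ^ (j + 1) * (v 0 ^ (j * k + 2 * j + k +
      2) * (2 * k + 5) + R v * v 2 * (2 * k + 5))) + 1, -v 0 ^ (j * k + 2 * j + 2 * k + 3), 0, 0, 0,
      0, 0, -1 - 2 * H v * v 2 ^ (j + 1), -1 - 2 * H v * v 2 ^ (j + 1), -(4 * H v * v 2 ^ (j + 1)),
      -(v 0 ^ k * (2 * v 0 ^ (j * k + 2 * j + k + 2) * v 2 ^ j * (v 0 ^ (k + 2) * (H v * (v 0 ^ (j *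
      k + 2 * j + k + 2) + 2 * R v * v 2) + 1) + 2 * H v * (v 3 + v 2 ^ (j + 2)) + v 2) + 2 * R v *
      v 2 ^ (j + 1) * (v 0 ^ (k + 2) * (H v * R v * v 2 + 1) + 2 * H v * (v 3 + v 2 ^ (j + 2)) +
      v 2) + R v * v 0 ^ (k + 2) * (2 * v 0 ^ (j * k + 2 * j + k + 2) + R v * v 2) + 2 * R v * v 3 +
      2 * v 2 ^ (2 * j + 2))), -(2 * v 0 ^ (j * k + 2 * j + 2 * k + 2)), -(2 * v 1 ^ k * v 2 ^ j *
      (v 2 ^ (j + 2) * (2 * k + 5) + v 1 + 2 * k * v 3 + 5 * v 3)), 0])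
    (fun v => ![2 * H v * (v 2 ^ (j + 1) + R v * v 0 ^ (k + 2)) - 1, H v * v 2 ^ (j + 1), H v, 2 *
      H v * R v * v 0 ^ (k + 2) + j + 2, 2 * H v, R v * v 0 ^ (k + 2) * (2 * k + 5), 2 * k + 5,
      H v * v 0 ^ (j * k + 2 * j + k + 2) + 1, 1, 2 * k + 5, v 0 ^ (k + 1) * (H v * v 0 ^ (k + 2) *
      (2 * v 0 ^ (j * k + 2 * j) * v 2 ^ j + R v ^ 2) + 2 * H v * R v * v 2 ^ (j + 1) + S v),
      v 1 ^ (k + 1) * v 2 ^ j * (2 * k + 5), 0, 0]) ?_ ?_ ?_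
  · funext i; fin_cases i <;> simp <;> ring
  · refine isCoordinateChange_of_leftInverse (Ψ := fun v => ![v 0 - v 1 - 2 * (v 3 - v 1), v 1,
      v 2 - (v 0 - v 1 - 2 * (v 3 - v 1)) ^ (k + 2), v 3 - v 1 - v 2 ^ (j + 2)]) fun i => ⟨?_, ?_,
      ?_, fun v => ?_⟩ <;>
    fin_cases i <;> simp <;> first | fun_prop | ring
  · intro i j; fin_cases i <;> fin_cases j <;> simp <;> fun_prop
  · simp [Matrix.det_fin_two, La0]
  · intro j; fin_cases j <;> simp <;> fun_prop
  · constructor <;> constructor <;> simp [H0, La0]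
  · intro v
    constructor <;> simp [Fin.sum_univ_succ]
    · linear_combination (norm := (push_cast; ring1)) (-(2 * v 2 ^ (j + 1))) * eF v + (-(2 *
        v 0 ^ (k + 2) * v 2 ^ (j + 1))) * eR v + (-(v 2 ^ (j + 1) * (2 * H v * (v 0 ^ (k + 2) *
        (v 0 ^ (j * k + 2 * j + k + 2) + R v * v 2) + 2 * v 3 + v 2 ^ (j + 2) + ((v 2 + v 0 ^ (k +
        2)) ^ (j + 2))) + 2 * v 1 ^ (k + 2) * (2 * k + 5) + v 2)) - v 0 ^ (k + 2) * (v 0 ^ (j * k +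
        2 * j + k + 2) + R v * v 2) - 2 * v 3 - ((v 2 + v 0 ^ (k + 2)) ^ (j + 2))) * eR v
    · linear_combination (norm := (push_cast; ring1)) eF v + (v 0 ^ (k + 2)) * eS v + (H v *
        (v 0 ^ (k + 2) * (v 0 ^ (j * k + 2 * j + k + 2) + R v * v 2) + 2 * v 3 + v 2 ^ (j + 2) +
        ((v 2 + v 0 ^ (k + 2)) ^ (j + 2))) + v 1 ^ (k + 2) * (2 * k + 5)) * eR v

theorem pairGabrielov_IV2_two {k : ℕ} :
    HasPairGabrielov (.IV2 (k + 2) (2)) ![2, 2, (k + 2) * 2, k + 3] := by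
  obtain ⟨Q, hQ, -, eQ⟩ := exists_add_pow_two (k)
    (fun v : Fin 4 → ℂ => v 0 + v 1) (fun v => 2 * (v 3 + (v 2 + v 0 ^ (k + 2)))) (by fun_prop)
  obtain ⟨M, hM, -, eM⟩ := exists_add_pow_mix (k + 1)
    (fun v : Fin 4 → ℂ => v 0) (fun v => v 1) (by fun_prop)
  obtain ⟨N, hN, -, eN⟩ := exists_add_pow_mix (k)
    (fun v : Fin 4 → ℂ => v 0) (fun v => v 1) (by fun_prop)
  obtain ⟨La, hLa, La0, eLa⟩ : ∃ La : (Fin 4 → ℂ) → ℂ, AnalyticAt ℂ La 0 ∧ La 0 = 0 ∧ ∀ v, La v =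
      M v * (v 1 + (v 3 + (v 2 + v 0 ^ (k + 2)))) + 2 * (k + 2) * (v 3 + (v 2 + v 0 ^ (k + 2))) * v
        0 ^ k + 2 * (k + 2) * (v 3 + (v 2 + v 0 ^ (k + 2))) * N v * (v 1 + (v 3 + (v 2 + v 0 ^ (k +
          2)))) + v 0 ^ (k + 1) :=
    ⟨_, by fun_prop, by simp, fun _ => rfl⟩
  obtain ⟨H, hH, H0, eH⟩ : ∃ H : (Fin 4 → ℂ) → ℂ, AnalyticAt ℂ H 0 ∧ H 0 = 0 ∧ ∀ v, H v =
      4 * Q v * (v 1 + (v 3 + (v 2 + v 0 ^ (k + 2)))) + 2 * (k + 2) * (v 0 ^ (k + 1) + v 1 ^ (k +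
        1)) + La v :=
    ⟨_, by fun_prop, by simp [La0], fun _ => rfl⟩
  have eF : ∀ v : Fin 4 → ℂ, ((v 0 + v 1 + 2 * (v 3 + (v 2 + v 0 ^ (k + 2)))) ^ (k + 2) * (v 1 +
    (v 3 + (v 2 + v 0 ^ (k + 2)))) + v 1 * (v 2 + v 0 ^ (k + 2)) + (v 2 + v 0 ^ (k + 2)) ^ (2) -
    (v 2 + v 0 ^ (k + 2)) * (v 1 + (v 3 + (v 2 + v 0 ^ (k + 2))))) =
      La v * (v 0 * v 1 - (v 3 + (v 2 + v 0 ^ (k + 2))) ^ 2) + (-(v 2 * v 3) + v 1 ^ (k + 3) + (2 *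
        (k + 2) + 1) * v 1 ^ (k + 2) * (v 3 + (v 2 + v 0 ^ (k + 2))) + (v 3 + (v 2 + v 0 ^ (k +
        2))) ^ 2 * H v + v 0 ^ (k + 2) * (v 2 + v 0 ^ (k + 2))) := by
    intro v
    linear_combination (v 1 + (v 3 + (v 2 + v 0 ^ (k + 2)))) * eQ v + (v 1 + (v 3 + (v 2 +
      v 0 ^ (k + 2)))) * eM v + 2 * (k + 2) * (v 3 + (v 2 + v 0 ^ (k + 2))) * (v 1 + (v 3 + (v 2 +
      v 0 ^ (k + 2)))) * eN v - (v 0 * v 1) * eLa v - (v 3 + (v 2 + v 0 ^ (k + 2))) ^ 2 * eH v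
  refine pairHasGabrielovNumbers_of_pairGerm (k+1) 0 0 (k+1) 0 0 0 0 ?_ (by omega)
    (Φ := fun v => ![(v 0 + v 1 + 2 * (v 3 + (v 2 + v 0 ^ (k + 2)))), v 1, (v 2 + v 0 ^ (k + 2)),
      v 1 + (v 3 + (v 2 + v 0 ^ (k + 2)))])
    ?_ (fun v => !![2 * La v + 1, -2; -La v, 1]) ?_ ?_
    (fun v => ![-(2 * v 0 ^ (k + 1) * v 1 ^ (k + 1) * (2 * k + 5)) + 1, -(v 0 ^ (k + 1) * (3 + 2 *
      H v)), -2, 0, 0, 0, 0, -1 - 2 * H v, -1 - 2 * H v, -(4 * H v), -(4 * v 0 ^ k * (1 + H v)),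
      -(2 * v 0 ^ k * (1 + 2 * H v)), -(2 * v 1 ^ k * (2 * k + 5)), -(2 * v 1 ^ k * (2 * k + 5))])
    (fun v => ![2 * H v - 1, H v, H v, 2 * H v + 1, 2 * H v, 2 * k + 5, 2 * k + 5, H v + 1, 1, 2 *
      k + 5, 0, 0, 0, 0]) ?_ ?_ ?_
  · funext i; fin_cases i <;> simp <;> ring
  · refine isCoordinateChange_of_leftInverse (Ψ := fun v => ![v 0 - v 1 - 2 * (v 3 - v 1), v 1,
      v 2 - (v 0 - v 1 - 2 * (v 3 - v 1)) ^ (k + 2), v 3 - v 1 - v 2]) fun i => ⟨?_, ?_, ?_,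
      fun v =>
      ?_⟩ <;>
    fin_cases i <;> simp <;> first | fun_prop | ring
  · intro i j; fin_cases i <;> fin_cases j <;> simp <;> fun_prop
  · simp [Matrix.det_fin_two, La0]
  · intro j; fin_cases j <;> simp <;> fun_prop
  · constructor <;> constructor <;> simp [H0, La0]
  · intro v
    constructor <;> simp [Fin.sum_univ_succ]
    · linear_combination (-2) * eF v + (-(2 * v 0 ^ (k + 2))) * (rfl : (v 2 + v 0 ^ (k + 2)) = _) +
        (-((v 2 + v 0 ^ (k + 2)) * (1 + 2 * H v)) - 2 * v 1 ^ (k + 2) * (2 * k + 5) - v 0 ^ (k +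
        2) * (1 + 2 * H v) - 2 * H v * (2 * v 3 + v 2) - 2 * v 3 - v 2) * (rfl : (v 2 + v 0 ^ (k +
        2)) = _)
    · linear_combination eF v + (v 0 ^ (k + 2)) * (rfl : (v 2 + v 0 ^ (k + 2)) = _) + (H v * (2 *
        v 3 + v 2 + v 0 ^ (k + 2) + (v 2 + v 0 ^ (k + 2))) + v 1 ^ (k + 2) * (2 * k + 5)) *
        (rfl : (v 2 + v 0 ^ (k + 2)) = _)

theorem pairGabrielov_IV2_one {j : ℕ} :
    HasPairGabrielov (.IV2 1 (j + 3)) ![2 * j + 4, 2, j + 3, 2] := by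
  obtain ⟨E, hE, E0, eE⟩ := exists_add_pow_quot (j + 2)
    (fun v : Fin 4 → ℂ => v 2 + v 0) (fun v => 3 * (v 1 + v 3)) (by fun_prop)
  simp at E0
  obtain ⟨Q, hQ, -, eQ⟩ := exists_add_pow_two (j)
    (fun v : Fin 4 → ℂ => v 2 + v 0) (fun v => 3 * (v 1 + v 3)) (by fun_prop)
  obtain ⟨R, hR, -, eR⟩ := exists_add_pow_mix (j + 1)
    (fun v : Fin 4 → ℂ => v 2) (fun v => v 0) (by fun_prop)
  obtain ⟨S, hS, -, eS⟩ := exists_add_pow_two (j)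
    (fun v : Fin 4 → ℂ => v 0) (fun v => v 2) (by fun_prop)
  obtain ⟨T, hT, -, eT⟩ := exists_add_pow_quot (j + 1)
    (fun v : Fin 4 → ℂ => v 0) (fun v => v 2) (by fun_prop)
  refine pairHasGabrielovNumbers_of_pairGerm 0 (j+1) 0 0 (j+1) 0 0 0 ?_ (by omega)
    (Φ := fun v => ![v 0 + v 1 + 2 * (v 3 + (v 2 + v 0 + 3 * (v 1 + v 3)) ^ (j + 2)), v 1, (v 2 +
      v 0 + 3 * (v 1 + v 3)), v 1 + (v 3 + (v 2 + v 0 + 3 * (v 1 + v 3)) ^ (j + 2))])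
    ?_ (fun v => !![1, 0; -1, 1]) ?_ ?_
    (fun v => ![-(6 * E v * (v 0 ^ (j + 1) + R v * v 2)) + 1, -v 0 ^ (j + 1), -(9 * E v ^ 2), -(2 *
      R v * v 2), -(6 * E v), -(2 * R v * v 2 * (1 + 3 * E v)), -(6 * E v * (1 + 3 * E v)), -1,
      -(3 * E v * (2 + 3 * E v)) - 1, -(2 * (1 + 3 * E v)), -(2 * v 0 ^ j * (v 2 ^ (j + 1) + R v *
      v 0)) - R v ^ 2 * v 2, -(2 * v 0 ^ j * (1 + 3 * E v)), 0, 0])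
    (fun v => ![6 * v 2 ^ (j + 1) * (1 + 3 * E v) + 3 * v 0 * (2 * R v * (1 + 3 * E v) + T v * (j +
      2)) - 1, 3 * v 2 ^ (j + 1), 9 * E v * (2 + 3 * E v), 6 * R v * v 0 + j + 2, 3 * (4 + 6 * E v +
      j), 3 * v 0 * (T v * (j + 2) + R v * (6 * E v + 1)), 9 * (3 * E v * (1 + 2 * E v) + 2 * Q v *
      v 0), 3 * v 0 ^ (j + 1) + 1, 9 * E v * (3 * E v + 1) + 9 * Q v * v 0 + 1, 3 * (6 * E v + j +
      3), 6 * v 2 ^ j * (v 0 ^ (j + 1) + R v * v 2) + 3 * R v ^ 2 * v 0 + S v, 3 * v 2 ^ j * (6 *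
      E v + 1), 9 * Q v, 0]) ?_ ?_ ?_
  · funext i; fin_cases i <;> simp <;> ring
  · refine isCoordinateChange_of_leftInverse (Ψ := fun v => ![v 0 - v 1 - 2 * (v 3 - v 1), v 1,
      v 2 - (v 0 - v 1 - 2 * (v 3 - v 1)) - 3 * (v 1 + (v 3 - v 1 - v 2 ^ (j + 2))), v 3 - v 1 -
      v 2 ^ (j + 2)]) fun i => ⟨?_, ?_, ?_, fun v => ?_⟩ <;>
    fin_cases i <;> simp <;> first | fun_prop | ring
  · intro i j; fin_cases i <;> fin_cases j <;> simp <;> fun_prop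
  · simp [Matrix.det_fin_two]
  · intro j; fin_cases j <;> simp <;> fun_prop
  · constructor <;> constructor <;> simp [E0]
  · intro v
    constructor <;> simp [Fin.sum_univ_succ]
    · linear_combination (norm := (push_cast; ring1)) (-(3 * E v * (v 1 + v 3)) - 2 * v 3 - ((v 2 +
        v 0) ^ (j + 2)) - ((v 2 + v 0 + 3 * (v 1 + v 3)) ^ (j + 2))) * eE v + (-(6 * E v * (v 1 +
        v 3)) - 2 * v 3 - v 2 ^ (j + 2) - v 0 ^ (j + 2) - R v * v 0 * v 2 - ((v 2 + v 0) ^ (j +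
        2))) * eR v
    · linear_combination (norm := (push_cast; ring1)) v 0 * eQ v + (3 * (3 * E v * (v 1 + v 3) + 2 *
        v 3 + v 1 + ((v 2 + v 0) ^ (j + 2)) + ((v 2 + v 0 + 3 * (v 1 + v 3)) ^ (j + 2)))) * eE v + v
        0 * eS v + (3 * (6 * E v * (v 1 + v 3) + 2 * v 3 + v 1 + v 2 ^ (j + 2) + v 0 ^ (j + 2) +
          R v * v 0 * v 2 + ((v 2 + v 0) ^ (j + 2)))) * eR v + (3 * v 0 * (j * v 1 + j * v 3 + 2 *
          v 1 + 2 * v 3)) * eT v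

theorem exists_powQuot_swap (n : ℕ) : ∃ C : ℂ → ℂ → ℂ,
    (∀ {E : Type} [NormedAddCommGroup E] [NormedSpace ℂ E] {f g : E → ℂ} {v : E},
      AnalyticAt ℂ f v → AnalyticAt ℂ g v → AnalyticAt ℂ (fun x => C (f x) (g x)) v) ∧
    ∀ x w, w * powQuot (n + 1) w x + (x + w) ^ (n + 1) =
      x ^ (n + 1) + (n + 2) * w ^ (n + 1) + x * w * C x w := by
  induction n with
  | zero => exact ⟨fun _ _ => 0, fun _ _ => analyticAt_const, fun x w => by simp [powQuot]; ring⟩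
  | succ n ih =>
    obtain ⟨C, hC, e⟩ := ih
    refine ⟨fun x w => x ^ n + C x w * (w + x) + (n + 2) * w ^ n, fun hf hg => ?_, fun x w => ?_⟩
    · have := hC hf hg
      fun_prop
    · rw [powQuot]
      push_cast
      linear_combination (w + x) * e x w

set_option maxHeartbeats 800000 in
theorem pairGabrielov_IV2sharp {k n : ℕ} :
    HasPairGabrielov (.IV2sharp (k + 1) (n + 3)) ![n + 3, k + 2, (k + 1) * (n + 3), n + 3] := by
  obtain ⟨C₀, hC₀, eC₀⟩ := exists_powQuot_swap k
  obtain ⟨C, hC, eC⟩ : ∃ C : (Fin 4 → ℂ) → ℂ, AnalyticAt ℂ C 0 ∧ ∀ v, C v = C₀ (v 0) (v 3) :=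
    ⟨_, hC₀ (by fun_prop) (by fun_prop), fun _ => rfl⟩
  have eG : ∀ v : Fin 4 → ℂ, v 3 * powQuot (k + 1) (v 3) (v 0) + (v 0 + v 3) ^ (k + 1) =
      v 0 ^ (k + 1) + (k + 2) * v 3 ^ (k + 1) + v 0 * v 3 * C v := fun v => by rw [eC, eC₀]
  obtain ⟨c, hc, ec⟩ := exists_analyticAt_eq (fun v : Fin 4 → ℂ =>
    v 0 ^ k + v 3 * C v) (by fun_prop)
  obtain ⟨b, hb, eb⟩ := exists_analyticAt_eq (fun v : Fin 4 → ℂ =>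
    (k + 2) * v 3 ^ k + v 0 * C v) (by fun_prop)
  obtain ⟨R1, hR1, eR1⟩ := exists_add_pow_three n
    (fun v : Fin 4 → ℂ => v 2 + v 1) (fun v => (k + 2) * v 3 ^ (k + 1) + v 0 * c v) (by fun_prop)
  obtain ⟨R2, hR2, eR2⟩ := exists_add_pow_three n
    (fun v : Fin 4 → ℂ => v 2) (fun v => v 1) (by fun_prop)
  obtain ⟨D1, hD1, D10, eD1⟩ := exists_add_pow_quot (n + 2)
    (fun v : Fin 4 → ℂ => v 2) (fun v => v 1) (by fun_prop)
  simp at D10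
  obtain ⟨M1, hM1, M10, eM1⟩ := exists_add_pow_mix (n + 2)
    (fun v : Fin 4 → ℂ => (k + 2) * v 3 ^ (k + 1)) (fun v => v 0 * c v) (by fun_prop)
  simp at M10
  obtain ⟨D2, hD2, -, eD2⟩ := exists_add_pow_quot (n + 3)
    (fun v : Fin 4 → ℂ => v 0 ^ k) (fun v => v 3 * C v) (by fun_prop)
  obtain ⟨S1, hS1, eS1⟩ := exists_add_pow_three n
    (fun v : Fin 4 → ℂ => v 1 + v 0 ^ (k + 1)) (fun v => v 2 + v 3 * b v) (by fun_prop)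
  obtain ⟨M2, hM2, M20, eM2⟩ := exists_add_pow_mix (n + 2)
    (fun v : Fin 4 → ℂ => v 1) (fun v => v 0 ^ (k + 1)) (by fun_prop)
  simp at M20
  obtain ⟨M3, hM3, -, eM3⟩ := exists_add_pow_mix (n + 1)
    (fun v : Fin 4 → ℂ => v 1) (fun v => v 0 ^ (k + 1)) (by fun_prop)
  obtain ⟨M4, hM4, M40, eM4⟩ := exists_add_pow_mix (n + 2)
    (fun v : Fin 4 → ℂ => v 2) (fun v => v 3 * b v) (by fun_prop)
  simp at M40
  obtain ⟨D3, hD3, -, eD3⟩ := exists_add_pow_quot (n + 3)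
    (fun v : Fin 4 → ℂ => (k + 2) * v 3 ^ k) (fun v => v 0 * C v) (by fun_prop)
  obtain ⟨la, hla, la0, ela⟩ : ∃ la : (Fin 4 → ℂ) → ℂ, AnalyticAt ℂ la 0 ∧ la 0 = 0 ∧ ∀ v, la v =
      v 0 ^ k * (M2 v + (n + 3) * M3 v * (v 2 + v 3 * b v)) :=
    ⟨_, by fun_prop, by simp [M20], fun _ => rfl⟩
  refine pairHasGabrielovNumbers_of_pairGerm k ((k+1)*(n+1)) 0 (n+1) 0 (n+1) 0 k ?_ (by omega)
    (Φ := fun v => ![v 0 + v 3, v 1 + v 3 * powQuot (k + 1) (v 3) (v 0), v 2 + (v 1 + v 3 * powQuot (k + 1) (v 3) (v 0) + (v 0 + v 3) ^ (k + 1)), v 3])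
    ?_ (fun v => !![1, -1; -la v, 1]) ?_ ?_
    (fun v => ![-(2 * R1 v * c v * v 3 ^ (k + 1) * (k + 2)) - D1 v * c v * (n + 3) + 1 - R1 v * c v ^ 2 * v 0,
      -v 0 ^ k,
      -1,
      -(c v * (n + 3)),
      -n - 3,
      -(c v * (2 * R1 v * v 2 * (k + 2) + M1 v * (k + 2))),
      -(R1 v * v 3 ^ (k + 1) * (k ^ 2 + 4 * k + 4)) - D1 v * (k * n + 2 * n + 3 * k + 6),
      -1,
      -(R1 v * v 3 ^ k * v 2 * (k ^ 2 + 4 * k + 4)) - 1 - (k + 2) ^ (n + 3) * v 3 ^ (k * n + 2 * k + n + 1),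
      -(k * n) - 2 * n - 3 * k - 6,
      -(R1 v * c v ^ 2),
      -(C v * D2 v * v 0 ^ (n + 1)),
      -R2 v,
      0])
    (fun v => ![2 * S1 v * b v * (v 1 + v 0 ^ (k + 1)) + la v + M4 v * b v - 1,
      1,
      la v + (k + 2) ^ (n + 3) * v 3 ^ (k * n + 2 * k + n + 1),
      n + 3,
      b v * (n + 3),
      n + 3,
      b v * (n + 3),
      1,
      1,
      0,
      S1 v * v 0 ^ k,
      S1 v,
      C v * D3 v * v 3 ^ (n + 1) + S1 v * b v ^ 2 * v 0 ^ k,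
      S1 v * b v ^ 2]) ?_ ?_ ?_
  · funext i; fin_cases i <;> simp <;> ring
  · refine isCoordinateChange_of_leftInverse (Ψ := fun v => ![v 0 - v 3, v 1 - v 3 * powQuot (k + 1) (v 3) (v 0 - v 3), v 2 - v 1 - v 0 ^ (k + 1), v 3]) fun i => ⟨?_, ?_, ?_, fun v => ?_⟩ <;>
    fin_cases i <;> simp <;> first | fun_prop | ring
  · intro i j; fin_cases i <;> fin_cases j <;> simp <;> fun_prop
  · simp [Matrix.det_fin_two, la0]
  · intro j; fin_cases j <;> simp <;> fun_prop
  · constructor <;> constructor <;> simp [D10, M10, la0, M40]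
  · intro v
    have hX : v 0 * powQuot (k + 1) (v 3) (v 0) = (v 0 + v 3) ^ (k + 1) - v 3 ^ (k + 1) := by rw [add_comm (v 0), add_pow_eq_powQuot]; ring
    constructor <;> simp [Fin.sum_univ_succ]
    · have hP1 : ((v 2 + v 1 + (v 3 * powQuot (k + 1) (v 3) (v 0) + (v 0 + v 3) ^ (k + 1))) ^ (n + 3)) = (v 2 + v 1) ^ (n + 3) + (n + 3) * (v 2 + v 1) ^ (n + 2) * ((k + 2) * v 3 ^ (k + 1) + v 0 * c v) + ((k + 2) * v 3 ^ (k + 1) + v 0 * c v) ^ (n + 3) + (v 2 + v 1) * ((k + 2) * v 3 ^ (k + 1) + v 0 * c v) ^ 2 * R1 v := by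
        rw [← eR1 v, eG v, ec v]
        ring
      have hG1 : ((k + 2) * v 3 ^ (k + 1) + v 0 * c v) ^ (n + 3) = (k + 2) ^ (n + 3) * v 3 ^ (k * n + 3 * k + n + 3) + v 0 ^ (k * n + 3 * k + n + 3) +
          v 0 * v 0 * v 3 * v 0 ^ (n + 1) * C v * D2 v + (k + 2) * v 3 ^ (k + 1) * v 0 * c v * M1 v := by
        have h := eD2 v
        rw [← ec v] at h
        have h₂ := eM1 v
        rw [mul_pow (k + 2 : ℂ)] at h₂
        linear_combination h₂ + v 0 ^ (n + 3) * h
      linear_combination v 3 * hX + (-1) * hP1 + (-1) * eR2 v + (-(v 3 ^ (k + 1) * (k * n + 2 * n + 3 * k + 6)) - c v * v 0 * (n + 3)) * eD1 v + (-1) * hG1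
    · have hP2 : ((v 2 + v 1 + (v 3 * powQuot (k + 1) (v 3) (v 0) + (v 0 + v 3) ^ (k + 1))) ^ (n + 3)) = v 0 * v 1 * la v + v 1 ^ (n + 3) + v 0 ^ (k * n + 3 * k + n + 3) + (n + 3) * (v 1 ^ (n + 2) + v 0 ^ (k * n + 2 * k + n + 2)) * (v 2 + v 3 * b v) +
          v 2 ^ (n + 3) + v 3 ^ (n + 3) * ((k + 2) ^ (n + 3) * v 3 ^ (k * n + 3 * k) + v 0 * C v * D3 v) + v 2 * v 3 * b v * M4 v + (v 1 + v 0 ^ (k + 1)) * (v 2 + v 3 * b v) ^ 2 * S1 v := by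
        have h₁ : (v 2 + v 1 + (v 3 * powQuot (k + 1) (v 3) (v 0) + (v 0 + v 3) ^ (k + 1))) = (v 1 + v 0 ^ (k + 1)) + (v 2 + v 3 * b v) := by rw [eG v, eb v]; ring
        have h₂ := eD3 v
        rw [← eb v, mul_pow (k + 2 : ℂ)] at h₂
        rw [h₁]
        linear_combination eS1 v + eM2 v + (n + 3) * (v 2 + v 3 * b v) * eM3 v + eM4 v + v 3 ^ (n + 3) * h₂ - v 0 * v 1 * ela v
      linear_combination (-(la v * v 3)) * hX + hP2

theorem pairGabrielov_IV2sharp_two {k : ℕ} :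
    HasPairGabrielov (.IV2sharp (k + 2) 2) ![2, k + 3, 2 * (k + 2), 2] := by
  obtain ⟨C₀, hC₀, eC₀⟩ := exists_powQuot_swap (k + 1)
  obtain ⟨C, hC, eC⟩ : ∃ C : (Fin 4 → ℂ) → ℂ, AnalyticAt ℂ C 0 ∧ ∀ v, C v = C₀ ((v 0 + 2 * v 2 + v 1)) ((v 3 + v 2 + 2 * v 1)) :=
    ⟨_, hC₀ (by fun_prop) (by fun_prop), fun _ => rfl⟩
  have eG : ∀ v : Fin 4 → ℂ, (v 3 + v 2 + 2 * v 1) * powQuot (k + 2) ((v 3 + v 2 + 2 * v 1)) ((v 0 + 2 * v 2 + v 1)) + ((v 0 + 2 * v 2 + v 1) + (v 3 + v 2 + 2 * v 1)) ^ (k + 2) =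
      (v 0 + 2 * v 2 + v 1) ^ (k + 2) + (k + 3) * (v 3 + v 2 + 2 * v 1) ^ (k + 2) + (v 0 + 2 * v 2 + v 1) * (v 3 + v 2 + 2 * v 1) * C v := fun v => by
    rw [eC, eC₀]; push_cast; ring
  obtain ⟨D, hD, D0, eD⟩ := exists_add_pow_quot (k + 2)
    (fun v : Fin 4 → ℂ => v 0) (fun v => 2 * v 2 + v 1) (by fun_prop)
  simp at D0
  obtain ⟨E, hE, E0, eE⟩ := exists_add_pow_quot (k + 2)
    (fun v : Fin 4 → ℂ => v 3) (fun v => v 2 + 2 * v 1) (by fun_prop)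
  simp at E0
  obtain ⟨Q, hQ, Q0, eQ⟩ := exists_add_pow_two (k + 1)
    (fun v : Fin 4 → ℂ => v 3) (fun v => v 2 + 2 * v 1) (by fun_prop)
  simp at Q0
  obtain ⟨A, hA, A0, eA⟩ : ∃ A : (Fin 4 → ℂ) → ℂ, AnalyticAt ℂ A 0 ∧ A 0 = 0 ∧ ∀ v, A v =
      2 * D v + (k + 3) * E v + C v * (v 0 + 2 * (v 3 + v 2 + 2 * v 1)) :=
    ⟨_, by fun_prop, by simp [D0, E0], fun _ => rfl⟩
  obtain ⟨B, hB, B0, eB⟩ : ∃ B : (Fin 4 → ℂ) → ℂ, AnalyticAt ℂ B 0 ∧ B 0 = 0 ∧ ∀ v, B v =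
      D v + 2 * (k + 3) * E v + C v * (2 * v 0 + (v 3 + v 2 + 2 * v 1)) :=
    ⟨_, by fun_prop, by simp [D0, E0], fun _ => rfl⟩
  have hG : ∀ v : Fin 4 → ℂ, ((v 3 + v 2 + 2 * v 1) * powQuot (k + 2) (v 3 + v 2 + 2 * v 1) (v 0 + 2 * v 2 + v 1) + ((v 0 + 2 * v 2 + v 1) + (v 3 + v 2 + 2 * v 1)) ^ (k + 2)) =
      v 0 ^ (k + 2) + (k + 3) * v 3 ^ (k + 2) + v 0 * v 3 * C v + v 2 * A v + v 1 * B v := by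
    intro v
    linear_combination eG v + eD v + (k + 3) * eE v - v 2 * eA v - v 1 * eB v
  refine pairHasGabrielovNumbers_of_pairGerm (k+1) 0 0 0 0 0 0 (k+1) ?_ (by omega)
    (Φ := fun v => ![(v 0 + 2 * v 2 + v 1) + (v 3 + v 2 + 2 * v 1), v 1 + (v 3 + v 2 + 2 * v 1) * powQuot (k + 2) (v 3 + v 2 + 2 * v 1) (v 0 + 2 * v 2 + v 1), v 2 + (v 1 + (v 3 + v 2 + 2 * v 1) * powQuot (k + 2) (v 3 + v 2 + 2 * v 1) (v 0 + 2 * v 2 + v 1) + ((v 0 + 2 * v 2 + v 1) + (v 3 + v 2 + 2 * v 1)) ^ (k + 2)), (v 3 + v 2 + 2 * v 1)])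
    ?_ (fun v => !![1, -1; 0, 1]) ?_ ?_
    (fun v => ![-(2 * v 0 ^ (k + 1) * (1 + B v)) - 2 * C v * v 3 * (1 + B v) + 1,
      -v 0 ^ (k + 1),
      -(B v * (2 + B v)) - 4 * Q v,
      -(2 * C v * v 3 * (1 + A v)),
      -(2 * (B v * (1 + A v) + 2 * Q v + A v)),
      -(2 * C v * v 3 * (k + 3)),
      -(2 * (B v * (k + 3) + 2 * k + 6)),
      -(A v * (2 + A v)) - Q v - 1,
      -(v 3 ^ (k + 1) * (k ^ 2 + 6 * k + 9)) - 1,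
      -(2 * A v * (k + 3)) - 3 * k - 9,
      -(2 * v 0 ^ k * (1 + A v)),
      -(2 * v 3 ^ (k + 1) * v 0 ^ k * (k + 3)) - C v * (2 * v 0 ^ (k + 1) + C v * v 3),
      0,
      0])
    (fun v => ![2 * v 3 ^ (k + 1) * (A v * (k + 3) + k + 3) + 2 * C v * v 0 * (1 + A v) - 1,
      A v * (2 + A v),
      v 3 ^ (k + 1) * (k ^ 2 + 6 * k + 9),
      2 * (1 + A v),
      2 * C v * v 0,
      2 * (B v * (1 + A v) + A v),
      2 * C v * v 0 * (1 + B v),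
      1,
      B v * (2 + B v) + 1,
      2 * (1 + B v),
      0,
      0,
      2 * v 3 ^ k * (v 0 ^ (k + 1) * (k + 3) + C v * v 3 * (k + 3)) + C v ^ 2 * v 0,
      2 * v 3 ^ k * (B v * (k + 3) + k + 3)]) ?_ ?_ ?_
  · funext i; fin_cases i <;> simp <;> ring
  · refine isCoordinateChange_of_leftInverse (Ψ := fun v => ![v 0 - v 3 - 2 * (v 2 - v 1 - v 0 ^ (k + 2)) - (v 1 - v 3 * powQuot (k + 2) (v 3) (v 0 - v 3)), v 1 - v 3 * powQuot (k + 2) (v 3) (v 0 - v 3), v 2 - v 1 - v 0 ^ (k + 2), v 3 - (v 2 - v 1 - v 0 ^ (k + 2)) - 2 * (v 1 - v 3 * powQuot (k + 2) (v 3) (v 0 - v 3))]) fun i => ⟨?_, ?_, ?_, fun v => ?_⟩ <;>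
    fin_cases i <;> simp <;> first | fun_prop | ring
  · intro i j; fin_cases i <;> fin_cases j <;> simp <;> fun_prop
  · simp [Matrix.det_fin_two]
  · intro j; fin_cases j <;> simp <;> fun_prop
  · constructor <;> constructor <;> simp [A0, B0, Q0]
  · intro v
    have hX : (v 3 + v 2 + 2 * v 1) * ((v 0 + 2 * v 2 + v 1) * powQuot (k + 2) (v 3 + v 2 + 2 * v 1) (v 0 + 2 * v 2 + v 1)) = (v 3 + v 2 + 2 * v 1) * ((v 0 + 2 * v 2 + v 1) + (v 3 + v 2 + 2 * v 1)) ^ (k + 2) - (v 3 + v 2 + 2 * v 1) ^ (k + 3) := by rw [add_comm (v 0 + 2 * v 2 + v 1), add_pow_eq_powQuot]; ring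
    constructor <;> simp [Fin.sum_univ_succ]
    · linear_combination (norm := (push_cast; ring1)) hX + (-(v 3 ^ (k + 2) * (k + 3)) - 2 * v 2 - 2 * v 1 - v 0 ^ (k + 2) - C v * v 3 * v 0 - A v * v 2 - B v * v 1 - ((v 3 + v 2 + 2 * v 1) * powQuot (k + 2) (v 3 + v 2 + 2 * v 1) (v 0 + 2 * v 2 + v 1) + ((v 0 + 2 * v 2 + v 1) + (v 3 + v 2 + 2 * v 1)) ^ (k + 2))) * hG v + (-1) * eQ v
    · linear_combination (norm := (push_cast; ring1)) (v 3 ^ (k + 2) * (k + 3) + 2 * v 2 + 2 * v 1 + v 0 ^ (k + 2) + C v * v 3 * v 0 + A v * v 2 + B v * v 1 + ((v 3 + v 2 + 2 * v 1) * powQuot (k + 2) (v 3 + v 2 + 2 * v 1) (v 0 + 2 * v 2 + v 1) + ((v 0 + 2 * v 2 + v 1) + (v 3 + v 2 + 2 * v 1)) ^ (k + 2))) * hG v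

/-! ### Normal forms of hypersurface germs of type `T_{p,q,r}`

The exponent of the pure power of `x` is `2 * rx + sx + 2`, and `tx + 1 = rx + sx`. -/

/-- The monomials spanning the admissible perturbations of `x ^ p + y ^ q + z ^ r - xyz`. -/
def triGen (rx sx ry sy rz sz : ℕ) (x y z : ℂ) : Fin 15 → ℂ :=
  ![x ^ (2 * rx + sx + 3), y ^ (2 * ry + sy + 3), z ^ (2 * rz + sz + 3), x ^ (rx + sx + 2) * y,
    x ^ (rx + sx + 2) * z, y ^ (ry + sy + 2) * z, y ^ (ry + sy + 2) * x, z ^ (rz + sz + 2) * x,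
    z ^ (rz + sz + 2) * y, x ^ 2 * y * z, x * y ^ 2 * z, x * y * z ^ 2, x ^ 2 * y ^ 2, x ^ 2 *
    z ^ 2, y ^ 2 * z ^ 2]

/-- The shift of a variable in terms of the two others. -/
def triShift (ry sy rz sz : ℕ) (y z a b c : ℂ) : ℂ :=
  a * y ^ (ry + sy + 1) + b * z ^ (rz + sz + 1) + c * (y * z)

/-- The coefficients in the expansion of `(x * (1 + a) + d) ^ (2 * r + s + 2)`. -/
def triPowCoeff (r s t : ℕ) (x a d : ℂ) : Fin 4 → ℂ :=
  ![powRem (2 * r + s) 1 a, powQuot (2 * r + s + 1) 1 a, powRemTail (r + t + 1) (x * (1 + a)) d,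
    d ^ (r + t)]

theorem triPowCoeff_expansion {r s t : ℕ} (ht : t + 1 = r + s) (x a d : ℂ) :
    (x * (1 + a) + d) ^ (2 * r + s + 2) =
      x ^ (2 * r + s + 2) * (1 + (2 * r + s + 2 : ℕ) * a + a ^ 2 * triPowCoeff r s t x a d 0) +
      (2 * r + s + 2 : ℕ) * x ^ (2 * r + s + 1) * (1 + a * triPowCoeff r s t x a d 1) * d +
      x * (1 + a) * d ^ 2 * triPowCoeff r s t x a d 2 + d ^ 3 * triPowCoeff r s t x a d 3 := by
  have e : 2 * r + s + 2 = r + t + 3 := by omega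
  have h₁ := add_pow_eq_powRem (r + t + 1) (x * (1 + a)) d
  rw [powRem_eq_tail] at h₁
  have h₂ := add_pow_eq_powRem (2 * r + s) 1 a
  have h₃ := add_pow_eq_powQuot (2 * r + s + 1) 1 a
  have h₄ : (x * (1 + a)) ^ (r + t + 3) = x ^ (2 * r + s + 2) * (1 + a) ^ (2 * r + s + 2) := by
    rw [← e, mul_pow]
  have h₅ : (x * (1 + a)) ^ (r + t + 2) = x ^ (2 * r + s + 1) * (1 + a) ^ (2 * r + s + 1) := by
    rw [← mul_pow]; congr 1; omega
  have h₆ : ((r : ℂ) + t + 3) = 2 * r + s + 2 := by exact_mod_cast e.symm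
  simp only [one_pow] at h₂ h₃
  simp only [triPowCoeff, Matrix.cons_val]
  rw [e]
  push_cast at h₁ h₂ h₃ ⊢
  rw [h₄, h₅] at h₁
  rw [← e] at h₁ ⊢
  linear_combination h₁ + x ^ (2 * r + s + 2) * h₂ +
    ((r : ℂ) + t + 3) * x ^ (2 * r + s + 1) * d * h₃ -
    x ^ (2 * r + s + 2) * a * h₆

theorem sum_fin_fifteen {R : Type*} [AddCommMonoid R] (f : Fin 15 → R) :
    ∑ j, f j = f 0 + f 1 + f 2 + f 3 + f 4 + f 5 + f 6 + f 7 + f 8 + f 9 + f 10 + f 11 + f 12 +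
      f 13 + f 14 := by
  simp only [Fin.sum_univ_castSucc, Fin.sum_univ_zero, zero_add]
  rfl

/-- The coefficients of the equation comparing the transformed normal form with its target. -/
def triRow {R : Type*} [CommRing R] (x y z Rx Sx Tx Ry Sy Ty Rz Sz Tz : R) (c : Fin 4 → R)
    (g : Fin 3 → R) (q : Fin 12 → R) (h u : Fin 15 → R) : Fin 15 → R :=
  ![-(Sx * u 9 * (c 0 * u 10 * (u 0 * x + u 1 * z + 1) - c 2 * u 9 * (q 7 * (Rx * Sx * u 9 + 3 *
    u 13 * z) + q 6 * u 3 * y))) + Sx * c 3 * q 11 * (u 10) ^ 2 * (Rx * Sx * u 10 + 3 * u 14 * y) +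
    c 1 * u 0 * (q 0 * (u 0 * x + 2 * u 1 * z) + g 0) - h 0, -(Sy * u 11 * (-(c 3 * u 11 * (q 11 *
    (Ry * Sy * u 11 + 3 * u 14 * x) + q 10 * u 5 * z)) + c 0 * u 6 * (u 2 * y + u 3 * x + 1))) +
    Sy * c 1 * q 3 * (u 6) ^ 2 * (Ry * Sy * u 6 + 3 * u 12 * z) + c 2 * u 2 * (q 4 * (u 2 * y + 2 *
    u 3 * x) + g 1) - h 1, -(Sz * u 7 * (c 0 * u 8 * (u 4 * z + u 5 * y + 1) - c 1 * u 7 * (q 3 *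
    (Rz * Sz * u 7 + 3 * u 12 * y) + q 2 * u 1 * x))) + Sz * c 2 * q 7 * (u 8) ^ 2 * (Rz * Sz *
    u 8 + 3 * u 13 * x) + c 3 * u 4 * (q 8 * (u 4 * z + 2 * u 5 * y) + g 2) - h 2, -(c 0 * u 10 *
    (u 3 * (x * (u 0 * x + u 1 * z + 1) + Ry * Sy * u 6 * y + Rz * Sz * u 7 * z + u 12 * y * z) +
    u 2 * y * (u 0 * x + u 1 * z + 1) + Ry * Sy * u 6 * (Rx * Sx * u 9 + u 13 * z) + u 12 * z *
    (Rx * Sx * u 9 + u 13 * z) + u 0 * x + u 1 * z + 1)) - c 0 * u 9 * (u 14 * (x * (u 0 * x + u 1 *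
    z + 1) + Ry * Sy * u 6 * y + Rz * Sz * u 7 * z + u 12 * y * z) + Ry * Sy * u 11 * (u 0 * x +
    u 1 * z + 1) + u 5 * z * (u 0 * x + u 1 * z + 1)) + c 2 * q 6 * u 9 * (2 * u 13 * z * (u 2 * y +
    u 3 * x + 1) + Rx * Sx * u 9 * (u 2 * y + 1) + 2 * Rz * Sz * u 3 * u 8 * z) + c 3 * u 10 *
    u 14 * (2 * q 10 * z * (u 4 * z + u 5 * y + 1) + 3 * q 11 * y * (2 * Ry * Sy * u 11 + u 14 *
    x)) + Rx * c 1 * g 0 * q 1 * u 0 * (Ry * Sy * u 6 + u 12 * z) + Rx * Sx * c 3 * (u 10) ^ 2 *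
    (q 10 * u 5 * z + 3 * Ry * Sy * q 11 * u 11) + Ry ^ 2 * Sy * c 2 * g 1 * q 5 * u 3 * u 9 - h 3,
    -(c 0 * u 10 * (Rz * Sz * (u 8 * (u 0 * x + u 1 * z + 1) + u 7 * (Rx * Sx * u 9 + u 13 * z)) +
    u 13 * x * (u 0 * x + u 1 * z + 1))) - c 0 * u 9 * (u 4 * z * (u 0 * x + u 1 * z + 1) + u 0 *
    x + u 1 * z + 1) + 3 * c 2 * q 7 * u 9 * (Rz * Sz * u 8 * (Rx * Sx * u 9 + 2 * u 13 * z) +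
    (u 13) ^ 2 * x * z) + Rx * Sx * c 3 * q 10 * (u 10) ^ 2 * (u 4 * z + 1) + Rx * c 1 * (u 1 *
    (g 0 + q 0 * u 1 * z) + Rz * Sz * g 0 * q 1 * u 0 * u 7) - h 4, -(c 0 * u 6 * (u 5 * (y * (u 2 *
    y + u 3 * x + 1) + Rz * Sz * u 8 * z + Rx * Sx * u 9 * x + u 13 * x * z) + u 4 * z * (u 2 * y +
    u 3 * x + 1) + Ry * Sy * u 11 * (Rz * Sz * u 8 + u 13 * x) + u 14 * x * (Rz * Sz * u 8 + u 13 *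
    x) + u 2 * y + u 3 * x + 1)) - c 0 * u 11 * (u 12 * (y * (u 2 * y + u 3 * x + 1) + Rz * Sz *
    u 8 * z + Rx * Sx * u 9 * x + u 13 * x * z) + Rz * Sz * u 7 * (u 2 * y + u 3 * x + 1) + u 1 *
    x * (u 2 * y + u 3 * x + 1)) + c 3 * q 10 * u 11 * (2 * u 14 * x * (u 4 * z + u 5 * y + 1) +
    Ry * Sy * u 11 * (u 4 * z + 1) + 2 * Rx * Sx * u 10 * u 5 * x) + c 1 * u 12 * u 6 * (2 * q 2 *
    x * (u 0 * x + u 1 * z + 1) + 3 * q 3 * z * (2 * Rz * Sz * u 7 + u 12 * y)) + Ry * c 2 * g 1 *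
    q 5 * u 2 * (Rz * Sz * u 8 + u 13 * x) + Ry * Sy * c 1 * (u 6) ^ 2 * (q 2 * u 1 * x + 3 * Rz *
    Sz * q 3 * u 7) + Rz ^ 2 * Sz * c 3 * g 2 * q 9 * u 11 * u 5 - h 5, -(c 0 * u 11 * (u 0 * x *
    (u 2 * y + u 3 * x + 1) + u 2 * y + u 3 * x + 1 + Rx * Ry * Sx * Sy * u 6 * u 9)) - c 0 * u 6 *
    (u 14 * y * (u 2 * y + u 3 * x + 1) + Rx * Sx * u 10 * (u 2 * y + 1)) + Ry * Sy * c 1 * q 2 *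
    (u 6) ^ 2 * (u 0 * x + 1) + Ry * c 2 * (u 3 * (g 1 + q 4 * u 3 * x) + Rx * Sx * g 1 * q 5 *
    u 2 * u 9) + 3 * c 3 * q 11 * u 11 * (Rx * Ry * Sx * Sy * u 10 * u 11 + (u 14) ^ 2 * x * y) -
    h 6, -(c 0 * u 8 * (u 1 * (z * (u 4 * z + u 5 * y + 1) + Ry * Sy * u 11 * y + u 14 * x * y) +
    u 0 * x * (u 4 * z + u 5 * y + 1) + Rx * Sx * u 10 * (Rz * Sz * u 7 + u 12 * y) + u 14 * y *
    (Rz * Sz * u 7 + u 12 * y) + u 4 * z + u 5 * y + 1)) - c 0 * u 7 * (Rx * Sx * u 9 * (u 4 * z +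
    u 5 * y + 1) + u 13 * (z * (u 4 * z + u 5 * y + 1) + Ry * Sy * u 11 * y + u 14 * x * y) + u 3 *
    y * (u 4 * z + u 5 * y + 1)) + c 1 * q 2 * u 7 * (2 * u 12 * y * (u 0 * x + u 1 * z + 1) + Rz *
    Sz * u 7 * (u 0 * x + 1) + 2 * Ry * Sy * u 1 * u 6 * y) + c 2 * q 6 * u 8 * y * (2 * u 13 *
    (u 2 * y + u 3 * x + 1) + Rz * Sz * u 3 * u 8) + Rz * c 3 * g 2 * q 9 * u 4 * (Rx * Sx * u 10 +
    u 14 * y) + 3 * c 2 * q 7 * u 8 * (Rx * Rz * Sx * Sz * u 8 * u 9 + (u 13) ^ 2 * x * z) +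
    Rx ^ 2 * Sx * c 1 * g 0 * q 1 * u 1 * u 7 - h 7, -(c 0 * u 7 * (u 2 * y * (u 4 * z + u 5 * y +
    1) + u 4 * z + u 5 * y + 1 + Ry * Rz * Sy * Sz * u 11 * u 8)) - c 0 * u 8 * (u 12 * z * (u 4 *
    z + u 5 * y + 1) + Ry * Sy * u 6 * (u 4 * z + 1)) + Rz * Sz * c 2 * q 6 * (u 8) ^ 2 * (u 2 * y +
    1) + Rz * c 3 * (u 5 * (g 2 + q 8 * u 5 * y) + Ry * Sy * g 2 * q 9 * u 11 * u 4) + 3 * c 1 *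
    q 3 * u 7 * (Ry * Rz * Sy * Sz * u 6 * u 7 + (u 12) ^ 2 * y * z) - h 8, -(c 0 * (u 0 * (u 13 *
    x * (u 5 * z + Ry * Sy * u 11 + u 14 * x) + u 2 * y * (u 4 * z + u 5 * y + 1) + u 3 * x * (u 4 *
    z + u 5 * y + 1) + Rz * Sz * u 8 * (Ry * Sy * u 11 + u 14 * x) + u 4 * z + u 5 * y + 1) + u 14 *
    (u 1 * y * (u 2 * y + u 3 * x + 1) + u 13 * (u 1 * x * z + x + u 12 * y * z) + u 3 * y * (Rz *
    Sz * u 7 + u 12 * y) + Rz * Sz * u 8) + Tx * u 9 * (u 12 * z * (u 4 * z + u 5 * y + 1) + Ry *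
    Sy * (u 6 * (u 4 * z + 1) + Rz * Sz * u 11 * u 7)) + Tx * u 10 * (Rz * Sz * (u 7 * (u 2 * y +
    1) + Ry * Sy * u 6 * u 8) + u 12 * y * (u 2 * y + 1)) + u 1 * z * (u 3 * (u 4 * z + u 5 * y +
    1) + u 13 * (u 5 * z + Ry * Sy * u 11)) + u 3 * (u 4 * z + u 5 * y + 1) + u 13 * (u 5 * z + Ry *
    Sy * u 11))) + c 3 * q 10 * ((u 14) ^ 2 * y * (u 4 * z + u 5 * y + 1) + 2 * Ry * Sy * Tx *
    u 10 * u 11 * (u 4 * z + 1)) + c 2 * q 6 * (u 13) ^ 2 * z * (u 2 * y + u 3 * x + 1) + Rx * Tx *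
    c 1 * g 0 * (q 1 * u 1 * (Ry * Sy * u 6 + u 12 * z) + u 12) + 2 * Rz * Sz * Tx * c 2 * q 6 *
    u 8 * u 9 * (u 2 * y + 1) + c 1 * q 2 * u 0 * (2 * Ry * Rz * Sy * Sz * u 6 * u 7 + (u 12) ^ 2 *
    y * z) + Ry ^ 2 * Sy * c 2 * g 1 * q 5 * u 13 * u 3 + Rz ^ 2 * Sz * Tx * c 3 * g 2 * q 9 *
    u 10 * u 5 - h 9, -(c 0 * (u 2 * (u 1 * z * (u 4 * z + u 5 * y + 1) + u 14 * y * (Rz * Sz *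
    u 7 + u 12 * y) + u 4 * z + u 5 * y + 1) + u 12 * u 3 * z * (u 4 * z + u 5 * y + 1) + Ty *
    u 13 * u 6 * z * (u 4 * z + 1) + u 5 * (u 1 * z + 1 + u 12 * u 13 * z ^ 2) + Rz * Sz * (Ty *
    u 11 * u 8 + u 14 * u 7) + u 12 * u 14 * y)) + c 1 * q 2 * (u 12) ^ 2 * z * (u 1 * z + 1) + Ry *
    Ty * c 2 * g 1 * (Rz * Sz * q 5 * u 3 * u 8 + u 13) + Rz * Sz * (2 * Ty * c 1 * q 2 * u 6 *
    u 7 + Rz * c 3 * g 2 * q 9 * u 14 * u 5) - h 10, -(c 0 * u 4 * (u 1 * z + 1 + u 12 * u 13 *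
    z ^ 2)) - c 0 * (u 1 + u 12 * u 13 * z) + Rz * Tz * c 3 * g 2 * u 14 - h 11, -(c 0 * u 14 *
    (u 0 * x * (u 2 * y + u 3 * x + 1) + u 2 * y + u 3 * x + 1)) + Tx * Ty * (Rx * c 1 * g 0 * u 6 +
    Ry * c 2 * g 1 * u 9) + c 3 * q 11 * (u 14) ^ 3 * x * y - h 12, -(c 0 * u 13 * (u 4 * z * (u 0 *
    x + u 1 * z + 1) + u 0 * x + u 1 * z + 1)) + Tx * Tz * (Rx * c 1 * g 0 * u 7 + Rz * c 3 * g 2 *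
    u 10) + c 2 * q 7 * (u 13) ^ 3 * x * z - h 13, -(c 0 * u 12 * (u 2 * y * (u 4 * z + u 5 * y +
    1) + u 4 * z + u 5 * y + 1)) + Ty * Tz * (Ry * c 2 * g 1 * u 8 + Rz * c 3 * g 2 * u 11) + c 1 *
    q 3 * (u 12) ^ 3 * y * z - h 14]

set_option maxHeartbeats 2000000 in
set_option maxRecDepth 4000 in
theorem triRow_identity (rx sx tx ry sy ty rz sz tz : ℕ) (hx : tx + 1 = rx + sx)
    (hy : ty + 1 = ry + sy) (hz : tz + 1 = rz + sz) (x y z : ℂ) (c : Fin 4 → ℂ) (g : Fin 3 → ℂ)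
    (q : Fin 12 → ℂ) (h u : Fin 15 → ℂ) :
    let a := x * u 0 + z * u 1
    let b := y * u 2 + x * u 3
    let e := z * u 4 + y * u 5
    let d₁ := triShift ry sy rz sz y z (u 6) (u 7) (u 12)
    let d₂ := triShift rx sx rz sz x z (u 9) (u 8) (u 13)
    let d₃ := triShift rx sx ry sy x y (u 10) (u 11) (u 14)
    c 0 * -((x * (1 + a) + d₁) * (y * (1 + b) + d₂) * (z * (1 + e) + d₃)) +
      c 1 * (x ^ (2 * rx + sx + 2) * (1 + g 0 * a + a ^ 2 * q 0) +
        g 0 * x ^ (2 * rx + sx + 1) * (1 + a * q 1) * d₁ + x * (1 + a) * d₁ ^ 2 * q 2 +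
        d₁ ^ 3 * q 3) +
      c 2 * (y ^ (2 * ry + sy + 2) * (1 + g 1 * b + b ^ 2 * q 4) +
        g 1 * y ^ (2 * ry + sy + 1) * (1 + b * q 5) * d₂ + y * (1 + b) * d₂ ^ 2 * q 6 +
        d₂ ^ 3 * q 7) +
      c 3 * (z ^ (2 * rz + sz + 2) * (1 + g 2 * e + e ^ 2 * q 8) +
        g 2 * z ^ (2 * rz + sz + 1) * (1 + e * q 9) * d₃ + z * (1 + e) * d₃ ^ 2 * q 10 +
        d₃ ^ 3 * q 11) =
      c 0 * -(x * y * z) + c 1 * x ^ (2 * rx + sx + 2) + c 2 * y ^ (2 * ry + sy + 2) +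
        c 3 * z ^ (2 * rz + sz + 2) + ∑ j, h j * triGen rx sx ry sy rz sz x y z j +
        ∑ j, triRow x y z (x ^ rx) (x ^ sx) (x ^ tx) (y ^ ry) (y ^ sy) (y ^ ty) (z ^ rz) (z ^ sz)
          (z ^ tz) c g q h u j * triGen rx sx ry sy rz sz x y z j := by
  have hTx : x ^ tx * x = x ^ rx * x ^ sx := by rw [← pow_succ, hx, pow_add]
  have hTy : y ^ ty * y = y ^ ry * y ^ sy := by rw [← pow_succ, hy, pow_add]
  have hTz : z ^ tz * z = z ^ rz * z ^ sz := by rw [← pow_succ, hz, pow_add]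
  intro a b e d₁ d₂ d₃
  simp only [a, b, e, d₁, d₂, d₃, sum_fin_fifteen, triGen, triShift]
  simp only [Matrix.cons_val]
  have e₂ (x : ℂ) (r : ℕ) : x ^ (2 * r) = (x ^ r) ^ 2 := by ring
  have e₃ (x : ℂ) : x ^ 3 = x * x * x := by ring
  simp only [pow_add, pow_one, e₂]
  generalize x ^ rx = Rx at *
  generalize x ^ sx = Sx at *
  generalize x ^ tx = Tx at *
  generalize y ^ ry = Ry at *
  generalize y ^ sy = Sy at *
  generalize y ^ ty = Ty at *
  generalize z ^ rz = Rz at *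
  generalize z ^ sz = Sz at *
  generalize z ^ tz = Tz at *
  simp only [triRow, Matrix.cons_val]
  linear_combination -(-(x * (c 0 * y * z * (u 12 * u 9 * z * (u 4 * z + u 5 * y + 1) + Rz * Sz * u 10 * (u 7 * (u 2
    * y + 1) + Ry * Sy * u 6 * u 8) + Ry * Sy * u 9 * (u 6 * (u 4 * z + 1) + Rz * Sz * u 11 * u
    7) + u 10 * u 12 * y * (u 2 * y + 1)) - Rx * c 1 * g 0 * (q 1 * u 1 * y * z * (Ry * Sy * u 6
    + u 12 * z) + u 12 * y * z + Ty * u 6 * y ^ 2 + Tz * u 7 * z ^ 2) - c 3 * u 10 * z * (2 * Ry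
    * Sy * q 10 * u 11 * y * (u 4 * z + 1) + Rz * g 2 * (Rz * Sz * q 9 * u 5 * y + Tz * z)) - 2
    * Rz * Sz * c 2 * q 6 * u 8 * u 9 * y * z * (u 2 * y + 1) - Ry * Ty * c 2 * g 1 * u 9 * y ^
    2))) * hTx - (-(y * (-(Ry * c 2 * g 1 * (u 8 * z * (Rz * Sz * q 5 * u 3 * x + Tz * z) + u 13
    * x * z + Rx * Sx * u 9 * x)) + c 0 * u 13 * u 6 * x * z ^ 2 * (u 4 * z + 1) - c 1 * u 6 * x
    * (2 * Rz * Sz * q 2 * u 7 * z + Rx ^ 2 * Sx * g 0) + Rz * u 11 * z * (Sz * c 0 * u 8 * x -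
    Tz * c 3 * g 2 * z)))) * hTy - (z * (Rz * c 3 * g 2 * (u 14 * x * y + Rx * Sx * u 10 * x +
    Ry * Sy * u 11 * y) + Rx ^ 2 * Sx * c 1 * g 0 * u 7 * x + Ry ^ 2 * Sy * c 2 * g 1 * u 8 *
    y)) * hTz

theorem hasDerivAt_quadratic (a b c : ℂ) : HasDerivAt (fun t : ℂ => a + t * b + t ^ 2 * c) b 0 := by
  have h := (((hasDerivAt_id (0 : ℂ)).mul_const b).const_add a).add
    (((hasDerivAt_id (0 : ℂ)).pow 2).mul_const c)
  exact h.congr_deriv (by simp)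

/-- The values of the rows at the origin; `fx`, `bx`, `tx` stand for `0 ^ rx`, `0 ^ sx`, `0 ^ tx`. -/
def triRowZero (fx bx tx fy b_y ty fz bz tz c₀ g₁ g₂ g₃ : ℂ) (h u : Fin 15 → ℂ) : Fin 15 → ℂ :=
  ![-(c₀ * u 10 * u 9 * bx) + g₁ * u 0 - h 0, -(c₀ * u 11 * u 6 * b_y) + g₂ * u 2 - h 1,
    -(c₀ * u 7 * u 8 * bz) + g₃ * u 4 - h 2, -(c₀ * u 10) - h 3,
    -(c₀ * u 9) + g₁ * u 1 * fx - h 4, -(c₀ * u 6) - h 5, -(c₀ * u 11) + g₂ * u 3 * fy - h 6,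
    -(c₀ * u 8) - h 7, -(c₀ * u 7) + g₃ * u 5 * fz - h 8,
    -(c₀ * (u 0 + u 3)) + g₁ * u 12 * (tx * fx) - h 9,
    -(c₀ * (u 2 + u 5)) + g₂ * u 13 * (ty * fy) - h 10,
    -(c₀ * (u 1 + u 4)) + g₃ * u 14 * (tz * fz) - h 11,
    -(c₀ * u 14) + g₁ * u 6 * (tx * fx) * ty + g₂ * u 9 * tx * (ty * fy) - h 12,
    -(c₀ * u 13) + g₁ * u 7 * (tx * fx) * tz + g₃ * u 10 * tx * (tz * fz) - h 13,
    -(c₀ * u 12) + g₂ * u 8 * (ty * fy) * tz + g₃ * u 11 * ty * (tz * fz) - h 14]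

theorem triRow_zero {fx bx tx fy b_y ty fz bz tz : ℂ} (hx : fx * bx = 0) (hy : fy * b_y = 0)
    (hz : fz * bz = 0) (c : Fin 4 → ℂ) (g : Fin 3 → ℂ) (q : Fin 12 → ℂ) (h u : Fin 15 → ℂ) :
    triRow 0 0 0 fx bx tx fy b_y ty fz bz tz c g q h u =
      triRowZero fx bx tx fy b_y ty fz bz tz (c 0) (c 1 * g 0) (c 2 * g 1) (c 3 * g 2) h u := by
  rcases mul_eq_zero.1 hx with rfl | rfl <;> rcases mul_eq_zero.1 hy with rfl | rfl <;>
    rcases mul_eq_zero.1 hz with rfl | rfl <;> funext j <;> fin_cases j <;>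
    simp only [triRow, triRowZero, Fin.reduceFinMk, Matrix.cons_val] <;> ring

/-- The differential of `triRowZero` with respect to `u`. -/
def triRowDeriv (fx bx tx fy b_y ty fz bz tz c₀ g₁ g₂ g₃ : ℂ) (u k : Fin 15 → ℂ) : Fin 15 → ℂ :=
  ![-(c₀ * (u 10 * k 9 + k 10 * u 9) * bx) + g₁ * k 0,
    -(c₀ * (u 11 * k 6 + k 11 * u 6) * b_y) + g₂ * k 2,
    -(c₀ * (u 7 * k 8 + k 7 * u 8) * bz) + g₃ * k 4, -(c₀ * k 10),
    -(c₀ * k 9) + g₁ * k 1 * fx, -(c₀ * k 6), -(c₀ * k 11) + g₂ * k 3 * fy,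
    -(c₀ * k 8), -(c₀ * k 7) + g₃ * k 5 * fz,
    -(c₀ * (k 0 + k 3)) + g₁ * k 12 * (tx * fx),
    -(c₀ * (k 2 + k 5)) + g₂ * k 13 * (ty * fy),
    -(c₀ * (k 1 + k 4)) + g₃ * k 14 * (tz * fz),
    -(c₀ * k 14) + g₁ * k 6 * (tx * fx) * ty + g₂ * k 9 * tx * (ty * fy),
    -(c₀ * k 13) + g₁ * k 7 * (tx * fx) * tz + g₃ * k 10 * tx * (tz * fz),
    -(c₀ * k 12) + g₂ * k 8 * (ty * fy) * tz + g₃ * k 11 * ty * (tz * fz)]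

theorem hasDerivAt_triRowZero (fx bx tx fy b_y ty fz bz tz c₀ g₁ g₂ g₃ : ℂ) (h u k : Fin 15 → ℂ) :
    HasDerivAt (fun t : ℂ => triRowZero fx bx tx fy b_y ty fz bz tz c₀ g₁ g₂ g₃ h (u + t • k))
      (triRowDeriv fx bx tx fy b_y ty fz bz tz c₀ g₁ g₂ g₃ u k) 0 := by
  have : (fun t : ℂ => triRowZero fx bx tx fy b_y ty fz bz tz c₀ g₁ g₂ g₃ h (u + t • k)) =
      fun t : ℂ => fun j => triRowZero fx bx tx fy b_y ty fz bz tz c₀ g₁ g₂ g₃ h u j +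
        t * triRowDeriv fx bx tx fy b_y ty fz bz tz c₀ g₁ g₂ g₃ u k j +
        t ^ 2 * (![-(c₀ * k 10 * k 9 * bx), -(c₀ * k 11 * k 6 * b_y), -(c₀ * k 7 * k 8 * bz),
          0, 0, 0, 0, 0, 0, 0, 0, 0, 0, 0, 0] : Fin 15 → ℂ) j := by
    funext t j
    fin_cases j <;> simp only [triRowZero, triRowDeriv, Fin.reduceFinMk, Matrix.cons_val,
      Pi.add_apply, Pi.smul_apply, smul_eq_mul] <;> ring
  rw [this, hasDerivAt_pi]
  exact fun j => hasDerivAt_quadratic _ _ _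

theorem exists_triRowZero_eq_zero {fx bx tx fy b_y ty fz bz tz c₀ g₁ g₂ g₃ : ℂ}
    (hx : fx * bx = 0) (hy : fy * b_y = 0) (hz : fz * bz = 0)
    (hall : tx * fx * (ty * fy) * (tz * fz) = 0) (h₀ : c₀ ≠ 0) (h₁ : g₁ ≠ 0) (h₂ : g₂ ≠ 0)
    (h₃ : g₃ ≠ 0) (h : Fin 15 → ℂ) :
    ∃ u, triRowZero fx bx tx fy b_y ty fz bz tz c₀ g₁ g₂ g₃ h u = 0 := by
  obtain ⟨u10, e10⟩ : ∃ u, c₀ * u = -h 3 := ⟨-h 3 / c₀, by field_simp⟩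
  obtain ⟨u6, e6⟩ : ∃ u, c₀ * u = -h 5 := ⟨-h 5 / c₀, by field_simp⟩
  obtain ⟨u8, e8⟩ : ∃ u, c₀ * u = -h 7 := ⟨-h 7 / c₀, by field_simp⟩
  obtain ⟨u0, e0⟩ : ∃ u, g₁ * u = h 0 - bx * u10 * h 4 := ⟨(h 0 - bx * u10 * h 4) / g₁, by field_simp⟩
  obtain ⟨u2, e2⟩ : ∃ u, g₂ * u = h 1 - b_y * u6 * h 6 := ⟨(h 1 - b_y * u6 * h 6) / g₂, by field_simp⟩
  obtain ⟨u4, e4⟩ : ∃ u, g₃ * u = h 2 - bz * u8 * h 8 := ⟨(h 2 - bz * u8 * h 8) / g₃, by field_simp⟩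
  obtain ⟨u14, e14⟩ : ∃ u, c₀ * u = g₁ * u6 * (tx * fx) * ty +
      g₂ * ((g₁ * ((-(c₀ * u4) - h 11) / c₀) * fx - h 4) / c₀) * tx * (ty * fy) - h 12 :=
    ⟨_, mul_div_cancel₀ _ h₀⟩
  obtain ⟨u13, e13⟩ : ∃ u, c₀ * u = g₁ * ((g₃ * ((-(c₀ * u2) - h 10) / c₀) * fz - h 8) / c₀) *
      (tx * fx) * tz + g₃ * u10 * tx * (tz * fz) - h 13 :=
    ⟨_, mul_div_cancel₀ _ h₀⟩
  obtain ⟨u12, e12⟩ : ∃ u, c₀ * u = g₂ * u8 * (ty * fy) * tz +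
      g₃ * ((g₂ * ((-(c₀ * u0) - h 9) / c₀) * fy - h 6) / c₀) * ty * (tz * fz) - h 14 :=
    ⟨_, mul_div_cancel₀ _ h₀⟩
  obtain ⟨u1, e1⟩ : ∃ u, u = (-(c₀ * u4) + g₃ * u14 * (tz * fz) - h 11) / c₀ := ⟨_, rfl⟩
  obtain ⟨u5, e5⟩ : ∃ u, u = (-(c₀ * u2) + g₂ * u13 * (ty * fy) - h 10) / c₀ := ⟨_, rfl⟩
  obtain ⟨u3, e3⟩ : ∃ u, u = (-(c₀ * u0) + g₁ * u12 * (tx * fx) - h 9) / c₀ := ⟨_, rfl⟩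
  obtain ⟨u9, e9⟩ : ∃ u, u = (g₁ * u1 * fx - h 4) / c₀ := ⟨_, rfl⟩
  obtain ⟨u7, e7⟩ : ∃ u, u = (g₃ * u5 * fz - h 8) / c₀ := ⟨_, rfl⟩
  obtain ⟨u11, e11⟩ : ∃ u, u = (g₂ * u3 * fy - h 6) / c₀ := ⟨_, rfl⟩
  have f9 : u9 = (g₁ * ((-(c₀ * u4) - h 11) / c₀) * fx - h 4) / c₀ +
      g₁ * g₃ * u14 * fx * (tz * fz) / c₀ ^ 2 := by
    rw [e9, e1]; field_simp; ring
  have f7 : u7 = (g₃ * ((-(c₀ * u2) - h 10) / c₀) * fz - h 8) / c₀ +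
      g₃ * g₂ * u13 * fz * (ty * fy) / c₀ ^ 2 := by
    rw [e7, e5]; field_simp; ring
  have f11 : u11 = (g₂ * ((-(c₀ * u0) - h 9) / c₀) * fy - h 6) / c₀ +
      g₂ * g₁ * u12 * fy * (tx * fx) / c₀ ^ 2 := by
    rw [e11, e3]; field_simp; ring
  rw [eq_div_iff h₀] at e1 e5 e3 e9 e7 e11
  refine ⟨![u0, u1, u2, u3, u4, u5, u6, u7, u8, u9, u10, u11, u12, u13, u14], ?_⟩
  funext j
  fin_cases j <;> simp only [triRowZero, Fin.reduceFinMk, Matrix.cons_val, Pi.zero_apply]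
  · linear_combination e0 - bx * u10 * e9 - u10 * g₁ * u1 * hx
  · linear_combination e2 - b_y * u6 * e11 - u6 * g₂ * u3 * hy
  · linear_combination e4 - bz * u8 * e7 - u8 * g₃ * u5 * hz
  · linear_combination -e10
  · linear_combination -e9
  · linear_combination -e6
  · linear_combination -e11
  · linear_combination -e8
  · linear_combination -e7
  · linear_combination -e3
  · linear_combination -e5
  · linear_combination -e1
  · linear_combination -e14 + g₂ * tx * (ty * fy) * f9 + g₁ * g₂ * g₃ * u14 / c₀ ^ 2 * hall
  · linear_combination -e13 + g₁ * tx * fx * tz * f7 + g₁ * g₂ * g₃ * u13 / c₀ ^ 2 * hall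
  · linear_combination -e12 + g₃ * ty * (tz * fz) * f11 + g₁ * g₂ * g₃ * u12 / c₀ ^ 2 * hall

theorem triRowDeriv_injective {fx bx tx fy b_y ty fz bz tz c₀ g₁ g₂ g₃ : ℂ}
    (hx : fx * bx = 0) (hy : fy * b_y = 0) (hz : fz * bz = 0)
    (hall : tx * fx * (ty * fy) * (tz * fz) = 0) (h₀ : c₀ ≠ 0) (h₁ : g₁ ≠ 0) (h₂ : g₂ ≠ 0)
    (h₃ : g₃ ≠ 0) {u k : Fin 15 → ℂ}
    (hk : triRowDeriv fx bx tx fy b_y ty fz bz tz c₀ g₁ g₂ g₃ u k = 0) : k = 0 := by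
  have e (j) := congrFun hk j
  have e0 := e 0; have e1 := e 1; have e2 := e 2; have e3 := e 3; have e4 := e 4
  have e5 := e 5; have e6 := e 6; have e7 := e 7; have e8 := e 8; have e9 := e 9
  have e10 := e 10; have e11 := e 11; have e12 := e 12; have e13 := e 13; have e14 := e 14
  clear e
  simp only [triRowDeriv, Matrix.cons_val, Pi.zero_apply] at e0 e1 e2 e3 e4 e5 e6 e7 e8 e9 e10 e11 e12 e13 e14
  have k10 : k 10 = 0 := by simpa [h₀] using e3
  have k6 : k 6 = 0 := by simpa [h₀] using e5
  have k8 : k 8 = 0 := by simpa [h₀] using e7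
  have k0 : k 0 = 0 := by
    have : g₁ * k 0 = 0 := by
      linear_combination e0 - u 10 * bx * e4 + c₀ * u 9 * bx * k10 + u 10 * g₁ * k 1 * hx
    simpa [h₁] using this
  have k2 : k 2 = 0 := by
    have : g₂ * k 2 = 0 := by
      linear_combination e1 - u 6 * b_y * e6 + c₀ * u 11 * b_y * k6 + u 6 * g₂ * k 3 * hy
    simpa [h₂] using this
  have k4 : k 4 = 0 := by
    have : g₃ * k 4 = 0 := by
      linear_combination e2 - u 8 * bz * e8 + c₀ * u 7 * bz * k8 + u 8 * g₃ * k 5 * hz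
    simpa [h₃] using this
  have k14 : k 14 = 0 := by
    have : c₀ ^ 3 * k 14 = 0 := by
      linear_combination -c₀ ^ 2 * e12 - c₀ * g₂ * tx * (ty * fy) * e4 -
        g₁ * g₂ * fx * tx * (ty * fy) * e11 + c₀ ^ 2 * g₁ * (tx * fx) * ty * k6 +
        g₁ * g₂ * g₃ * k 14 * hall - g₁ * g₂ * fx * tx * (ty * fy) * c₀ * k4
    simpa [h₀] using this
  have k13 : k 13 = 0 := by
    have : c₀ ^ 3 * k 13 = 0 := by
      linear_combination -c₀ ^ 2 * e13 - c₀ * g₁ * (tx * fx) * tz * e8 -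
        g₁ * g₃ * fz * (tx * fx) * tz * e10 + c₀ ^ 2 * g₃ * tx * (tz * fz) * k10 +
        g₁ * g₂ * g₃ * k 13 * hall - g₁ * g₃ * fz * (tx * fx) * tz * c₀ * k2
    simpa [h₀] using this
  have k12 : k 12 = 0 := by
    have : c₀ ^ 3 * k 12 = 0 := by
      linear_combination -c₀ ^ 2 * e14 - c₀ * g₃ * ty * (tz * fz) * e6 -
        g₃ * g₂ * fy * ty * (tz * fz) * e9 + c₀ ^ 2 * g₂ * (ty * fy) * tz * k8 +
        g₁ * g₂ * g₃ * k 12 * hall - g₃ * g₂ * fy * ty * (tz * fz) * c₀ * k0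
    simpa [h₀] using this
  have k1 : k 1 = 0 := by simpa [h₀, k4, k14] using e11
  have k3 : k 3 = 0 := by simpa [h₀, k0, k12] using e9
  have k5 : k 5 = 0 := by simpa [h₀, k2, k13] using e10
  have k9 : k 9 = 0 := by simpa [h₀, k1] using e4
  have k7 : k 7 = 0 := by simpa [h₀, k5] using e8
  have k11 : k 11 = 0 := by simpa [h₀, k3] using e6
  funext j
  fin_cases j <;> simp [*]

@[fun_prop]
theorem AnalyticAt.triPowCoeff {E : Type*} [NormedAddCommGroup E] [NormedSpace ℂ E] {p : E}
    {x a d : E → ℂ} (r s t : ℕ) (j : Fin 4) (hx : AnalyticAt ℂ x p) (ha : AnalyticAt ℂ a p)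
    (hd : AnalyticAt ℂ d p) :
    AnalyticAt ℂ (fun v => triPowCoeff r s t (x v) (a v) (d v) j) p := by
  fin_cases j <;> simp only [_root_.triPowCoeff, Fin.reduceFinMk, Matrix.cons_val] <;> fun_prop

theorem AnalyticAt.triRow {E : Type*} [NormedAddCommGroup E] [NormedSpace ℂ E] {p : E}
    {x y z Rx Sx Tx Ry Sy Ty Rz Sz Tz : E → ℂ} {q : E → Fin 12 → ℂ} {h u : E → Fin 15 → ℂ}
    (c : Fin 4 → ℂ) (g : Fin 3 → ℂ)
    (hx : AnalyticAt ℂ x p) (hy : AnalyticAt ℂ y p) (hz : AnalyticAt ℂ z p)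
    (hRx : AnalyticAt ℂ Rx p) (hSx : AnalyticAt ℂ Sx p) (hTx : AnalyticAt ℂ Tx p)
    (hRy : AnalyticAt ℂ Ry p) (hSy : AnalyticAt ℂ Sy p) (hTy : AnalyticAt ℂ Ty p)
    (hRz : AnalyticAt ℂ Rz p) (hSz : AnalyticAt ℂ Sz p) (hTz : AnalyticAt ℂ Tz p)
    (hq : ∀ j, AnalyticAt ℂ (fun v => q v j) p) (hh : ∀ j, AnalyticAt ℂ (fun v => h v j) p)
    (hu : ∀ j, AnalyticAt ℂ (fun v => u v j) p) :
    AnalyticAt ℂ (fun v => triRow (x v) (y v) (z v) (Rx v) (Sx v) (Tx v) (Ry v) (Sy v) (Ty v)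
      (Rz v) (Sz v) (Tz v) c g (q v) (h v) (u v)) p := by
  rw [analyticAt_pi_iff]
  intro j
  fin_cases j <;> simp only [_root_.triRow, Fin.reduceFinMk, Matrix.cons_val] <;> fun_prop

theorem exists_triRow_solution {rx sx tx ry sy ty rz sz tz : ℕ} (hx : tx + 1 = rx + sx)
    (hy : ty + 1 = ry + sy) (hz : tz + 1 = rz + sz) (hall : rx + tx + (ry + ty) + (rz + tz) ≠ 0)
    {c : Fin 4 → ℂ} (hc : ∀ i, c i ≠ 0) {g : Fin 3 → ℂ} (hg : ∀ i, g i ≠ 0)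
    {q : (Fin 3 → ℂ) → (Fin 15 → ℂ) → Fin 12 → ℂ}
    (hq : ∀ j, ∀ p : (Fin 3 → ℂ) × (Fin 15 → ℂ), AnalyticAt ℂ (fun p => q p.1 p.2 j) p)
    {H : (Fin 3 → ℂ) → Fin 15 → ℂ} (hH : ∀ j, AnalyticAt ℂ (fun v => H v j) 0) :
    ∃ u : (Fin 3 → ℂ) → Fin 15 → ℂ, (∀ j, AnalyticAt ℂ (fun v => u v j) 0) ∧
      ∀ᶠ v in nhds 0, triRow (v 0) (v 1) (v 2) (v 0 ^ rx) (v 0 ^ sx) (v 0 ^ tx) (v 1 ^ ry)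
        (v 1 ^ sy) (v 1 ^ ty) (v 2 ^ rz) (v 2 ^ sz) (v 2 ^ tz) c g (q v (u v)) (H v) (u v) = 0 := by
  have zx : (0 : ℂ) ^ rx * 0 ^ sx = 0 := by rw [← pow_add, ← hx]; simp
  have zy : (0 : ℂ) ^ ry * 0 ^ sy = 0 := by rw [← pow_add, ← hy]; simp
  have zz : (0 : ℂ) ^ rz * 0 ^ sz = 0 := by rw [← pow_add, ← hz]; simp
  have zall : (0 : ℂ) ^ tx * 0 ^ rx * (0 ^ ty * 0 ^ ry) * (0 ^ tz * 0 ^ rz) = 0 := by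
    rw [← pow_add, ← pow_add, ← pow_add, ← pow_add, ← pow_add]
    exact zero_pow (by omega)
  have g₁ := mul_ne_zero (hc 1) (hg 0)
  have g₂ := mul_ne_zero (hc 2) (hg 1)
  have g₃ := mul_ne_zero (hc 3) (hg 2)
  obtain ⟨b, hb⟩ := exists_triRowZero_eq_zero zx zy zz zall (hc 0) g₁ g₂ g₃ (H 0)
  let f : (Fin 3 → ℂ) × (Fin 15 → ℂ) → Fin 15 → ℂ := fun p =>
    triRow (p.1 0) (p.1 1) (p.1 2) (p.1 0 ^ rx) (p.1 0 ^ sx) (p.1 0 ^ tx) (p.1 1 ^ ry)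
      (p.1 1 ^ sy) (p.1 1 ^ ty) (p.1 2 ^ rz) (p.1 2 ^ sz) (p.1 2 ^ tz) c g (q p.1 p.2) (H p.1) p.2
  have f0 : ∀ u, f (0, u) = triRowZero (0 ^ rx) (0 ^ sx) (0 ^ tx) (0 ^ ry) (0 ^ sy) (0 ^ ty)
      (0 ^ rz) (0 ^ sz) (0 ^ tz) (c 0) (c 1 * g 0) (c 2 * g 1) (c 3 * g 2) (H 0) u :=
    fun u => triRow_zero zx zy zz _ _ _ _ _
  obtain ⟨u, hu, -, hsol⟩ := exists_analytic_implicit (f := f) (v₀ := 0) (u₀ := b) rfl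
    (by
      refine AnalyticAt.triRow c g ?_ ?_ ?_ ?_ ?_ ?_ ?_ ?_ ?_ ?_ ?_ ?_ (fun j => hq j _) ?_ ?_
      case refine_13 =>
        exact fun j => AnalyticAt.comp (g := fun v => H v j) (hH j) analyticAt_fst
      case refine_14 => exact fun j => by fun_prop
      all_goals fun_prop)
    (by rw [f0, hb])
    (triRowDeriv (0 ^ rx) (0 ^ sx) (0 ^ tx) (0 ^ ry) (0 ^ sy) (0 ^ ty) (0 ^ rz) (0 ^ sz) (0 ^ tz)
      (c 0) (c 1 * g 0) (c 2 * g 1) (c 3 * g 2) b)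
    (fun h => by
      simp only [f0]
      exact hasDerivAt_triRowZero _ _ _ _ _ _ _ _ _ _ _ _ _ _ _ _)
    (fun h hh => triRowDeriv_injective zx zy zz zall (hc 0) g₁ g₂ g₃ hh)
  exact ⟨u, analyticAt_pi_iff.1 hu, hsol⟩

/-- The germ with coefficients `c` of the main terms and `H` of the perturbations. -/
def triGerm (rx sx ry sy rz sz : ℕ) (c : Fin 4 → ℂ) (H : (Fin 3 → ℂ) → Fin 15 → ℂ)
    (v : Fin 3 → ℂ) : ℂ :=
  c 0 * -(v 0 * v 1 * v 2) + c 1 * v 0 ^ (2 * rx + sx + 2) + c 2 * v 1 ^ (2 * ry + sy + 2) +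
    c 3 * v 2 ^ (2 * rz + sz + 2) + ∑ j, H v j * triGen rx sx ry sy rz sz (v 0) (v 1) (v 2) j

theorem germEquiv_triGerm {rx sx tx ry sy ty rz sz tz : ℕ} (hx : tx + 1 = rx + sx)
    (hy : ty + 1 = ry + sy) (hz : tz + 1 = rz + sz) (hall : rx + tx + (ry + ty) + (rz + tz) ≠ 0)
    {c : Fin 4 → ℂ} (hc : ∀ i, c i ≠ 0) {H : (Fin 3 → ℂ) → Fin 15 → ℂ}
    (hH : ∀ j, AnalyticAt ℂ (fun v => H v j) 0) :
    GermEquiv (triGerm rx sx ry sy rz sz c 0) (triGerm rx sx ry sy rz sz c H) := by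
  let a : (Fin 3 → ℂ) → (Fin 15 → ℂ) → ℂ := fun v u => v 0 * u 0 + v 2 * u 1
  let b : (Fin 3 → ℂ) → (Fin 15 → ℂ) → ℂ := fun v u => v 1 * u 2 + v 0 * u 3
  let e : (Fin 3 → ℂ) → (Fin 15 → ℂ) → ℂ := fun v u => v 2 * u 4 + v 1 * u 5
  let d₁ : (Fin 3 → ℂ) → (Fin 15 → ℂ) → ℂ := fun v u =>
    triShift ry sy rz sz (v 1) (v 2) (u 6) (u 7) (u 12)
  let d₂ : (Fin 3 → ℂ) → (Fin 15 → ℂ) → ℂ := fun v u =>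
    triShift rx sx rz sz (v 0) (v 2) (u 9) (u 8) (u 13)
  let d₃ : (Fin 3 → ℂ) → (Fin 15 → ℂ) → ℂ := fun v u =>
    triShift rx sx ry sy (v 0) (v 1) (u 10) (u 11) (u 14)
  let Qx : (Fin 3 → ℂ) → (Fin 15 → ℂ) → Fin 4 → ℂ := fun v u =>
    triPowCoeff rx sx tx (v 0) (a v u) (d₁ v u)
  let Qy : (Fin 3 → ℂ) → (Fin 15 → ℂ) → Fin 4 → ℂ := fun v u =>
    triPowCoeff ry sy ty (v 1) (b v u) (d₂ v u)
  let Qz : (Fin 3 → ℂ) → (Fin 15 → ℂ) → Fin 4 → ℂ := fun v u =>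
    triPowCoeff rz sz tz (v 2) (e v u) (d₃ v u)
  let g : Fin 3 → ℂ :=
    ![(2 * rx + sx + 2 : ℕ), (2 * ry + sy + 2 : ℕ), (2 * rz + sz + 2 : ℕ)]
  let q : (Fin 3 → ℂ) → (Fin 15 → ℂ) → Fin 12 → ℂ := fun v u =>
    ![Qx v u 0, Qx v u 1, Qx v u 2, Qx v u 3, Qy v u 0, Qy v u 1, Qy v u 2, Qy v u 3,
      Qz v u 0, Qz v u 1, Qz v u 2, Qz v u 3]
  obtain ⟨u, hu, hsol⟩ := exists_triRow_solution hx hy hz hall hc (g := g)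
    (fun i => by fin_cases i <;> simp only [g, Fin.reduceFinMk, Matrix.cons_val,
      Nat.cast_ne_zero, ne_eq] <;> exact Nat.succ_ne_zero _)
    (q := q)
    (fun j p => by
      fin_cases j <;> simp only [q, Qx, Qy, Qz, Fin.reduceFinMk, Matrix.cons_val] <;>
        refine AnalyticAt.triPowCoeff _ _ _ _ (by fun_prop) ?_ ?_ <;>
        simp only [a, b, e, d₁, d₂, d₃, triShift] <;> fun_prop)
    hH
  refine GermEquiv.of_change (Φ := fun v => ![v 0 * (1 + a v (u v)) + d₁ v (u v),
    v 1 * (1 + b v (u v)) + d₂ v (u v), v 2 * (1 + e v (u v)) + d₃ v (u v)]) ?_ ?_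
  · refine isCoordinateChange_of_eq_mulVec (fun v =>
      !![1 + a v (u v), u v 6 * v 1 ^ (ry + sy) + u v 12 * v 2, u v 7 * v 2 ^ (rz + sz);
        u v 9 * v 0 ^ (rx + sx) + u v 13 * v 2, 1 + b v (u v), u v 8 * v 2 ^ (rz + sz);
        u v 10 * v 0 ^ (rx + sx) + u v 14 * v 1, u v 11 * v 1 ^ (ry + sy), 1 + e v (u v)])
      ?_ ?_ ?_
    · intro i j
      fin_cases i <;> fin_cases j <;> simp [a, b, e] <;> fun_prop
    · rw [← hx, ← hy, ← hz]
      simp [Matrix.det_fin_three, a, b, e]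
    · intro v i
      fin_cases i <;> simp [Fin.sum_univ_succ, d₁, d₂, d₃, triShift] <;> ring
  · filter_upwards [hsol] with v hv
    have i₁ := triRow_identity rx sx tx ry sy ty rz sz tz hx hy hz (v 0) (v 1) (v 2) c g
      (q v (u v)) (H v) (u v)
    rw [hv] at i₁
    have px := triPowCoeff_expansion hx (v 0) (a v (u v)) (d₁ v (u v))
    have py := triPowCoeff_expansion hy (v 1) (b v (u v)) (d₂ v (u v))
    have pz := triPowCoeff_expansion hz (v 2) (e v (u v)) (d₃ v (u v))
    simp only [Pi.zero_apply, zero_mul, Finset.sum_const_zero, add_zero] at i₁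
    simp only [triGerm, Pi.zero_apply, zero_mul, Finset.sum_const_zero, add_zero, Matrix.cons_val]
    rw [← i₁, px, py, pz]
    simp only [g, q, Qx, Qy, Qz, Matrix.cons_val]
    rfl

theorem one_sub_inv_add_inv_add_inv_ne_zero {p q r : ℕ} (h : p + q + r ≠ 0) :
    1 - (1 / (p + 3 : ℂ) + 1 / (q + 3) + 1 / (r + 3)) ≠ 0 := by
  have e : ∀ n : ℕ, (n + 3 : ℂ) ≠ 0 := fun n => by exact_mod_cast (by omega : n + 3 ≠ 0)
  have hp := e p; have hq := e q; have hr := e r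
  intro h0
  field_simp at h0
  have h1 : ((p + 3) * (q + 3) * (r + 3) : ℂ) =
      (q + 3) * (r + 3) + (p + 3) * (r + 3) + (p + 3) * (q + 3) := by linear_combination h0
  have h2 : (p + 3) * (q + 3) * (r + 3) =
      (q + 3) * (r + 3) + (p + 3) * (r + 3) + (p + 3) * (q + 3) := by exact_mod_cast h1
  have h3 : p + q + r = 0 := by
    ring_nf at h2
    have := Nat.zero_le (p * q * r)
    nlinarith [Nat.zero_le (p * q), Nat.zero_le (p * r), Nat.zero_le (q * r)]
  exact h h3

theorem germEquiv_triNormalForm {p q r : ℕ}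
    (hk : 1 - (1 / (p : ℂ) + 1 / q + 1 / r) ≠ 0) (hp : p ≠ 0) (hq : q ≠ 0) (hr : r ≠ 0)
    {c : Fin 4 → ℂ} (hc : ∀ i, c i ≠ 0) :
    GermEquiv (fun v : Fin 3 → ℂ =>
        c 0 * -(v 0 * v 1 * v 2) + c 1 * v 0 ^ p + c 2 * v 1 ^ q + c 3 * v 2 ^ r)
      (fun v => v 0 ^ p + v 1 ^ q + v 2 ^ r - v 0 * v 1 * v 2) := by
  choose l hl using fun i => (⟨_, Complex.exp_log (hc i)⟩ : ∃ l, Complex.exp l = c i)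
  have hp' : (p : ℂ) ≠ 0 := Nat.cast_ne_zero.2 hp
  have hq' : (q : ℂ) ≠ 0 := Nat.cast_ne_zero.2 hq
  have hr' : (r : ℂ) ≠ 0 := Nat.cast_ne_zero.2 hr
  set k := 1 - (1 / (p : ℂ) + 1 / q + 1 / r) with hkd
  let E : ℂ := (l 0 - (l 1 / p + l 2 / q + l 3 / r)) / k
  have hE : l 0 + ((E - l 1) / p + (E - l 2) / q + (E - l 3) / r) = E := by
    have : E * k = l 0 - (l 1 / p + l 2 / q + l 3 / r) := div_mul_cancel₀ _ hk
    rw [hkd] at this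
    linear_combination -this
  have key : ∀ (m : ℕ) (x l' d : ℂ), (m : ℂ) ≠ 0 → Complex.exp l' = d →
      d * (Complex.exp ((E - l') / m) * x) ^ m = Complex.exp E * x ^ m := by
    intro m x l' d hm hd
    rw [mul_pow, ← Complex.exp_nat_mul, mul_div_cancel₀ _ hm, ← mul_assoc, ← hd, ← Complex.exp_add,
      add_sub_cancel]
  refine ⟨fun v => ![Complex.exp ((E - l 1) / p) * v 0, Complex.exp ((E - l 2) / q) * v 1,
    Complex.exp ((E - l 3) / r) * v 2], Complex.exp E, ?_, Complex.exp_ne_zero _, ?_⟩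
  · refine isCoordinateChange_of_eq_mulVec (fun _ => Matrix.diagonal ![Complex.exp ((E - l 1) / p),
      Complex.exp ((E - l 2) / q), Complex.exp ((E - l 3) / r)]) ?_ ?_ ?_
    · exact fun i j => analyticAt_const
    · simp [Matrix.det_diagonal, Fin.prod_univ_three, Complex.exp_ne_zero]
    · intro v i
      fin_cases i <;> simp [Matrix.diagonal]
  · refine Filter.Eventually.of_forall fun v => ?_
    simp only [Matrix.cons_val]
    rw [key p _ _ _ hp' (hl 1), key q _ _ _ hq' (hl 2), key r _ _ _ hr' (hl 3), ← hl 0]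
    have h0 : Complex.exp (l 0) * (Complex.exp ((E - l 1) / p) * Complex.exp ((E - l 2) / q) *
        Complex.exp ((E - l 3) / r)) = Complex.exp E := by
      rw [← Complex.exp_add, ← Complex.exp_add, ← Complex.exp_add, hE]
    linear_combination -(v 0 * v 1 * v 2) * h0

theorem hasGabrielovNumbers_of_triGerm {h : MvPolynomial (Fin 3) ℂ}
    (rx sx tx ry sy ty rz sz tz : ℕ) (hx : tx + 1 = rx + sx)
    (hy : ty + 1 = ry + sy) (hz : tz + 1 = rz + sz) (hall : rx + tx + (ry + ty) + (rz + tz) ≠ 0)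
    {γ : Fin 3 → ℕ} (hγ : γ = ![2 * rx + sx + 2, 2 * ry + sy + 2, 2 * rz + sz + 2])
    {Φ : (Fin 3 → ℂ) → Fin 3 → ℂ} (hΦ : IsCoordinateChange Φ)
    (c : Fin 4 → ℂ) (hc : ∀ i, c i ≠ 0) (H : (Fin 3 → ℂ) → Fin 15 → ℂ)
    (hH : ∀ j, AnalyticAt ℂ (fun v => H v j) 0)
    (hF : ∀ v, eval (Φ v) (h - X 0 * X 1 * X 2) = triGerm rx sx ry sy rz sz c H v) :
    HasGabrielovNumbers h γ := by
  have h₁ : GermEquiv (fun v => eval v (h - X 0 * X 1 * X 2)) (triGerm rx sx ry sy rz sz c H) :=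
    GermEquiv.of_change hΦ (Filter.Eventually.of_forall hF)
  have h₂ := (germEquiv_triGerm hx hy hz hall hc hH).symm
  have ex : 2 * rx + sx + 2 = rx + tx + 3 := by omega
  have ey : 2 * ry + sy + 2 = ry + ty + 3 := by omega
  have ez : 2 * rz + sz + 2 = rz + tz + 3 := by omega
  have h₃ := germEquiv_triNormalForm (p := 2 * rx + sx + 2) (q := 2 * ry + sy + 2)
    (r := 2 * rz + sz + 2) (by
      rw [ex, ey, ez]
      have := one_sub_inv_add_inv_add_inv_ne_zero hall
      push_cast at this ⊢
      exact this) (Nat.succ_ne_zero _) (Nat.succ_ne_zero _) (Nat.succ_ne_zero _) hc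
  have h₄ : triGerm rx sx ry sy rz sz c 0 = fun v : Fin 3 → ℂ =>
      c 0 * -(v 0 * v 1 * v 2) + c 1 * v 0 ^ (2 * rx + sx + 2) + c 2 * v 1 ^ (2 * ry + sy + 2) +
        c 3 * v 2 ^ (2 * rz + sz + 2) := by
    funext v
    simp [triGerm]
  rw [← h₄] at h₃
  obtain ⟨Ψ, d, hΨ, hd, h₅⟩ := (h₁.trans h₂).trans h₃
  refine ⟨Ψ, d, hΨ, hd, ?_⟩
  filter_upwards [h₅] with v hv
  rw [hv, hγ]
  rfl

/-- The remainder in the symmetric expansion of `(a + b) ^ (n + 3)`. -/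
def powMixTwo : ℕ → ℂ → ℂ → ℂ
  | 0, _, _ => 0
  | n + 1, a, b => (a + b) * powMixTwo n a b + (n + 3) * (a ^ n + b ^ n)

theorem add_pow_eq_powMixTwo (n : ℕ) (a b : ℂ) :
    (a + b) ^ (n + 3) = a ^ (n + 3) + (n + 3) * a ^ (n + 2) * b + (n + 3) * a * b ^ (n + 2) +
      b ^ (n + 3) + a ^ 2 * b ^ 2 * powMixTwo n a b := by
  induction n with
  | zero => simp [powMixTwo]; ring
  | succ n ih => rw [pow_succ, ih, powMixTwo]; push_cast; ring

theorem exists_add_pow_four {E : Type*} [NormedAddCommGroup E] [NormedSpace ℂ E] (n : ℕ)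
    (f g : E → ℂ) (h : AnalyticAt ℂ (fun x => (f x, g x)) 0) :
    ∃ R : E → ℂ, AnalyticAt ℂ R 0 ∧ ∀ x, (f x + g x) ^ (n + 3) =
      f x ^ (n + 3) + (n + 3) * f x ^ (n + 2) * g x + (n + 3) * f x * g x ^ (n + 2) + g x ^ (n +
        3) + f x ^ 2 * g x ^ 2 * R x := by
  refine ⟨fun x => powMixTwo n (f x) (g x), ?_, fun x => add_pow_eq_powMixTwo n _ _⟩
  have hf := h.fst_prod
  have hg := h.snd_prod
  induction n with
  | zero => exact analyticAt_const
  | succ n ih => simp only [powMixTwo]; fun_prop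

theorem hasGabrielov_IIA {n k : ℕ} :
    HasTriGabrielov (.IIA (n + 4) (k + 2)) ![3, (n + 4) * (2 * k + 3), n + 4] := by
  obtain ⟨RDA, hRDA, -, eRDA⟩ := exists_add_pow_two (n+1)
    (fun v : Fin 3 → ℂ => v 1 ^ (2 * k + 3)) (fun v => -(2 * v 0 * v 1 ^ (k + 1))) (by fun_prop)
  obtain ⟨RDB, hRDB, -, eRDB⟩ := exists_add_pow_two (n+2)
    (fun v : Fin 3 → ℂ => v 1 ^ (2 * k + 3)) (fun v => -(2 * v 0 * v 1 ^ (k + 1))) (by fun_prop)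
  obtain ⟨RA, hRA, eRA⟩ := exists_add_pow_four (n+1)
    (fun v : Fin 3 → ℂ => v 2) (fun v => v 1 ^ (k + 1) * (v 1 ^ (k + 2) - 2 * v 0)) (by fun_prop)
  refine hasGabrielovNumbers_of_triGerm 0 1 0 (2*k+3) ((2*k+3)*(n+1)+2*k+1) ((2*k+3)*(n+2)+2*k) 1 n
    n
    (by ring) (by ring) (by ring) (by positivity) (by funext i; fin_cases i <;> simp <;> ring)
    (Φ := fun v => ![v 0 - v 1 ^ (k + 2), v 1, v 2 + (v 1 ^ (2 * k + 3) + (-(2 * v 0 * v 1 ^ (k +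
      1))))]) ?_
    ![1, 1, 1, 1] ?_
    (fun v => ![0, 0, 0, 0, 0, n + 4, -(2 * v 1 ^ (k + 1) * (n + 4)), 0, 0, 4 * v 1 ^ (2 * k + 1) *
      (RDA v * (n + 4) + RA v * v 2), -(2 * v 1 ^ (3 * k + 2) * (v 1 ^ (2 * k * n + 2 * k + 3 * n +
      3) * (n ^ 2 + 7 * n + 12) + 2 * RA v * v 2)), -(2 * v 1 ^ k * v 2 ^ (n + 1) * (n + 4)), 4 *
      RDB v * v 1 ^ (2 * k), 0, v 1 ^ (2 * k + 1) * (v 2 ^ (n + 1) * (n + 4) + RA v * v 1 ^ (2 * k +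
      3))]) ?_ ?_
  · refine isCoordinateChange_of_leftInverse (Ψ := fun v => ![v 0 + v 1 ^ (k + 2), v 1, v 2 -
      v 1 ^ (2 * k + 3) + 2 * (v 0 + v 1 ^ (k + 2)) * v 1 ^ (k + 1)]) fun i => ⟨?_, ?_, ?_,
      fun v => ?_⟩
      <;>
    fin_cases i <;> simp <;> first | fun_prop | ring
  · intro i; fin_cases i <;> simp
  · intro j; fin_cases j <;> simp <;> fun_prop
  · intro v
    simp [triGerm, sum_fin_fifteen, triGen]
    linear_combination (norm := (push_cast; ring1)) eRA v + (v 2 * (n + 4)) * eRDA v + eRDB v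

theorem hasGabrielov_III {n k : ℕ} :
    HasTriGabrielov (.III (n + 3) (k + 1)) ![2 * (n + 3), 2 * (k + 1) * (n + 3), n + 3] := by
  obtain ⟨RSA, hRSA, eRSA⟩ := exists_add_pow_four (2 * n + 3)
    (fun v : Fin 3 → ℂ => v 0) (fun v => v 1 ^ (k + 1)) (by fun_prop)
  obtain ⟨RSB, hRSB, eRSB⟩ := exists_add_pow_four (2 * n + 1)
    (fun v : Fin 3 → ℂ => v 0) (fun v => v 1 ^ (k + 1)) (by fun_prop)
  obtain ⟨RA, hRA, eRA⟩ := exists_add_pow_three n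
    (fun v : Fin 3 → ℂ => (v 0 + v 1 ^ (k + 1)) ^ 2) (fun v => v 2) (by fun_prop)
  refine hasGabrielovNumbers_of_triGerm 2 (2*n) (2*n+1) (2*k+2) (2*n+2*k*n+2*k) (2*n+1+2*k*n+4*k) 0
    (n+1) n
    (by ring) (by ring) (by ring) (by positivity) (by funext i; fin_cases i <;> simp <;> ring)
    (Φ := fun v => ![-v 0 - v 1 ^ (k + 1), v 1, v 2 + (v 0 + v 1 ^ (k + 1)) ^ 2]) ?_
    ![-1, 1, 1, 1] ?_
    (fun v => ![0, 0, 0, 2 * v 0 * v 1 ^ k * (n + 3), n + 3, n + 3, 2 * v 1 ^ (k + 1) * (n + 3), 0,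
      0, v 1 ^ k * (2 * v 0 ^ (2 * n + 1) * (n ^ 2 + 5 * n + 6) + RSB v * v 1 ^ (k + 1) * (n + 3)),
      2 * v 1 ^ (2 * k * n + 3 * k + 2 * n + 1) * (n ^ 2 + 5 * n + 6), 2 * RA v * v 1 ^ k, RSA v *
      v 1 ^ (2 * k), RA v, RA v * v 1 ^ (2 * k)]) ?_ ?_
  · refine isCoordinateChange_of_leftInverse (Ψ := fun v => ![-v 0 - v 1 ^ (k + 1), v 1, v 2 -
      v 0 ^ 2]) fun i => ⟨?_, ?_, ?_, fun v => ?_⟩ <;>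
    fin_cases i <;> simp <;> first | fun_prop | ring
  · intro i; fin_cases i <;> simp
  · intro j; fin_cases j <;> simp <;> fun_prop
  · intro v
    simp [triGerm, sum_fin_fifteen, triGen]
    have hFA : (((v 0 + v 1 ^ (k + 1)) ^ 2) ^ (n + 3)) = (v 0 + v 1 ^ (k + 1)) ^ (2 * n + 6) := by
      rw [← pow_mul]; ring
    have hFB : (((v 0 + v 1 ^ (k + 1)) ^ 2) ^ (n + 2)) = (v 0 + v 1 ^ (k + 1)) ^ (2 * n + 4) := by
      rw [← pow_mul]; ring
    linear_combination (norm := (push_cast; ring1)) eRA v + hFA + (v 2 * (n + 3)) * hFB + eRSA v +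
      (v 2 * (n + 3)) * eRSB v

theorem hasGabrielov_IV1 {n k : ℕ} :
    HasTriGabrielov (.IV1 (k + 1) (n + 3)) ![3, (2 * k + 1) * (n + 3) + 1, 3 * (n + 2)] := by
  obtain ⟨AN, hAN, eAN⟩ := exists_analyticAt_eq (fun v : Fin 3 → ℂ =>
    (-(2 * v 1 ^ k * (v 0 + v 2 ^ (n + 2)))) ^ (n)) (by fun_prop)
  obtain ⟨RD2, hRD2, -, eRD2⟩ := exists_add_pow_two n
    (fun v : Fin 3 → ℂ => v 1 ^ (2 * k + 1)) (fun v => -(2 * v 1 ^ k * (v 0 + v 2 ^ (n + 2)))) (by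
      fun_prop)
  obtain ⟨RD3, hRD3, eRD3⟩ := exists_add_pow_four n
    (fun v : Fin 3 → ℂ => v 1 ^ (2 * k + 1)) (fun v => -(2 * v 1 ^ k * (v 0 + v 2 ^ (n + 2)))) (by
      fun_prop)
  obtain ⟨RZQ, hRZQ, eRZQ⟩ := exists_add_pow_four n
    (fun v : Fin 3 → ℂ => v 2) (fun v => v 1 ^ (2 * k + 1) + (-(2 * v 1 ^ k * (v 0 + v 2 ^ (n +
      2))))) (by fun_prop)
  refine hasGabrielovNumbers_of_triGerm 0 1 0 (2*k+1) (2*k*n+2*k+n) (2*k*n+4*k+n) (n+2) n (2*n+1)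
    (by ring) (by ring) (by ring) (by positivity) (by funext i; fin_cases i <;> simp <;> ring)
    (Φ := fun v => ![v 0 + v 2 ^ (n + 2) - v 1 ^ (k + 1), v 1, v 2 + (v 1 ^ (2 * k + 1) + (-(2 *
      v 1 ^ k * (v 0 + v 2 ^ (n + 2)))))]) ?_
    ![1, 1, 1, 1] ?_
    (fun v => ![0, 0, 0, -(8 * AN v * v 1 ^ (3 * k)), 0, n + 3, -(2 * v 1 ^ k * (n + 3)), 3, -(2 *
      v 1 ^ k * (-(2 * v 1 ^ k * v 2 * (RD2 v * (n + 3) + RZQ v * v 2 - 2 * AN v * v 1 ^ k *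
      v 2 ^ (n + 1))) + n + 3)), 4 * v 1 ^ (2 * k) * (RD2 v * (n + 3) + RZQ v * v 2 - 6 * AN v *
      v 1 ^ k * v 2 ^ (n + 1)), -(2 * v 1 ^ (3 * k) * (v 1 ^ (2 * k * n + n) * (n ^ 2 + 5 * n + 6) -
      4 * v 1 ^ k * v 2 ^ (n + 1) * (AN v * (n + 3) + RD3 v * v 1 ^ (2 * k + 1)) + 2 * RZQ v *
      v 2)), -(2 * v 1 ^ k * v 2 ^ n * (-(4 * v 1 ^ k * v 2 * (RD2 v * (n + 3) + RZQ v * v 2 - 3 *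
      AN v * v 1 ^ k * v 2 ^ (n + 1))) + n + 3)), 4 * v 1 ^ (4 * k) * (AN v * (n + 3) + RD3 v *
      v 1 ^ (2 * k + 1)), 3 * v 2 ^ n, v 1 ^ (2 * k) * (-(2 * v 1 ^ (2 * k * n + k + n) * v 2 ^ n *
      (v 1 ^ (2 * k + 1) * (n + 3) + n * v 2 * (n + 5) + 6 * v 2)) + 4 * v 1 ^ k * v 2 ^ (n + 2) *
      (v 1 ^ k * v 2 ^ n * (AN v * (n + 3) + RD3 v * v 1 ^ (2 * k + 1)) - RZQ v) + v 2 ^ n * (n +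
      3) + RZQ v * v 1 ^ (2 * k + 1))]) ?_ ?_
  · refine isCoordinateChange_of_leftInverse (Ψ := fun v => ![v 0 + v 1 ^ (k + 1) - (v 2 -
      v 1 ^ (2 * k + 1) + 2 * v 1 ^ k * (v 0 + v 1 ^ (k + 1))) ^ (n + 2), v 1, v 2 - v 1 ^ (2 * k +
      1) + 2 * v 1 ^ k * (v 0 + v 1 ^ (k + 1))]) fun i => ⟨?_, ?_, ?_, fun v => ?_⟩ <;>
    fin_cases i <;> simp <;> first | fun_prop | ring
  · intro i; fin_cases i <;> simp
  · intro j; fin_cases j <;> simp <;> fun_prop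
  · intro v
    simp [triGerm, sum_fin_fifteen, triGen]
    linear_combination (norm := (push_cast; ring1)) v 1 * eRZQ v + (v 1 * v 2 * (n + 3)) * eRD2 v +
      v 1 * eRD3 v + (4 * v 1 ^ (3 * k + 1) * (v 1 ^ (k + 1) * v 2 ^ (n + 2) * (v 2 ^ (n + 2) * (n +
      3) + 2 * n * v 0 + 6 * v 0) - 2 * v 2 ^ (n + 2) * (v 2 ^ (n + 2) * (3 * v 0 + v 2 ^ (n + 2)) +
      3 * v 0 ^ 2) + v 0 ^ 2 * v 1 ^ (k + 1) * (n + 3) - 2 * v 0 ^ 3)) * (eAN v).symm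

theorem hasGabrielov_IV1_two {k : ℕ} :
    HasTriGabrielov (.IV1 (k + 2) 2) ![3, 4 * k + 7, 3] := by
  obtain ⟨RYA, hRYA, -, eRYA⟩ := exists_add_pow_quot (2 * k + 2)
    (fun v : Fin 3 → ℂ => v 1) (fun v => 3 * (v 0 + v 2 + 2 * v 1 ^ (2 * k + 3))) (by fun_prop)
  obtain ⟨YB, hYB, eYB⟩ := exists_analyticAt_eq (fun v : Fin 3 → ℂ =>
    (v 1 + 3 * (v 0 + v 2 + 2 * v 1 ^ (2 * k + 3))) ^ (k)) (by fun_prop)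
  obtain ⟨RYC, hRYC, -, eRYC⟩ := exists_add_pow_two (4 * k + 3)
    (fun v : Fin 3 → ℂ => v 1) (fun v => 3 * (v 0 + v 2 + 2 * v 1 ^ (2 * k + 3))) (by fun_prop)
  obtain ⟨RYD, hRYD, -, eRYD⟩ := exists_add_pow_quot (2 * k + 3)
    (fun v : Fin 3 → ℂ => v 1) (fun v => 3 * (v 0 + v 2 + 2 * v 1 ^ (2 * k + 3))) (by fun_prop)
  obtain ⟨YE, hYE, eYE⟩ := exists_analyticAt_eq (fun v : Fin 3 → ℂ =>
    (v 1 + 3 * (v 0 + v 2 + 2 * v 1 ^ (2 * k + 3))) ^ (2 * k + 1)) (by fun_prop)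
  refine hasGabrielovNumbers_of_triGerm 0 1 0 (2*k+2) 1 (2*k+2) 0 1 0
    (by ring) (by ring) (by ring) (by positivity) (by funext i; fin_cases i <;> simp <;> ring)
    (Φ := fun v => ![(v 0 + v 2 + 2 * v 1 ^ (2 * k + 3)) - (v 1 + 3 * (v 0 + v 2 + 2 * v 1 ^ (2 *
      k + 3))) ^ (k + 2), (v 1 + 3 * (v 0 + v 2 + 2 * v 1 ^ (2 * k + 3))), v 2 + (v 1 + 3 * (v 0 +
      v 2 + 2 * v 1 ^ (2 * k + 3))) ^ (2 * k + 3) - 2 * (v 0 + v 2 + 2 * v 1 ^ (2 * k + 3)) * (v 1 +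
      3 * (v 0 + v 2 + 2 * v 1 ^ (2 * k + 3))) ^ (k + 1)]) ?_
    ![1, 1, 1, 1] ?_
    (fun v => ![9 * (9 * RYC v + 4 * YE v - 12 * RYD v * YB v), 2 * (v 1 ^ (2 * k + 1) * (18 *
      v 1 ^ (2 * k + 2) * (2 * v 1 * (3 * v 1 ^ (2 * k + 1) * (4 * k + 5) - 4 * YB v * (1 + 6 *
      RYD v) + 18 * RYC v + 8 * YE v) + 8 * k + 11) + 24 * v 1 * (-(2 * YB v * (1 + 6 * RYD v)) +
      9 * RYC v + 4 * YE v) + 25 + 12 * k) - 4 * YB v * (1 + 6 * RYD v) + 18 * RYC v + 8 * YE v),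
      9 * (-(4 * YB v * (1 + 3 * RYD v)) + 6 * RYA v + 9 * RYC v + 4 * YE v), 6 * (9 * RYC v + 4 *
      YE v - 12 * RYD v * YB v), 18 * (-(2 * YB v * (1 + 12 * RYD v)) + 3 * RYA v + 18 * RYC v + 8 *
      YE v), 3 * v 1 ^ (2 * k + 1) * (12 * v 1 ^ (2 * k + 2) * (v 1 * (9 * v 1 ^ (2 * k + 1) * (4 *
      k + 5) - 4 * YB v * (5 + 24 * RYD v) + 12 * RYA v + 72 * RYC v + 32 * YE v) + 13 + 8 * k) +
      8 * v 1 * (-(4 * YB v * (2 + 9 * RYD v)) + 6 * RYA v + 27 * RYC v + 12 * YE v) + 15 + 4 * k) -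
      12 * YB v * (1 + 4 * RYD v) + 12 * RYA v + 36 * RYC v + 16 * YE v, 3 * v 1 ^ (2 * k + 1) *
      (12 * v 1 ^ (2 * k + 2) * (v 1 * (9 * v 1 ^ (2 * k + 1) * (4 * k + 5) - 12 * YB v * (1 + 8 *
      RYD v) + 72 * RYC v + 32 * YE v) + 8 * k + 11) + 8 * v 1 * (-(4 * YB v * (1 + 9 * RYD v)) +
      27 * RYC v + 12 * YE v) + 11 + 4 * k) - 4 * YB v * (1 + 12 * RYD v) + 36 * RYC v + 16 * YE v,
      18 * (-(6 * YB v * (1 + 4 * RYD v)) + 9 * RYA v + 18 * RYC v + 8 * YE v), 6 * (-(4 * YB v *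
      (1 + 3 * RYD v)) + 6 * RYA v + 9 * RYC v + 4 * YE v), 3 * (3 * v 1 ^ (2 * k + 1) * (3 * v 1 *
      (3 * v 1 ^ (2 * k + 1) * (4 * k + 5) - 12 * YB v * (1 + 8 * RYD v) + 12 * RYA v + 72 * RYC v +
      32 * YE v) + 2) - 8 * YB v * (1 + 9 * RYD v) + 12 * RYA v + 54 * RYC v + 24 * YE v), 3 *
      v 1 ^ (2 * k + 1) * (3 * v 1 ^ (2 * k + 1) * (12 * v 1 ^ 2 * (3 * v 1 ^ (2 * k + 1) * (4 * k +
      5) - 8 * YB v * (1 + 6 * RYD v) + 6 * RYA v + 36 * RYC v + 16 * YE v) + 30 * v 1 + 16 * k *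
      v 1 + 36 * k * v 2 + 45 * v 2) - 12 * YB v * (24 * RYD v * (v 1 + 3 * v 2) + 4 * v 1 + 15 *
      v 2) + 24 * RYA v * (2 * v 1 + 9 * v 2) + 216 * RYC v * (v 1 + 3 * v 2) + 96 * YE v * (v 1 +
      3 * v 2) + 4) - 4 * YB v * (1 + 6 * RYD v) + 6 * RYA v + 36 * v 1 ^ (2 * k) * v 2 + 18 *
      RYC v + 8 * YE v, 6 * (-(4 * YB v * (2 + 9 * RYD v)) + 12 * RYA v + 27 * RYC v + 12 * YE v),
      3 * v 1 ^ (2 * k + 1) * (3 * v 1 ^ (2 * k + 1) * (6 * v 1 ^ 2 * (3 * v 1 ^ (2 * k + 1) * (4 *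
      k + 5) - 4 * YB v * (1 + 12 * RYD v) + 36 * RYC v + 16 * YE v) + 8 * k * v 1 + 11 * v 1 + 12 *
      k * v 0 + 15 * v 0) - 4 * YB v * (36 * RYD v * (v 1 + 2 * v 0) + 2 * v 1 + 3 * v 0) + 108 *
      RYC v * (v 1 + 2 * v 0) + 48 * YE v * (v 1 + 2 * v 0) + 2) + 9 * RYC v + 4 * YE v - 12 *
      RYD v * YB v, 54 * (-(2 * YB v * (1 + 6 * RYD v)) + 3 * RYA v + 9 * RYC v + 4 * YE v), 3 *
      v 1 ^ (2 * k + 1) * (3 * v 1 ^ (2 * k + 1) * (6 * v 1 ^ 2 * (3 * v 1 ^ (2 * k + 1) * (4 * k +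
      5) - 12 * YB v * (1 + 4 * RYD v) + 12 * RYA v + 36 * RYC v + 16 * YE v) + 19 * v 1 + 8 * k *
      v 1 + 12 * k * v 2 + 15 * v 2) - 4 * YB v * (36 * RYD v * (v 1 + 2 * v 2) + 10 * v 1 + 21 *
      v 2) + 12 * RYA v * (4 * v 1 + 9 * v 2) + 108 * RYC v * (v 1 + 2 * v 2) + 48 * YE v * (v 1 +
      2 * v 2) + 4) - 4 * YB v * (1 + 3 * RYD v) + 6 * RYA v + 18 * v 1 ^ (2 * k) * v 2 + 9 *
      RYC v + 4 * YE v]) ?_ ?_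
  · refine isCoordinateChange_of_leftInverse (Ψ := fun v => ![(v 0 + v 1 ^ (k + 2)) - (v 2 -
      v 1 ^ (2 * k + 3) + 2 * (v 0 + v 1 ^ (k + 2)) * v 1 ^ (k + 1)) - 2 * (v 1 - 3 * (v 0 +
      v 1 ^ (k + 2))) ^ (2 * k + 3), v 1 - 3 * (v 0 + v 1 ^ (k + 2)), (v 2 - v 1 ^ (2 * k + 3) + 2 *
      (v 0 + v 1 ^ (k + 2)) * v 1 ^ (k + 1))]) fun i => ⟨?_, ?_, ?_, fun v => ?_⟩ <;>
    fin_cases i <;> simp <;> first | fun_prop | ring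
  · intro i; fin_cases i <;> simp
  · intro j; fin_cases j <;> simp <;> fun_prop
  · intro v
    simp [triGerm, sum_fin_fifteen, triGen]
    linear_combination (norm := (push_cast; ring1)) (2 * v 2 * (12 * v 1 ^ (2 * k + 3) * (v 1 + 3 *
      v 0 + 3 * v 2 + 3 * v 1 ^ (2 * k + 3)) + v 1 * (v 1 + 6 * v 0 + 6 * v 2) + 9 * v 0 ^ 2 + 18 *
      v 0 * v 2 + 9 * v 2 ^ 2)) * eRYA v + (-(4 * (((v 1 + (3 * (v 0 + v 2 + 2 * v 1 ^ (2 * k +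
      3)))) ^ (2 * k + 3)) * (2 * v 1 ^ (2 * k + 3) * (6 * v 1 ^ (2 * k + 3) * (9 * v 0 + 9 * v 2 +
      2 * v 1 + 6 * v 1 ^ (2 * k + 3)) + 3 * v 0 * (4 * v 1 + 9 * v 0 + 18 * v 2) + 12 * v 1 * v 2 +
      27 * v 2 ^ 2 + v 1 ^ 2) + v 0 * (v 1 * (v 1 + 6 * v 0 + 12 * v 2) + 9 * v 0 ^ 2 + 27 * v 0 *
      v 2 + 27 * v 2 ^ 2) + v 1 * v 2 * (v 1 + 6 * v 2) + 9 * v 2 ^ 3) + 2 * v 1 ^ (2 * k + 3) *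
      v 2 * (6 * v 1 ^ (2 * k + 3) * (9 * v 0 + 9 * v 2 + 2 * v 1 + 6 * v 1 ^ (2 * k + 3)) + 3 *
      v 0 * (4 * v 1 + 9 * v 0 + 18 * v 2) + 12 * v 1 * v 2 + 27 * v 2 ^ 2 + v 1 ^ 2) + v 0 * v 2 *
      (v 1 * (v 1 + 6 * v 0 + 12 * v 2) + 9 * v 0 ^ 2 + 27 * v 0 * v 2 + 27 * v 2 ^ 2) + v 2 ^ 2 *
      (v 1 ^ 2 + 6 * v 1 * v 2 + 9 * v 2 ^ 2)))) * (eYB v).symm + (12 * v 1 ^ (2 * k + 3) * (v 1 +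
      3 * v 0 + 3 * v 2 + 3 * v 1 ^ (2 * k + 3)) + v 1 * (v 1 + 6 * v 0 + 6 * v 2) + 9 * v 0 ^ 2 +
      18 * v 0 * v 2 + 9 * v 2 ^ 2) * eRYC v + (-(4 * YB v * (2 * v 1 ^ (2 * k + 3) * (6 *
      v 1 ^ (2 * k + 3) * (9 * v 0 + 9 * v 2 + 2 * v 1 + 6 * v 1 ^ (2 * k + 3)) + 3 * v 0 * (4 *
      v 1 + 9 * v 0 + 18 * v 2) + 12 * v 1 * v 2 + 27 * v 2 ^ 2 + v 1 ^ 2) + v 0 * (v 1 * (v 1 + 6 *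
      v 0 + 12 * v 2) + 9 * v 0 ^ 2 + 27 * v 0 * v 2 + 27 * v 2 ^ 2) + v 1 * v 2 * (v 1 + 6 * v 2) +
      9 * v 2 ^ 3))) * eRYD v + (4 * (4 * v 1 ^ (2 * k + 3) * (v 1 ^ (2 * k + 3) * (12 * v 1 ^ (2 *
      k + 3) * (6 * v 0 + 6 * v 2 + v 1 + 3 * v 1 ^ (2 * k + 3)) + 18 * v 0 * (3 * v 0 + 6 * v 2 +
      v 1) + 54 * v 2 ^ 2 + 18 * v 1 * v 2 + v 1 ^ 2) + v 0 * (9 * v 0 * (v 1 + 2 * v 0 + 6 * v 2) +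
      18 * v 1 * v 2 + 54 * v 2 ^ 2 + v 1 ^ 2) + 9 * v 2 ^ 2 * (v 1 + 2 * v 2) + v 1 ^ 2 * v 2) +
      v 0 ^ 2 * (v 1 * (v 1 + 6 * v 0 + 18 * v 2) + 9 * v 0 ^ 2 + 36 * v 0 * v 2 + 54 * v 2 ^ 2) +
      v 2 ^ 2 * (v 1 * (18 * v 0 + v 1 + 6 * v 2) + 36 * v 0 * v 2 + 9 * v 2 ^ 2) + 2 * v 0 *
      v 1 ^ 2 * v 2)) * (eYE v).symm

theorem hasGabrielov_IV2 {n k : ℕ} :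
    HasTriGabrielov (.IV2 (k + 1) (n + 3)) ![2 * k + 3, n + 4, (2 * k + 3) * (n + 2)] := by
  obtain ⟨RXE, hRXE, -, eRXE⟩ := exists_add_pow_mix (k)
    (fun v : Fin 3 → ℂ => v 0) (fun v => v 2 ^ (n + 2)) (by fun_prop)
  obtain ⟨RXO, hRXO, eRXO⟩ := exists_add_pow_four (2 * k)
    (fun v : Fin 3 → ℂ => v 0) (fun v => v 2 ^ (n + 2)) (by fun_prop)
  obtain ⟨BN, hBN, eBN⟩ := exists_analyticAt_eq (fun v : Fin 3 → ℂ =>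
    (-(2 * (v 0 + v 2 ^ (n + 2)) ^ (k + 1))) ^ (n)) (by fun_prop)
  obtain ⟨RD2, hRD2, -, eRD2⟩ := exists_add_pow_two n
    (fun v : Fin 3 → ℂ => v 1) (fun v => -(2 * (v 0 + v 2 ^ (n + 2)) ^ (k + 1))) (by fun_prop)
  obtain ⟨RD3, hRD3, eRD3⟩ := exists_add_pow_four n
    (fun v : Fin 3 → ℂ => v 1) (fun v => -(2 * (v 0 + v 2 ^ (n + 2)) ^ (k + 1))) (by fun_prop)
  obtain ⟨RZQ, hRZQ, eRZQ⟩ := exists_add_pow_four n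
    (fun v : Fin 3 → ℂ => v 2) (fun v => v 1 + (-(2 * (v 0 + v 2 ^ (n + 2)) ^ (k + 1)))) (by
      fun_prop)
  refine hasGabrielovNumbers_of_triGerm 0 (2*k+1) (2*k) 1 n n ((k+1)*(n+2)) n (k*n+2*k+2*n+1)
    (by ring) (by ring) (by ring) (by positivity) (by funext i; fin_cases i <;> simp <;> ring)
    (Φ := fun v => ![(v 0 + v 2 ^ (n + 2)), v 1 - (v 0 + v 2 ^ (n + 2)) ^ (k + 1), v 2 + (v 1 +
      (-(2 * (v 0 + v 2 ^ (n + 2)) ^ (k + 1))))]) ?_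
    ![1, 1, 1, 1] ?_
    (fun v => ![0, 0, 0, -(8 * BN v * v 0 ^ k), 0, n + 3, -(2 * v 0 ^ k * (n + 3)), v 2 ^ (k * n +
      2 * k) * (2 * k + 3), -(2 * (-(2 * v 2 ^ (k * n + 2 * k + 1) * (RD2 v * (n + 3) + RZQ v *
      v 2 - 2 * BN v * v 2 ^ (k * n + 2 * k + n + 1))) + n + 3)), 4 * (RXE v * v 2 ^ (n + 1) *
      (RXE v * v 2 ^ (n + 2) * (BN v * (-(2 * v 2 ^ (n + 2) * (3 * v 2 ^ (k * n + 2 * k) + RXE v *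
      v 0)) + n * v 1 + 3 * v 1 - 6 * v 0 ^ (k + 1)) + RD2 v * v 2 * (n + 3) + RD3 v * v 1 ^ 2 +
      RZQ v * v 2 ^ 2) + 2 * v 0 ^ k * (BN v * (n * v 1 + 3 * v 1 - 3 * v 0 ^ (k + 1) - 6 *
      v 2 ^ (k * n + 2 * k + n + 2)) + RD2 v * v 2 * (n + 3) + RD3 v * v 1 ^ 2 + RZQ v * v 2 ^ 2)) +
      v 0 ^ (2 * k) * (RD2 v * (n + 3) + RZQ v * v 2 - 6 * BN v * v 2 ^ (k * n + 2 * k + n + 1))),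
      -(2 * (RXE v * v 2 ^ (n + 1) * (-(4 * v 2 ^ (k * n + 2 * k + n + 2) * (BN v * (n + 3) +
      RD3 v * v 1)) + v 1 ^ n * (n * v 2 * (n + 5) + 6 * v 2 + n * v 1 + 3 * v 1) + 2 * RZQ v *
      v 2 ^ 2) - 4 * v 0 ^ k * v 2 ^ (k * n + 2 * k + n + 1) * (BN v * (n + 3) + RD3 v * v 1) +
      v 0 ^ k * v 1 ^ n * (n ^ 2 + 5 * n + 6) + 2 * RZQ v * v 0 ^ k * v 2)), -(2 * v 2 ^ n * (-(4 *
      v 2 ^ (k * n + 2 * k + 1) * (RXE v * v 2 ^ (n + 2) * (RD2 v * (n + 3) + RZQ v * v 2 - 3 *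
      BN v * v 2 ^ (k * n + 2 * k + n + 1)) + v 0 ^ k * (RD2 v * (n + 3) + RZQ v * v 2 - 3 * BN v *
      v 2 ^ (k * n + 2 * k + n + 1)))) + RXE v * v 2 ^ (n + 2) * (n + 3) + v 0 ^ k * (n + 3))), 4 *
      v 0 ^ (2 * k) * (BN v * (n + 3) + RD3 v * v 1), v 2 ^ n * (v 0 ^ (2 * k) * (2 * k + 3) +
      RXO v * v 2 ^ (n + 2)), -(2 * v 2 ^ (k * n + 2 * k + n) * (-(2 * v 2 ^ (k * n + 2 * k + n +
      2) * (BN v * (n + 3) + RD3 v * v 1)) + v 1 ^ n * (n * v 2 * (n + 5) + 6 * v 2 + n * v 1 + 3 *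
      v 1) + 2 * RZQ v * v 2 ^ 2)) + v 2 ^ n * (n + 3) + RZQ v * v 1]) ?_ ?_
  · refine isCoordinateChange_of_leftInverse (Ψ := fun v => ![v 0 - (v 2 - v 1 + v 0 ^ (k +
      1)) ^ (n + 2), v 1 + v 0 ^ (k + 1), v 2 - v 1 + v 0 ^ (k + 1)]) fun i => ⟨?_, ?_, ?_,
      fun v => ?_⟩ <;>
    fin_cases i <;> simp <;> first | fun_prop | ring
  · intro i; fin_cases i <;> simp
  · intro j; fin_cases j <;> simp <;> fun_prop
  · intro v
    simp [triGerm, sum_fin_fifteen, triGen]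
    linear_combination (norm := (push_cast; ring1)) v 1 * eRZQ v + (v 1 * v 2 * (n + 3)) * eRD2 v +
      v 1 * eRD3 v + (4 * ((v 0 + (v 2 ^ (n + 2))) ^ (k + 1)) ^ 2 * v 1 * (n * v 1 + 3 * v 1 - 2 *
      ((v 0 + (v 2 ^ (n + 2))) ^ (k + 1)))) * (eBN v).symm + eRXO v + (-(2 * v 1 * (-(2 * ((v 0 +
      (v 2 ^ (n + 2))) ^ (k + 1)) * (BN v * (-(2 * v 2 ^ (n + 2) * (v 2 ^ (k * n + 2 * k) + RXE v *
      v 0)) + n * v 1 + 3 * v 1 - 2 * v 0 ^ (k + 1) - 2 * ((v 0 + (v 2 ^ (n + 2))) ^ (k + 1))) +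
      RD2 v * v 2 * (n + 3) + RD3 v * v 1 ^ 2 + RZQ v * v 2 ^ 2)) + v 2 ^ (n + 2) * (-(2 *
      v 2 ^ (k * n + 2 * k) * (BN v * (-(2 * v 2 ^ (n + 2) * (v 2 ^ (k * n + 2 * k) + 2 * RXE v *
      v 0)) + n * v 1 + 3 * v 1 - 4 * v 0 ^ (k + 1)) + RD2 v * v 2 * (n + 3) + RD3 v * v 1 ^ 2 +
      RZQ v * v 2 ^ 2)) - 2 * RXE v * v 0 * (BN v * (n * v 1 + 3 * v 1 - 4 * v 0 ^ (k + 1) - 2 *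
      RXE v * v 0 * v 2 ^ (n + 2)) + RD2 v * v 2 * (n + 3) + RD3 v * v 1 ^ 2 + RZQ v * v 2 ^ 2) +
      n + 3) - 2 * v 0 ^ (k + 1) * (BN v * (n * v 1 + 3 * v 1 - 2 * v 0 ^ (k + 1)) + RD2 v * v 2 *
      (n + 3) + RD3 v * v 1 ^ 2 + RZQ v * v 2 ^ 2) + v 1 ^ (n + 1) * (n * v 2 * (n + 5) + 6 * v 2 +
      n * v 1 + 3 * v 1) + 2 * RZQ v * v 1 * v 2 ^ 2))) * eRXE v

theorem hasGabrielov_IV2_two {k : ℕ} :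
    HasTriGabrielov (.IV2 (k + 2) 2) ![2 * k + 5, 3, 2 * k + 5] := by
  obtain ⟨RUE, hRUE, -, eRUE⟩ := exists_add_pow_quot (2 * k + 5)
    (fun v : Fin 3 → ℂ => 1) (fun v => -(4 * v 2 ^ (k + 1))) (by fun_prop)
  obtain ⟨UD, hUD, eUD⟩ := exists_analyticAt_eq (fun v : Fin 3 → ℂ =>
    (1 + (-(4 * v 2 ^ (k + 1)))) ^ (2 * k + 4)) (by fun_prop)
  obtain ⟨UC, hUC, eUC⟩ := exists_analyticAt_eq (fun v : Fin 3 → ℂ =>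
    (1 + (-(4 * v 2 ^ (k + 1)))) ^ (2 * k + 3)) (by fun_prop)
  obtain ⟨RA4, hRA4, eRA4⟩ := exists_add_pow_four (2 * k + 1)
    (fun v : Fin 3 → ℂ => v 0) (fun v => v 2 - 4 * v 2 ^ (k + 2)) (by fun_prop)
  obtain ⟨RA5, hRA5, eRA5⟩ := exists_add_pow_four (2 * k + 2)
    (fun v : Fin 3 → ℂ => v 0) (fun v => v 2 - 4 * v 2 ^ (k + 2)) (by fun_prop)
  obtain ⟨AO, hAO, eAO⟩ := exists_analyticAt_eq (fun v : Fin 3 → ℂ =>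
    (v 0 + (v 2 - 4 * v 2 ^ (k + 2))) ^ (2 * k)) (by fun_prop)
  obtain ⟨RXE, hRXE, -, eRXE⟩ := exists_add_pow_two (k)
    (fun v : Fin 3 → ℂ => v 2) (fun v => v 0 + 2 * v 1 - 4 * v 2 ^ (k + 2)) (by fun_prop)
  obtain ⟨XK, hXK, eXK⟩ := exists_analyticAt_eq (fun v : Fin 3 → ℂ =>
    (v 0 + (v 2 - 4 * v 2 ^ (k + 2)) + 2 * v 1) ^ (k)) (by fun_prop)
  obtain ⟨RQA, hRQA, -, eRQA⟩ := exists_add_pow_quot (2 * k + 2)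
    (fun v : Fin 3 → ℂ => (v 0 + (v 2 - 4 * v 2 ^ (k + 2)))) (fun v => 2 * v 1) (by fun_prop)
  obtain ⟨RQB, hRQB, -, eRQB⟩ := exists_add_pow_two (2 * k + 1)
    (fun v : Fin 3 → ℂ => (v 0 + (v 2 - 4 * v 2 ^ (k + 2)))) (fun v => 2 * v 1) (by fun_prop)
  refine hasGabrielovNumbers_of_triGerm 1 (2*k+1) (2*k+1) 0 1 0 1 (2*k+1) (2*k+1)
    (by ring) (by ring) (by ring) (by positivity) (by funext i; fin_cases i <;> simp <;> ring)
    (Φ := fun v => ![((v 0 + (v 2 - 4 * v 2 ^ (k + 2))) + 2 * v 1), v 1 - ((v 0 + (v 2 - 4 *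
      v 2 ^ (k + 2))) + 2 * v 1) ^ (k + 2), v 2 + v 1 - 2 * ((v 0 + (v 2 - 4 * v 2 ^ (k + 2))) + 2 *
      v 1) ^ (k + 2)]) ?_
    ![1, 1, 1, 1] ?_
    (fun v => ![0, -(16 * (XK v - 2 * RQA v - RQB v)), -(4 * RUE v * v 2 ^ k), 2 * (7 + 2 * k), 2 *
      k + 5, -(16 * (RXE v + XK v - 2 * RQA v - RQB v)), -(16 * (XK v - 2 * RQA v - RQB v)), UD v *
      (2 * k + 5), 2 * (UD v * (7 + 2 * k) + 8 * k + 16 - 32 * RXE v * v 2), -(2 * (8 * v 2 ^ (k +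
      1) * (v 0 ^ (2 * k + 1) * (11 * k + 14 + 2 * k ^ 2) + RA4 v * v 2 * (-(2 * v 2 ^ (k + 1) *
      (7 + 2 * k)) + 7 + 2 * k) + 3 * AO v * v 1 * (11 + 4 * k)) - 2 * v 0 ^ (2 * k + 1) * (11 * k +
      14 + 2 * k ^ 2) - RA4 v * v 2 * (7 + 2 * k) - 6 * AO v * v 1 * (11 + 4 * k) + 2 * RXE v)),
      -(4 * (-(8 * v 2 ^ (k + 1) * (-(AO v * (-(6 * v 2 ^ (k + 2) * (11 + 4 * k)) + 33 * v 2 + 10 *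
      v 1 + 12 * k * v 2 + 4 * k * v 1)) + XK v - 2 * RQA v - RQB v)) - AO v * (33 * v 2 + 20 *
      v 1 + 12 * k * v 2 + 8 * k * v 1) + 4 * RXE v + 2 * XK v - 4 * RQA v - 2 * RQB v)), -(4 *
      v 2 ^ k * (-(UC v * v 2 ^ (k + 1) * (11 * k + 14 + 2 * k ^ 2)) + k + 2 - 8 * RXE v * v 2)),
      -(4 * (-(AO v * (11 * v 0 + 10 * v 1 + 4 * k * v 0 + 4 * k * v 1)) + XK v - 2 * RQA v -
      RQB v)), -(4 * v 0 ^ (2 * k + 2) * v 2 ^ k * (2 * k + 5)) - 8 * RA5 v * v 2 ^ (k + 1) * (1 -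
      2 * v 2 ^ (k + 1)) + RA5 v, -(4 * (-(4 * v 2 ^ (k + 1) * (-(4 * v 2 ^ (k + 1) * (-(AO v *
      (-(4 * v 2 ^ (k + 2) * (11 + 4 * k)) + 33 * v 2 + 10 * v 1 + 12 * k * v 2 + 4 * k * v 1)) +
      XK v - 2 * RQA v - RQB v)) - AO v * (33 * v 2 + 20 * v 1 + 12 * k * v 2 + 8 * k * v 1) + 4 *
      RXE v + 2 * XK v - 4 * RQA v - 2 * RQB v)) + 2 * v 2 ^ k * (-(8 * v 1 * (XK v - 2 * RQA v -
      RQB v)) + k + 2) - AO v * (11 * v 2 + 10 * v 1 + 4 * k * v 2 + 4 * k * v 1) + XK v - 2 *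
      RQA v - RQB v))]) ?_ ?_
  · refine isCoordinateChange_of_leftInverse (Ψ := fun v => ![v 0 - (v 2 - v 1 + v 0 ^ (k + 2)) +
      4 * (v 2 - v 1 + v 0 ^ (k + 2)) ^ (k + 2) - 2 * (v 1 + v 0 ^ (k + 2)), v 1 + v 0 ^ (k + 2),
      v 2 - v 1 + v 0 ^ (k + 2)]) fun i => ⟨?_, ?_, ?_, fun v => ?_⟩ <;>
    fin_cases i <;> simp <;> first | fun_prop | ring
  · intro i; fin_cases i <;> simp
  · intro j; fin_cases j <;> simp <;> fun_prop
  · intro v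
    simp [triGerm, sum_fin_fifteen, triGen]
    have hZ3 : ((v 2 - 4 * v 2 ^ (k + 2)) ^ (2 * k + 3)) = v 2 ^ (2 * k + 3) * (1 + (-(4 *
      v 2 ^ (k + 1)))) ^ (2 * k + 3) := by
      rw [← mul_pow]; ring
    have hZ4 : ((v 2 - 4 * v 2 ^ (k + 2)) ^ (2 * k + 4)) = v 2 ^ (2 * k + 4) * (1 + (-(4 *
      v 2 ^ (k + 1)))) ^ (2 * k + 4) := by
      rw [← mul_pow]; ring
    have hZ5 : ((v 2 - 4 * v 2 ^ (k + 2)) ^ (2 * k + 5)) = v 2 ^ (2 * k + 5) * (1 + (-(4 *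
      v 2 ^ (k + 1)))) ^ (2 * k + 5) := by
      rw [← mul_pow]; ring
    linear_combination (norm := (push_cast; ring1)) (4 * v 1 * ((v 0 + (v 2 - 4 * v 2 ^ (k + 2))) *
      ((v 0 + (v 2 - 4 * v 2 ^ (k + 2))) + 4 * v 1) + 4 * v 1 ^ 2)) * eRQA v + ((v 0 + (v 2 - 4 *
      v 2 ^ (k + 2))) * ((v 0 + (v 2 - 4 * v 2 ^ (k + 2))) + 4 * v 1) + 4 * v 1 ^ 2) * eRQB v + (2 *
      v 1 * (7 + 2 * k)) * eRA4 v + 1 * eRA5 v + (4 * v 0 * v 1 * (11 * k + 14 + 2 * k ^ 2)) * hZ3 +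
      (14 * v 1 + 2 * k * v 0 + 5 * v 0 + 4 * k * v 1) * hZ4 + hZ5 + (v 2 ^ (2 * k + 5)) * eRUE v +
      (4 * v 0 * v 1 * v 2 ^ (2 * k + 3) * (11 * k + 14 + 2 * k ^ 2)) * (eUC v).symm + (v 2 ^ (2 *
      k + 4) * (14 * v 1 + 2 * k * v 0 + 5 * v 0 + 4 * k * v 1)) * (eUD v).symm + (4 * v 1 ^ 2 *
      (-(4 * v 2 ^ (k + 2) * (-(4 * v 2 ^ (k + 2) * (-(4 * v 2 ^ (k + 2) * (11 + 4 * k)) + 4 * k *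
      (3 * v 0 + 3 * v 2 + v 1) + 33 * v 0 + 33 * v 2 + 10 * v 1)) + v 0 * (4 * k * (3 * v 0 + 6 *
      v 2 + 2 * v 1) + 33 * v 0 + 66 * v 2 + 20 * v 1) + v 2 * (33 * v 2 + 20 * v 1 + 12 * k * v 2 +
      8 * k * v 1))) + v 0 ^ 2 * (4 * k * (v 0 + 3 * v 2 + v 1) + 11 * v 0 + 33 * v 2 + 10 * v 1) +
      v 2 ^ 2 * (4 * k * (3 * v 0 + v 2 + v 1) + 33 * v 0 + 11 * v 2 + 10 * v 1) + 4 * v 0 * v 1 *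
      v 2 * (5 + 2 * k))) * (eAO v).symm + (-(4 * v 1 * v 2)) * eRXE v + (-(4 * v 1 ^ 2 * (-(8 *
      v 2 ^ (k + 2) * (v 0 + v 2 + 2 * v 1 - 2 * v 2 ^ (k + 2))) + v 0 * (v 0 + 2 * v 2 + 4 * v 1) +
      v 2 ^ 2 + 4 * v 1 * v 2 + 4 * v 1 ^ 2))) * (eXK v).symm

set_option maxHeartbeats 1000000 in
theorem hasGabrielov_IV2sharp {n k : ℕ} :
    HasTriGabrielov (.IV2sharp (k + 2) (n + 3)) ![(k + 2) * (n + 4), n + 4, (k + 2) * (n + 2) + n +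
      3] := by
  obtain ⟨RXE, hRXE, -, eRXE⟩ := exists_add_pow_two (k)
    (fun v : Fin 3 → ℂ => v 2 ^ (n + 2)) (fun v => v 0) (by fun_prop)
  obtain ⟨RXN, hRXN, eRXN⟩ := exists_add_pow_four (k * n + 3 * k + 2 * n + 3)
    (fun v : Fin 3 → ℂ => v 0) (fun v => v 2 ^ (n + 2)) (by fun_prop)
  obtain ⟨RXM, hRXM, eRXM⟩ := exists_add_pow_four (k * n + 4 * k + 2 * n + 5)
    (fun v : Fin 3 → ℂ => v 0) (fun v => v 2 ^ (n + 2)) (by fun_prop)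
  obtain ⟨BN, hBN, eBN⟩ := exists_analyticAt_eq (fun v : Fin 3 → ℂ =>
    (-(v 0 + v 2 ^ (n + 2)) ^ (k + 2)) ^ (n)) (by fun_prop)
  obtain ⟨RSA, hRSA, eRSA⟩ := exists_add_pow_four n
    (fun v : Fin 3 → ℂ => v 1) (fun v => -(v 0 + v 2 ^ (n + 2)) ^ (k + 2)) (by fun_prop)
  obtain ⟨RSB, hRSB, eRSB⟩ := exists_add_pow_four (n + 1)
    (fun v : Fin 3 → ℂ => v 1) (fun v => -(v 0 + v 2 ^ (n + 2)) ^ (k + 2)) (by fun_prop)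
  obtain ⟨RZQ, hRZQ, eRZQ⟩ := exists_add_pow_four n
    (fun v : Fin 3 → ℂ => v 2) (fun v => (v 1 + (-(v 0 + v 2 ^ (n + 2)) ^ (k + 2)))) (by fun_prop)
  refine hasGabrielovNumbers_of_triGerm (k+2) (k*n+2*k+2*n+2) (k*n+3*k+2*n+3) 1 n n (n+2)
    (k*n+2*k+n+1) (k*n+2*k+2*n+2)
    (by ring) (by ring) (by ring) (by positivity) (by funext i; fin_cases i <;> simp <;> ring)
    (Φ := fun v => ![(v 0 + v 2 ^ (n + 2)), (v 1 + (-(v 0 + v 2 ^ (n + 2)) ^ (k + 2))), v 2 + (v 1 +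
      (-(v 0 + v 2 ^ (n + 2)) ^ (k + 2)))]) ?_
    ![1, ((-1) ^ n), 1, -1] ?_
    (fun v => ![0, 0, v 2 ^ (k * n + 2 * k + 2 * n + 2) * (-(((-1) ^ n) * v 2 ^ (k * n * n + 3 * k *
      n + 2 * n * n + 2 * k + 5 * n + 3) * (n + 3 - v 2 ^ (k * n + 2 * k + 2 * n + 3))) + n + 3 -
      RZQ v * v 2 ^ (k * n + 2 * k + n + 4)), -(((-1) ^ n) * (n + 4)), -(((-1) ^ n) * (n + 3)), n +
      3, 0, -(((-1) ^ n) * v 2 ^ (k * n * n + 4 * k * n + 2 * n * n + 4 * k + 7 * n + 6) *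
      (-(v 2 ^ (k * n + 2 * k + 2 * n + 3) * (k * n + 4 * k + 2 * n + 8)) + n * (k * n + 6 * k + 2 *
      n + 12) + 9 * k + 18)) + v 2 ^ (k * n + 2 * k + 2 * n + 3) * (-(3 * RZQ v * v 2 ^ (k * n + 2 *
      k + n + 4) * (k + 2)) + 2 * k * n + 4 * n + 6 * k + 12) - k - 2, -(v 2 ^ (n + 1) *
      (-(v 2 ^ (k * n + 2 * k + n + 3) * (-(((-1) ^ n) * v 2 ^ (k * n * n + 3 * k * n + 2 * n * n +
      2 * k + 6 * n + 3) * (n + 4)) + BN v * (n ^ 2 + 6 * n + 9) + 3 * RZQ v * v 2)) + 2 * n + 6)),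
      v 2 ^ (k * n + 2 * k + n + 1) * (v 2 ^ (k * n + 2 * k + n + 2) * (BN v * v 2 * (k * n * (k *
      n + 4 * n + 6 * k + 24) + 4 * n ^ 2 + 24 * n + 9 * k ^ 2 + 36 * k + 36) + RSA v * v 1 * v 2 *
      (k * (k * n + 4 * n + 3 * k + 12) + 4 * n + 12) + 3 * RZQ v * v 2 ^ 2 * (k ^ 2 + 4 * k + 4) +
      RSB v * v 1 * (k ^ 2 + 4 * k + 4)) + 2 * RXE v * v 2 * (v 2 ^ (n + 1) * (BN v * v 2 * (n ^ 2 +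
      6 * n + 9) + RSA v * v 1 * v 2 * (n + 3) + RSB v * v 1 + 3 * RZQ v * v 2 ^ 2) + BN v * v 0 *
      (n * (k * n + 2 * n + 6 * k + 12) + 9 * k + 18) + RSA v * v 0 * v 1 * (k * n + 2 * n + 3 * k +
      6) + 3 * RZQ v * v 0 * v 2 * (k + 2)) + 2 * RSB v * RXE v * v 0 * v 1 * (k + 2)) -
      ((-1) ^ n) * v 0 ^ (k * n + 3 * k + 2 * n + 3) * v 2 ^ (n + 1) * (n * (k * n + 7 * k + 2 * n +
      14) + 12 * k + 24) + RXE v ^ 2 * v 0 ^ 2 * (BN v * (n ^ 2 + 6 * n + 9) + RSA v * v 1 * (n +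
      3) + 3 * RZQ v * v 2) - RXE v * v 1 ^ (n + 1) * (n ^ 2 + 6 * n + 9) - v 2 ^ (n + 1) * (RXN v *
      ((-1) ^ n) * v 2 ^ (n + 2) * (n + 4) + 2 * RXE v * (n + 3)) - 3 * RXE v * RZQ v * v 1 * v 2,
      -(v 2 ^ (k * n + 2 * k + n + 1) * (-(2 * v 2 ^ (k * n + 2 * k + 2 * n + 4) * (RSA v * v 2 *
      (k * n + 2 * n + 3 * k + 6) + RSB v * (k + 2))) + v 1 ^ n * (n * v 2 * (k * n + 2 * n + 6 *
      k + 12) + v 1 * (k * n + 2 * n + 4 * k + 8) + 9 * k * v 2 + 18 * v 2) + 3 * RZQ v * v 2 ^ 2 *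
      (k + 2))), -(v 2 ^ (k * n + 2 * k + 2 * n + 2) * (-(v 2 ^ (k * n + 2 * k + n + 3) *
      (-(((-1) ^ n) * v 2 ^ (k * n * n + 3 * k * n + 2 * n * n + 2 * k + 6 * n + 3) * (n * (k * n +
      7 * k + 2 * n + 14) + 12 * k + 24)) + 2 * BN v * (n * (k * n + 2 * n + 6 * k + 12) + 9 * k +
      18) + 6 * RZQ v * v 2 * (k + 2))) + 2 * k * n + 4 * n + 6 * k + 12)), -(RXE v * (v 1 ^ (n +
      1) * (n + 4) - RSB v * RXE v * v 0 ^ 2)), v 2 ^ (k * n + 2 * k + 2 * n + 2) * (v 2 ^ (k * n +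
      2 * k + 2) * (-(RZQ v * v 2 ^ (k * n + 2 * k + n + 2) * (3 * v 2 ^ (n + 2) * (k ^ 2 + 4 * k +
      4) + k * v 0 * (k ^ 2 + 6 * k + 12) + 8 * v 0)) - 3 * RXE v * RZQ v * (v 2 ^ (n + 2) *
      (v 2 ^ (n + 2) + 2 * k * v 0 + 4 * v 0) + v 0 ^ 2 * (k ^ 2 + 4 * k + 4)) + v 2 ^ n * (k * (k *
      n + 4 * n + 3 * k + 12) + 4 * n + 12)) + RXE v * (v 0 * (2 * k * n + 4 * n + 6 * k + 12 - 3 *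
      RXE v * RZQ v * v 0 * v 2 ^ 2) + 2 * v 2 ^ (n + 2) * (n + 3))) - ((-1) ^ n) * v 0 ^ (k * n +
      3 * k + 2 * n + 3) * v 2 ^ n * (-(v 0 ^ (k + 2) * (k * n + 4 * k + 2 * n + 8)) + n * v 2 *
      (k * n + 6 * k + 2 * n + 12) + 9 * k * v 2 + 18 * v 2) + RXE v ^ 2 * v 0 ^ 2 * v 2 ^ n *
      (-(3 * RZQ v * v 0 * v 2 ^ (k * n + 2 * k + 2) * (k + 2)) + n + 3) - ((-1) ^ n) * v 2 ^ (2 *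
      n + 2) * (RXN v * v 2 * (n + 3) - RXM v) - RXE v * (v 2 ^ (n + 1) + RXE v ^ 2 * RZQ v *
      v 0 ^ 4), -(v 2 ^ (k * n + 2 * k + 2 * n + 2) * (-(v 2 ^ (k * n + 2 * k + 2 * n + 4) *
      (RSA v * v 2 * (n + 3) + RSB v)) + v 1 ^ n * (n * v 2 * (n + 6) + 9 * v 2 + n * v 1 + 4 *
      v 1) + 3 * RZQ v * v 2 ^ 2)) + v 2 ^ n * (n + 3) + RZQ v * v 1]) ?_ ?_
  · refine isCoordinateChange_of_leftInverse (Ψ := fun v => ![v 0 - (v 2 - v 1) ^ (n + 2), v 1 +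
      v 0 ^ (k + 2), v 2 - v 1]) fun i => ⟨?_, ?_, ?_, fun v => ?_⟩ <;>
    fin_cases i <;> simp <;> first | fun_prop | ring
  · intro i; fin_cases i <;> simp
  · intro j; fin_cases j <;> simp <;> fun_prop
  · intro v
    simp [triGerm, sum_fin_fifteen, triGen]
    have hNA : ((-(v 0 + v 2 ^ (n + 2)) ^ (k + 2)) ^ (n + 3)) = -((-1) ^ n * (v 0 + v 2 ^ (n +
      2)) ^ (k * n + 3 * k + 2 * n + 6)) := by
      rw [neg_pow, ← pow_mul]; ring
    have hNB : ((-(v 0 + v 2 ^ (n + 2)) ^ (k + 2)) ^ (n + 4)) = (-1) ^ n * (v 0 + v 2 ^ (n +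
      2)) ^ (k * n + 4 * k + 2 * n + 8) := by
      rw [neg_pow, ← pow_mul]; ring
    linear_combination (norm := (push_cast; ring1)) ((v 1 + (-(v 0 + v 2 ^ (n + 2)) ^ (k + 2)))) *
      eRZQ v + (v 2 * (n + 3)) * eRSA v + eRSB v + (((v 0 + v 2 ^ (n + 2)) ^ (k + 2)) ^ 2 * v 1 *
      v 2 * (n ^ 2 + 6 * n + 9)) * (eBN v).symm + (n * v 2 + 3 * v 2 + n * v 1 + 4 * v 1) * hNA +
      hNB + (-(((-1) ^ n) * (n * v 2 + 3 * v 2 + n * v 1 + 4 * v 1))) * eRXN v + (((-1) ^ n)) *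
      eRXM v + (v 2 ^ (k * n + 2 * k + n + 2) * (v 2 ^ (n + 2) * (-(RZQ v * v 2 ^ (k * n + 2 * k +
      2) * (v 2 ^ (n + 2) * (v 2 ^ (n + 2) + 2 * k * v 0 + 4 * v 0) + v 0 ^ 2 * (k ^ 2 + 4 * k +
      4))) + v 1 * v 2 * (BN v * (n ^ 2 + 6 * n + 9) + RSA v * v 1 * (n + 3) + 3 * RZQ v * v 2) +
      v 2 ^ 2 * (v 2 ^ n * (n + 3) - RZQ v * (2 * RXE v * v 0 ^ 2 + ((v 0 + v 2 ^ (n + 2)) ^ (k +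
      2)))) + v 0 * (k * n + 2 * n + 3 * k + 6) + RSB v * v 1 ^ 2) + v 0 * v 1 * v 2 * (RSA v *
      v 1 * (k * n + 2 * n + 3 * k + 6) + BN v * (n * (k * n + 2 * n + 6 * k + 12) + 9 * k + 18) +
      3 * RZQ v * v 2 * (k + 2)) - RZQ v * v 0 * v 2 ^ 2 * (((v 0 + v 2 ^ (n + 2)) ^ (k + 2)) * (k +
      2) + 2 * RXE v * v 0 ^ 2 * (k + 2)) + RSB v * v 0 * v 1 ^ 2 * (k + 2)) + ((v 0 + v 2 ^ (n +
      2)) ^ (k + 2)) * v 2 * (RZQ v * v 2 * (3 * v 1 - RXE v * v 0 ^ 2 - ((v 0 + v 2 ^ (n +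
      2)) ^ (k + 2))) + BN v * v 1 * (n ^ 2 + 6 * n + 9) + RSA v * v 1 ^ 2 * (n + 3) + v 2 ^ (n +
      1) * (n + 3)) + RXE v * v 0 ^ 2 * v 2 * (BN v * v 1 * (n ^ 2 + 6 * n + 9) + RSA v * v 1 ^ 2 *
      (n + 3) + v 2 ^ (n + 1) * (n + 3) + RZQ v * v 2 * (3 * v 1 - RXE v * v 0 ^ 2)) - v 1 ^ (n +
      2) * (n * v 2 * (n + 6) + 9 * v 2 + n * v 1 + 4 * v 1) - v 2 ^ (n + 2) * (v 2 + 2 * n * v 1 +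
      6 * v 1) - v 1 ^ 2 * (-(RSB v * (RXE v * v 0 ^ 2 + ((v 0 + v 2 ^ (n + 2)) ^ (k + 2)))) + 3 *
      RZQ v * v 2 ^ 2)) * eRXE v

theorem hasGabrielov_IV2sharp_one {n : ℕ} :
    HasTriGabrielov (.IV2sharp 1 (n + 3)) ![n + 4, n + 4, 2 * n + 5] := by
  obtain ⟨UN, hUN, eUN⟩ := exists_analyticAt_eq (fun v : Fin 3 → ℂ =>
    (v 1 + (-v 0)) ^ (n)) (by fun_prop)
  obtain ⟨GN, hGN, eGN⟩ := exists_analyticAt_eq (fun v : Fin 3 → ℂ =>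
    (-(2 * v 2 ^ (n + 2))) ^ (n)) (by fun_prop)
  obtain ⟨RUA, hRUA, eRUA⟩ := exists_add_pow_four n
    (fun v : Fin 3 → ℂ => v 1) (fun v => -v 0) (by fun_prop)
  obtain ⟨RUB, hRUB, eRUB⟩ := exists_add_pow_four (n + 1)
    (fun v : Fin 3 → ℂ => v 1) (fun v => -v 0) (by fun_prop)
  obtain ⟨RSA, hRSA, eRSA⟩ := exists_add_pow_four n
    (fun v : Fin 3 → ℂ => (v 1 + (-v 0))) (fun v => -(2 * v 2 ^ (n + 2))) (by fun_prop)
  obtain ⟨RSB, hRSB, eRSB⟩ := exists_add_pow_four (n + 1)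
    (fun v : Fin 3 → ℂ => (v 1 + (-v 0))) (fun v => -(2 * v 2 ^ (n + 2))) (by fun_prop)
  obtain ⟨RZQ, hRZQ, eRZQ⟩ := exists_add_pow_four n
    (fun v : Fin 3 → ℂ => v 2) (fun v => ((v 1 + (-v 0)) + (-(2 * v 2 ^ (n + 2))))) (by fun_prop)
  refine hasGabrielovNumbers_of_triGerm 1 n n 1 n n 1 (2*n+1) (2*n+1)
    (by ring) (by ring) (by ring) (by positivity) (by funext i; fin_cases i <;> simp <;> ring)
    (Φ := fun v => ![v 0 + v 2 ^ (n + 2), v 1 - v 2 ^ (n + 2) - (v 0 + v 2 ^ (n + 2)), v 2 + ((v 1 +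
      (-v 0)) + (-(2 * v 2 ^ (n + 2))))]) ?_
    ![1, ((-1) ^ n), 1, -1] ?_
    (fun v => ![0, 0, 4 * v 2 ^ n * (-(2 * GN v * v 2 * (n + 3 - 2 * v 2 ^ (n + 1))) + n + 3 - 2 *
      RZQ v * v 2 ^ 2), -(((-1) ^ n) * (n + 4)), -(((-1) ^ n) * (n + 3)), n + 3, -n - 4, 4 *
      (-(GN v * v 2 * (-(2 * v 2 ^ (n + 1) * (n + 4)) + n ^ 2 + 6 * n + 9)) + n + 3 - 3 * RZQ v *
      v 2 ^ 2), -(4 * (-(GN v * v 2 * (-(2 * v 2 ^ (n + 1) * (n + 4)) + n ^ 2 + 6 * n + 9)) + n +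
      3 - 3 * RZQ v * v 2 ^ 2)), ((-1) ^ n) * v 0 ^ n * (-(2 * v 2 ^ (n + 1) * (n ^ 2 + 7 * n +
      12)) + n ^ 2 + 6 * n + 9) + RUA v * v 1 * (-(2 * v 2 ^ (n + 1) * (n + 4)) + n + 3) + 3 *
      RZQ v * v 2, 2 * v 1 ^ n * v 2 ^ (n + 1) * (n ^ 2 + 7 * n + 12) - v 1 ^ n * (n ^ 2 + 6 * n +
      9) - 3 * RZQ v * v 2, -(2 * v 2 ^ n * (4 * v 2 ^ (n + 2) * (RSA v * v 2 * (n + 3) + RSB v) -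
      2 * UN v * v 2 * (n ^ 2 + 6 * n + 9) + n + 3 - 6 * RZQ v * v 2 ^ 2)), RUB v, -(2 * v 2 ^ (n +
      1) * (-(2 * v 2 ^ (n + 1) * (RSA v * v 2 * (n + 3) + RSB v)) + UN v * (n ^ 2 + 6 * n + 9) +
      3 * RZQ v * v 2)) + 2 * ((-1) ^ n) * v 0 ^ (n + 1) * v 2 ^ n * (n + 4) + v 2 ^ n * (n + 3) -
      RZQ v * v 0, -(2 * v 2 ^ (n + 1) * (-(2 * v 2 ^ (n + 1) * (RSA v * v 2 * (n + 3) + RSB v)) +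
      UN v * (n ^ 2 + 6 * n + 9) + 3 * RZQ v * v 2)) + v 2 ^ n * (-(2 * v 1 ^ (n + 1) * (n + 4)) +
      n + 3) + RZQ v * v 1]) ?_ ?_
  · refine isCoordinateChange_of_leftInverse (Ψ := fun v => ![v 0 - (v 2 - v 1) ^ (n + 2), v 1 +
      v 0 + (v 2 - v 1) ^ (n + 2), v 2 - v 1]) fun i => ⟨?_, ?_, ?_, fun v => ?_⟩ <;>
    fin_cases i <;> simp <;> first | fun_prop | ring
  · intro i; fin_cases i <;> simp
  · intro j; fin_cases j <;> simp <;> fun_prop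
  · intro v
    simp [triGerm, sum_fin_fifteen, triGen]
    have hMA : ((-v 0) ^ (n + 2)) = (-1) ^ n * v 0 ^ (n + 2) := by
      rw [neg_pow]; ring
    have hMB : ((-v 0) ^ (n + 3)) = -((-1) ^ n * v 0 ^ (n + 3)) := by
      rw [neg_pow]; ring
    have hMC : ((-v 0) ^ (n + 4)) = (-1) ^ n * v 0 ^ (n + 4) := by
      rw [neg_pow]; ring
    linear_combination (norm := (push_cast; ring1)) (((v 1 + (-v 0)) + (-(2 * v 2 ^ (n + 2))))) *
      eRZQ v + (v 2 * (n + 3)) * eRSA v + eRSB v + (4 * v 2 ^ (2 * n + 5) * (-(2 * v 2 ^ (n + 1) *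
      ((v 1 + (-v 0)) * (n + 4) + v 2 * (n + 3 - 2 * v 2 ^ (n + 1)))) + (v 1 + (-v 0)) * (n ^ 2 +
      6 * n + 9))) * (eGN v).symm + (v 2 * (-(2 * v 2 ^ (n + 1) * (n + 4)) + n + 3)) * eRUA v +
      eRUB v + (-(2 * v 2 ^ (n + 3) * (n * v 1 * (n * v 1 + 6 * v 1 - 2 * n * v 0 - 12 * v 0) +
      v 0 ^ 2 * (n ^ 2 + 6 * n + 9) + 9 * v 1 ^ 2 - 18 * v 0 * v 1))) * (eUN v).symm + (v 1 * v 2 *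
      (-(2 * v 2 ^ (n + 1) * (n ^ 2 + 7 * n + 12)) + n ^ 2 + 6 * n + 9)) * hMA + (-(2 * v 2 ^ (n +
      2) * (n + 4)) + n * v 2 + 3 * v 2 + n * v 1 + 4 * v 1) * hMB + hMC

theorem hasGabrielov_IV2sharp_two {k : ℕ} :
    HasTriGabrielov (.IV2sharp (k + 2) 2) ![3 * (k + 2), 3, k + 4] := by
  obtain ⟨RXE, hRXE, -, eRXE⟩ := exists_add_pow_two (k)
    (fun v : Fin 3 → ℂ => v 2) (fun v => v 0 + v 1) (by fun_prop)
  obtain ⟨RXA, hRXA, eRXA⟩ := exists_add_pow_four (2 * k + 1)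
    (fun v : Fin 3 → ℂ => (v 0 + v 1)) (fun v => v 2) (by fun_prop)
  obtain ⟨RXB, hRXB, eRXB⟩ := exists_add_pow_four (3 * k + 3)
    (fun v : Fin 3 → ℂ => (v 0 + v 1)) (fun v => v 2) (by fun_prop)
  obtain ⟨RBA, hRBA, eRBA⟩ := exists_add_pow_four (2 * k + 1)
    (fun v : Fin 3 → ℂ => v 0) (fun v => v 1) (by fun_prop)
  obtain ⟨RBB, hRBB, eRBB⟩ := exists_add_pow_four (3 * k + 3)
    (fun v : Fin 3 → ℂ => v 0) (fun v => v 1) (by fun_prop)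
  obtain ⟨BO, hBO, eBO⟩ := exists_analyticAt_eq (fun v : Fin 3 → ℂ =>
    (v 0 + v 1) ^ (2 * k + 1)) (by fun_prop)
  obtain ⟨BU, hBU, eBU⟩ := exists_analyticAt_eq (fun v : Fin 3 → ℂ =>
    (v 0 + v 1) ^ (k + 1)) (by fun_prop)
  refine hasGabrielovNumbers_of_triGerm (k+2) k (2*k+1) 0 1 0 1 k k
    (by ring) (by ring) (by ring) (by positivity) (by funext i; fin_cases i <;> simp <;> ring)
    (Φ := fun v => ![(v 0 + v 1 + v 2), (v 1 / 2 - (v 0 + v 1 + v 2) ^ (k + 2)), v 2 + (v 1 / 2 -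
      (v 0 + v 1 + v 2) ^ (k + 2))]) ?_
    ![1/2, -1, 1/8, -1] ?_
    (fun v => ![0, -(1/4 * (-(2 * v 1 ^ (2 * k + 1) * (3 - 2 * v 1 ^ (k + 1))) + 3 * RXE v)),
      v 2 ^ k * (2 - v 2 ^ (k + 1)), 3/2 * (-(2 * v 0 ^ (k + 1) * (k + 2)) + 1), -(3 * BU v * (k +
      2)) + 2, -(1/4 * (-(4 * v 1 ^ (2 * k + 1) * (-(3 * BU v * (k + 2)) + 2)) + 3 * v 2 ^ k * (k +
      2) - 12 * BO v * (k + 2) + 8 * RXE v)), -(3/2 * (-(2 * v 1 ^ (2 * k + 1) * (-(v 1 ^ (k + 1) *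
      (k + 2)) + k + 2)) + RXE v)), v 2 ^ (k + 1) * (-(3 * v 2 ^ (k + 1) * (k + 2)) + 4 * k + 8) -
      k - 2, -(1/2 * (-(v 2 ^ (k + 1) * (-(6 * v 2 ^ (k + 1) * (k + 2)) + 8 * k + 19)) + 2 * k +
      8)), -(1/2 * (-(4 * v 0 ^ (2 * k + 1) * (-(3 * BU v * (k ^ 2 + 4 * k + 4)) + 2 * k + 4)) - 2 *
      RBA v * v 1 * (-(3 * BU v * (k + 2)) + 2) - 6 * BO v * (k + 2) + 4 * RXE v - 3 * RXA v *
      v 2)), -(1/4 * (-(8 * v 1 ^ (2 * k + 1) * (-(3 * BU v * (k ^ 2 + 4 * k + 4)) + 2 * k + 4)) +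
      3 * v 2 ^ k * (k + 2) - 24 * BO v * (k + 2) + 16 * RXE v - 12 * RXA v * v 2)), -(v 2 ^ k *
      (-(3 * v 2 ^ (k + 1) * (k + 2)) + 2 * k + 4)) + 8 * BO v * (k + 2) + 4 * RXA v * v 2 - 2 *
      RXE v - 2 * RXB v, -(1/4 * (-(12 * v 0 ^ (2 * k + 1) * (k + 2)) + 3 * RXE v + 4 * RBB v - 6 *
      RBA v * v 1)), 4 * BO v * (k + 2) + 2 * RXA v * v 2 - RXE v - RXB v, -(1/4 * (v 2 ^ k *
      (-(12 * v 2 ^ (k + 1) * (k + 2)) + 8 * k + 19) - 2 * RXA v * (4 * v 2 + 3 * v 1) - 16 * BO v *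
      (k + 2) + 4 * RXE v + 4 * RXB v))]) ?_ ?_
  · refine isCoordinateChange_of_leftInverse (Ψ := fun v => ![v 0 - (v 2 - v 1) - 2 * (v 1 +
      v 0 ^ (k + 2)), 2 * (v 1 + v 0 ^ (k + 2)), v 2 - v 1]) fun i => ⟨?_, ?_, ?_, fun v => ?_⟩ <;>
    fin_cases i <;> simp <;> first | fun_prop | ring
  · intro i; fin_cases i <;> simp
  · intro j; fin_cases j <;> simp <;> fun_prop
  · intro v
    simp [triGerm, sum_fin_fifteen, triGen]
    linear_combination (norm := (push_cast; ring1)) (1/2 * (4 * v 2 + 3 * v 1)) * eRXA v + (-1) *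
      eRXB v + (-(1/4 * (4 * v 2 ^ 2 + 8 * v 1 * v 2 + 3 * v 1 ^ 2))) * eRXE v + (1/2 * (-(6 *
      ((v 0 + v 1) ^ (k + 1)) * v 2 * (k + 2)) + 4 * v 2 + 3 * v 1)) * eRBA v + (-1) * eRBB v +
      (v 2 * (v 0 * v 1 * (k * (8 * v 2 + 3 * v 0 + 6 * v 1) + 16 * v 2 + 6 * v 0 + 12 * v 1) +
      v 1 ^ 2 * (4 * k * v 2 + 8 * v 2 + 3 * k * v 1 + 6 * v 1) + 4 * v 0 ^ 2 * v 2 * (k + 2))) *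
      (eBO v).symm + (-(3 * v 2 * (v 0 ^ (2 * k + 3) * (k * (v 0 + 2 * k * v 1 + 8 * v 1) + 2 *
      v 0 + 8 * v 1) + v 1 ^ (2 * k + 3) * (2 * k * v 0 * (k + 4) + k * v 1 + 8 * v 0 + 2 * v 1) +
      RBA v * v 0 ^ 2 * v 1 ^ 2 * (k + 2)))) * (eBU v).symm

/-! ### Normal forms of hypersurface germs of type `T_{2,p,q}`

The exponent of the pure power of `x` is `2 * rx + sx + 3`, and `tx + 1 = rx + sx`. -/

/-- The monomials spanning the admissible perturbations of `x ^ p + z ^ q - x ^ 2 * z ^ 2`. -/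
def biGen (rx sx rz sz : ℕ) (x z : ℂ) : Fin 6 → ℂ :=
  ![x ^ (2 * rx + sx + 4), z ^ (2 * rz + sz + 4), x ^ (rx + sx + 3) * z, z ^ (rz + sz + 3) * x,
    x ^ 3 * z ^ 2, x ^ 2 * z ^ 3]

/-- The coefficients of the equation comparing the transformed normal form with its target. -/
def biRow {R : Type*} [CommRing R] (x z Rx Sx Tx Rz Sz Tz : R) (c : Fin 3 → R)
    (g : Fin 2 → R) (q : Fin 8 → R) (h u : Fin 6 → R) : Fin 6 → R :=
  ![-(Sx * (u 5) ^ 2 * (c 0 * u 0 * x * (u 0 * x + 2) + c 0 - Tx * c 2 * q 7 * u 5)) + c 1 * u 0 *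
    (g 0 + q 0 * u 0 * x) - h 0, -(Sz * (u 2) ^ 2 * (c 0 * u 3 * z * (u 3 * z + 2) + c 0 - Tz *
    c 1 * q 3 * u 2)) + c 2 * u 3 * (g 1 + q 4 * u 3 * z) - h 1, -(2 * c 0 * u 5 * x * (u 0 * x *
    (u 4 * (u 0 * x + 2) + u 0 + Rx * Sx * u 1 * u 5) + 2 * u 0 + Rx * Sx * u 1 * u 5 + u 4)) +
    c 2 * q 6 * (u 5) ^ 2 * (Rx * Sx * u 4 + Tx) + Rx * c 1 * u 1 * (g 0 + 2 * q 0 * u 0 * x) - 2 *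
    c 0 * u 5 - h 2, -(2 * c 0 * u 2 * z * (u 3 * z * (u 1 * (u 3 * z + 2) + u 3 + Rz * Sz * u 2 *
    u 4) + u 1 + 2 * u 3 + Rz * Sz * u 2 * u 4)) + c 1 * q 2 * (u 2) ^ 2 * (Rz * Sz * u 1 + Tz) +
    Rz * c 2 * u 4 * (g 1 + 2 * q 4 * u 3 * z) - 2 * c 0 * u 2 - h 3, -(Rx * Sx * c 0 * u 5 * (Rz *
    Sz * u 2 * (4 * u 0 * (u 3 * z + u 4 * x + 1) + 2 * u 1 * (2 * u 4 * z + Rx * Sx * u 5) + 4 *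
    u 4 + Rz * Sz * Tx * u 2 * u 5) + u 1 * (4 * u 0 * x * (u 3 * z + u 4 * x + 1) + 2 * u 1 * z *
    (u 3 * z + u 4 * x + 1) + 4 * u 3 * z + 4 * u 4 * x + 4 + Rx * Sx * u 1 * u 5 * x) + 2 * Rx *
    Sx * Tz * u 2 * u 5 * (u 0 * x + 1) + 2 * u 0 * u 3 * x * (u 0 * x + 2) + 2 * u 3)) - c 0 *
    u 4 * (2 * Rz * Sz * u 2 * z * (u 0 * (2 * u 3 * z + u 4 * x + 2) + u 4 * (u 1 * z + 1) + Rz *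
    Sz * Tx * u 2 * u 5) + u 0 * x * (2 * u 3 * z * (u 0 * x + 2 * u 1 * z + 2) + u 4 * x * (u 0 *
    x + 2 * u 1 * z + 2) + 2 * u 0 * x + 4 * u 1 * z + 4) + u 1 * z * (u 1 * z * (2 * u 3 * z +
    u 4 * x + 2) + 4 * u 3 * z + 2 * u 4 * x + 4) + 2 * u 3 * z + u 4 * x + 2) - c 0 * u 0 * u 3 *
    z * (u 3 * z * (u 0 * x + 2 * u 1 * z + 2) + 2 * u 0 * x + 4 * u 1 * z + 4) - 4 * Rz * Sz * Tx *
    c 0 * u 2 * u 5 * (u 1 * z * (u 3 * z + 1) + u 3 * z + 1) + Rx * c 1 * (g 0 * q 1 * u 2 * (Rx *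
    Sx * Tz * u 0 + Rz * Sz * Tx * u 1) + Rx * Sx * q 0 * (u 1) ^ 2 + Tx * Tz * g 0 * u 2) - c 0 *
    u 0 * (u 0 * x + 2 * u 1 * z + 2) + Tx * c 2 * u 5 * (Rz ^ 2 * Sz * g 1 * q 5 * u 4 + Rx * Sx *
    q 6 * u 3 * u 5) - h 4, -(Rz * Sz * c 0 * u 2 * (2 * u 3 * z * (u 0 * (u 3 * z + 2) + 2 * u 4 *
    (u 1 * z + 1) + Rz * Sz * Tx * u 2 * u 5) + Rz * Sz * u 2 * ((u 4) ^ 2 * z + 2 * Tx * u 5) + 4 *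
    u 4 * (u 1 * z + 1) + 2 * u 0)) - c 0 * u 1 * u 3 * z * (u 1 * z * (u 3 * z + 2) + 2 * u 3 * z +
    4) + Rz * Tx * c 2 * g 1 * u 5 * (Rz * Sz * q 5 * u 3 + Tz) - c 0 * (u 1 * (u 1 * z + 2) + u 3 *
    (u 3 * z + 2)) + Rz * Sz * (Tz * c 1 * q 2 * u 0 * (u 2) ^ 2 + Rz * c 2 * q 4 * (u 4) ^ 2) -
    h 5]

set_option maxHeartbeats 2000000 in
set_option maxRecDepth 4000 in
theorem biRow_identity (rx sx tx rz sz tz : ℕ) (hx : tx + 1 = rx + sx)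
    (hz : tz + 1 = rz + sz) (x z : ℂ) (c : Fin 3 → ℂ) (g : Fin 2 → ℂ)
    (q : Fin 8 → ℂ) (h u : Fin 6 → ℂ) :
    let a := x * u 0 + z * u 1
    let e := z * u 3 + x * u 4
    let d₁ := u 2 * z ^ (rz + sz + 1)
    let d₃ := u 5 * x ^ (rx + sx + 1)
    c 0 * -((x * (1 + a) + d₁) ^ 2 * (z * (1 + e) + d₃) ^ 2) +
      c 1 * (x ^ (2 * rx + sx + 3) * (1 + g 0 * a + a ^ 2 * q 0) +
        g 0 * x ^ (2 * rx + sx + 2) * (1 + a * q 1) * d₁ + x * (1 + a) * d₁ ^ 2 * q 2 +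
        d₁ ^ 3 * q 3) +
      c 2 * (z ^ (2 * rz + sz + 3) * (1 + g 1 * e + e ^ 2 * q 4) +
        g 1 * z ^ (2 * rz + sz + 2) * (1 + e * q 5) * d₃ + z * (1 + e) * d₃ ^ 2 * q 6 +
        d₃ ^ 3 * q 7) =
      c 0 * -(x ^ 2 * z ^ 2) + c 1 * x ^ (2 * rx + sx + 3) + c 2 * z ^ (2 * rz + sz + 3) +
        ∑ j, h j * biGen rx sx rz sz x z j +
        ∑ j, biRow x z (x ^ rx) (x ^ sx) (x ^ tx) (z ^ rz) (z ^ sz) (z ^ tz) c g q h u j *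
          biGen rx sx rz sz x z j := by
  have hTx : x ^ tx * x = x ^ rx * x ^ sx := by rw [← pow_succ, hx, pow_add]
  have hTz : z ^ tz * z = z ^ rz * z ^ sz := by rw [← pow_succ, hz, pow_add]
  intro a e d₁ d₃
  simp only [a, e, d₁, d₃, Fin.sum_univ_six, biGen]
  simp only [Matrix.cons_val]
  have e₂ (x : ℂ) (r : ℕ) : x ^ (2 * r) = (x ^ r) ^ 2 := by ring
  simp only [pow_add, pow_one, e₂]
  generalize x ^ rx = Rx at *
  generalize x ^ sx = Sx at *
  generalize x ^ tx = Tx at *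
  generalize z ^ rz = Rz at *
  generalize z ^ sz = Sz at *
  generalize z ^ tz = Tz at *
  simp only [biRow, Matrix.cons_val]
  linear_combination -(x * (-(Rz * Sz * c 0 * u 2 * u 5 * z ^ 2 * (Rz * Sz * u 2 * (2 * z * (u 4 * x + u 3 * z + 1) +
    Rx * Sx * u 5 * x) + 4 * u 1 * x * z * (u 3 * z + 1) + 4 * u 3 * x * z + 4 * x)) + c 2 * u 5
    * (Rx * Sx * u 5 * x * (q 6 * z * (1 + u 3 * z) + Rx * Sx * q 7 * u 5 * x) + Rz * g 1 * z ^
    2 * (Rz * Sz * q 5 * (u 4 * x + u 3 * z) + Tz * z)) + Rx * c 1 * g 0 * u 2 * x * z ^ 2 * (Rz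
    * Sz * q 1 * u 1 + Tz))) * hTx - (z * (-(Rx ^ 2 * Sx * u 2 * x ^ 2 * (2 * Sx * c 0 * (u 5) ^
    2 * x * (u 0 * x + 1) - c 1 * g 0 * (q 1 * u 0 * x + 1))) + Rz * Sz * c 1 * (u 2) ^ 2 * z *
    (q 2 * x * (1 + u 0 * x) + Rz * Sz * q 3 * u 2 * z) + Rx * Rz * Sx * c 2 * g 1 * u 5 * x *
    z)) * hTz

/-- The values of the rows at the origin; `fx`, `bx`, `tx` stand for `0 ^ rx`, `0 ^ sx`,
  `0 ^ tx`. -/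
def biRowZero (fx bx tx fz bz tz c₀ g₁ g₂ : ℂ) (h u : Fin 6 → ℂ) : Fin 6 → ℂ :=
  ![-(c₀ * u 5 ^ 2 * bx) + g₁ * u 0 - h 0, -(c₀ * u 2 ^ 2 * bz) + g₂ * u 3 - h 1, -(2 * c₀ * u 5) +
    g₁ * u 1 * fx - h 2, -(2 * c₀ * u 2) + g₂ * u 4 * fz - h 3, -(2 * c₀ * (u 0 + u 4)) + g₁ * u 2 *
    (tx * fx) * tz - h 4, -(2 * c₀ * (u 1 + u 3)) + g₂ * u 5 * tx * (tz * fz) - h 5]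

theorem biRow_zero {fx bx tx fz bz tz : ℂ} (hx : fx * bx = 0) (hz : fz * bz = 0)
    (c : Fin 3 → ℂ) (g : Fin 2 → ℂ) {q : Fin 8 → ℂ} (hq : q 2 = 0 ∧ q 3 = 0 ∧ q 6 = 0 ∧ q 7 = 0)
    (h u : Fin 6 → ℂ) :
    biRow 0 0 fx bx tx fz bz tz c g q h u =
      biRowZero fx bx tx fz bz tz (c 0) (c 1 * g 0) (c 2 * g 1) h u := by
  obtain ⟨q2, q3, q6, q7⟩ := hq
  rcases mul_eq_zero.1 hx with rfl | rfl <;>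
    rcases mul_eq_zero.1 hz with rfl | rfl <;> funext j <;> fin_cases j <;>
    simp only [biRow, biRowZero, Fin.reduceFinMk, Matrix.cons_val, q2, q3, q6, q7] <;> ring

/-- The differential of `biRowZero` with respect to `u`. -/
def biRowDeriv (fx bx tx fz bz tz c₀ g₁ g₂ : ℂ) (u k : Fin 6 → ℂ) : Fin 6 → ℂ :=
  ![-(2 * c₀ * u 5 * k 5 * bx) + g₁ * k 0, -(2 * c₀ * u 2 * k 2 * bz) + g₂ * k 3, -(2 * c₀ * k 5) +
    g₁ * k 1 * fx, -(2 * c₀ * k 2) + g₂ * k 4 * fz, -(2 * c₀ * (k 0 + k 4)) + g₁ * k 2 * (tx * fx) *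
    tz, -(2 * c₀ * (k 1 + k 3)) + g₂ * k 5 * tx * (tz * fz)]

theorem hasDerivAt_biRowZero (fx bx tx fz bz tz c₀ g₁ g₂ : ℂ) (h u k : Fin 6 → ℂ) :
    HasDerivAt (fun t : ℂ => biRowZero fx bx tx fz bz tz c₀ g₁ g₂ h (u + t • k))
      (biRowDeriv fx bx tx fz bz tz c₀ g₁ g₂ u k) 0 := by
  have : (fun t : ℂ => biRowZero fx bx tx fz bz tz c₀ g₁ g₂ h (u + t • k)) =
      fun t : ℂ => fun j => biRowZero fx bx tx fz bz tz c₀ g₁ g₂ h u j +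
        t * biRowDeriv fx bx tx fz bz tz c₀ g₁ g₂ u k j +
        t ^ 2 * (![-(c₀ * k 5 ^ 2 * bx), -(c₀ * k 2 ^ 2 * bz), 0, 0, 0, 0] : Fin 6 → ℂ) j := by
    funext t j
    fin_cases j <;> simp only [biRowZero, biRowDeriv, Fin.reduceFinMk, Matrix.cons_val,
      Pi.add_apply, Pi.smul_apply, smul_eq_mul] <;> ring
  rw [this, hasDerivAt_pi]
  exact fun j => hasDerivAt_quadratic _ _ _

theorem exists_biRowZero_eq_zero {fx bx tx fz bz tz c₀ g₁ g₂ : ℂ}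
    (hx : fx * bx = 0) (hz : fz * bz = 0) (hall : tx * fx * (tz * fz) = 0) (h₀ : c₀ ≠ 0)
    (h₁ : g₁ ≠ 0) (h₂ : g₂ ≠ 0) (h : Fin 6 → ℂ) :
    ∃ u, biRowZero fx bx tx fz bz tz c₀ g₁ g₂ h u = 0 := by
  obtain ⟨u0, e0⟩ : ∃ u, g₁ * u = h 0 + bx * h 2 ^ 2 / (4 * c₀) := ⟨_, mul_div_cancel₀ _ h₁⟩
  obtain ⟨u3, e3⟩ : ∃ u, g₂ * u = h 1 + bz * h 3 ^ 2 / (4 * c₀) := ⟨_, mul_div_cancel₀ _ h₂⟩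
  obtain ⟨u2, f2⟩ : ∃ u, u = (g₂ * fz * (-h 4 / (2 * c₀) - u0) - h 3) / (2 * c₀) := ⟨_, rfl⟩
  obtain ⟨u5, f5⟩ : ∃ u, u = (g₁ * fx * (-h 5 / (2 * c₀) - u3) - h 2) / (2 * c₀) := ⟨_, rfl⟩
  obtain ⟨u4, f4⟩ : ∃ u, u = (-h 4 + g₁ * u2 * (tx * fx) * tz) / (2 * c₀) - u0 := ⟨_, rfl⟩
  obtain ⟨u1, f1⟩ : ∃ u, u = (-h 5 + g₂ * u5 * tx * (tz * fz)) / (2 * c₀) - u3 := ⟨_, rfl⟩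
  have e2 : 2 * c₀ * u2 = g₂ * u4 * fz - h 3 := by
    rw [f4]
    have : 2 * c₀ * u2 = g₂ * fz * (-h 4 / (2 * c₀) - u0) - h 3 := by rw [f2]; field_simp
    rw [this]
    field_simp
    linear_combination -(g₂ * g₁ * u2) * hall
  have e5 : 2 * c₀ * u5 = g₁ * u1 * fx - h 2 := by
    rw [f1]
    have : 2 * c₀ * u5 = g₁ * fx * (-h 5 / (2 * c₀) - u3) - h 2 := by rw [f5]; field_simp
    rw [this]
    field_simp
    linear_combination -(g₂ * g₁ * u5) * hall
  have b5 : c₀ * u5 ^ 2 * bx = bx * h 2 ^ 2 / (4 * c₀) := by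
    field_simp
    linear_combination bx * (2 * c₀ * u5 - h 2) * e5 + g₁ * u1 * (2 * c₀ * u5 - h 2) * hx
  have b2 : c₀ * u2 ^ 2 * bz = bz * h 3 ^ 2 / (4 * c₀) := by
    field_simp
    linear_combination bz * (2 * c₀ * u2 - h 3) * e2 + g₂ * u4 * (2 * c₀ * u2 - h 3) * hz
  have e4 : 2 * c₀ * (u0 + u4) = -h 4 + g₁ * u2 * (tx * fx) * tz := by
    rw [f4]; field_simp; ring
  have e1 : 2 * c₀ * (u1 + u3) = -h 5 + g₂ * u5 * tx * (tz * fz) := by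
    rw [f1]; field_simp; ring
  refine ⟨![u0, u1, u2, u3, u4, u5], ?_⟩
  funext j
  fin_cases j <;> simp only [biRowZero, Fin.reduceFinMk, Matrix.cons_val, Pi.zero_apply]
  · linear_combination e0 - b5
  · linear_combination e3 - b2
  · linear_combination -e5
  · linear_combination -e2
  · linear_combination -e4
  · linear_combination -e1

theorem biRowDeriv_injective {fx bx tx fz bz tz c₀ g₁ g₂ : ℂ}
    (hx : fx * bx = 0) (hz : fz * bz = 0) (hall : tx * fx * (tz * fz) = 0) (h₀ : c₀ ≠ 0)
    (h₁ : g₁ ≠ 0) (h₂ : g₂ ≠ 0) {u k : Fin 6 → ℂ}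
    (hk : biRowDeriv fx bx tx fz bz tz c₀ g₁ g₂ u k = 0) : k = 0 := by
  have e (j) := congrFun hk j
  have e0 := e 0; have e1 := e 1; have e2 := e 2; have e3 := e 3; have e4 := e 4; have e5 := e 5
  clear e
  simp only [biRowDeriv, Matrix.cons_val, Pi.zero_apply] at e0 e1 e2 e3 e4 e5
  have k0 : k 0 = 0 := by
    have : g₁ * k 0 = 0 := by linear_combination e0 - u 5 * bx * e2 + u 5 * g₁ * k 1 * hx
    simpa [h₁] using this
  have k3 : k 3 = 0 := by
    have : g₂ * k 3 = 0 := by linear_combination e1 - u 2 * bz * e3 + u 2 * g₂ * k 4 * hz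
    simpa [h₂] using this
  have k2 : k 2 = 0 := by
    have : c₀ ^ 2 * k 2 = 0 := by
      linear_combination -(c₀ / 2) * e3 - g₂ * fz / 4 * e4 + g₁ * g₂ * k 2 / 4 * hall -
        g₂ * fz / 2 * c₀ * k0
    simpa [h₀] using this
  have k5 : k 5 = 0 := by
    have : c₀ ^ 2 * k 5 = 0 := by
      linear_combination -(c₀ / 2) * e2 - g₁ * fx / 4 * e5 + g₁ * g₂ * k 5 / 4 * hall -
        g₁ * fx / 2 * c₀ * k3
    simpa [h₀] using this
  have k4 : k 4 = 0 := by simpa [h₀, k0, k2] using e4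
  have k1 : k 1 = 0 := by simpa [h₀, k3, k5] using e5
  funext j
  fin_cases j <;> simp [*]

theorem AnalyticAt.biRow {E : Type*} [NormedAddCommGroup E] [NormedSpace ℂ E] {p : E}
    {x z Rx Sx Tx Rz Sz Tz : E → ℂ} {q : E → Fin 8 → ℂ} {h u : E → Fin 6 → ℂ}
    (c : Fin 3 → ℂ) (g : Fin 2 → ℂ) (hx : AnalyticAt ℂ x p) (hz : AnalyticAt ℂ z p)
    (hRx : AnalyticAt ℂ Rx p) (hSx : AnalyticAt ℂ Sx p) (hTx : AnalyticAt ℂ Tx p)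
    (hRz : AnalyticAt ℂ Rz p) (hSz : AnalyticAt ℂ Sz p) (hTz : AnalyticAt ℂ Tz p)
    (hq : ∀ j, AnalyticAt ℂ (fun v => q v j) p) (hh : ∀ j, AnalyticAt ℂ (fun v => h v j) p)
    (hu : ∀ j, AnalyticAt ℂ (fun v => u v j) p) :
    AnalyticAt ℂ (fun v => biRow (x v) (z v) (Rx v) (Sx v) (Tx v) (Rz v) (Sz v) (Tz v) c g (q v)
      (h v) (u v)) p := by
  rw [analyticAt_pi_iff]
  intro j
  fin_cases j <;> simp only [_root_.biRow, Fin.reduceFinMk, Matrix.cons_val] <;> fun_prop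

theorem exists_biRow_solution {rx sx tx rz sz tz : ℕ} (hx : tx + 1 = rx + sx)
    (hz : tz + 1 = rz + sz) (hall : rx + tx + (rz + tz) ≠ 0)
    {c : Fin 3 → ℂ} (hc : ∀ i, c i ≠ 0) {g : Fin 2 → ℂ} (hg : ∀ i, g i ≠ 0)
    {q : (Fin 3 → ℂ) → (Fin 6 → ℂ) → Fin 8 → ℂ}
    (hq : ∀ j, ∀ p : (Fin 3 → ℂ) × (Fin 6 → ℂ), AnalyticAt ℂ (fun p => q p.1 p.2 j) p)
    (hq0 : ∀ u, q 0 u 2 = 0 ∧ q 0 u 3 = 0 ∧ q 0 u 6 = 0 ∧ q 0 u 7 = 0)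
    {H : (Fin 3 → ℂ) → Fin 6 → ℂ} (hH : ∀ j, AnalyticAt ℂ (fun v => H v j) 0) :
    ∃ u : (Fin 3 → ℂ) → Fin 6 → ℂ, (∀ j, AnalyticAt ℂ (fun v => u v j) 0) ∧
      ∀ᶠ v in nhds 0, biRow (v 0) (v 2) (v 0 ^ rx) (v 0 ^ sx) (v 0 ^ tx) (v 2 ^ rz) (v 2 ^ sz)
        (v 2 ^ tz) c g (q v (u v)) (H v) (u v) = 0 := by
  have zx : (0 : ℂ) ^ rx * 0 ^ sx = 0 := by rw [← pow_add, ← hx]; simp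
  have zz : (0 : ℂ) ^ rz * 0 ^ sz = 0 := by rw [← pow_add, ← hz]; simp
  have zall : (0 : ℂ) ^ tx * 0 ^ rx * (0 ^ tz * 0 ^ rz) = 0 := by
    rw [← pow_add, ← pow_add, ← pow_add]
    exact zero_pow (by omega)
  have g₁ := mul_ne_zero (hc 1) (hg 0)
  have g₂ := mul_ne_zero (hc 2) (hg 1)
  obtain ⟨b, hb⟩ := exists_biRowZero_eq_zero zx zz zall (hc 0) g₁ g₂ (H 0)
  let f : (Fin 3 → ℂ) × (Fin 6 → ℂ) → Fin 6 → ℂ := fun p =>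
    biRow (p.1 0) (p.1 2) (p.1 0 ^ rx) (p.1 0 ^ sx) (p.1 0 ^ tx) (p.1 2 ^ rz) (p.1 2 ^ sz)
      (p.1 2 ^ tz) c g (q p.1 p.2) (H p.1) p.2
  have f0 : ∀ u, f (0, u) = biRowZero (0 ^ rx) (0 ^ sx) (0 ^ tx) (0 ^ rz) (0 ^ sz) (0 ^ tz) (c 0)
      (c 1 * g 0) (c 2 * g 1) (H 0) u :=
    fun u => biRow_zero zx zz _ _ (hq0 u) _ _
  obtain ⟨u, hu, -, hsol⟩ := exists_analytic_implicit (f := f) (v₀ := 0) (u₀ := b) rfl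
    (by
      refine AnalyticAt.biRow c g ?_ ?_ ?_ ?_ ?_ ?_ ?_ ?_ (fun j => hq j _) ?_ ?_
      case refine_9 =>
        exact fun j => AnalyticAt.comp (g := fun v => H v j) (hH j) analyticAt_fst
      case refine_10 => exact fun j => by fun_prop
      all_goals fun_prop)
    (by rw [f0, hb])
    (biRowDeriv (0 ^ rx) (0 ^ sx) (0 ^ tx) (0 ^ rz) (0 ^ sz) (0 ^ tz)
      (c 0) (c 1 * g 0) (c 2 * g 1) b)
    (fun h => by
      simp only [f0]
      exact hasDerivAt_biRowZero _ _ _ _ _ _ _ _ _ _ _ _)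
    (fun h hh => biRowDeriv_injective zx zz zall (hc 0) g₁ g₂ hh)
  exact ⟨u, analyticAt_pi_iff.1 hu, hsol⟩

/-- The germ with coefficients `c` of the main terms and `H` of the perturbations. -/
def biGerm (rx sx rz sz : ℕ) (c : Fin 3 → ℂ) (H : (Fin 3 → ℂ) → Fin 6 → ℂ)
    (v : Fin 3 → ℂ) : ℂ :=
  v 1 ^ 2 + (c 0 * -(v 0 ^ 2 * v 2 ^ 2) + c 1 * v 0 ^ (2 * rx + sx + 3) +
    c 2 * v 2 ^ (2 * rz + sz + 3) + ∑ j, H v j * biGen rx sx rz sz (v 0) (v 2) j)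

theorem triPowCoeff_zero (r s t : ℕ) (a : ℂ) :
    triPowCoeff r s (t + 1) 0 a 0 2 = 0 ∧ triPowCoeff r s (t + 1) 0 a 0 3 = 0 := by
  have : r + (t + 1) + 1 = (r + t) + 1 + 1 := by ring
  constructor
  · simp [triPowCoeff, this, powRemTail, powRem_zero_zero]
  · simp [triPowCoeff]

theorem germEquiv_biGerm {rx sx tx rz sz tz : ℕ} (hx : tx + 1 = rx + sx)
    (hz : tz + 1 = rz + sz) (hall : rx + tx + (rz + tz) ≠ 0)
    {c : Fin 3 → ℂ} (hc : ∀ i, c i ≠ 0) {H : (Fin 3 → ℂ) → Fin 6 → ℂ}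
    (hH : ∀ j, AnalyticAt ℂ (fun v => H v j) 0) :
    GermEquiv (biGerm rx sx rz sz c 0) (biGerm rx sx rz sz c H) := by
  let a : (Fin 3 → ℂ) → (Fin 6 → ℂ) → ℂ := fun v u => v 0 * u 0 + v 2 * u 1
  let e : (Fin 3 → ℂ) → (Fin 6 → ℂ) → ℂ := fun v u => v 2 * u 3 + v 0 * u 4
  let d₁ : (Fin 3 → ℂ) → (Fin 6 → ℂ) → ℂ := fun v u => u 2 * v 2 ^ (rz + sz + 1)
  let d₃ : (Fin 3 → ℂ) → (Fin 6 → ℂ) → ℂ := fun v u => u 5 * v 0 ^ (rx + sx + 1)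
  let Qx : (Fin 3 → ℂ) → (Fin 6 → ℂ) → Fin 4 → ℂ := fun v u =>
    triPowCoeff rx (sx + 1) (tx + 1) (v 0) (a v u) (d₁ v u)
  let Qz : (Fin 3 → ℂ) → (Fin 6 → ℂ) → Fin 4 → ℂ := fun v u =>
    triPowCoeff rz (sz + 1) (tz + 1) (v 2) (e v u) (d₃ v u)
  let g : Fin 2 → ℂ :=
    ![(2 * rx + (sx + 1) + 2 : ℕ), (2 * rz + (sz + 1) + 2 : ℕ)]
  let q : (Fin 3 → ℂ) → (Fin 6 → ℂ) → Fin 8 → ℂ := fun v u =>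
    ![Qx v u 0, Qx v u 1, Qx v u 2, Qx v u 3, Qz v u 0, Qz v u 1, Qz v u 2, Qz v u 3]
  obtain ⟨u, hu, hsol⟩ := exists_biRow_solution hx hz hall hc (g := g)
    (fun i => by fin_cases i <;> simp only [g, Fin.reduceFinMk, Matrix.cons_val,
      Nat.cast_ne_zero, ne_eq] <;> exact Nat.succ_ne_zero _)
    (q := q)
    (fun j p => by
      fin_cases j <;> simp only [q, Qx, Qz, Fin.reduceFinMk, Matrix.cons_val] <;>
        refine AnalyticAt.triPowCoeff _ _ _ _ (by fun_prop) ?_ ?_ <;>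
        simp only [a, e, d₁, d₃] <;> fun_prop)
    (fun u => by
      have h₁ : d₁ 0 u = 0 := by simp [d₁]
      have h₃ : d₃ 0 u = 0 := by simp [d₃]
      simp only [q, Qx, Qz, Matrix.cons_val, h₁, h₃, Pi.zero_apply]
      exact ⟨(triPowCoeff_zero _ _ _ _).1, (triPowCoeff_zero _ _ _ _).2,
        (triPowCoeff_zero _ _ _ _).1, (triPowCoeff_zero _ _ _ _).2⟩)
    hH
  refine GermEquiv.of_change (Φ := fun v => ![v 0 * (1 + a v (u v)) + d₁ v (u v),
    v 1, v 2 * (1 + e v (u v)) + d₃ v (u v)]) ?_ ?_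
  · refine isCoordinateChange_of_eq_mulVec (fun v =>
      !![1 + a v (u v), 0, u v 2 * v 2 ^ (rz + sz); 0, 1, 0;
        u v 5 * v 0 ^ (rx + sx), 0, 1 + e v (u v)])
      ?_ ?_ ?_
    · intro i j
      fin_cases i <;> fin_cases j <;> simp [a, e] <;> fun_prop
    · rw [← hx, ← hz]
      simp [Matrix.det_fin_three, a, e]
    · intro v i
      fin_cases i <;> simp [Fin.sum_univ_succ, d₁, d₃] <;> ring
  · filter_upwards [hsol] with v hv
    have i₁ := biRow_identity rx sx tx rz sz tz hx hz (v 0) (v 2) c g (q v (u v)) (H v) (u v)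
    rw [hv] at i₁
    have px := triPowCoeff_expansion (s := sx + 1) (t := tx + 1) (by rw [hx]; ring) (v 0)
      (a v (u v)) (d₁ v (u v))
    have pz := triPowCoeff_expansion (s := sz + 1) (t := tz + 1) (by rw [hz]; ring) (v 2)
      (e v (u v)) (d₃ v (u v))
    simp only [Pi.zero_apply, zero_mul, Finset.sum_const_zero, add_zero] at i₁
    simp only [biGerm, Pi.zero_apply, zero_mul, Finset.sum_const_zero, add_zero, Matrix.cons_val]
    rw [← i₁]
    congr 1
    exact congr_arg₂ (· + ·) (congr_arg₂ (· + ·) rfl (congr_arg (c 1 * ·) px))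
      (congr_arg (c 2 * ·) pz)

theorem germEquiv_biNormalForm {p r : ℕ} (hk : 1 - (2 / (p : ℂ) + 2 / r) ≠ 0) (hp : p ≠ 0)
    (hr : r ≠ 0) {c : Fin 3 → ℂ} (hc : ∀ i, c i ≠ 0) :
    GermEquiv (fun v : Fin 3 → ℂ =>
        v 1 ^ 2 + (c 0 * -(v 0 ^ 2 * v 2 ^ 2) + c 1 * v 0 ^ p + c 2 * v 2 ^ r))
      (fun v => v 0 ^ p + v 1 ^ 2 + v 2 ^ r - v 0 * v 1 * v 2) := by
  have hc' : ∀ i, (![4 * c 0, c 1, c 2] : Fin 3 → ℂ) i ≠ 0 := by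
    intro i; fin_cases i <;> simp [hc]
  choose l hl using fun i => (⟨_, Complex.exp_log (hc' i)⟩ :
    ∃ l, Complex.exp l = (![4 * c 0, c 1, c 2] : Fin 3 → ℂ) i)
  have l0 := hl 0; have l1 := hl 1; have l2 := hl 2
  simp only [Matrix.cons_val] at l0 l1 l2
  have hp' : (p : ℂ) ≠ 0 := Nat.cast_ne_zero.2 hp
  have hr' : (r : ℂ) ≠ 0 := Nat.cast_ne_zero.2 hr
  set k := 1 - (2 / (p : ℂ) + 2 / r) with hkd
  let E : ℂ := (l 0 - (2 * l 1 / p + 2 * l 2 / r)) / k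
  have hE : l 0 + 2 * ((E - l 1) / p) + 2 * ((E - l 2) / r) = E := by
    have : E * k = l 0 - (2 * l 1 / p + 2 * l 2 / r) := div_mul_cancel₀ _ hk
    rw [hkd] at this
    linear_combination -this
  have key : ∀ (m : ℕ) (x l' d : ℂ), (m : ℂ) ≠ 0 → Complex.exp l' = d →
      d * (Complex.exp ((E - l') / m) * x) ^ m = Complex.exp E * x ^ m := by
    intro m x l' d hm hd
    rw [mul_pow, ← Complex.exp_nat_mul, mul_div_cancel₀ _ hm, ← mul_assoc, ← hd, ← Complex.exp_add,
      add_sub_cancel]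
  refine ⟨fun v => ![Complex.exp ((E - l 1) / p) * v 0, Complex.exp (E / 2) * (v 1 - v 0 * v 2 / 2),
    Complex.exp ((E - l 2) / r) * v 2], Complex.exp E, ?_, Complex.exp_ne_zero _, ?_⟩
  · refine isCoordinateChange_of_eq_mulVec (fun v => !![Complex.exp ((E - l 1) / p), 0, 0;
      Complex.exp (E / 2) * (-v 2 / 2), Complex.exp (E / 2), 0;
      0, 0, Complex.exp ((E - l 2) / r)]) ?_ ?_ ?_
    · intro i j
      fin_cases i <;> fin_cases j <;> simp <;> fun_prop
    · simp [Matrix.det_fin_three, Complex.exp_ne_zero]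
    · intro v i
      fin_cases i <;> simp [Fin.sum_univ_succ]
      ring
  · refine Filter.Eventually.of_forall fun v => ?_
    simp only [Matrix.cons_val]
    rw [key p _ _ _ hp' l1, key r _ _ _ hr' l2]
    have h2 : Complex.exp (E / 2) ^ 2 = Complex.exp E := by
      rw [← Complex.exp_nat_mul]; congr 1; push_cast; ring
    have h0 : 4 * c 0 * (Complex.exp ((E - l 1) / p) ^ 2 * Complex.exp ((E - l 2) / r) ^ 2) =
        Complex.exp E := by
      rw [← Complex.exp_nat_mul, ← Complex.exp_nat_mul, ← l0, ← Complex.exp_add, ← Complex.exp_add]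
      congr 1
      push_cast
      linear_combination hE
    linear_combination (v 1 - v 0 * v 2 / 2) ^ 2 * h2 - (v 0 ^ 2 * v 2 ^ 2) / 4 * h0

theorem one_sub_two_div_add_ne_zero {p q : ℕ} (h : p + q ≠ 0) :
    1 - (2 / (p + 4 : ℂ) + 2 / (q + 4)) ≠ 0 := by
  have e : ∀ n : ℕ, (n + 4 : ℂ) ≠ 0 := fun n => by exact_mod_cast (by omega : n + 4 ≠ 0)
  have hp := e p; have hq := e q
  intro h0
  field_simp at h0
  have h1 : ((p + 4) * (q + 4) : ℂ) = 2 * (q + 4) + 2 * (p + 4) := by linear_combination h0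
  have h2 : (p + 4) * (q + 4) = 2 * (q + 4) + 2 * (p + 4) := by exact_mod_cast h1
  ring_nf at h2
  have := Nat.zero_le (p * q)
  omega

theorem hasGabrielovNumbers_of_biGerm {h : MvPolynomial (Fin 3) ℂ}
    (rx sx tx rz sz tz : ℕ) (hx : tx + 1 = rx + sx) (hz : tz + 1 = rz + sz)
    (hall : rx + tx + (rz + tz) ≠ 0)
    {γ : Fin 3 → ℕ} (hγ : γ = ![2 * rx + sx + 3, 2, 2 * rz + sz + 3])
    {Φ : (Fin 3 → ℂ) → Fin 3 → ℂ} (hΦ : IsCoordinateChange Φ)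
    (c : Fin 3 → ℂ) (hc : ∀ i, c i ≠ 0) (H : (Fin 3 → ℂ) → Fin 6 → ℂ)
    (hH : ∀ j, AnalyticAt ℂ (fun v => H v j) 0)
    (hF : ∀ v, eval (Φ v) (h - X 0 * X 1 * X 2) = biGerm rx sx rz sz c H v) :
    HasGabrielovNumbers h γ := by
  have h₁ : GermEquiv (fun v => eval v (h - X 0 * X 1 * X 2)) (biGerm rx sx rz sz c H) :=
    GermEquiv.of_change hΦ (Filter.Eventually.of_forall hF)
  have h₂ := (germEquiv_biGerm hx hz hall hc hH).symm
  have ex : 2 * rx + sx + 3 = rx + tx + 4 := by omega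
  have ez : 2 * rz + sz + 3 = rz + tz + 4 := by omega
  have h₃ := germEquiv_biNormalForm (p := 2 * rx + sx + 3) (r := 2 * rz + sz + 3) (by
      rw [ex, ez]
      have := one_sub_two_div_add_ne_zero hall
      push_cast at this ⊢
      exact this) (Nat.succ_ne_zero _) (Nat.succ_ne_zero _) hc
  have h₄ : biGerm rx sx rz sz c 0 = fun v : Fin 3 → ℂ =>
      v 1 ^ 2 + (c 0 * -(v 0 ^ 2 * v 2 ^ 2) + c 1 * v 0 ^ (2 * rx + sx + 3) +
        c 2 * v 2 ^ (2 * rz + sz + 3)) := by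
    funext v
    simp [biGerm]
  rw [← h₄] at h₃
  obtain ⟨Ψ, d, hΨ, hd, h₅⟩ := (h₁.trans h₂).trans h₃
  refine ⟨Ψ, d, hΨ, hd, ?_⟩
  filter_upwards [h₅] with v hv
  rw [hv, hγ]
  rfl

theorem hasGabrielov_IIB {n k : ℕ} :
    HasTriGabrielov (.IIB (n + 3) (k + 2)) ![2 * (n + 3), 2, 2 * (n + 3) * (k + 1)] := by
  obtain ⟨RZM, hRZM, -, eRZM⟩ := exists_add_pow_quot (k + 1)
    (fun v : Fin 3 → ℂ => v 2) (fun v => -(2 * v 0 ^ (n + 2))) (by fun_prop)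
  obtain ⟨RAC, hRAC, -, eRAC⟩ := exists_add_pow_quot (n + 3)
    (fun v : Fin 3 → ℂ => 1) (fun v => -(2 * v 0 ^ (n + 1) * RZM v)) (by fun_prop)
  obtain ⟨AB, hAB, eAB⟩ := exists_analyticAt_eq (fun v : Fin 3 → ℂ =>
    (1 + (-(2 * v 0 ^ (n + 1) * RZM v))) ^ (n + 2)) (by fun_prop)
  obtain ⟨RBC, hRBC, -, eRBC⟩ := exists_add_pow_quot (n + 3)
    (fun v : Fin 3 → ℂ => 1) (fun v => -(2 * v 2 ^ (k * n + 2 * k + n + 1))) (by fun_prop)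
  obtain ⟨BB, hBB, eBB⟩ := exists_analyticAt_eq (fun v : Fin 3 → ℂ =>
    (1 + (-(2 * v 2 ^ (k * n + 2 * k + n + 1)))) ^ (n + 2)) (by fun_prop)
  obtain ⟨RPQ, hRPQ, eRPQ⟩ := exists_add_pow_four n
    (fun v : Fin 3 → ℂ => v 0 * (1 + (-(2 * v 0 ^ (n + 1) * RZM v)))) (fun v => v 2 ^ (k + 1) * (1 +
      (-(2 * v 2 ^ (k * n + 2 * k + n + 1))))) (by fun_prop)
  refine hasGabrielovNumbers_of_biGerm (n+1) 1 (n+1) (k*n+3*k+n+1) 1 (k*n+3*k+n+1)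
    (by ring) (by ring) (by positivity) (by funext i; fin_cases i <;> simp <;> ring)
    (Φ := fun v => ![((v 0 - 2 * v 2 ^ (k * n + 3 * k + n + 2)) + (v 2 - 2 * v 0 ^ (n + 2)) ^ (k +
      1)), v 1 + (v 0 - 2 * v 2 ^ (k * n + 3 * k + n + 2)) * (v 2 - 2 * v 0 ^ (n + 2)) / 2, (v 2 -
      2 * v 0 ^ (n + 2))]) ?_
    ![1/4, 1, 1] ?_
    (fun v => ![-(4 * RAC v * RZM v * v 0 ^ n), -(4 * RBC v * v 2 ^ (k * n + 2 * k + n)), 2 *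
      v 0 ^ n * (AB v * v 2 ^ k * (n + 3) + RAC v * RZM v), 2 * v 2 ^ (k * n + 2 * k + n) * (BB v *
      (n + 3) + RBC v), v 2 ^ k * (2 * v 0 ^ n * v 2 ^ (k * n + 2 * k + n + 1) * (-(2 * v 2 ^ (k *
      n + 2 * k + n + 1) * (4 * RPQ v * RZM v * v 0 ^ (n + 1) * v 2 ^ k * (-(2 * v 2 ^ (k + 1) *
      (v 2 ^ (k * n + 2 * k + n + 1) * (RZM v * (v 2 - 2 * v 0 ^ (n + 2)) + 2 * v 0) - RZM v *
      (v 2 - 2 * v 0 ^ (n + 2)) - 2 * v 0)) + RZM v * v 0 * (v 2 - 2 * v 0 ^ (n + 2)) + 2 *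
      v 0 ^ 2) - 2 * RPQ v * v 2 ^ k * (-(2 * v 2 ^ (k + 1) * (v 2 ^ (k * n + 2 * k + n + 1) * (2 *
      RZM v * v 2 + v 0) - 2 * RZM v * v 2 - v 0)) + 2 * RZM v * v 0 * v 2 + v 0 ^ 2) + v 0 ^ (n +
      1) * (v 2 ^ k * (-(2 * AB v * (n + 3)) + 1) - 2 * BB v * RZM v * (n + 3)) + BB v * (n + 3) +
      RBC v)) + 4 * RPQ v * RZM v * v 0 ^ (n + 1) * v 2 ^ k * (v 2 ^ (k + 1) * (RZM v * (v 2 - 2 *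
      v 0 ^ (n + 2)) + 2 * v 0) + 2 * RZM v * v 0 * (v 2 - 2 * v 0 ^ (n + 2)) + 4 * v 0 ^ 2) - 2 *
      RPQ v * v 2 ^ k * (v 2 ^ (k + 1) * (2 * RZM v * v 2 + v 0) + 4 * RZM v * v 0 * v 2 + 2 *
      v 0 ^ 2) - 2 * AB v * v 0 ^ (n + 1) * v 2 ^ k * (n + 3) + AB v * (n + 3) - 2 * RAC v * RZM v *
      v 0 ^ (n + 1)) - 2 * v 0 ^ (n + 1) * v 2 ^ k * (2 * v 0 ^ (n + 1) * v 2 ^ (k * n + n) *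
      (v 2 ^ k * (AB v * (n + 3) - 2 * RAC v * RZM v * v 0 ^ (n + 1)) + BB v * RZM v * (n + 3)) +
      2 * RPQ v * RZM v * v 0 ^ (n + 1) * (RZM v * (v 2 - 2 * v 0 ^ (n + 2)) + 2 * v 0) - BB v *
      v 2 ^ (k * n + n) * (n + 3) - RPQ v * (2 * RZM v * v 2 + v 0)) + 2 * v 2 ^ (k * n + k + n +
      1) * (-(2 * RPQ v * v 2 ^ (2 * k + 1) * (v 2 ^ (k * n + 2 * k + n + 1) - 1)) + BB v * RZM v *
      v 0 ^ n * (n + 3)) - AB v * v 0 ^ n * (n + 3) - RPQ v * v 2 ^ (k + 1)), -(v 2 ^ (k * n + 2 *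
      k + n) * (4 * v 2 ^ (k * n + 3 * k + n + 2) * (-(2 * v 2 ^ (2 * k + 1) * (v 2 ^ (k * n + k +
      n) * (RPQ v * v 2 ^ (k + 1) + RBC v * v 0 ^ n) - RPQ v)) + v 0 ^ n * (AB v * v 2 ^ k * (n +
      3) + BB v * RZM v * (n + 3))) - 2 * v 2 ^ (2 * k + 1) * (AB v * v 0 ^ n * (n + 3) + RPQ v *
      v 2 ^ (k + 1)) + BB v * (n + 3)))]) ?_ ?_
  · refine isCoordinateChange_of_eq_mulVec (fun v => !![1 - 2 * v 0 ^ (n + 1) * (v 2 - 2 *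
      v 0 ^ (n + 2)) ^ k, 0, -2 * v 2 ^ (k * n + 3 * k + n + 1) + (v 2 - 2 * v 0 ^ (n +
      2)) ^ k; (v 2 - 2 * v 0 ^ (n + 2)) / 2, 1, -(v 2 ^ (k * n + 3 * k + n + 1)) * (v 2 - 2 *
      v 0 ^ (n + 2)); -2 * v 0 ^ (n + 1), 0, 1]) ?_ ?_ ?_
    · intro i j; fin_cases i <;> fin_cases j <;> simp <;> fun_prop
    · simp [Matrix.det_fin_three]
    · intro v i; fin_cases i <;> simp [Fin.sum_univ_succ] <;> ring
  · intro i; fin_cases i <;> simp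
  · intro j; fin_cases j <;> simp <;> fun_prop
  · intro v
    simp [biGerm, Fin.sum_univ_six, biGen]
    have hFC : ((v 0 * (1 + (-(2 * v 0 ^ (n + 1) * RZM v)))) ^ (n + 3)) = v 0 ^ (n + 3) * (1 +
      (-(2 * v 0 ^ (n + 1) * RZM v))) ^ (n + 3) := by
      rw [mul_pow]
    have hFB : ((v 0 * (1 + (-(2 * v 0 ^ (n + 1) * RZM v)))) ^ (n + 2)) = v 0 ^ (n + 2) * (1 +
      (-(2 * v 0 ^ (n + 1) * RZM v))) ^ (n + 2) := by
      rw [mul_pow]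
    have hGC : ((v 2 ^ (k + 1) * (1 + (-(2 * v 2 ^ (k * n + 2 * k + n + 1))))) ^ (n + 3)) =
      v 2 ^ (k * n + 3 * k + n + 3) * (1 + (-(2 * v 2 ^ (k * n + 2 * k + n + 1)))) ^ (n + 3) := by
      rw [mul_pow]; ring
    have hGB : ((v 2 ^ (k + 1) * (1 + (-(2 * v 2 ^ (k * n + 2 * k + n + 1))))) ^ (n + 2)) =
      v 2 ^ (k * n + 2 * k + n + 2) * (1 + (-(2 * v 2 ^ (k * n + 2 * k + n + 1)))) ^ (n + 2) := by
      rw [mul_pow]; ring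
    have hPP : (((v 0 - 2 * v 2 ^ (k * n + 3 * k + n + 2)) + (v 2 - 2 * v 0 ^ (n + 2)) ^ (k +
      1)) ^ (n + 3)) = (v 0 * (1 + (-(2 * v 0 ^ (n + 1) * RZM v))) + (v 2 ^ (k + 1) * (1 + (-(2 *
      v 2 ^ (k * n + 2 * k + n + 1)))))) ^ (n + 3) := by
      rw [show ((v 0 - 2 * v 2 ^ (k * n + 3 * k + n + 2)) + (v 2 - 2 * v 0 ^ (n + 2)) ^ (k + 1)) =
        v 0 * (1 + (-(2 * v 0 ^ (n + 1) * RZM v))) + (v 2 ^ (k + 1) * (1 + (-(2 * v 2 ^ (k * n + 2 *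
        k + n + 1))))) by linear_combination (norm := (push_cast; ring1)) eRZM v]
    linear_combination (norm := (push_cast; ring1)) (2 * v 2 ^ (k * n + 3 * k + n + 2) * (v 2 - 2 *
      v 0 ^ (n + 2)) + 2 * v 0 ^ (n + 3) - v 0 * v 2) * hPP + (2 * v 2 ^ (k * n + 3 * k + n + 2) *
      (v 2 - 2 * v 0 ^ (n + 2)) + 2 * v 0 ^ (n + 3) - v 0 * v 2) * eRPQ v + (2 * v 2 ^ (k * n + 3 *
      k + n + 2) * (v 2 - 2 * v 0 ^ (n + 2)) + 2 * v 0 ^ (n + 3) - v 0 * v 2) * hFC + (v 2 ^ (k +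
      1) * (2 * v 2 ^ (k * n + 2 * k + n + 1) * (-(v 2 ^ (k + 1) * (2 * v 2 ^ (k * n + 2 * k + n +
      1) * (-(2 * v 0 ^ (n + 2) * (n + 3)) + n * v 2 + 3 * v 2) + 2 * v 0 ^ (n + 2) * (n + 3) - n *
      v 2 - 3 * v 2)) - 2 * v 0 ^ (n + 3) * (n + 3) + v 0 * v 2 * (n + 3)) + 2 * v 0 ^ (n + 3) *
      (n + 3) - v 0 * v 2 * (n + 3))) * hFB + (2 * v 2 ^ (k * n + 3 * k + n + 2) * (v 2 - 2 *
      v 0 ^ (n + 2)) + 2 * v 0 ^ (n + 3) - v 0 * v 2) * hGC + (v 0 * (-(4 * v 0 ^ (n + 1) *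
      v 2 ^ (k * n + 3 * k + n + 2) * (RZM v * (-(2 * v 0 ^ (n + 2) * (n + 3)) + n * v 2 + 3 *
      v 2) + n * v 0 + 3 * v 0)) + 2 * v 0 ^ (n + 2) * (RZM v * (-(2 * v 0 ^ (n + 2) * (n + 3)) +
      n * v 2 + 3 * v 2) + n * v 0 + 3 * v 0) + 2 * v 2 ^ (k * n + 3 * k + n + 3) * (n + 3) - v 0 *
      v 2 * (n + 3))) * hGB + (-(v 0 ^ (n + 3) * (-(2 * v 2 ^ (k * n + 3 * k + n + 2) * (v 2 - 2 *
      v 0 ^ (n + 2))) + v 0 * v 2 - 2 * v 0 ^ (n + 3)))) * eRAC v + (-(v 2 ^ (k * n + 3 * k + n +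
      3) * (-(2 * v 2 ^ (k * n + 3 * k + n + 2) * (v 2 - 2 * v 0 ^ (n + 2))) + v 0 * v 2 - 2 *
      v 0 ^ (n + 3)))) * eRBC v + (v 0 ^ (n + 2) * v 2 ^ (k + 1) * (2 * v 2 ^ (k * n + 2 * k + n +
      1) * (-(v 2 ^ (k + 1) * (2 * v 2 ^ (k * n + 2 * k + n + 1) * (-(2 * v 0 ^ (n + 2) * (n + 3)) +
      n * v 2 + 3 * v 2) + 2 * v 0 ^ (n + 2) * (n + 3) - n * v 2 - 3 * v 2)) - 2 * v 0 ^ (n + 3) *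
      (n + 3) + v 0 * v 2 * (n + 3)) + 2 * v 0 ^ (n + 3) * (n + 3) - v 0 * v 2 * (n + 3))) *
      (eAB v).symm + (v 0 * v 2 ^ (k * n + 2 * k + n + 2) * (-(4 * v 0 ^ (n + 1) * v 2 ^ (k * n +
      3 * k + n + 2) * (RZM v * (-(2 * v 0 ^ (n + 2) * (n + 3)) + n * v 2 + 3 * v 2) + n * v 0 + 3 *
      v 0)) + 2 * v 0 ^ (n + 2) * (RZM v * (-(2 * v 0 ^ (n + 2) * (n + 3)) + n * v 2 + 3 * v 2) +
      n * v 0 + 3 * v 0) + 2 * v 2 ^ (k * n + 3 * k + n + 3) * (n + 3) - v 0 * v 2 * (n + 3))) *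
      (eBB v).symm

theorem hasGabrielov_IIB_two {k : ℕ} :
    HasTriGabrielov (.IIB 2 (k + 3)) ![4, 2, 4 * (k + 2)] := by
  obtain ⟨RZM, hRZM, -, eRZM⟩ := exists_add_pow_two (k)
    (fun v : Fin 3 → ℂ => v 2) (fun v => -(2 * v 0)) (by fun_prop)
  refine hasGabrielovNumbers_of_biGerm 0 1 0 (2*k+2) 1 (2*k+2)
    (by ring) (by ring) (by positivity) (by funext i; fin_cases i <;> simp <;> ring)
    (Φ := fun v => ![((v 0 - 2 * v 2 ^ (2 * k + 3)) + (v 2 - 2 * v 0) ^ (k + 2)), v 1 + (v 0 - 2 *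
      v 2 ^ (2 * k + 3)) * (v 2 - 2 * v 0) / 2, (v 2 - 2 * v 0)]) ?_
    ![1/4, 1, 1] ?_
    (fun v => ![16 * RZM v * (1 + 2 * RZM v * v 0), 8 * v 2 ^ k * (v 2 ^ (k + 1) - 1), -(8 *
      (RZM v * (4 * v 0 * v 2 ^ k * (k + 2) + 1 + 2 * RZM v * v 0) + v 2 ^ k * (k + 2))), -(4 *
      v 2 ^ k * (v 2 ^ (k + 1) * (-(4 * v 2 ^ (k + 1) * (k + 3 - v 2 ^ (k + 1))) + 7 + 2 * k) - 2)),
      4 * v 2 ^ k * (v 2 ^ (k + 1) * (4 * v 2 ^ (k + 1) * (v 2 ^ (k + 1) * (4 * RZM v * v 2 -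
      k ^ 2 - 4 * k - 4) - 2 * RZM v * (k * v 2 + 3 * v 2 - 2 * k * v 0 - 4 * v 0) + 2 * k + 4) +
      8 * RZM v * (RZM v * v 0 * (v 2 - 2 * v 0) + v 2 - 2 * v 0) - k ^ 2 - 6 * k - 10) + 2 * v 0 *
      v 2 ^ k * (k ^ 2 + 4 * k + 4) - 2 * RZM v * (v 2 - 2 * k * v 0 - 6 * v 0) + k + 3), 2 *
      v 2 ^ k * (-(2 * v 2 ^ (2 * k + 2) * (-(v 2 ^ (k + 1) * (-(8 * v 2 ^ (k + 1) * (k + 2)) + 21 +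
      2 * k ^ 2 + 12 * k - 8 * RZM v * v 2)) + 4 * k + 12 - 4 * RZM v * v 2)) + 2 * v 2 ^ (k + 1) *
      (3 + k) - 1)]) ?_ ?_
  · refine isCoordinateChange_of_eq_mulVec (fun v => !![1 - 2 * (v 2 - 2 * v 0) ^ (k + 1), 0, -2 *
      v 2 ^ (2 * k + 2) + (v 2 - 2 * v 0) ^ (k + 1); (v 2 - 2 * v 0) / 2, 1, -(v 2 ^ (2 * k + 2)) *
      (v 2 - 2 * v 0); -2, 0, 1]) ?_ ?_ ?_
    · intro i j; fin_cases i <;> fin_cases j <;> simp <;> fun_prop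
    · simp [Matrix.det_fin_three]
    · intro v i; fin_cases i <;> simp [Fin.sum_univ_succ] <;> ring
  · intro i; fin_cases i <;> simp
  · intro j; fin_cases j <;> simp <;> fun_prop
  · intro v
    simp [biGerm, Fin.sum_univ_six, biGen]
    linear_combination (norm := (push_cast; ring1)) (v 0 * v 2 ^ (k + 1) * (4 * v 2 ^ (k + 2) *
      (v 2 ^ (k + 1) * (v 2 * (4 * v 2 ^ (k + 1) - k - 3) + 2 * k * v 0 + 4 * v 0) + 2 * RZM v *
      v 0 * (v 2 - 2 * v 0) + 2 * v 2 - 4 * v 0 - ((v 2 + (-(2 * v 0))) ^ (k + 2))) + 2 * v 0 * (k *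
      v 2 + 3 * v 2 - 2 * k * v 0 - 4 * v 0) - v 2 ^ 2) - ((v 2 + (-(2 * v 0))) ^ (k + 2)) * (v 0 *
      v 2 - 2 * v 0 ^ 2 - 2 * v 2 ^ (2 * k + 4)) - 2 * v 0 ^ 2 * (2 * RZM v * v 0 * (v 2 - 2 *
      v 0) + v 2 - 2 * v 0) - 2 * v 2 ^ (3 * k + 6) * (4 * v 2 ^ (k + 1) - 1)) * eRZM v

theorem hasGabrielov_III_two {k : ℕ} :
    HasTriGabrielov (.III 2 (k + 2)) ![4, 2, 4 * (k + 2)] := by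
  obtain ⟨RZM, hRZM, -, eRZM⟩ := exists_add_pow_two (k)
    (fun v : Fin 3 → ℂ => v 2) (fun v => -(2 * v 0)) (by fun_prop)
  refine hasGabrielovNumbers_of_biGerm 0 1 0 (2*k+2) 1 (2*k+2)
    (by ring) (by ring) (by positivity) (by funext i; fin_cases i <;> simp <;> ring)
    (Φ := fun v => ![-((v 0 - 2 * v 2 ^ (2 * k + 3)) + (v 2 - 2 * v 0) ^ (k + 2)), (v 2 - 2 * v 0),
      v 1 - (v 0 - 2 * v 2 ^ (2 * k + 3)) * (v 2 - 2 * v 0) / 2]) ?_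
    ![1/4, 1, 1] ?_
    (fun v => ![16 * RZM v * (1 + 2 * RZM v * v 0), 8 * v 2 ^ k * (v 2 ^ (k + 1) - 1), -(8 *
      (RZM v * (4 * v 0 * v 2 ^ k * (k + 2) + 1 + 2 * RZM v * v 0) + v 2 ^ k * (k + 2))), -(4 *
      v 2 ^ k * (v 2 ^ (k + 1) * (-(4 * v 2 ^ (k + 1) * (k + 3 - v 2 ^ (k + 1))) + 7 + 2 * k) - 2)),
      4 * v 2 ^ k * (v 2 ^ (k + 1) * (4 * v 2 ^ (k + 1) * (v 2 ^ (k + 1) * (4 * RZM v * v 2 -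
      k ^ 2 - 4 * k - 4) - 2 * RZM v * (k * v 2 + 3 * v 2 - 2 * k * v 0 - 4 * v 0) + 2 * k + 4) +
      8 * RZM v * (RZM v * v 0 * (v 2 - 2 * v 0) + v 2 - 2 * v 0) - k ^ 2 - 6 * k - 10) + 2 * v 0 *
      v 2 ^ k * (k ^ 2 + 4 * k + 4) - 2 * RZM v * (v 2 - 2 * k * v 0 - 6 * v 0) + k + 3), 2 *
      v 2 ^ k * (-(2 * v 2 ^ (2 * k + 2) * (-(v 2 ^ (k + 1) * (-(8 * v 2 ^ (k + 1) * (k + 2)) + 21 +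
      2 * k ^ 2 + 12 * k - 8 * RZM v * v 2)) + 4 * k + 12 - 4 * RZM v * v 2)) + 2 * v 2 ^ (k + 1) *
      (3 + k) - 1)]) ?_ ?_
  · refine isCoordinateChange_of_eq_mulVec (fun v => !![-(1 - 2 * (v 2 - 2 * v 0) ^ (k + 1)), 0,
      -(-2 * v 2 ^ (2 * k + 2) + (v 2 - 2 * v 0) ^ (k + 1)); -2, 0, 1; -((v 2 - 2 * v 0) / 2), 1,
      v 2 ^ (2 * k + 2) * (v 2 - 2 * v 0)]) ?_ ?_ ?_
    · intro i j; fin_cases i <;> fin_cases j <;> simp <;> fun_prop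
    · simp [Matrix.det_fin_three]
    · intro v i; fin_cases i <;> simp [Fin.sum_univ_succ] <;> ring
  · intro i; fin_cases i <;> simp
  · intro j; fin_cases j <;> simp <;> fun_prop
  · intro v
    simp [biGerm, Fin.sum_univ_six, biGen]
    linear_combination (norm := (push_cast; ring1)) (v 0 * v 2 ^ (k + 1) * (4 * v 2 ^ (k + 2) *
      (v 2 ^ (k + 1) * (v 2 * (4 * v 2 ^ (k + 1) - k - 3) + 2 * k * v 0 + 4 * v 0) + 2 * RZM v *
      v 0 * (v 2 - 2 * v 0) + 2 * v 2 - 4 * v 0 - ((v 2 + (-(2 * v 0))) ^ (k + 2))) + 2 * v 0 * (k *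
      v 2 + 3 * v 2 - 2 * k * v 0 - 4 * v 0) - v 2 ^ 2) - ((v 2 + (-(2 * v 0))) ^ (k + 2)) * (v 0 *
      v 2 - 2 * v 0 ^ 2 - 2 * v 2 ^ (2 * k + 4)) - 2 * v 0 ^ 2 * (2 * RZM v * v 0 * (v 2 - 2 *
      v 0) + v 2 - 2 * v 0) - 2 * v 2 ^ (3 * k + 6) * (4 * v 2 ^ (k + 1) - 1)) * eRZM v

theorem hasGabrielov_IIBsharp_two_left {n : ℕ} :
    HasTriGabrielov (.IIBsharp 2 (n + 3)) ![n + 5, 2, 3 * n + 7] := by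
  obtain ⟨RZQ, hRZQ, eRZQ⟩ := exists_add_pow_four n
    (fun v : Fin 3 → ℂ => v 2) (fun v => -v 0) (by fun_prop)
  refine hasGabrielovNumbers_of_biGerm 1 n n (n+2) n (2*n+1)
    (by ring) (by ring) (by positivity) (by funext i; fin_cases i <;> simp <;> ring)
    (Φ := fun v => ![(v 0 + v 2 ^ (n + 2)), v 1 + ((v 0 + v 2 ^ (n + 2)) * (v 2 - v 0) - (v 2 -
      v 0) ^ (n + 3) - (v 0 + v 2 ^ (n + 2)) ^ (2)) / 2, (v 2 - v 0)]) ?_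
    ![1/4, ((-1) ^ n), -1] ?_
    (fun v => ![-(1/4 * ((-1) ^ n) ^ 2 * v 0 ^ n), -(1/4 * v 2 ^ n), -(1/2 * ((-1) ^ n) *
      (-(((-1) ^ n) * v 0 ^ (n + 1) * (n + 3)) + 7 + 2 * n)), -(1/2 * (-(v 2 ^ (n + 1) * (2 + n)) +
      5)), 1/4 * (((-1) ^ n) * v 0 ^ n * (-(((-1) ^ n) * v 0 ^ (n + 1) * (n ^ 2 + 6 * n + 9)) + 2 *
      v 2 ^ (n + 1) * (3 * n + n ^ 2 + v 2 ^ (n + 1)) - 2 * RZQ v * v 0 * (n * v 2 + 3 * v 2 -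
      v 0) + 2 * n + 6 - 2 * n * v 0 * v 2 ^ n) + RZQ v * v 2 * (2 + 2 * n * v 2 ^ (n + 1) - RZQ v *
      v 0 * v 2) + 4 * v 2 ^ n * (n + 3) - 4 * RZQ v * v 0), -(1/4 * v 2 ^ n * (-(v 2 ^ (n + 1) *
      (-(2 * ((-1) ^ n) * v 0 ^ n * v 2 * (n + 3)) + 8 - n ^ 2 - 2 * RZQ v * v 2 ^ 2)) + 12 + 2 *
      n))]) ?_ ?_
  · refine isCoordinateChange_of_eq_mulVec (fun v => !![1, 0, v 2 ^ (n + 1); ((v 2 - v 0) - (v 2 -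
      v 0) ^ (n + 2) * (-1) - (v 0 + v 2 ^ (n + 2)) ^ 1 * (1)) / 2, 1, ((v 2 ^ (n + 1)) * (v 2 -
      v 0) - (v 2 - v 0) ^ (n + 2) * (1) - (v 0 + v 2 ^ (n + 2)) ^ 1 * (v 2 ^ (n + 1))) / 2; -1, 0,
      1])
      ?_ ?_ ?_
    · intro i j; fin_cases i <;> fin_cases j <;> simp <;> fun_prop
    · simp [Matrix.det_fin_three]
    · intro v i; fin_cases i <;> simp [Fin.sum_univ_succ] <;> ring
  · intro i; fin_cases i <;> simp
  · intro j; fin_cases j <;> simp <;> fun_prop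
  · intro v
    simp [biGerm, Fin.sum_univ_six, biGen]
    have hNB : ((-v 0) ^ (n + 2)) = (-1) ^ n * v 0 ^ (n + 2) := by
      rw [neg_pow]; ring
    have hNC : ((-v 0) ^ (n + 3)) = -((-1) ^ n * v 0 ^ (n + 3)) := by
      rw [neg_pow]; ring
    linear_combination (norm := (push_cast; ring1)) (1/4 * (v 2 ^ (n + 2) * (v 2 + n * v 0 - 3 *
      v 0 - 2 * v 2 ^ (n + 2)) - ((-v 0) ^ (n + 2)) * v 2 * (n + 3) + v 0 * (2 * v 2 - 4 * v 0 -
      RZQ v * v 0 * v 2 ^ 2) - ((-v 0) ^ (n + 3)) - ((v 2 + (-v 0)) ^ (n + 3)))) * eRZQ v + (1/4 *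
      v 2 * (v 0 * v 2 * (-(((-1) ^ n) * v 0 ^ (n + 1) * (n ^ 2 + 6 * n + 9)) + 2 * n * v 2 ^ (n +
      1) * (3 + n) - 2 * RZQ v * v 0 * v 2 * (n + 3) + 2 * n + 6) - ((-v 0) ^ (n + 2)) * v 2 *
      (n ^ 2 + 6 * n + 9) - 2 * ((-v 0) ^ (n + 3)) * (n + 3) - 2 * v 2 ^ (2 * n + 4) * (n + 3) - 4 *
      v 0 ^ 2 * (n + 3))) * hNB + (1/4 * (-(((-1) ^ n) * v 0 ^ (n + 2) * (2 * n * v 2 + 6 * v 2 -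
      v 0)) + 2 * v 0 * v 2 * (1 + n * v 2 ^ (n + 1) - RZQ v * v 0 * v 2) - 2 * v 2 ^ (2 * n + 4) -
      4 * v 0 ^ 2 - ((-v 0) ^ (n + 3)))) * hNC

theorem hasGabrielov_IIBsharp_two_right {n : ℕ} :
    HasTriGabrielov (.IIBsharp (n + 3) 2) ![3 * n + 7, 2, n + 5] := by
  obtain ⟨RXP, hRXP, eRXP⟩ := exists_add_pow_four n
    (fun v : Fin 3 → ℂ => v 0) (fun v => v 2) (by fun_prop)
  refine hasGabrielovNumbers_of_biGerm (n+2) n (2*n+1) 1 n n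
    (by ring) (by ring) (by positivity) (by funext i; fin_cases i <;> simp <;> ring)
    (Φ := fun v => ![(v 0 + v 2), v 1 + ((v 0 + v 2) * (v 2 - v 0 ^ (n + 2)) - (v 2 - v 0 ^ (n +
      2)) ^ (2) - (v 0 + v 2) ^ (n + 3)) / 2, (v 2 - v 0 ^ (n + 2))]) ?_
    ![1/4, -1, -1] ?_
    (fun v => ![-(1/4 * v 0 ^ n), -(1/4 * v 2 ^ n), 1/2 * (-(v 0 ^ (n + 1) * (2 + n)) + 5), -(1/2 *
      (v 2 ^ (n + 1) * (n + 3) + 7 + 2 * n)), -(1/4 * (-(v 0 ^ (2 * n + 1) * (-(2 * v 2 ^ n * (n *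
      v 0 + 3 * v 0 + v 2)) + 8 - 2 * RXP v * v 0 ^ 2 - n ^ 2)) + RXP v * v 2 * (2 * v 2 ^ (n + 1) *
      (n + 3) + 2 + 2 * n * v 0 ^ (n + 1) + RXP v * v 0 * v 2) + 2 * n * v 0 ^ n * v 2 ^ (n + 1) *
      (3 + n) + 2 * v 0 ^ n * (6 + n))), -(1/4 * (v 2 ^ (n + 1) * (v 2 ^ n * (n ^ 2 + 6 * n + 9) +
      2 * n * v 0 ^ n + 2 * RXP v * v 2) + 2 * v 2 ^ n * (n + 3) + 4 * v 0 ^ n * (n + 3) + 4 *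
      RXP v * v 2))]) ?_ ?_
  · refine isCoordinateChange_of_eq_mulVec (fun v => !![1, 0, 1; ((v 2 - v 0 ^ (n + 2)) - (v 2 -
      v 0 ^ (n + 2)) ^ 1 * (-(v 0 ^ (n + 1))) - (v 0 + v 2) ^ (n + 2) * (1)) / 2, 1, ((v 2 -
      v 0 ^ (n + 2)) - (v 2 - v 0 ^ (n + 2)) ^ 1 * (1) - (v 0 + v 2) ^ (n + 2) * (1)) / 2; -(v 0 ^
      (n + 1)), 0, 1]) ?_ ?_ ?_
    · intro i j; fin_cases i <;> fin_cases j <;> simp <;> fun_prop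
    · simp [Matrix.det_fin_three]
    · intro v i; fin_cases i <;> simp [Fin.sum_univ_succ] <;> ring
  · intro i; fin_cases i <;> simp
  · intro j; fin_cases j <;> simp <;> fun_prop
  · intro v
    simp [biGerm, Fin.sum_univ_six, biGen]
    linear_combination (norm := (push_cast; ring1)) (-(1/4 * (-(v 0 ^ (n + 2) * (v 0 + 3 * v 2 - 2 *
      v 0 ^ (n + 2) - n * v 2)) + v 2 ^ 2 * (v 2 ^ n * (n * v 0 + 3 * v 0 + v 2) + 4 + RXP v *
      v 0 ^ 2) + 2 * v 0 * v 2 + ((v 0 + (v 2)) ^ (n + 3))))) * eRXP v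

theorem hasGabrielov_IIBsharp {n k : ℕ} :
    HasTriGabrielov (.IIBsharp (k + 3) (n + 3)) ![k * n + 4 * k + 2 * n + 9, 2, k * n + 4 * n + 2 *
      k + 9] := by
  obtain ⟨RXP, hRXP, eRXP⟩ := exists_add_pow_four (k)
    (fun v : Fin 3 → ℂ => v 0) (fun v => v 2 ^ (n + 2)) (by fun_prop)
  obtain ⟨RZQ, hRZQ, eRZQ⟩ := exists_add_pow_four n
    (fun v : Fin 3 → ℂ => v 2) (fun v => -v 0 ^ (k + 2)) (by fun_prop)
  refine hasGabrielovNumbers_of_biGerm (k+2) (k*n+2*k+2*n+2) (k*n+3*k+2*n+3) (n+2) (k*n+2*n+2*k+2)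
    (k*n+3*n+2*k+3)
    (by ring) (by ring) (by positivity) (by funext i; fin_cases i <;> simp <;> ring)
    (Φ := fun v => ![(v 0 + v 2 ^ (n + 2)), v 1 + ((v 0 + v 2 ^ (n + 2)) * (v 2 - v 0 ^ (k + 2)) -
      (v 2 - v 0 ^ (k + 2)) ^ (n + 3) - (v 0 + v 2 ^ (n + 2)) ^ (k + 3)) / 2, (v 2 - v 0 ^ (k +
      2))]) ?_
    ![1/4, ((-1) ^ n), -1] ?_
    (fun v => ![-(1/4 * ((-1) ^ n) ^ 2 * v 0 ^ (k * n + 2 * k + 2 * n + 2)), -(1/4 * v 2 ^ (k * n +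
      2 * k + 2 * n + 2)), -(1/2 * ((-1) ^ n) * (-(((-1) ^ n) * v 0 ^ (k * n + 2 * k + 2 * n + 3) *
      (n + 3)) + 7 + 2 * n)), -(1/2 * (v 2 ^ (k * n + 2 * k + 2 * n + 3) * (k + 3) + 7 + 2 * k)),
      -(1/4 * (-(((-1) ^ n) * v 0 ^ (k * n + 2 * k + 2 * n + 1) * (-(2 * v 2 ^ (k * n + 2 * k + 2 *
      n + 2) * (v 0 * v 2 * (k * n + 3 * n + 3 * k + 9 - v 0 ^ (k + 1) * v 2 ^ (n + 1)) + v 2 ^ (n +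
      3) * (n + 3) - v 0 ^ (k + 3) * (k + 3))) + v 0 ^ (k + 2) * (v 0 ^ (k + 2) * (-(((-1) ^ n) *
      v 0 ^ (k * n + 2 * n) * (n ^ 2 + 6 * n + 9)) + 2 * v 2 ^ n * (1 + k - n) - 2 * RZQ v * (n *
      v 2 + 3 * v 2 - v 0 ^ (k + 2))) + 2 * v 2 ^ (n + 1) * (n * (2 + n - k) + RXP v * v 0 ^ 2 *
      v 2 ^ (n + 1) - 3 - 3 * k)) - 2 * RXP v * v 0 ^ 2 * v 2 ^ (2 * n + 3) * (n + 3) + 2 * n *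
      v 0 + 6 * v 0)) + v 0 ^ k * v 2 ^ (n + 1) * (-(v 0 ^ (k + 1) * v 2 ^ (n + 1) * (-(2 * RZQ v *
      v 2 ^ (k * n + 2 * k + 2) * (k * v 0 + 3 * v 0 + v 2 ^ (n + 2))) + n * (2 + 2 * k - n) + 11 +
      2 * k - 2 * RXP v * RZQ v * v 0 ^ 2 * v 2 ^ 2 - k ^ 2)) - 2 * v 2 ^ (k * n + 2 * k + 2 * n +
      3) * (-(k * (2 + k - n)) + 3 + 3 * n) + 2 * RZQ v * v 0 ^ (2 * k + 3) * v 2 * (1 + k - n) -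
      2 * RXP v * v 0 * v 2 ^ (2 * n + 3) * (1 + n - k) + 14 + 2 * n + 2 * k) + RXP v * v 2 ^ (2 *
      n + 3) * (v 2 ^ (2 * n + 3) * (2 * v 2 ^ (k * n + 2 * k) * (k + 3) + RXP v * v 0) + 2) -
      v 0 ^ (2 * k + 2) * (-(RZQ v * v 0 ^ (k + 2) * (4 + RZQ v * v 0 ^ (k + 1) * v 2 ^ 2)) + 4 *
      v 2 ^ n * (3 + n) + 2 * RZQ v * v 2))), -(1/4 * v 2 ^ (2 * n + 2) * (-(v 2 ^ (k * n + 2 * k +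
      2 * n + 3) * (-(v 2 ^ (k * n + 2 * k) * (k ^ 2 + 6 * k + 9)) + 2 * v 0 ^ k * (1 + n - k) - 2 *
      RXP v * v 2 ^ (n + 2))) + 2 * v 2 ^ (k * n + 2 * k) * (k + 3) + 4 * v 0 ^ k * (k + 3) + 4 *
      RXP v * v 2 ^ (n + 2)))]) ?_ ?_
  · refine isCoordinateChange_of_eq_mulVec (fun v => !![1, 0, v 2 ^ (n + 1); ((v 2 - v 0 ^ (k +
      2)) - (v 2 - v 0 ^ (k + 2)) ^ (n + 2) * (-(v 0 ^ (k + 1))) - (v 0 + v 2 ^ (n + 2)) ^ (k + 2) *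
      (1)) / 2, 1, ((v 2 ^ (n + 1)) * (v 2 - v 0 ^ (k + 2)) - (v 2 - v 0 ^ (k + 2)) ^ (n + 2) *
      (1) - (v 0 + v 2 ^ (n + 2)) ^ (k + 2) * (v 2 ^ (n + 1))) / 2; -(v 0 ^ (k + 1)), 0,
      1]) ?_ ?_ ?_
    · intro i j; fin_cases i <;> fin_cases j <;> simp <;> fun_prop
    · simp [Matrix.det_fin_three]
    · intro v i; fin_cases i <;> simp [Fin.sum_univ_succ] <;> ring
  · intro i; fin_cases i <;> simp
  · intro j; fin_cases j <;> simp <;> fun_prop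
  · intro v
    simp [biGerm, Fin.sum_univ_six, biGen]
    have hNB : ((-v 0 ^ (k + 2)) ^ (n + 2)) = (-1) ^ n * v 0 ^ (k * n + 2 * k + 2 * n + 4) := by
      rw [neg_pow, ← pow_mul]; ring
    have hNC : ((-v 0 ^ (k + 2)) ^ (n + 3)) = -((-1) ^ n * v 0 ^ (k * n + 3 * k + 2 * n + 6)) := by
      rw [neg_pow, ← pow_mul]; ring
    linear_combination (norm := (push_cast; ring1)) (1/4 * (v 0 ^ (k + 2) * v 2 ^ 2 * (v 2 ^ n *
      (1 + n) - RZQ v * v 0 ^ (k + 2)) - ((-v 0 ^ (k + 2)) ^ (n + 2)) * v 2 * (n + 3) + 2 * v 0 *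
      v 2 + v 2 ^ (n + 3) - 2 * v 0 ^ (k + 3) - 2 * ((v 0 + (v 2 ^ (n + 2))) ^ (k + 3)) -
      ((-v 0 ^ (k + 2)) ^ (n + 3)) - ((v 2 + (-v 0 ^ (k + 2))) ^ (n + 3)))) * eRZQ v + (-(1/4 *
      (v 2 ^ (n + 2) * (v 2 ^ (k * n + 2 * k + n + 2) * (k * v 0 + 3 * v 0 + v 2 ^ (n + 2)) -
      v 0 ^ (k + 2) * (5 + 2 * n - k) + 4 * v 2 + RXP v * v 0 ^ 2 * v 2 ^ (n + 2)) + 2 *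
      ((-v 0 ^ (k + 2)) ^ (n + 2)) * v 2 * (n + 3) - v 0 ^ (k + 3) * (1 - 2 * RZQ v * v 0 ^ (k +
      1) * v 2 ^ 2) + 2 * v 0 * v 2 + 2 * ((-v 0 ^ (k + 2)) ^ (n + 3)) + ((v 0 + (v 2 ^ (n +
      2))) ^ (k + 3))))) * eRXP v + (1/4 * v 2 * (2 * v 0 * v 2 ^ (n + 2) * (-(v 2 ^ (k * n + 2 *
      k + n + 2) * (k * n + 3 * n + 3 * k + 9)) + v 0 ^ (k + 1) * (n * (2 + n - k) - 3 - 3 * k) -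
      RXP v * v 0 * v 2 ^ (n + 2) * (n + 3)) - ((-1) ^ n) * v 0 ^ (k * n + 2 * k + 2 * n + 4) *
      v 2 * (n ^ 2 + 6 * n + 9) - ((-v 0 ^ (k + 2)) ^ (n + 2)) * v 2 * (n ^ 2 + 6 * n + 9) - 2 *
      v 0 ^ (k + 3) * (RZQ v * v 0 ^ (k + 1) * v 2 ^ 2 * (n + 3) + 2 * n + 6) - 2 * v 2 ^ (k * n +
      2 * k + 3 * n + 6) * (n + 3) - 2 * ((-v 0 ^ (k + 2)) ^ (n + 3)) * (n + 3) + 2 * v 0 * v 2 *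
      (n + 3))) * hNB + (1/4 * (-(v 0 ^ (k + 2) * (((-1) ^ n) * v 0 ^ (k * n + k + 2 * n + 2) * (2 *
      n * v 2 + 6 * v 2 - v 0 ^ (k + 2)) + 2 * v 2 ^ (n + 2) * (1 + k - n) + 4 * v 0 + 2 * RZQ v *
      v 0 ^ (k + 2) * v 2 ^ 2)) - 2 * v 2 ^ (k * n + 2 * k + 2 * n + 4) * (k * v 0 + 3 * v 0 +
      v 2 ^ (n + 2)) + 2 * v 0 * v 2 * (1 - RXP v * v 0 * v 2 ^ (2 * n + 3)) - ((-v 0 ^ (k +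
      2)) ^ (n + 3)))) * hNC

/-! ### Normal forms of hypersurface germs of type `T_{2,3,q}` -/

/-- The monomials spanning the admissible perturbations of `x ^ 3 + z ^ (n + 9) - x ^ 2 * z ^ 2`. -/
def cubicGen (n : ℕ) (x z : ℂ) : Fin 5 → ℂ :=
  ![x ^ 4, x ^ 3 * z, x ^ 2 * z ^ 3, x * z ^ (n + 7), z ^ (n + 10)]

/-- The coefficients of the equation comparing the transformed normal form with its target. -/
def cubicRow (n : ℕ) (x z : ℂ) (c : Fin 3 → ℂ) (q h u : Fin 5 → ℂ) : Fin 5 → ℂ :=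
  ![-(c 0 * (u 2) ^ 2 * (u 0 * x * (u 0 * x + 2) + 1)) + c 1 * u 0 * (u 0 * x * (u 0 * x + 3) + 3) +
    c 2 * q 4 * (u 2) ^ 4 - h 0, -(c 0 * u 2 * (2 * u 0 * x * (u 0 * x * (u 3 * z + 1) + u 1 * (2 *
    z + u 2 * x) + 2 * u 3 * z + 2) + u 1 * u 2 * x * (u 1 * z + 2) + 4 * u 1 * z + 2 * u 3 * z +
    2)) + 3 * c 1 * u 1 * (u 0 * x * (u 0 * x + u 1 * z + 2) + u 1 * z + 1) + c 2 * q 3 *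
    (u 2) ^ 3 * (u 3 * z + 1) - c 0 * u 0 * z * (u 0 * x + 2) - h 1, -(u 4 * z ^ (n + 2) * (c 0 *
    u 2 * (4 * u 3 * z ^ 2 * (u 0 * x + u 1 * z + 1) + 2 * u 2 * x * (u 0 * x + u 1 * z + 1) + z *
    (4 * u 0 * x + 4 * u 1 * z + 4 + u 2 * u 4 * z ^ (n + 4))) + 2 * c 0 * u 0 * z ^ 2 * (u 3 * z *
    (u 3 * z + 2) + 1) - 3 * c 1 * u 0 * (x * (u 0 * x + 2 * u 1 * z + 2) + u 4 * z ^ (n + 5)) - 3 *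
    c 1 * u 1 * z * (u 1 * z + 2) - 3 * c 1)) - c 0 * u 3 * (u 0 * x * (u 3 * z * (u 0 * x + 2 *
    u 1 * z + 2) + 4 * u 1 * (z + u 2 * x) + 2 * u 0 * x + 4) + u 1 * z * (u 1 * (u 3 * z ^ 2 + 2 *
    z + 2 * u 2 * x) + 2 * u 3 * z + 4) + 4 * u 1 * u 2 * x + u 3 * z + 2) + c 2 * q 2 * (u 2) ^ 2 *
    (u 3 * z * (u 3 * z * (u 3 * z + 3) + 3) + 1) - c 0 * u 1 * (u 1 * (z + 2 * u 2 * x) + 2 * u 0 *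
    x + 2) + c 1 * (u 1) ^ 3 * x - h 2, -(2 * c 0 * u 4 * z * (u 3 * z * (u 1 * (u 3 * z + 2) +
    u 3 + u 2 * u 4 * z ^ (n + 3)) + u 1 + 2 * u 3 + u 2 * u 4 * z ^ (n + 3))) + 3 * c 1 *
    (u 4) ^ 2 * z ^ (n + 3) * (u 1 * z + 1) + c 2 * q 1 * u 2 * z * (n + 9) - 2 * c 0 * u 4 - h 3,
    -((u 4) ^ 2 * z ^ (n + 2) * (c 0 * u 3 * z * (u 3 * z + 2) + c 0 - c 1 * u 4 * z ^ (n + 3))) +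
    c 2 * u 3 * (n + 9 + q 0 * u 3 * z) - h 4]

/-- The coefficients in the expansion of `(f + g) ^ (n + 9)` up to the fourth order in `g`. -/
def powCoeff (n : ℕ) (f g : ℂ) : Fin 3 → ℂ :=
  ![(4 * n + 26) * f ^ (n + 4) + (f + 4 * g) * powRem (n + 3) f g, (6 * n + 34) * f ^ (n + 5) + 6 *
    f * g * powRem (n + 3) f g, (4 * n + 21) * f ^ (n + 5) + (n + 5) * f ^ (n + 4) * g + (4 * f *
    g + g ^ 2) * powRem (n + 3) f g]

theorem powCoeff_expansion (n : ℕ) (f g : ℂ) :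
    (f + g) ^ (n + 9) = f ^ (n + 9) + (n + 9) * f ^ (n + 8) * g + f ^ 3 * g ^ 2 * powCoeff n f g 0 +
      f * g ^ 3 * powCoeff n f g 1 + g ^ 4 * powCoeff n f g 2 := by
  have h := add_pow_eq_powRem (n + 3) f g
  simp only [powCoeff, Matrix.cons_val]
  push_cast at h
  linear_combination (f + g) ^ 4 * h

theorem cubicRow_identity (n : ℕ) (x z : ℂ) (c : Fin 3 → ℂ) (q h u : Fin 5 → ℂ) :
    c 0 * -((x * (1 + (x * u 0 + z * u 1)) + u 4 * z ^ (n + 5)) ^ 2 * (z * (1 + z * u 3) + x *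
      u 2) ^ 2) + c 1 * (x * (1 + (x * u 0 + z * u 1)) + u 4 * z ^ (n + 5)) ^ 3 + c 2 * (z ^ (n +
      9) * (1 + (n + 9) * (z * u 3) + (z * u 3) ^ 2 * q 0) + (n + 9) * (z ^ (n + 8) * q 1) * (x *
      u 2) + (z * (1 + z * u 3)) ^ 3 * (x * u 2) ^ 2 * q 2 + z * (1 + z * u 3) * (x * u 2) ^ 3 *
      q 3 + (x * u 2) ^ 4 * q 4) =
      c 0 * -(x ^ 2 * z ^ 2) + c 1 * x ^ 3 + c 2 * z ^ (n + 9) + ∑ j, h j * cubicGen n x z j + ∑ j,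
        cubicRow n x z c q h u j * cubicGen n x z j := by
  simp only [Fin.sum_univ_five, cubicGen, cubicRow, Matrix.cons_val]
  ring

/-- The germ with coefficients `c` of the main terms and `H` of the perturbations. -/
def cubicGerm (n : ℕ) (c : Fin 3 → ℂ) (H : (Fin 3 → ℂ) → Fin 5 → ℂ) (v : Fin 3 → ℂ) : ℂ :=
  v 1 ^ 2 + (c 0 * -(v 0 ^ 2 * v 2 ^ 2) + c 1 * v 0 ^ 3 + c 2 * v 2 ^ (n + 9) + ∑ j, H v j *
    cubicGen n (v 0) (v 2) j)

theorem germEquiv_cubicGerm {n : ℕ} {c : Fin 3 → ℂ} (hc : ∀ i, c i ≠ 0)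
    {H : (Fin 3 → ℂ) → Fin 5 → ℂ} (hH : ∀ j, AnalyticAt ℂ (fun v => H v j) 0) :
    GermEquiv (cubicGerm n c 0) (cubicGerm n c H) := by
  let q : (Fin 3 → ℂ) → (Fin 5 → ℂ) → Fin 5 → ℂ := fun v u =>
    ![powRem (n + 7) 1 (v 2 * u 3), (1 + v 2 * u 3) ^ (n + 8), powCoeff n (v 2 * (1 + v 2 *
      u 3)) (v 0 * u 2) 0, powCoeff n (v 2 * (1 + v 2 * u 3)) (v 0 * u 2) 1, powCoeff n (v 2 * (1 +
      v 2 * u 3)) (v 0 * u 2) 2]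
  let f : (Fin 3 → ℂ) × (Fin 5 → ℂ) → Fin 5 → ℂ := fun p =>
    cubicRow n (p.1 0) (p.1 2) c (q p.1 p.2) (H p.1) p.2
  have f0 : ∀ u, f (0, u) = ![-(c 0 * u 2 ^ 2) + 3 * c 1 * u 0 - H 0 0, -(2 * c 0 * u 2) + 3 * c 1 *
    u 1 - H 0 1, -(2 * c 0 * (u 1 + u 3)) - H 0 2, -(2 * c 0 * u 4) - H 0 3, (n + 9) * c 2 * u 3 -
    H 0 4] := by
    intro u
    funext j
    fin_cases j <;> simp [f, q, cubicRow, powCoeff] <;> ring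
  have h0 := hc 0; have h1 := hc 1; have h2 := hc 2
  have hn : (n + 9 : ℂ) ≠ 0 := by exact_mod_cast Nat.succ_ne_zero (n + 8)
  obtain ⟨b3, e3⟩ : ∃ b, (n + 9) * c 2 * b - H 0 4 = 0 :=
    ⟨H 0 4 / ((n + 9) * c 2), by field_simp; ring⟩
  obtain ⟨b1, e1⟩ : ∃ b, -(2 * c 0 * (b + b3)) - H 0 2 = 0 :=
    ⟨-H 0 2 / (2 * c 0) - b3, by field_simp; ring⟩
  obtain ⟨b2, e2⟩ : ∃ b, -(2 * c 0 * b) + 3 * c 1 * b1 - H 0 1 = 0 :=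
    ⟨(3 * c 1 * b1 - H 0 1) / (2 * c 0), by field_simp; ring⟩
  obtain ⟨b0, e0⟩ : ∃ b, -(c 0 * b2 ^ 2) + 3 * c 1 * b - H 0 0 = 0 :=
    ⟨(c 0 * b2 ^ 2 + H 0 0) / (3 * c 1), by field_simp; ring⟩
  obtain ⟨b4, e4⟩ : ∃ b, -(2 * c 0 * b) - H 0 3 = 0 := ⟨-H 0 3 / (2 * c 0), by field_simp; ring⟩
  obtain ⟨u, hu', -, hsol⟩ := exists_analytic_implicit (f := f) (v₀ := 0)
    (u₀ := ![b0, b1, b2, b3, b4]) rfl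
    (by
      have hH' : ∀ j, AnalyticAt ℂ (fun p : (Fin 3 → ℂ) × (Fin 5 → ℂ) => H p.1 j)
          (0, ![b0, b1, b2, b3, b4]) :=
        fun j => AnalyticAt.comp (g := fun v => H v j) (hH j) analyticAt_fst
      rw [analyticAt_pi_iff]
      intro j
      fin_cases j <;> simp only [f, q, cubicRow, powCoeff, Fin.reduceFinMk, Matrix.cons_val] <;>
        fun_prop)
    (by
      rw [f0]
      funext j
      fin_cases j <;> simp [e0, e1, e2, e3, e4])
    (fun k => ![-(2 * c 0 * b2 * k 2) + 3 * c 1 * k 0, -(2 * c 0 * k 2) + 3 * c 1 * k 1, -(2 * c 0 *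
      (k 1 + k 3)), -(2 * c 0 * k 4), (n + 9) * c 2 * k 3])
    (fun k => by
      simp only [f0]
      rw [hasDerivAt_pi]
      intro j
      have key := hasDerivAt_quadratic (f (0, ![b0, b1, b2, b3, b4]) j)
        ((![-(2 * c 0 * b2 * k 2) + 3 * c 1 * k 0, -(2 * c 0 * k 2) + 3 * c 1 * k 1, -(2 * c 0 *
          (k 1 + k 3)), -(2 * c 0 * k 4), (n + 9) * c 2 * k 3] : Fin 5 → ℂ) j)
        ((![-(c 0 * k 2 ^ 2), 0, 0, 0, 0] : Fin 5 → ℂ) j)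
      refine key.congr_of_eventuallyEq (Filter.Eventually.of_forall fun t => ?_)
      simp only [f0]
      fin_cases j <;> simp <;> ring)
    (fun k hk => by
      have e (j) := congrFun hk j
      have g0 := e 0; have g1 := e 1; have g2 := e 2; have g3 := e 3; have g4 := e 4
      simp only [Matrix.cons_val, Pi.zero_apply] at g0 g1 g2 g3 g4
      have k3 : k 3 = 0 := by simpa [hn, h2] using g4
      have k4 : k 4 = 0 := by simpa [h0] using g3
      have k1 : k 1 = 0 := by simpa [h0, k3] using g2
      have k2 : k 2 = 0 := by simpa [h0, k1] using g1
      have k0 : k 0 = 0 := by simpa [h1, k2] using g0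
      funext j
      fin_cases j <;> simp [*])
  have hu := analyticAt_pi_iff.1 hu'
  refine GermEquiv.of_change (Φ := fun v =>
    ![v 0 * (1 + (v 0 * u v 0 + v 2 * u v 1)) + u v 4 * v 2 ^ (n + 5), v 1, v 2 * (1 + v 2 *
      u v 3) + v 0 * u v 2]) ?_ ?_
  · have a0 := hu 0; have a1 := hu 1; have a2 := hu 2; have a3 := hu 3; have a4 := hu 4
    refine isCoordinateChange_of_eq_mulVec (fun v =>
      !![1 + (v 0 * u v 0 + v 2 * u v 1), 0, u v 4 * v 2 ^ (n + 4); 0, 1, 0; u v 2, 0, 1 + v 2 *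
        u v 3]) ?_ ?_ ?_
    · intro i j
      fin_cases i <;> fin_cases j <;> simp <;> fun_prop
    · simp [Matrix.det_fin_three]
    · intro v i
      fin_cases i <;> simp [Fin.sum_univ_succ] <;> ring
  · filter_upwards [hsol] with v hv
    have i₁ := cubicRow_identity n (v 0) (v 2) c (q v (u v)) (H v) (u v)
    have hv' : cubicRow n (v 0) (v 2) c (q v (u v)) (H v) (u v) = 0 := hv
    rw [hv'] at i₁
    have p₁ := powCoeff_expansion n (v 2 * (1 + v 2 * u v 3)) (v 0 * u v 2)
    have p₂ := add_pow_eq_powRem (n + 7) 1 (v 2 * u v 3)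
    rw [mul_pow, mul_pow] at p₁
    simp only [one_pow] at p₂
    push_cast at p₂
    simp only [Pi.zero_apply, zero_mul, Finset.sum_const_zero, add_zero] at i₁
    simp only [cubicGerm, Pi.zero_apply, zero_mul, Finset.sum_const_zero, add_zero, Matrix.cons_val]
    simp only [q, Matrix.cons_val] at i₁
    linear_combination i₁ + c 2 * p₁ + c 2 * v 2 ^ (n + 9) * p₂

theorem hasGabrielov_IIA_two {k : ℕ} :
    HasGabrielovNumbers (VirtualType.IIA 2 (k + 3)).h ![3, 2, 4 * k + 10] := by
  obtain ⟨R, hR, eR⟩ : ∃ R : (Fin 3 → ℂ) → ℂ, AnalyticAt ℂ R 0 ∧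
      ∀ᶠ v in nhds 0, (1 + 8 * v 2 ^ (k + 1)) * R v = 1 := by
    have ha : AnalyticAt ℂ (fun v : Fin 3 → ℂ => 1 + 8 * v 2 ^ (k + 1)) 0 := by fun_prop
    have h0 : (1 + 8 * (0 : Fin 3 → ℂ) 2 ^ (k + 1)) ≠ 0 := by simp
    exact ⟨_, ha.inv h0, (ha.continuousAt.eventually_ne h0).mono fun v hv => mul_inv_cancel₀ hv⟩
  have h₁ : GermEquiv (fun v => eval v ((VirtualType.IIA 2 (k + 3)).h - X 0 * X 1 * X 2))
      (cubicGerm (4 * k + 1) ![1 / 4, 1, 1] fun v => ![0, 0, 6 * R v * v 2 ^ (2 * k + 1) - 2 *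
        v 2 ^ k, 12 * R v ^ 2, -(8 * v 2 ^ k * R v) + 8 * R v ^ 3 * v 2 ^ (2 * k + 1)]) := by
    refine GermEquiv.of_change (Φ := fun v => ![v 0 + 2 * v 2 ^ (2 * k + 4) * R v - v 2 ^ (k + 3),
      v 2, v 1 + (v 0 + 2 * v 2 ^ (2 * k + 4) * R v) * v 2 / 2]) ?_ ?_
    · refine isCoordinateChange_of_eq_mulVec (fun v =>
        !![1, 0, 2 * v 2 ^ (2 * k + 3) * R v - v 2 ^ (k + 2); 0, 0, 1; v 2 / 2, 1, v 2 ^ (2 * k +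
          4) * R v]) ?_ ?_ ?_
      · intro i j
        fin_cases i <;> fin_cases j <;> simp <;> fun_prop
      · simp [Matrix.det_fin_three]
      · intro v i
        fin_cases i <;> simp [Fin.sum_univ_succ] <;> ring
    · filter_upwards [eR] with v hv
      simp only [VirtualType.h, cubicGerm, Fin.sum_univ_five, cubicGen, map_add, map_sub, map_neg,
        map_mul, map_pow, eval_X, Matrix.cons_val]
      linear_combination (-(v 0 * v 2 ^ (2 * k + 6)) + v 2 ^ (4 * k + 10) * (1 - R v)) * hv
  have h₂ := (germEquiv_cubicGerm (n := 4 * k + 1) (c := ![1 / 4, 1, 1]) (by intro i; fin_cases i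
    <;> simp) (H := fun v => ![0, 0, 6 * R v * v 2 ^ (2 * k + 1) - 2 * v 2 ^ k, 12 * R v ^ 2, -(8 *
    v 2 ^ k * R v) + 8 * R v ^ 3 * v 2 ^ (2 * k + 1)]) (by intro j; fin_cases j <;> simp <;>
    fun_prop)).symm
  have h₃ := germEquiv_biNormalForm (p := 3) (r := 4 * k + 10) (c := ![1 / 4, 1, 1]) (by
      intro h0
      have e : ((4 * k + 10 : ℕ) : ℂ) ≠ 0 := by exact_mod_cast Nat.succ_ne_zero (4 * k + 9)
      field_simp at h0
      have h1 : ((4 * k + 10 : ℕ) : ℂ) = 6 := by push_cast at h0 ⊢; linear_combination h0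
      have : 4 * k + 10 = 6 := by exact_mod_cast h1
      omega) (by omega) (by omega) (by intro i; fin_cases i <;> simp)
  have h₄ : cubicGerm (4 * k + 1) ![1 / 4, 1, 1] 0 = fun v : Fin 3 → ℂ =>
      v 1 ^ 2 + ((![1 / 4, 1, 1] : Fin 3 → ℂ) 0 * -(v 0 ^ 2 * v 2 ^ 2) + (![1 / 4, 1, 1] : Fin 3 →
        ℂ) 1 * v 0 ^ 3 + (![1 / 4, 1, 1] : Fin 3 → ℂ) 2 * v 2 ^ (4 * k + 10)) := by
    funext v
    simp [cubicGerm]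
  rw [← h₄] at h₃
  exact (h₁.trans h₂).trans h₃

/-! ### Isotropy groups and exceptional orbits -/

theorem mem_isotropyGroup_iff {n : ℕ} {w : Fin n → ℕ} {x : Fin n → ℂ} {t : ℂˣ} :
    t ∈ isotropyGroup w x ↔ ∀ j, x j ≠ 0 → orderOf t ∣ w j := by
  change weightAct w t x = x ↔ _
  rw [funext_iff]
  refine forall_congr' fun j => ?_
  rw [orderOf_dvd_iff_pow_eq_one, Units.ext_iff]
  simp only [weightAct, Units.val_pow_eq_pow_val, Units.val_one]
  rcases eq_or_ne (x j) 0 with h | h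
  · simp [h]
  · simp [h]

theorem isotropyGroup_eq_rootsOfUnity {n : ℕ} {w : Fin n → ℕ} {x : Fin n → ℂ} {g : ℕ}
    (hg : ∀ m, m ∣ g ↔ ∀ j, x j ≠ 0 → m ∣ w j) : isotropyGroup w x = rootsOfUnity g ℂ := by
  ext t
  rw [mem_isotropyGroup_iff, ← hg, mem_rootsOfUnity, orderOf_dvd_iff_pow_eq_one]

theorem exists_prime_dvd_of_isotropyGroup_ne_bot {n : ℕ} {w : Fin n → ℕ} {x : Fin n → ℂ}
    (h : isotropyGroup w x ≠ ⊥) : ∃ r : ℕ, r.Prime ∧ ∀ j, x j ≠ 0 → r ∣ w j := by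
  obtain ⟨⟨t, ht⟩, h2⟩ := Subgroup.ne_bot_iff_exists_ne_one.1 h
  have h1 : t ≠ 1 := fun e => h2 (Subtype.ext e)
  exact ⟨_, Nat.minFac_prime fun e => h1 (orderOf_eq_one_iff.1 e), fun j hj =>
    (Nat.minFac_dvd _).trans (mem_isotropyGroup_iff.1 ht j hj)⟩

/-- A criterion for the orders of the isotropy groups of the exceptional orbits in `S`. -/
theorem hasExceptionalOrders_of {n k : ℕ} {w : Fin n → ℕ} {S : Set (Fin n → ℂ)} {α : Fin k → ℕ}
    (x : Fin k → Fin n → ℂ) (hS : ∀ i, x i ∈ S) (hα : ∀ i, 2 ≤ α i)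
    (hg : ∀ i m, m ∣ α i ↔ ∀ j, x i j ≠ 0 → m ∣ w j)
    (hsupp : ∀ i j, (∀ l, x i l = 0 ↔ x j l = 0) → i = j)
    (hall : ∀ y ∈ S, ∀ r : ℕ, r.Prime → (∀ j, y j ≠ 0 → r ∣ w j) →
      ∃ i, ∃ t : ℂ, t ≠ 0 ∧ ∀ j, y j = t ^ w j * x i j) :
    HasExceptionalOrders w S α := by
  have hcard (i) : Nat.card (isotropyGroup w (x i)) = α i := by
    have : NeZero (α i) := ⟨by have := hα i; omega⟩
    rw [isotropyGroup_eq_rootsOfUnity (hg i), Complex.card_rootsOfUnity]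
  refine ⟨x, fun i => ⟨hS i, fun h => ?_, hcard i⟩, fun i j h => hsupp i j fun l => ?_,
    fun y hy h => ?_⟩
  · have := hcard i
    rw [h, Subgroup.card_bot] at this
    have := hα i
    omega
  · have : x i ∈ weightOrbit w (x j) := by
      rw [← h]
      exact ⟨1, by funext l; simp [weightAct]⟩
    obtain ⟨t, ht⟩ := this
    rw [congrFun ht l]
    simp [weightAct]
  · obtain ⟨r, hr, hd⟩ := exists_prime_dvd_of_isotropyGroup_ne_bot h
    obtain ⟨i, t, ht, hi⟩ := hall y hy r hr hd
    exact ⟨i, Units.mk0 t ht, funext hi⟩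

theorem exists_pow_eq_and_pow_eq {m n : ℕ} (k : ℕ) (hmn : m.Coprime n) (hk : k ≠ 0) {a b : ℂ}
    (ha : a ≠ 0) (hb : b ≠ 0) (h : a ^ m = b ^ n) :
    ∃ t : ℂ, t ≠ 0 ∧ t ^ (n * k) = a ∧ t ^ (m * k) = b := by
  have hz : (n : ℤ) * m.gcdB n + m * m.gcdA n = 1 := by
    have := Nat.gcd_eq_gcd_ab m n
    rw [hmn] at this
    push_cast at this
    linarith
  have h' : a ^ (m : ℤ) = b ^ (n : ℤ) := by exact_mod_cast h
  set s : ℂ := a ^ m.gcdB n * b ^ m.gcdA n with hs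
  have hsn : s ^ n = a := by
    rw [← zpow_natCast, hs, mul_zpow, ← zpow_mul, ← zpow_mul, mul_comm (m.gcdA n), zpow_mul b,
      ← h', ← zpow_mul, ← zpow_add₀ ha, mul_comm (m.gcdB n), hz, zpow_one]
  have hsm : s ^ m = b := by
    rw [← zpow_natCast, hs, mul_zpow, ← zpow_mul, ← zpow_mul, mul_comm (m.gcdB n), zpow_mul a,
      h', ← zpow_mul, ← zpow_add₀ hb, mul_comm (m.gcdA n), hz, zpow_one]
  obtain ⟨t, ht⟩ := IsAlgClosed.exists_pow_nat_eq s (Nat.pos_of_ne_zero hk)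
  refine ⟨t, ?_, by rw [mul_comm, pow_mul, ht, hsn], by rw [mul_comm, pow_mul, ht, hsm]⟩
  rintro rfl
  rw [zero_pow hk] at ht
  rw [← ht] at hsn hsm
  rcases Nat.eq_zero_or_pos n with hn | hn
  · subst hn
    have : m = 1 := by simpa using hmn
    subst this
    exact hb (by simpa using hsm.symm)
  · exact ha (by rw [← hsn, zero_pow hn.ne'])

theorem exists_pow_eq {a : ℂ} (ha : a ≠ 0) {k : ℕ} (hk : k ≠ 0) : ∃ t : ℂ, t ≠ 0 ∧ t ^ k = a := by
  obtain ⟨t, ht⟩ := IsAlgClosed.exists_pow_nat_eq a (Nat.pos_of_ne_zero hk)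
  exact ⟨t, by rintro rfl; exact ha (by rw [← ht, zero_pow hk]), ht⟩

theorem IsReducedWeights.eq_one {n : ℕ} {w : Fin n → ℕ} (h : IsReducedWeights w) {r : ℕ}
    (hr : ∀ j, r ∣ w j) : r = 1 :=
  Nat.dvd_one.1 (h ▸ Finset.dvd_gcd fun j _ => hr j)

theorem isWeightedHomogeneous_pow {n : ℕ} (w : Fin n → ℕ) (i : Fin n) (k : ℕ) :
    IsWeightedHomogeneous w (X i ^ k : MvPolynomial (Fin n) ℂ) (k * w i) := by
  simpa using (isWeightedHomogeneous_X ℂ w i).pow k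

theorem MvPolynomial.IsWeightedHomogeneous.of_eq {n : ℕ} {w : Fin n → ℕ}
    {p : MvPolynomial (Fin n) ℂ} {a b : ℕ} (h : IsWeightedHomogeneous w p a) (e : a = b) :
    IsWeightedHomogeneous w p b := e ▸ h

theorem HasExceptionalOrders.perm {n k : ℕ} {w : Fin n → ℕ} {S : Set (Fin n → ℂ)} {α : Fin k → ℕ}
    (h : HasExceptionalOrders w S α) (σ : Equiv.Perm (Fin k)) :
    HasExceptionalOrders w S (α ∘ σ) := by
  obtain ⟨x, h₁, h₂, h₃⟩ := h
  refine ⟨x ∘ σ, fun i => h₁ (σ i), fun i j hij => σ.injective (h₂ _ _ hij), fun y hy hi => ?_⟩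
  obtain ⟨i, hi⟩ := h₃ y hy hi
  exact ⟨σ.symm i, by simpa using hi⟩

theorem PairHasDolgachevNumbers.perm {f₁ f₂ : MvPolynomial (Fin 4) ℂ} {α : Fin 3 → ℕ}
    (h : PairHasDolgachevNumbers f₁ f₂ α) (σ : Equiv.Perm (Fin 3)) :
    PairHasDolgachevNumbers f₁ f₂ (α ∘ σ) := by
  obtain ⟨w, d₁, d₂, hr, h₁, h₂, h₃⟩ := h
  exact ⟨w, d₁, d₂, hr, h₁, h₂, h₃.perm σ⟩

theorem pairDolgachev_IIA {p k : ℕ} (hp : 2 ≤ p)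
    (hr : IsReducedWeights (VirtualType.IIA p (k + 2)).dualWeights) :
    HasPairDolgachev (.IIA p (k + 2)) ![3, p * (2 * k + 3), p] := by
  have hw : (VirtualType.IIA p (k + 2)).dualWeights =
      ![p * (2 * k + 3), 3 * p, 3 * (k + 2), p * (k + 3)] := by
    simp [VirtualType.dualWeights, show 2 * (k + 2) - 1 = 2 * k + 3 by omega]
  rw [hw] at hr
  have hpe : p.Coprime (3 * (k + 2)) := by
    refine Nat.coprime_of_dvd' fun r _ h₁ h₂ => (hr.eq_one fun j => ?_).dvd
    fin_cases j <;> simp [h₂, h₁.mul_right, h₁.mul_left]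
  have h3 : (k + 3).Coprime 3 := by
    refine Nat.coprime_of_dvd' fun r _ h₁ h₂ => (hr.eq_one fun j => ?_).dvd
    fin_cases j <;> simp [h₂.mul_right, h₁.mul_left]
    rw [show 2 * k + 3 = 2 * (k + 3) - 3 by omega]
    exact (Nat.dvd_sub (h₁.mul_left 2) h₂).mul_left p
  obtain ⟨c, hc0, hc⟩ := exists_pow_eq (a := -1) (by simp) (by omega : p ≠ 0)
  refine ⟨_, 2 * p * (k + 3), 3 * p * (k + 2), hr, ⟨?_, ?_⟩, ⟨?_, ?_⟩,
    hasExceptionalOrders_of ![![0, 1, c, 0], ![1, 0, 0, 0], ![1, 1, 0, -1]] ?_ ?_ ?_ ?_ ?_⟩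
  · intro i; fin_cases i <;> simp <;> omega
  · exact (((isWeightedHomogeneous_X ℂ _ 0).mul (isWeightedHomogeneous_X ℂ _ 1)).of_eq (by simp <;>
      ring)).sub ((isWeightedHomogeneous_pow _ 3 2).of_eq (by simp <;> ring))
  · intro i; fin_cases i <;> simp <;> omega
  · exact ((((isWeightedHomogeneous_X ℂ _ 0).mul (isWeightedHomogeneous_X ℂ _ 3)).of_eq (by simp
      <;> ring)).add ((isWeightedHomogeneous_pow _ 1 _).of_eq (by simp <;> ring))).add
      ((isWeightedHomogeneous_pow _ 2 _).of_eq (by simp <;> ring))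
  · have : p ≠ 0 := by omega
    intro i; fin_cases i <;> simp [this, hc, funext_iff, Fin.forall_fin_succ]
  · intro i; fin_cases i <;> simp <;> nlinarith
  · intro i m
    fin_cases i <;> simp [Fin.forall_fin_succ, hc0]
    · refine ⟨fun h => ⟨h.mul_right _, h.mul_right _⟩, fun ⟨h₁, h₂⟩ => ?_⟩
      have := Nat.dvd_gcd h₁ h₂
      rwa [Nat.gcd_mul_left, hpe.coprime_mul_left_right, mul_one] at this
    · refine ⟨fun h => ⟨h.mul_right _, h.mul_left _, h.mul_right _⟩, fun ⟨_, h₁, h₂⟩ => ?_⟩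
      have := Nat.dvd_gcd h₁ h₂
      rwa [mul_comm 3, Nat.gcd_mul_left, h3.symm, mul_one] at this
  · intro i j h
    fin_cases i <;> fin_cases j <;> simp [Fin.forall_fin_succ, hc0] at h ⊢
  · rintro y ⟨hy, h₁, h₂⟩ r hr' hd
    simp at h₁ h₂
    have hy' : y 0 ≠ 0 ∨ y 1 ≠ 0 ∨ y 2 ≠ 0 ∨ y 3 ≠ 0 := by
      by_contra! h
      exact hy (funext fun j => by fin_cases j <;> simp [h])
    rcases eq_or_ne (y 0) 0 with h0 | h0
    · have h3' : y 3 = 0 := by simpa [h0] using h₁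
      have e : y 1 ^ (k + 2) + y 2 ^ p = 0 := by simpa [h0] using h₂
      have h1 : y 1 ≠ 0 := fun h1 => by simp_all
      have h2 : y 2 ≠ 0 := fun h2 => by simp_all [show p ≠ 0 by omega]
      obtain ⟨t, ht, e1, e2⟩ := exists_pow_eq_and_pow_eq 3 hpe.coprime_mul_left_right.symm
        three_ne_zero h1 (div_ne_zero h2 hc0) (by rw [div_pow, hc]; linear_combination e)
      exact ⟨0, t, ht, by simp [Fin.forall_fin_succ, h0, h3', mul_comm 3, e1, e2, hc0]⟩
    rcases eq_or_ne (y 1) 0 with h1 | h1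
    · have h3' : y 3 = 0 := by simpa [h1] using h₁
      have h2 : y 2 = 0 := by simp_all
      obtain ⟨t, ht, e1⟩ := exists_pow_eq h0 (k := p * (2 * k + 3)) (by positivity)
      exact ⟨1, t, ht, by simp [Fin.forall_fin_succ, h1, h2, h3', e1]⟩
    have h3' : y 3 ≠ 0 := fun h => by simp_all
    rcases eq_or_ne (y 2) 0 with h2 | h2
    · have e : y 0 * y 3 = -y 1 ^ (k + 2) := by
        rw [h2, zero_pow (by omega)] at h₂; linear_combination h₂
      have e' : (-y 3) ^ 3 = y 1 ^ (k + 3) := by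
        linear_combination y 3 * h₁ - y 1 * e
      obtain ⟨t, ht, e1, e2⟩ := exists_pow_eq_and_pow_eq p h3 (by omega) h1 (neg_ne_zero.2 h3')
        e'.symm
      rw [mul_comm _ p] at e2
      refine ⟨2, t, ht, ?_⟩
      have e0 : y 0 = t ^ (p * (2 * k + 3)) := by
        refine mul_right_cancel₀ h1 ?_
        rw [sub_eq_zero.1 h₁, ← neg_sq, ← e2, ← e1]
        ring
      simp [Fin.forall_fin_succ, h2, ← e0, e1, e2]
    · exact absurd (hr.eq_one fun j => hd j (by fin_cases j <;> simpa)) hr'.ne_one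

theorem pairDolgachev_IIB {p k : ℕ} (hp : 2 ≤ p)
    (hr : IsReducedWeights (VirtualType.IIB p (k + 2)).dualWeights) :
    HasPairDolgachev (.IIB p (k + 2)) ![2 * p, 2, 2 * p * (k + 1)] := by
  have hw : (VirtualType.IIB p (k + 2)).dualWeights =
      ![2 * (k + 2), 2 * p * (k + 1), 2 * p, p * (k + 1) + k + 2] := by
    have e₁ : p * (k + 2) + (k + 2) - p = p * (k + 1) + k + 2 := Nat.sub_eq_of_eq_add (by ring)
    simp [VirtualType.dualWeights, e₁]
  rw [hw] at hr
  have hpq : p.Coprime (k + 2) := by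
    refine Nat.coprime_of_dvd' fun r _ h₁ h₂ => (hr.eq_one fun j => ?_).dvd
    fin_cases j <;> simp [h₁.mul_right, h₁.mul_left, h₂.mul_left]
    · exact (h₁.mul_left 2).mul_right _
    · rw [add_assoc]; exact dvd_add (h₁.mul_right _) h₂
  obtain ⟨c, hc0, hc⟩ := exists_pow_eq (a := -1) (by simp) (by omega : k + 2 ≠ 0)
  refine ⟨_, 2 * (p * (k + 1) + k + 2), 2 * p * (k + 2), hr, ⟨?_, ?_⟩, ⟨?_, ?_⟩,
    hasExceptionalOrders_of ![![0, -1, 1, 0], ![1, 0, c, 0], ![0, 1, 0, 0]] ?_ ?_ ?_ ?_ ?_⟩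
  · intro i; fin_cases i <;> simp <;> omega
  · exact (((isWeightedHomogeneous_X ℂ _ 0).mul (isWeightedHomogeneous_X ℂ _ 1)).of_eq (by simp <;>
      ring)).sub ((isWeightedHomogeneous_pow _ 3 _).of_eq (by simp <;> ring))
  · intro i; fin_cases i <;> simp <;> omega
  · exact (((isWeightedHomogeneous_pow _ 0 _).of_eq (by simp <;> ring)).add
      (((isWeightedHomogeneous_X ℂ _ 1).mul (isWeightedHomogeneous_X ℂ _ 2)).of_eq (by simp <;>
      ring))).add ((isWeightedHomogeneous_pow _ 2 _).of_eq (by simp <;> ring))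
  · intro i; fin_cases i <;> simp [funext_iff, Fin.forall_fin_succ, hc, show p ≠ 0 by omega]
  · intro i; fin_cases i <;> simp <;> nlinarith
  · intro i m
    fin_cases i <;> simp [Fin.forall_fin_succ, hc0]
    · exact fun h => h.mul_right _
    · refine ⟨fun h => ⟨h.mul_right _, h.mul_right _⟩, fun ⟨h₁, h₂⟩ => ?_⟩
      have := Nat.dvd_gcd h₁ h₂
      rwa [Nat.gcd_mul_left, hpq.symm, mul_one] at this
  · intro i j h
    fin_cases i <;> fin_cases j <;> simp [Fin.forall_fin_succ, hc0] at h ⊢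
  · rintro y ⟨hy, h₁, h₂⟩ r hr' hd
    simp at h₁ h₂
    have hy' : y 0 ≠ 0 ∨ y 1 ≠ 0 ∨ y 2 ≠ 0 ∨ y 3 ≠ 0 := by
      by_contra! h
      exact hy (funext fun j => by fin_cases j <;> simp [h])
    rcases eq_or_ne (y 1) 0 with h1 | h1
    · have h3 : y 3 = 0 := by simpa [h1] using h₁
      have e : y 0 ^ p + y 2 ^ (k + 2) = 0 := by simpa [h1] using h₂
      have h0 : y 0 ≠ 0 := fun h0 => by simp_all [show p ≠ 0 by omega]
      have h2 : y 2 ≠ 0 := fun h2 => by simp_all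
      obtain ⟨t, ht, e1, e2⟩ := exists_pow_eq_and_pow_eq 2 hpq two_ne_zero h0
        (div_ne_zero h2 hc0) (by rw [div_pow, hc]; linear_combination e)
      exact ⟨1, t, ht, by simp [Fin.forall_fin_succ, h1, h3, mul_comm 2, e1, e2, hc0]⟩
    rcases eq_or_ne (y 0) 0 with h0 | h0
    · have h3 : y 3 = 0 := by simpa [h0] using h₁
      rcases eq_or_ne (y 2) 0 with h2 | h2
      · obtain ⟨t, ht, e1⟩ := exists_pow_eq h1 (k := 2 * p * (k + 1)) (by positivity)
        exact ⟨2, t, ht, by simp [Fin.forall_fin_succ, h0, h2, h3, e1]⟩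
      · obtain ⟨t, ht, e1⟩ := exists_pow_eq h2 (k := 2 * p) (by omega)
        have e : y 1 = -y 2 ^ (k + 1) := by
          rw [h0, zero_pow (by omega)] at h₂
          refine mul_right_cancel₀ h2 ?_
          linear_combination h₂
        exact ⟨0, t, ht, by simp [Fin.forall_fin_succ, h0, h3, pow_mul _ (2 * p), e1, e]⟩
    have h3 : y 3 ≠ 0 := fun h => by simp_all
    have h2 : y 2 ≠ 0 := fun h => by simp_all
    exact absurd (hr.eq_one fun j => hd j (by fin_cases j <;> simpa)) hr'.ne_one


theorem pairDolgachev_IIBsharp {n k : ℕ} 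
    (hr : IsReducedWeights (VirtualType.IIBsharp (n + 2) (k + 2)).dualWeights) :
    HasPairDolgachev (.IIBsharp (n + 2) (k + 2)) ![(n + 1) * (k + 2) + n + 2, 2, (n + 2) * (k + 1) + k + 2] := by
  have hw : (VirtualType.IIBsharp (n + 2) (k + 2)).dualWeights =
      ![2 * (k + 2), (n + 1) * (k + 2) + n + 2, 2 * (n + 2), (n + 2) * (k + 1) + k + 2] := by
    have e₁ : (n + 2) * (k + 2) + (n + 2) - (k + 2) = (n + 1) * (k + 2) + n + 2 :=
      Nat.sub_eq_of_eq_add (by ring)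
    have e₂ : (n + 2) * (k + 2) + (k + 2) - (n + 2) = (n + 2) * (k + 1) + k + 2 :=
      Nat.sub_eq_of_eq_add (by ring)
    simp [VirtualType.dualWeights, e₁, e₂]
  rw [hw] at hr
  have hpq : (n + 2).Coprime (k + 2) := by
    refine Nat.coprime_of_dvd' fun r _ h₁ h₂ => (hr.eq_one fun j => ?_).dvd
    fin_cases j <;> simp [h₁.mul_left, h₂.mul_left]
    · rw [add_assoc]; exact dvd_add (h₂.mul_left _) h₁
    · rw [add_assoc]; exact dvd_add (h₁.mul_right _) h₂
  obtain ⟨c, hc0, hc⟩ := exists_pow_eq (a := -1) (by simp) (by omega : k + 2 ≠ 0)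
  refine ⟨_, (n + 2) * (k + 2) + n + k + 4, 2 * (n + 2) * (k + 2), hr, ⟨?_, ?_⟩, ⟨?_, ?_⟩,
    hasExceptionalOrders_of ![![0, 1, 0, 0], ![1, 0, c, 0], ![0, 0, 0, 1]] ?_ ?_ ?_ ?_ ?_⟩
  · intro i; fin_cases i <;> simp <;> omega
  · exact (((isWeightedHomogeneous_X ℂ _ 0).mul (isWeightedHomogeneous_X ℂ _ 1)).of_eq (by simp <;>
      ring)).sub (((isWeightedHomogeneous_X ℂ _ 2).mul (isWeightedHomogeneous_X ℂ _ 3)).of_eq (by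
      simp <;> ring))
  · intro i; fin_cases i <;> simp <;> omega
  · exact (((isWeightedHomogeneous_pow _ 0 _).of_eq (by simp <;> ring)).add
      (((isWeightedHomogeneous_X ℂ _ 1).mul (isWeightedHomogeneous_X ℂ _ 3)).of_eq (by simp <;>
      ring))).add ((isWeightedHomogeneous_pow _ 2 _).of_eq (by simp <;> ring))
  · intro i; fin_cases i <;> simp [funext_iff, Fin.forall_fin_succ, hc]
  · intro i; fin_cases i <;> simp <;> nlinarith
  · intro i m
    fin_cases i <;> simp [Fin.forall_fin_succ, hc0]
    refine ⟨fun h => ⟨h.mul_right _, h.mul_right _⟩, fun ⟨h₁, h₂⟩ => ?_⟩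
    have := Nat.dvd_gcd h₁ h₂
    rwa [Nat.gcd_mul_left, hpq.symm, mul_one] at this
  · intro i j h
    fin_cases i <;> fin_cases j <;> simp [Fin.forall_fin_succ, hc0] at h ⊢
  · rintro y ⟨hy, h₁, h₂⟩ r hr' hd
    simp at h₁ h₂
    have hy' : y 0 ≠ 0 ∨ y 1 ≠ 0 ∨ y 2 ≠ 0 ∨ y 3 ≠ 0 := by
      by_contra! h
      exact hy (funext fun j => by fin_cases j <;> simp [h])
    rcases eq_or_ne (y 1) 0 with h1 | h1
    · rcases eq_or_ne (y 3) 0 with h3 | h3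
      · have e : y 0 ^ (n + 2) + y 2 ^ (k + 2) = 0 := by simpa [h1] using h₂
        have h0 : y 0 ≠ 0 := fun h0 => by simp_all
        have h2 : y 2 ≠ 0 := fun h2 => by simp_all
        obtain ⟨t, ht, e1, e2⟩ := exists_pow_eq_and_pow_eq 2 hpq two_ne_zero h0
          (div_ne_zero h2 hc0) (by rw [div_pow, hc]; linear_combination e)
        exact ⟨1, t, ht, by simp [Fin.forall_fin_succ, h1, h3, mul_comm 2, e1, e2, hc0]⟩
      · have h2 : y 2 = 0 := by simpa [h1, h3] using h₁
        have h0 : y 0 = 0 := by simp_all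
        obtain ⟨t, ht, e1⟩ := exists_pow_eq h3 (k := (n + 2) * (k + 1) + k + 2) (by omega)
        exact ⟨2, t, ht, by simp [Fin.forall_fin_succ, h0, h1, h2, e1]⟩
    rcases eq_or_ne (y 3) 0 with h3 | h3
    · have h0 : y 0 = 0 := by simpa [h1, h3] using h₁
      have h2 : y 2 = 0 := by simp_all
      obtain ⟨t, ht, e1⟩ := exists_pow_eq h1 (k := (n + 1) * (k + 2) + n + 2) (by omega)
      exact ⟨0, t, ht, by simp [Fin.forall_fin_succ, h0, h2, h3, e1]⟩
    have h0 : y 0 ≠ 0 := fun h0 => by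
      have h2 : y 2 = 0 := by simpa [h0, h3] using h₁
      simp_all
    have h2 : y 2 ≠ 0 := fun h => by simp_all
    exact absurd (hr.eq_one fun j => hd j (by fin_cases j <;> simpa)) hr'.ne_one


theorem pairDolgachev_III {p e : ℕ} (hp : 2 ≤ p) (he : 1 ≤ e)
    (hr : IsReducedWeights (VirtualType.III p e).dualWeights) :
    HasPairDolgachev (.III p e) ![2 * p, 2 * e * p, p] := by
  have hw : (VirtualType.III p e).dualWeights =
      ![2 * e * p, 2 * p, 3 * e + 1, (e + 1) * p] := by
    simp [VirtualType.dualWeights]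
  rw [hw] at hr
  have he2 : (e + 1).Coprime 2 := by
    refine Nat.coprime_of_dvd' fun r _ h₁ h₂ => (hr.eq_one fun j => ?_).dvd
    fin_cases j <;> simp [h₂.mul_right, h₁.mul_right, mul_assoc]
    rw [show 3 * e + 1 = (e + 1) + 2 * e by ring]
    exact dvd_add h₁ (h₂.mul_right _)
  refine ⟨_, 2 * p * (e + 1), p * (3 * e + 1), hr, ⟨?_, ?_⟩, ⟨?_, ?_⟩,
    hasExceptionalOrders_of ![![0, 1, 0, 0], ![1, 0, 0, 0], ![-1, 1, 0, Complex.I]] ?_ ?_ ?_ ?_ ?_⟩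
  · intro i; fin_cases i <;> simp <;> omega
  · exact (((isWeightedHomogeneous_X ℂ _ 0).mul (isWeightedHomogeneous_X ℂ _ 1)).of_eq (by simp <;>
      ring)).sub ((isWeightedHomogeneous_pow _ 3 _).of_eq (by simp <;> ring))
  · intro i; fin_cases i <;> simp <;> omega
  · exact ((((isWeightedHomogeneous_X ℂ _ 0).of_eq rfl).add ((isWeightedHomogeneous_pow _ 1
      _).of_eq (by simp <;> ring))).mul (isWeightedHomogeneous_X ℂ _ 3)).of_eq (by simp <;> ring)
      |>.add ((isWeightedHomogeneous_pow _ 2 _).of_eq (by simp <;> ring))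
  · intro i; fin_cases i <;> simp [funext_iff, Fin.forall_fin_succ, show p ≠ 0 by omega, show e ≠ 0 by omega]
  · intro i; fin_cases i <;> simp <;> nlinarith
  · intro i m
    fin_cases i <;> simp [Fin.forall_fin_succ]
    refine ⟨fun h => ⟨h.mul_left _, h.mul_left _, h.mul_left _⟩, fun ⟨_, h₁, h₂⟩ => ?_⟩
    have := Nat.dvd_gcd h₁ h₂
    rwa [Nat.gcd_mul_right, he2.symm, one_mul] at this
  · intro i j h
    fin_cases i <;> fin_cases j <;> simp [Fin.forall_fin_succ] at h ⊢
  · rintro y ⟨hy, h₁, h₂⟩ r hr' hd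
    simp at h₁ h₂
    have hy' : y 0 ≠ 0 ∨ y 1 ≠ 0 ∨ y 2 ≠ 0 ∨ y 3 ≠ 0 := by
      by_contra! h
      exact hy (funext fun j => by fin_cases j <;> simp [h])
    rcases eq_or_ne (y 0) 0 with h0 | h0
    · have h3 : y 3 = 0 := by simpa [h0] using h₁
      have h2 : y 2 = 0 := by simp_all
      obtain ⟨t, ht, e1⟩ := exists_pow_eq (a := y 1) (by simp_all) (k := 2 * p) (by omega)
      exact ⟨0, t, ht, by simp [Fin.forall_fin_succ, h0, h2, h3, e1]⟩
    rcases eq_or_ne (y 1) 0 with h1 | h1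
    · have h3 : y 3 = 0 := by simpa [h1] using h₁
      have h2 : y 2 = 0 := by simp_all
      obtain ⟨t, ht, e1⟩ := exists_pow_eq h0 (k := 2 * e * p) (by positivity)
      exact ⟨1, t, ht, by simp [Fin.forall_fin_succ, h1, h2, h3, e1]⟩
    have h3 : y 3 ≠ 0 := fun h => by simp_all
    rcases eq_or_ne (y 2) 0 with h2 | h2
    · have e0 : y 0 = -y 1 ^ e := by
        rw [h2, zero_pow (by omega), add_zero] at h₂
        simpa [h3, add_eq_zero_iff_eq_neg] using h₂
      obtain ⟨t, ht, e1, e2⟩ := exists_pow_eq_and_pow_eq p he2 (by omega) h1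
        (div_ne_zero h3 Complex.I_ne_zero) (by
          rw [div_pow, Complex.I_sq]
          linear_combination -h₁ + y 1 * e0)
      refine ⟨2, t, ht, ?_⟩
      simp [Fin.forall_fin_succ, h2, e0, e1, e2, mul_comm 2 e, mul_assoc, pow_mul' _ e,
        Complex.I_ne_zero]
    · exact absurd (hr.eq_one fun j => hd j (by fin_cases j <;> simpa)) hr'.ne_one


theorem pairDolgachev_IV1 {k j : ℕ} (hkj : 1 ≤ k + j)
    (hr : IsReducedWeights (VirtualType.IV1 (k + 1) (j + 2)).dualWeights) :
    HasPairDolgachev (.IV1 (k + 1) (j + 2)) ![3, (2 * k + 1) * (j + 2) + 1, 3 * (j + 1)] := by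
  have hw : (VirtualType.IV1 (k + 1) (j + 2)).dualWeights =
      ![(2 * k + 1) * (j + 2) + 1, 3 * (j + 1), 3 * (k + 1), (k + 1) * (j + 2) + j + 1] := by
    have e₁ : (k + 1) * (j + 2) + (j + 2) - 1 = (k + 1) * (j + 2) + j + 1 := rfl
    simp [VirtualType.dualWeights, e₁, show 2 * (k + 1) - 1 = 2 * k + 1 by omega]
  rw [hw] at hr
  have hjk : (k + 1).Coprime (j + 1) := by
    refine Nat.coprime_of_dvd' fun r _ h₁ h₂ => (hr.eq_one fun j => ?_).dvd
    fin_cases j <;> simp [h₁.mul_left, h₂.mul_left]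
    · rw [show (2 * k + 1) * (j + 2) + 1 = 2 * (j + 2) * (k + 1) - (j + 1) by
        exact (Nat.sub_eq_of_eq_add (by ring)).symm]
      exact Nat.dvd_sub (h₁.mul_left _) h₂
    · rw [add_assoc]; exact dvd_add (h₁.mul_right _) h₂
  obtain ⟨c, hc0, hc⟩ := exists_pow_eq (a := -1) (by simp) (by omega : k + 1 ≠ 0)
  refine ⟨_, 2 * ((k + 1) * (j + 2) + j + 1), 3 * (k + 1) * (j + 2), hr, ⟨?_, ?_⟩, ⟨?_, ?_⟩,
    hasExceptionalOrders_of ![![0, c, 1, 0], ![1, 0, 0, 0], ![0, 1, 0, 0]] ?_ ?_ ?_ ?_ ?_⟩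
  · intro i; fin_cases i <;> simp <;> omega
  · exact (((isWeightedHomogeneous_X ℂ _ 0).mul (isWeightedHomogeneous_X ℂ _ 1)).of_eq (by simp <;>
      ring)).sub ((isWeightedHomogeneous_pow _ 3 _).of_eq (by simp <;> ring))
  · intro i; fin_cases i <;> simp <;> omega
  · exact ((((isWeightedHomogeneous_X ℂ _ 0).mul (isWeightedHomogeneous_X ℂ _ 3)).of_eq (by simp
      <;> ring)).add (((isWeightedHomogeneous_pow _ 1 _).mul (isWeightedHomogeneous_X ℂ _ 2)).of_eq
      (by simp <;> ring))).add ((isWeightedHomogeneous_pow _ 2 _).of_eq (by simp <;> ring))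
  · intro i; fin_cases i <;> simp [funext_iff, Fin.forall_fin_succ, hc]
  · intro i; fin_cases i <;> simp <;> nlinarith
  · intro i m
    fin_cases i <;> simp [Fin.forall_fin_succ, hc0]
    refine ⟨fun h => ⟨h.mul_right _, h.mul_right _⟩, fun ⟨h₁, h₂⟩ => ?_⟩
    have := Nat.dvd_gcd h₁ h₂
    rwa [Nat.gcd_mul_left, hjk.symm, mul_one] at this
  · intro i j h
    fin_cases i <;> fin_cases j <;> simp [Fin.forall_fin_succ, hc0] at h ⊢
  · rintro y ⟨hy, h₁, h₂⟩ r hr' hd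
    simp at h₁ h₂
    have hy' : y 0 ≠ 0 ∨ y 1 ≠ 0 ∨ y 2 ≠ 0 ∨ y 3 ≠ 0 := by
      by_contra! h
      exact hy (funext fun j => by fin_cases j <;> simp [h])
    rcases eq_or_ne (y 0) 0 with h0 | h0
    · have h3 : y 3 = 0 := by simpa [h0] using h₁
      rcases eq_or_ne (y 2) 0 with h2 | h2
      · obtain ⟨t, ht, e1⟩ := exists_pow_eq (a := y 1) (by simp_all) (k := 3 * (j + 1)) (by omega)
        exact ⟨2, t, ht, by simp [Fin.forall_fin_succ, h0, h2, h3, e1]⟩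
      · have e : y 1 ^ (k + 1) = -y 2 ^ (j + 1) := by
          rw [h0] at h₂
          refine mul_right_cancel₀ h2 ?_
          linear_combination h₂
        have h1 : y 1 ≠ 0 := fun h => by simp_all
        obtain ⟨t, ht, e1, e2⟩ := exists_pow_eq_and_pow_eq 3 hjk three_ne_zero
          (div_ne_zero h1 hc0) h2 (by rw [div_pow, hc]; linear_combination -e)
        exact ⟨0, t, ht, by simp [Fin.forall_fin_succ, h0, h3, mul_comm 3, e1, e2, hc0]⟩
    rcases eq_or_ne (y 1) 0 with h1 | h1
    · have h3 : y 3 = 0 := by simpa [h1] using h₁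
      have h2 : y 2 = 0 := by simp_all
      obtain ⟨t, ht, e1⟩ := exists_pow_eq h0 (k := (2 * k + 1) * (j + 2) + 1) (by omega)
      exact ⟨1, t, ht, by simp [Fin.forall_fin_succ, h1, h2, h3, e1]⟩
    have h3 : y 3 ≠ 0 := fun h => by simp_all
    have h2 : y 2 ≠ 0 := fun h => by simp_all
    exact absurd (hr.eq_one fun j => hd j (by fin_cases j <;> simpa)) hr'.ne_one


theorem pairDolgachev_IV2 {e j : ℕ} (he : 1 ≤ e)
    (hr : IsReducedWeights (VirtualType.IV2 e (j + 2)).dualWeights) :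
    HasPairDolgachev (.IV2 e (j + 2)) ![2 * e + 1, j + 3, (2 * e + 1) * (j + 1)] := by
  have hw : (VirtualType.IV2 e (j + 2)).dualWeights =
      ![j + 3, (2 * e + 1) * (j + 1), 2 * e + 1, e * (j + 1) + j + 2] := by
    have e₁ : e * (j + 2) + (j + 2) - e = e * (j + 1) + j + 2 :=
      Nat.sub_eq_of_eq_add (by ring)
    simp [VirtualType.dualWeights, e₁]
  rw [hw] at hr
  refine ⟨_, 2 * (e * (j + 1) + j + 2), (2 * e + 1) * (j + 2), hr, ⟨?_, ?_⟩, ⟨?_, ?_⟩,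
    hasExceptionalOrders_of ![![0, -1, 1, 0], ![1, 0, 0, 0], ![0, 1, 0, 0]] ?_ ?_ ?_ ?_ ?_⟩
  · intro i; fin_cases i <;> simp <;> omega
  · exact (((isWeightedHomogeneous_X ℂ _ 0).mul (isWeightedHomogeneous_X ℂ _ 1)).of_eq (by simp <;>
      ring)).sub ((isWeightedHomogeneous_pow _ 3 _).of_eq (by simp <;> ring))
  · intro i; fin_cases i <;> simp <;> omega
  · exact ((((isWeightedHomogeneous_pow _ 0 _).mul (isWeightedHomogeneous_X ℂ _ 3)).of_eq (by simp
      <;> ring)).add (((isWeightedHomogeneous_X ℂ _ 1).mul (isWeightedHomogeneous_X ℂ _ 2)).of_eq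
      (by simp <;> ring))).add ((isWeightedHomogeneous_pow _ 2 _).of_eq (by simp <;> ring))
  · intro i; fin_cases i <;> simp [funext_iff, Fin.forall_fin_succ]
  · intro i; fin_cases i <;> simp <;> nlinarith
  · intro i m
    fin_cases i <;> simp [Fin.forall_fin_succ]
    exact fun h => h.mul_right _
  · intro i j h
    fin_cases i <;> fin_cases j <;> simp [Fin.forall_fin_succ] at h ⊢
  · rintro y ⟨hy, h₁, h₂⟩ r hr' hd
    simp at h₁ h₂
    have hy' : y 0 ≠ 0 ∨ y 1 ≠ 0 ∨ y 2 ≠ 0 ∨ y 3 ≠ 0 := by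
      by_contra! h
      exact hy (funext fun j => by fin_cases j <;> simp [h])
    rcases eq_or_ne (y 0) 0 with h0 | h0
    · have h3 : y 3 = 0 := by simpa [h0] using h₁
      rcases eq_or_ne (y 2) 0 with h2 | h2
      · obtain ⟨t, ht, e1⟩ := exists_pow_eq (a := y 1) (by simp_all)
          (k := (2 * e + 1) * (j + 1)) (by positivity)
        exact ⟨2, t, ht, by simp [Fin.forall_fin_succ, h0, h2, h3, e1]⟩
      · obtain ⟨t, ht, e1⟩ := exists_pow_eq h2 (k := 2 * e + 1) (by omega)
        have e : y 1 = -y 2 ^ (j + 1) := by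
          rw [h3] at h₂
          refine mul_right_cancel₀ h2 ?_
          linear_combination h₂
        exact ⟨0, t, ht, by simp [Fin.forall_fin_succ, h0, h3, pow_mul, e1, e]⟩
    rcases eq_or_ne (y 1) 0 with h1 | h1
    · have h3 : y 3 = 0 := by simpa [h1] using h₁
      have h2 : y 2 = 0 := by simp_all
      obtain ⟨t, ht, e1⟩ := exists_pow_eq h0 (k := j + 3) (by omega)
      exact ⟨1, t, ht, by simp [Fin.forall_fin_succ, h1, h2, h3, e1]⟩
    have h3 : y 3 ≠ 0 := fun h => by simp_all
    have h2 : y 2 ≠ 0 := fun h => by simp_all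
    exact absurd (hr.eq_one fun j => hd j (by fin_cases j <;> simpa)) hr'.ne_one


theorem pairDolgachev_IV2sharp {e j : ℕ} (he : 1 ≤ e)
    (hr : IsReducedWeights (VirtualType.IV2sharp e (j + 2)).dualWeights) :
    HasPairDolgachev (.IV2sharp e (j + 2)) ![e * (j + 3), j + 3, e * (j + 1) + j + 2] := by
  have hw : (VirtualType.IV2sharp e (j + 2)).dualWeights =
      ![j + 3, e * (j + 3), 2 * e + 1, e * (j + 1) + j + 2] := by
    have e₁ : e * (j + 2) + (j + 2) - e = e * (j + 1) + j + 2 :=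
      Nat.sub_eq_of_eq_add (by ring)
    simp [VirtualType.dualWeights, e₁]
  rw [hw] at hr
  refine ⟨_, (e + 1) * (j + 3), (2 * e + 1) * (j + 2), hr, ⟨?_, ?_⟩, ⟨?_, ?_⟩,
    hasExceptionalOrders_of ![![0, 1, 0, 0], ![1, 0, 0, 0], ![0, 0, 0, 1]] ?_ ?_ ?_ ?_ ?_⟩
  · intro i; fin_cases i <;> simp <;> omega
  · exact (((isWeightedHomogeneous_X ℂ _ 0).mul (isWeightedHomogeneous_X ℂ _ 1)).of_eq (by simp <;>
      ring)).sub (((isWeightedHomogeneous_X ℂ _ 2).mul (isWeightedHomogeneous_X ℂ _ 3)).of_eq (by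
      simp <;> ring))
  · intro i; fin_cases i <;> simp <;> omega
  · exact ((((isWeightedHomogeneous_pow _ 0 _).mul (isWeightedHomogeneous_X ℂ _ 3)).of_eq (by simp
      <;> ring)).add (((isWeightedHomogeneous_X ℂ _ 1).mul (isWeightedHomogeneous_X ℂ _ 3)).of_eq
      (by simp <;> ring))).add ((isWeightedHomogeneous_pow _ 2 _).of_eq (by simp <;> ring))
  · intro i; fin_cases i <;> simp [funext_iff, Fin.forall_fin_succ, show e ≠ 0 by omega]
  · intro i; fin_cases i <;> simp <;> nlinarith
  · intro i m
    fin_cases i <;> simp [Fin.forall_fin_succ]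
  · intro i j h
    fin_cases i <;> fin_cases j <;> simp [Fin.forall_fin_succ] at h ⊢
  · rintro y ⟨hy, h₁, h₂⟩ r hr' hd
    simp at h₁ h₂
    have hy' : y 0 ≠ 0 ∨ y 1 ≠ 0 ∨ y 2 ≠ 0 ∨ y 3 ≠ 0 := by
      by_contra! h
      exact hy (funext fun j => by fin_cases j <;> simp [h])
    rcases eq_or_ne (y 3) 0 with h3 | h3
    · have h2 : y 2 = 0 := by simp_all
      rcases eq_or_ne (y 0) 0 with h0 | h0
      · obtain ⟨t, ht, e1⟩ := exists_pow_eq (a := y 1) (by simp_all) (k := e * (j + 3))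
          (by positivity)
        exact ⟨0, t, ht, by simp [Fin.forall_fin_succ, h0, h2, h3, e1]⟩
      · have h1 : y 1 = 0 := by simpa [h0, h2] using h₁
        obtain ⟨t, ht, e1⟩ := exists_pow_eq h0 (k := j + 3) (by omega)
        exact ⟨1, t, ht, by simp [Fin.forall_fin_succ, h1, h2, h3, e1]⟩
    by_cases h01 : y 0 * y 1 = 0
    · have h2 : y 2 = 0 := by simpa [h01, h3] using h₁
      have e' : y 0 ^ e + y 1 = 0 := by
        rw [h2, zero_pow (by omega)] at h₂
        refine mul_right_cancel₀ h3 ?_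
        linear_combination h₂
      have h1 : y 1 = 0 := by
        rcases mul_eq_zero.1 h01 with h | h
        · simpa [h, show e ≠ 0 by omega] using e'
        · exact h
      have h0 : y 0 = 0 := by simpa [h1, show e ≠ 0 by omega] using e'
      obtain ⟨t, ht, e1⟩ := exists_pow_eq h3 (k := e * (j + 1) + j + 2) (by omega)
      exact ⟨2, t, ht, by simp [Fin.forall_fin_succ, h0, h1, h2, e1]⟩
    obtain ⟨h0, h1⟩ := mul_ne_zero_iff.1 h01
    have h2 : y 2 ≠ 0 := fun h => by simp_all
    exact absurd (hr.eq_one fun j => hd j (by fin_cases j <;> simpa)) hr'.ne_one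

/-! ### Newton polytopes with two outer facets -/

theorem newtonPolytope_le {n : ℕ} {p : MvPolynomial (Fin n) ℂ} {u q : Fin n → ℝ}
    (hu : ∀ m ∈ p.support, ∑ j, u j * exponentPoint m j ≤ 1) (hq : q ∈ newtonPolytope p) :
    ∑ j, u j * q j ≤ 1 := by
  have hc : Convex ℝ {q : Fin n → ℝ | ∑ j, u j * q j ≤ 1} :=
    convex_halfSpace_le ⟨fun x y => by simp [mul_add, Finset.sum_add_distrib],
      fun c x => by simp [Finset.mul_sum, mul_left_comm]⟩ 1
  refine convexHull_min ?_ hc hq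
  rintro _ (rfl | ⟨m, hm, rfl⟩)
  · simp
  · exact hu m hm

theorem exponentPoint_mem_newtonPolytope {n : ℕ} {p : MvPolynomial (Fin n) ℂ} {m : Fin n →₀ ℕ}
    (hm : m ∈ p.support) : exponentPoint m ∈ newtonPolytope p :=
  subset_convexHull ℝ _ (Or.inr ⟨m, hm, rfl⟩)

theorem mem_span_of_mem_newtonPolytope {n : ℕ} {p : MvPolynomial (Fin n) ℂ} {u q : Fin n → ℝ}
    {V : Submodule ℝ (Fin n → ℝ)} (hu : ∀ m ∈ p.support, ∑ j, u j * exponentPoint m j < 1 ∨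
      ∑ j, u j * exponentPoint m j = 1 ∧ exponentPoint m ∈ V)
    (hq : q ∈ newtonPolytope p) (h1 : ∑ j, u j * q j = 1) : q ∈ V := by
  have hc : Convex ℝ {q : Fin n → ℝ | ∑ j, u j * q j < 1 ∨ ∑ j, u j * q j = 1 ∧ q ∈ V} := by
    intro x hx y hy a b ha hb hab
    have e : ∑ j, u j * (a • x + b • y) j = a * ∑ j, u j * x j + b * ∑ j, u j * y j := by
      simp only [Finset.mul_sum, ← Finset.sum_add_distrib, Pi.add_apply, Pi.smul_apply, smul_eq_mul]
      exact Finset.sum_congr rfl fun j _ => by ring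
    simp only [Set.mem_setOf_eq, e] at hx hy ⊢
    rcases ha.eq_or_lt with rfl | ha
    · obtain rfl : b = 1 := by linarith
      simpa using hy
    rcases hb.eq_or_lt with rfl | hb
    · obtain rfl : a = 1 := by linarith
      simpa using hx
    rcases hx with hx | ⟨hx, hxV⟩
    · left
      have hy' : ∑ j, u j * y j ≤ 1 := hy.elim le_of_lt fun h => h.1.le
      nlinarith
    · rcases hy with hy | ⟨hy, hyV⟩
      · left
        nlinarith
      · right
        exact ⟨by rw [hx, hy]; linarith, V.add_mem (V.smul_mem _ hxV) (V.smul_mem _ hyV)⟩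
  have := convexHull_min (s := insert 0 (exponentPoint '' (p.support : Set (Fin n →₀ ℕ)))) (by
    rintro _ (rfl | ⟨m, hm, rfl⟩)
    · left; simp
    · exact hu m hm) hc hq
  rcases this with h | h
  · exact absurd h1 h.ne
  · exact h.2

theorem eq_of_sum_mul_eq_one {n : ℕ} {E : Matrix (Fin n) (Fin n) ℝ} (hE : E.det ≠ 0)
    {u v : Fin n → ℝ} (hu : ∀ i, ∑ j, u j * E i j = 1) (hv : ∀ i, ∑ j, v j * E i j = 1) :
    u = v := by
  refine Matrix.mulVec_injective_of_isUnit ((Matrix.isUnit_iff_isUnit_det _).2 hE.isUnit) ?_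
  funext i
  simp only [Matrix.mulVec, dotProduct, mul_comm (E i _), hu, hv]

theorem span_range_eq_top_of_det_ne_zero {E : Matrix (Fin 3) (Fin 3) ℝ}
    (hE : E.det ≠ 0) : Submodule.span ℝ (Set.range E) = ⊤ :=
  (Matrix.linearIndependent_rows_iff_isUnit.2
    ((Matrix.isUnit_iff_isUnit_det _).2 hE.isUnit)).span_eq_top_of_card_eq_finrank (by simp)

theorem span_pair_ne_top (x y : Fin 3 → ℝ) : Submodule.span ℝ {x, y} ≠ ⊤ := by
  intro h
  classical
  have h₁ := finrank_span_finset_le_card (R := ℝ) ({x, y} : Finset (Fin 3 → ℝ))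
  have h₂ := Finset.card_le_two (a := x) (b := y)
  rw [Set.finrank, Finset.coe_insert, Finset.coe_singleton, h, finrank_top,
    Module.finrank_fin_fun] at h₁
  omega

/-- The polynomial in three variables with exponent vectors `A i` and coefficients `c i`. -/
def ofExponents {k : ℕ} (A : Fin k → Fin 3 → ℕ) (c : Fin k → ℂ) : MvPolynomial (Fin 3) ℂ :=
  ∑ i, monomial (Finsupp.equivFunOnFinite.symm (A i)) (c i)

theorem ofExponents_eq {k : ℕ} (A : Fin k → Fin 3 → ℕ) (c : Fin k → ℂ) :
    ofExponents A c = ∑ i, C (c i) * (X 0 ^ A i 0 * X 1 ^ A i 1 * X 2 ^ A i 2) := by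
  refine Finset.sum_congr rfl fun i _ => ?_
  rw [monomial_eq, Finsupp.prod_fintype _ _ (by simp)]
  simp [Fin.prod_univ_three]

theorem coeff_ofExponents {k : ℕ} {A : Fin k → Fin 3 → ℕ} (hA : Function.Injective A)
    (c : Fin k → ℂ) (i : Fin k) :
    coeff (Finsupp.equivFunOnFinite.symm (A i)) (ofExponents A c) = c i := by
  classical
  simp [ofExponents, coeff_sum, coeff_monomial, hA.eq_iff]

theorem support_ofExponents {k : ℕ} {A : Fin k → Fin 3 → ℕ} (hA : Function.Injective A)
    {c : Fin k → ℂ} (hc : ∀ i, c i ≠ 0) :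
    (ofExponents A c).support =
      Finset.univ.image fun i => Finsupp.equivFunOnFinite.symm (A i) := by
  classical
  ext m
  simp only [Finset.mem_image, Finset.mem_univ, true_and]
  constructor
  · intro hm
    by_contra h
    refine (mem_support_iff.1 hm) ?_
    simp only [ofExponents, coeff_sum, coeff_monomial]
    exact Finset.sum_eq_zero fun i _ => if_neg fun e => h ⟨i, e⟩
  · rintro ⟨i, rfl⟩
    rw [mem_support_iff, coeff_ofExponents hA]
    exact hc i

theorem mem_support_ofExponents {k : ℕ} {A : Fin k → Fin 3 → ℕ} (hA : Function.Injective A)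
    {c : Fin k → ℂ} (hc : ∀ i, c i ≠ 0) (m : Fin 3 →₀ ℕ) :
    m ∈ (ofExponents A c).support ↔ ∃ i, ∀ j, m j = A i j := by
  simp only [support_ofExponents hA hc, Finset.mem_image, Finset.mem_univ, true_and]
  refine exists_congr fun i => ⟨fun h j => by rw [← h]; rfl, fun h => ?_⟩
  ext j
  exact (h j).symm

theorem facePart_ofExponents {k l : ℕ} {A : Fin k → Fin 3 → ℕ} (hA : Function.Injective A)
    {c : Fin k → ℂ} (hc : ∀ i, c i ≠ 0) {F : Set (Fin 3 → ℝ)} (r : Fin l → Fin k)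
    (hr : Function.Injective r) (hF : ∀ i, (fun j => (A i j : ℝ)) ∈ F ↔ i ∈ Set.range r) :
    facePart (ofExponents A c) F = ofExponents (fun i => A (r i)) fun i => c (r i) := by
  classical
  have e : Function.Injective fun i => Finsupp.equivFunOnFinite.symm (A i) :=
    Finsupp.equivFunOnFinite.symm.injective.comp hA
  rw [facePart, Finset.sum_filter, support_ofExponents hA hc,
    Finset.sum_image fun _ _ _ _ h => e h]
  simp only [coeff_ofExponents hA]
  change _ = ∑ i, monomial (Finsupp.equivFunOnFinite.symm (A (r i))) (c (r i))
  rw [← Finset.sum_filter, ← Finset.sum_image (s := Finset.univ) (g := r)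
    (f := fun i => monomial (Finsupp.equivFunOnFinite.symm (A i)) (c i)) fun _ _ _ _ h => hr h]
  refine Finset.sum_congr ?_ fun _ _ => rfl
  ext i
  rw [Finset.mem_filter]
  exact (and_iff_right (Finset.mem_univ i)).trans ((hF i).trans (by simp))

theorem isWeights_ofExponents {k : ℕ} {A : Fin k → Fin 3 → ℕ} {c : Fin k → ℂ} {w : Fin 3 → ℕ}
    {d : ℕ} (hw : ∀ i, 0 < w i) (h : ∀ i, ∑ j, A i j * w j = d) :
    IsWeights (ofExponents A c) w d := by
  refine ⟨hw, ?_⟩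
  refine (weightedHomogeneousSubmodule ℂ w d).sum_mem fun i _ => ?_
  refine isWeightedHomogeneous_monomial _ _ _ ?_
  rw [← h i, Finsupp.weight_apply, Finsupp.sum_fintype _ _ (by simp)]
  rfl

theorem isCanonicalWeights_ofExponents {A : Matrix (Fin 3) (Fin 3) ℕ} {c : Fin 3 → ℂ}
    (hA : Function.Injective A) (hc : ∀ i, c i ≠ 0) {w : Fin 3 → ℕ} {d : ℕ} (hd : 0 < d)
    (hdet : (A.map (Nat.cast : ℕ → ℤ)).det = d) (h : ∀ i, ∑ j, A i j * w j = d) :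
    IsCanonicalWeights (ofExponents A c) w d :=
  ⟨A, mem_support_ofExponents hA hc, hd, hdet, h⟩

/-- The polytope spanned by the origin and the rows of `A` has the two outer facets spanned by the
rows `0, 1, 2` and `0, 2, 3`, which define the systems of weights `(w₁; d₁)` and `(w₂; d₂)`. -/
structure IsBifacial (A : Fin 4 → Fin 3 → ℕ) (w₁ w₂ : Fin 3 → ℕ) (d₁ d₂ : ℕ) : Prop where
  pos₁ : ∀ i, 0 < w₁ i
  pos₂ : ∀ i, 0 < w₂ i
  deg₁ : ∀ i, ∑ j, A (![0, 1, 2] i) j * w₁ j = d₁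
  deg₂ : ∀ i, ∑ j, A (![0, 2, 3] i) j * w₂ j = d₂
  lt₁ : ∑ j, A 3 j * w₁ j < d₁
  lt₂ : ∑ j, A 1 j * w₂ j < d₂
  det₁ : (Matrix.of fun i j => (A (![0, 1, 2] i) j : ℤ)).det = d₁
  det₂ : (Matrix.of fun i j => (A (![0, 2, 3] i) j : ℤ)).det = d₂
  rel : ∃ l : Fin 4 → ℕ, (∀ j, l 0 * A 0 j + l 2 * A 2 j = l 1 * A 1 j + l 3 * A 3 j) ∧
    l 0 + l 2 < l 1 + l 3

/-- The face of the Newton polytope supported by the weights `(w; d)`. -/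
def weightFace (p : MvPolynomial (Fin 3) ℂ) (w : Fin 3 → ℕ) (d : ℕ) : Set (Fin 3 → ℝ) :=
  {q ∈ newtonPolytope p | ∑ j, ((w j : ℝ) / d) * q j = 1}

namespace IsBifacial

variable {A : Fin 4 → Fin 3 → ℕ} {w₁ w₂ : Fin 3 → ℕ} {d₁ d₂ : ℕ} {c : Fin 4 → ℂ}

theorem injective (D : IsBifacial A w₁ w₂ d₁ d₂) : Function.Injective A := by
  have h3 {i} (h : A i = A 3) : i = 3 := by
    have := D.lt₁
    rw [← h] at this
    fin_cases i
    exacts [(this.ne (D.deg₁ 0)).elim, (this.ne (D.deg₁ 1)).elim, (this.ne (D.deg₁ 2)).elim, rfl]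
  have h1 {i} (h : A i = A 1) : i = 1 := by
    have := D.lt₂
    rw [← h] at this
    fin_cases i
    exacts [(this.ne (D.deg₂ 0)).elim, rfl, (this.ne (D.deg₂ 1)).elim, (this.ne (D.deg₂ 2)).elim]
  have h02 : A 0 ≠ A 2 := fun h => by
    have h' := D.det₁
    rw [Matrix.det_zero_of_row_eq (i := 0) (j := 2) (by decide)
      (funext fun j => by simp [h])] at h'
    have := D.lt₁
    omega
  intro i j h
  fin_cases i <;> fin_cases j <;> first
    | rfl
    | exact h3 h
    | exact (h3 h.symm).symm
    | exact h1 h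
    | exact (h1 h.symm).symm
    | exact (h02 h).elim
    | exact (h02 h.symm).elim

theorem sum_div {w m : Fin 3 → ℕ} {d : ℕ} :
    ∑ j, ((w j : ℝ) / d) * (m j : ℝ) = (∑ j, m j * w j : ℕ) / (d : ℝ) := by
  push_cast
  rw [Finset.sum_div]
  exact Finset.sum_congr rfl fun j _ => by ring

theorem sum_eq_one_iff {w m : Fin 3 → ℕ} {d : ℕ} (hd : 0 < d) :
    ∑ j, ((w j : ℝ) / d) * (m j : ℝ) = 1 ↔ ∑ j, m j * w j = d := by
  have : (d : ℝ) ≠ 0 := by positivity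
  rw [sum_div, div_eq_one_iff_eq this, Nat.cast_inj]

theorem sum_le_one_iff {w m : Fin 3 → ℕ} {d : ℕ} (hd : 0 < d) :
    ∑ j, ((w j : ℝ) / d) * (m j : ℝ) ≤ 1 ↔ ∑ j, m j * w j ≤ d := by
  have : (0 : ℝ) < d := by positivity
  rw [sum_div, div_le_one this, Nat.cast_le]

theorem det_ne_zero {r : Fin 3 → Fin 4} {d : ℕ} (hd : 0 < d)
    (h : (Matrix.of fun i j => (A (r i) j : ℤ)).det = d) :
    (Matrix.of fun i j => (A (r i) j : ℝ)).det ≠ 0 := by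
  have e := (Int.castRingHom ℝ).map_det (Matrix.of fun i j => (A (r i) j : ℤ))
  rw [h] at e
  have : (Int.castRingHom ℝ).mapMatrix (Matrix.of fun i j => (A (r i) j : ℤ)) =
      Matrix.of fun i j => (A (r i) j : ℝ) := by ext; simp
  rw [← this, ← e]
  simpa using hd.ne'

theorem exponentPoint_eq (hA : Function.Injective A) (hc : ∀ i, c i ≠ 0) {m : Fin 3 →₀ ℕ}
    (hm : m ∈ (ofExponents A c).support) : ∃ i, exponentPoint m = fun j => (A i j : ℝ) := by
  obtain ⟨i, hi⟩ := (mem_support_ofExponents hA hc m).1 hm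
  exact ⟨i, funext fun j => by simp [exponentPoint, hi]⟩

theorem mem_newtonPolytope (hA : Function.Injective A) (hc : ∀ i, c i ≠ 0) (i : Fin 4) :
    (fun j => (A i j : ℝ)) ∈ newtonPolytope (ofExponents A c) :=
  exponentPoint_mem_newtonPolytope ((mem_support_ofExponents hA hc
    (Finsupp.equivFunOnFinite.symm (A i))).2 ⟨i, fun _ => rfl⟩)

theorem isOuterFacet_weightFace (hA : Function.Injective A) (hc : ∀ i, c i ≠ 0) {w : Fin 3 → ℕ}
    {d : ℕ} (r : Fin 3 → Fin 4) (hd : 0 < d) (hle : ∀ i, ∑ j, A i j * w j ≤ d)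
    (hdeg : ∀ i, ∑ j, A (r i) j * w j = d)
    (hdet : (Matrix.of fun i j => (A (r i) j : ℤ)).det = d) :
    IsOuterFacet (ofExponents A c) (weightFace (ofExponents A c) w d) := by
  refine ⟨fun j => (w j : ℝ) / d, fun q hq => newtonPolytope_le (fun m hm => ?_) hq, rfl, ?_⟩
  · obtain ⟨i, hi⟩ := exponentPoint_eq hA hc hm
    rw [hi, sum_le_one_iff hd]
    exact hle i
  · rw [eq_top_iff, ← span_range_eq_top_of_det_ne_zero (det_ne_zero hd hdet)]
    refine Submodule.span_mono ?_
    rintro _ ⟨i, rfl⟩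
    exact ⟨mem_newtonPolytope hA hc (r i), (sum_eq_one_iff hd).2 (hdeg i)⟩

theorem isOuterFacet_iff (D : IsBifacial A w₁ w₂ d₁ d₂)
    (hc : ∀ i, c i ≠ 0) (F : Set (Fin 3 → ℝ)) :
    IsOuterFacet (ofExponents A c) F ↔
      F = weightFace (ofExponents A c) w₁ d₁ ∨ F = weightFace (ofExponents A c) w₂ d₂ := by
  have hA := D.injective
  have hd₁ : 0 < d₁ := (Nat.zero_le _).trans_lt D.lt₁
  have hd₂ : 0 < d₂ := (Nat.zero_le _).trans_lt D.lt₂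
  constructor
  · rintro ⟨u, hle, rfl, hspan⟩
    have le (i) := hle _ (mem_newtonPolytope (c := c) hA hc i)
    have two : ∀ i₀ i₁, i₀ ≠ i₁ → ∑ j, u j * (A i₀ j : ℝ) < 1 → ∑ j, u j * (A i₁ j : ℝ) < 1 →
        False := by
      intro i₀ i₁ hne h₀ h₁
      obtain ⟨k, l, hkl⟩ : ∃ k l, ∀ i, i = i₀ ∨ i = i₁ ∨ i = k ∨ i = l := by
        revert hne; clear h₀ h₁; revert i₀ i₁; decide
      refine span_pair_ne_top (fun j => (A k j : ℝ)) (fun j => (A l j : ℝ)) ?_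
      rw [eq_top_iff, ← hspan, Submodule.span_le]
      rintro q ⟨hq, hq1⟩
      refine mem_span_of_mem_newtonPolytope (fun m hm => ?_) hq hq1
      obtain ⟨i, hi⟩ := exponentPoint_eq hA hc hm
      rw [hi]
      rcases (le i).lt_or_eq with h | h
      · exact Or.inl h
      · refine Or.inr ⟨h, ?_⟩
        rcases hkl i with rfl | rfl | rfl | rfl
        · exact absurd h h₀.ne
        · exact absurd h h₁.ne
        · exact Submodule.subset_span (by simp)
        · exact Submodule.subset_span (by simp)
    have eq_of (i₀) (h₀ : ∑ j, u j * (A i₀ j : ℝ) < 1) (i) (hi : i₀ ≠ i) :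
        ∑ j, u j * (A i j : ℝ) = 1 :=
      (le i).lt_or_eq.elim (fun h => (two i₀ i hi h₀ h).elim) id
    have key {w : Fin 3 → ℕ} {d : ℕ} {r : Fin 3 → Fin 4} (hd : 0 < d)
        (hdeg : ∀ i, ∑ j, A (r i) j * w j = d)
        (hdet : (Matrix.of fun i j => (A (r i) j : ℤ)).det = d)
        (hu : ∀ i, ∑ j, u j * (A (r i) j : ℝ) = 1) : u = fun j => (w j : ℝ) / d :=
      eq_of_sum_mul_eq_one (det_ne_zero hd hdet) hu fun i => (sum_eq_one_iff hd).2 (hdeg i)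
    rcases (le 1).lt_or_eq with h | h
    · right
      rw [key hd₂ D.deg₂ D.det₂ fun i => eq_of 1 h _ (by revert i; decide)]
      rfl
    rcases (le 3).lt_or_eq with h3 | h3
    · left
      rw [key hd₁ D.deg₁ D.det₁ fun i => eq_of 3 h3 _ (by revert i; decide)]
      rfl
    · exfalso
      obtain ⟨l, hl, hlt⟩ := D.rel
      have hl' (j) : (l 0 : ℝ) * A 0 j + l 2 * A 2 j = l 1 * A 1 j + l 3 * A 3 j := by
        exact_mod_cast hl j
      have hlt' : (l 0 : ℝ) + l 2 < l 1 + l 3 := by exact_mod_cast hlt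
      have h0 := mul_le_mul_of_nonneg_left (le 0) (Nat.cast_nonneg (α := ℝ) (l 0))
      have h2 := mul_le_mul_of_nonneg_left (le 2) (Nat.cast_nonneg (α := ℝ) (l 2))
      simp only [Fin.sum_univ_three] at h h3 h0 h2
      have := hl' 0; have := hl' 1; have := hl' 2
      have e : (l 0 : ℝ) * (u 0 * A 0 0 + u 1 * A 0 1 + u 2 * A 0 2) +
          l 2 * (u 0 * A 2 0 + u 1 * A 2 1 + u 2 * A 2 2) = l 1 + l 3 := by
        linear_combination u 0 * hl' 0 + u 1 * hl' 1 + u 2 * hl' 2 + l 1 * h + l 3 * h3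
      linarith
  · have hle₁ : ∀ i, ∑ j, A i j * w₁ j ≤ d₁ := by
      intro i
      fin_cases i
      exacts [(D.deg₁ 0).le, (D.deg₁ 1).le, (D.deg₁ 2).le, D.lt₁.le]
    have hle₂ : ∀ i, ∑ j, A i j * w₂ j ≤ d₂ := by
      intro i
      fin_cases i
      exacts [(D.deg₂ 0).le, D.lt₂.le, (D.deg₂ 1).le, (D.deg₂ 2).le]
    rintro (rfl | rfl)
    · exact isOuterFacet_weightFace hA hc _ hd₁ hle₁ D.deg₁ D.det₁
    · exact isOuterFacet_weightFace hA hc _ hd₂ hle₂ D.deg₂ D.det₂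

theorem facePart_weightFace (hA : Function.Injective A) (hc : ∀ i, c i ≠ 0) {w : Fin 3 → ℕ}
    {d : ℕ} (r : Fin 3 → Fin 4) (hr : Function.Injective r) (i₀ : Fin 4)
    (hi₀ : ∀ i, i = i₀ ∨ i ∈ Set.range r) (hlt : ∑ j, A i₀ j * w j < d)
    (hdeg : ∀ i, ∑ j, A (r i) j * w j = d) :
    facePart (ofExponents A c) (weightFace (ofExponents A c) w d) =
      ofExponents (fun i => A (r i)) fun i => c (r i) := by
  refine facePart_ofExponents hA hc r hr fun i => ?_
  refine (and_iff_right (mem_newtonPolytope hA hc i)).trans ?_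
  rw [sum_eq_one_iff ((Nat.zero_le _).trans_lt hlt)]
  refine ⟨fun h => (hi₀ i).resolve_left ?_, ?_⟩
  · rintro rfl
    exact hlt.ne h
  · rintro ⟨i, rfl⟩
    exact hdeg i

/-- The parts of the polynomial on the two facets. -/
theorem facePart_eq (D : IsBifacial A w₁ w₂ d₁ d₂)
    (hc : ∀ i, c i ≠ 0) :
    facePart (ofExponents A c) (weightFace (ofExponents A c) w₁ d₁) =
      ofExponents (fun i => A (![0, 1, 2] i)) (fun i => c (![0, 1, 2] i)) ∧
    facePart (ofExponents A c) (weightFace (ofExponents A c) w₂ d₂) =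
      ofExponents (fun i => A (![0, 2, 3] i)) (fun i => c (![0, 2, 3] i)) :=
  ⟨facePart_weightFace D.injective hc _ (by decide) 3 (by decide) D.lt₁ D.deg₁,
    facePart_weightFace D.injective hc _ (by decide) 1 (by decide) D.lt₂ D.deg₂⟩

theorem isCanonicalWeights (D : IsBifacial A w₁ w₂ d₁ d₂)
    (hc : ∀ i, c i ≠ 0) :
    IsCanonicalWeights (facePart (ofExponents A c) (weightFace (ofExponents A c) w₁ d₁)) w₁ d₁ ∧
    IsCanonicalWeights (facePart (ofExponents A c) (weightFace (ofExponents A c) w₂ d₂)) w₂ d₂ := by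
  rw [(D.facePart_eq hc).1, (D.facePart_eq hc).2]
  exact ⟨isCanonicalWeights_ofExponents (D.injective.comp (by decide)) (fun i => hc _)
      ((Nat.zero_le _).trans_lt D.lt₁) D.det₁ D.deg₁,
    isCanonicalWeights_ofExponents (D.injective.comp (by decide)) (fun i => hc _)
      ((Nat.zero_le _).trans_lt D.lt₂) D.det₂ D.deg₂⟩

theorem isReducedWeights (D : IsBifacial A w₁ w₂ d₁ d₂)
    (hc : ∀ i, c i ≠ 0)
    (h : FacetsReduced (ofExponents A c)) :
    IsReducedWeights w₁ ∧ IsReducedWeights w₂ :=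
  ⟨h _ _ _ ((D.isOuterFacet_iff hc _).2 (Or.inl rfl)) (D.isCanonicalWeights hc).1,
    h _ _ _ ((D.isOuterFacet_iff hc _).2 (Or.inr rfl)) (D.isCanonicalWeights hc).2⟩

theorem hasDolgachevNumbers (D : IsBifacial A w₁ w₂ d₁ d₂)
    (hc : ∀ i, c i ≠ 0) {f : MvPolynomial (Fin 3) ℂ} (hf : IsWeights f w₂ d₂) {α : Fin 4 → ℕ}
    (h₁ : HasExceptionalOrders w₁ (principalPart
      (ofExponents (fun i => A (![0, 1, 2] i)) fun i => c (![0, 1, 2] i))) ![α 0, α 1])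
    (h₂ : HasExceptionalOrders w₂ (principalPart
      (ofExponents (fun i => A (![0, 2, 3] i)) fun i => c (![0, 2, 3] i))) ![α 2, α 3]) :
    HasDolgachevNumbers f (ofExponents A c) α := by
  have e := D.facePart_eq hc
  have hcan := D.isCanonicalWeights hc
  refine ⟨_, _, w₁, w₂, d₁, d₂, ?_, D.isOuterFacet_iff hc, hcan.1, ?_, hcan.2, ?_, hf, ?_, ?_⟩
  · intro h
    have h₁ : (fun j => (A 1 j : ℝ)) ∈ weightFace (ofExponents A c) w₁ d₁ :=
      ⟨mem_newtonPolytope D.injective hc 1, (sum_eq_one_iff ((Nat.zero_le _).trans_lt D.lt₁)).2 (D.deg₁ 1)⟩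
    rw [h] at h₁
    exact D.lt₂.ne ((sum_eq_one_iff ((Nat.zero_le _).trans_lt D.lt₂)).1 h₁.2)
  · rw [e.1]; exact isWeights_ofExponents D.pos₁ D.deg₁
  · rw [e.2]; exact isWeights_ofExponents D.pos₂ D.deg₂
  · rw [e.1]; exact h₁
  · rw [e.2]; exact h₂

end IsBifacial

theorem principalPart_of_not_containsHyperplane {p : MvPolynomial (Fin 3) ℂ}
    {T : Set (Fin 3 → ℂ)} (y : Fin 3 → Fin 3 → ℂ)
    (h : 0 ∉ T ∧ ∀ j, y j j = 0 ∧ eval (y j) p ≠ 0)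
    (hT : ∀ x, eval x p = 0 → x ∈ T → ∃ i, eval x (pderiv i p) ≠ 0)
    (hT' : ∀ x, eval x p = 0 → x ∉ T → ∀ i, eval x (pderiv i p) = 0) :
    principalPart p = {x | eval x p = 0 ∧ x ∈ T} := by
  have h' : ∀ j, ¬ ContainsHyperplane p j := fun j hj => (h.2 j).2 (hj _ (h.2 j).1)
  ext x
  simp only [principalPart, h', Set.mem_setOf_eq, exists_false, not_false_eq_true, true_imp_iff,
    false_imp_iff, implies_true, true_and]
  refine ⟨fun hx => ⟨hx.2.1, ?_⟩, fun hx => ⟨?_, hx.1, hT x hx.1 hx.2⟩⟩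
  · by_contra hxT
    obtain ⟨i, hi⟩ := hx.2.2
    exact hi (hT' x hx.2.1 hxT i)
  · rintro rfl
    exact h.1 hx.2

theorem principalPart_of_containsHyperplane {p : MvPolynomial (Fin 3) ℂ} (j₀ : Fin 3)
    (h₀ : ContainsHyperplane p j₀)
    (h : ∀ j, j ≠ j₀ → ∃ x : Fin 3 → ℂ, x j = 0 ∧ eval x p ≠ 0) :
    principalPart p = {x | eval x p = 0 ∧ x j₀ ≠ 0} := by
  have h' : ∀ j, ContainsHyperplane p j ↔ j = j₀ := fun j => by
    refine ⟨fun hj => ?_, fun hj => hj ▸ h₀⟩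
    by_contra hne
    obtain ⟨x, h₁, h₂⟩ := h j hne
    exact h₂ (hj x h₁)
  ext x
  simp only [principalPart, h', Set.mem_setOf_eq, forall_eq, exists_eq, not_true_eq_false,
    false_imp_iff, and_true]
  exact ⟨fun h => h.2, fun h => ⟨fun h0 => h.2 (by simp [h0]), h⟩⟩

theorem eval_ofExponents {k : ℕ} (A : Fin k → Fin 3 → ℕ) (c : Fin k → ℂ) (x : Fin 3 → ℂ) :
    eval x (ofExponents A c) = ∑ i, c i * (x 0 ^ A i 0 * x 1 ^ A i 1 * x 2 ^ A i 2) := by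
  simp [ofExponents_eq]

theorem eval_pderiv_ofExponents {k : ℕ} (A : Fin k → Fin 3 → ℕ) (c : Fin k → ℂ) (x : Fin 3 → ℂ)
    (j : Fin 3) : eval x (pderiv j (ofExponents A c)) =
      ∑ i, c i * A i j * ∏ l, x l ^ (A i l - if l = j then 1 else 0) := by
  classical
  simp only [ofExponents, map_sum, pderiv_monomial, eval_monomial]
  refine Finset.sum_congr rfl fun i _ => ?_
  rw [Finsupp.prod_fintype _ _ (by simp)]
  refine congrArg _ (Finset.prod_congr rfl fun l _ => ?_)
  simp [Finsupp.single_apply, eq_comm]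

/-- Orbits of `v ^ k (z ^ (j + 2) - v ^ m z) + u ^ 2 v ^ l` outside `{v = 0}`. -/
theorem hasExceptionalOrders_of_eval {u v : Fin 3} (huv : u = 0 ∧ v = 1 ∨ u = 1 ∧ v = 0)
    {p : MvPolynomial (Fin 3) ℂ} {k m j l : ℕ} {w : Fin 3 → ℕ} (hw : IsReducedWeights w)
    (hp : ∀ x, eval x p = -(x v ^ (k + m) * x 2) + x v ^ k * x 2 ^ (j + 2) + x u ^ 2 * x v ^ l)
    (hv : w v = 2 * (j + 1)) (hz : w 2 = 2 * m)
    (hu : w u + l * (j + 1) = (k + m) * (j + 1) + m) :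
    HasExceptionalOrders w {x | eval x p = 0 ∧ x v ≠ 0} ![2 * (j + 1), 2] := by
  have hcop : m.Coprime (j + 1) := by
    refine Nat.coprime_of_dvd' fun r _ h₁ h₂ => ?_
    refine (hw.eq_one fun i => ?_).dvd
    have hr : r ∣ w u := (Nat.dvd_add_left (h₂.mul_left l)).1
      (hu ▸ (Nat.dvd_add (h₂.mul_left _) h₁))
    have : i = u ∨ i = v ∨ i = 2 := by revert i; rcases huv with ⟨rfl, rfl⟩ | ⟨rfl, rfl⟩ <;> decide
    rcases this with rfl | rfl | rfl
    exacts [hr, hv ▸ h₂.mul_left 2, hz ▸ h₁.mul_left 2]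
  have huz : u ≠ 2 := by omega
  have hvz : v ≠ 2 := by omega
  have huv' : u ≠ v := by omega
  have all : ∀ {P : Fin 3 → Prop}, (∀ i, P i) ↔ P u ∧ P v ∧ P 2 := by
    intro P
    rw [Fin.forall_fin_succ, Fin.forall_fin_two]
    rcases huv with ⟨rfl, rfl⟩ | ⟨rfl, rfl⟩
    · rfl
    · exact and_left_comm
  refine hasExceptionalOrders_of ![Pi.single v 1, Pi.single v 1 + Pi.single 2 1] ?_ ?_ ?_ ?_ ?_
  · rw [Fin.forall_fin_two]
    simp [hp, huz, huv', hvz, hvz.symm]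
  · simp [Fin.forall_fin_two]
  · rw [Fin.forall_fin_two]
    refine ⟨fun r => ?_, fun r => ?_⟩
    · rw [all]
      simp [huv', huz, hvz.symm, hvz, hv]
    · rw [all]
      simp only [hv, hz]
      simp only [Matrix.cons_val_one, Matrix.cons_val_fin_one, Pi.add_apply,
        Pi.single_apply, huv', huz, hvz, hvz.symm, if_true, if_false, add_zero, zero_add, ne_eq,
        not_true_eq_false, false_imp_iff, one_ne_zero, not_false_eq_true, true_imp_iff, true_and]
      rw [← Nat.dvd_gcd_iff, Nat.gcd_mul_left, hcop.symm.gcd_eq_one]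
  · intro i j h
    have := h 2
    fin_cases i <;> fin_cases j <;> simp_all
  · rintro y ⟨hy, hyv⟩ r hr h
    have hrv := h v hyv
    rw [hp] at hy
    by_cases hyz : y 2 = 0
    · have hyu : y u = 0 := by simpa [hyz, hyv] using hy
      obtain ⟨t, ht, e⟩ := exists_pow_eq hyv (k := w v) (by omega)
      refine ⟨0, t, ht, all.2 ⟨?_, ?_, ?_⟩⟩ <;> simp [hyz, hyu, e, huv', hvz.symm, Pi.single_apply]
    · have hyu : y u = 0 := by
        by_contra hyu
        exact hr.one_lt.ne' (hw.eq_one (all.2 ⟨h u hyu, hrv, h 2 hyz⟩))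
      have e : y 2 ^ (j + 1) = y v ^ m := by
        have : y v ^ k * y 2 * (y 2 ^ (j + 1) - y v ^ m) = 0 := by
          rw [hyu] at hy; linear_combination hy
        simpa [hyv, hyz, sub_eq_zero] using this
      obtain ⟨t, ht, e₁, e₂⟩ := exists_pow_eq_and_pow_eq 2 hcop.symm two_ne_zero hyz hyv e
      refine ⟨1, t, ht, all.2 ⟨?_, ?_, ?_⟩⟩
      · simp [hyu, huv', huz]
      · simp [hv, mul_comm 2, e₂, hvz]
      · simp [hz, mul_comm 2, e₁, hvz.symm]

theorem IsBifacial.hasDolgachevNumbers_of {A : Fin 4 → Fin 3 → ℕ} {w₁ w₂ : Fin 3 → ℕ} {d₁ d₂ : ℕ}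
    (D : IsBifacial A w₁ w₂ d₁ d₂) {f h : MvPolynomial (Fin 3) ℂ} (B : Fin 3 → Fin 3 → ℕ)
    (hB : ∀ i, ∑ j, B i j * w₂ j = d₂) (hf : f = ofExponents B 1)
    (hh : h = ofExponents A ![1, -1, 1, 1])
    (hred : FacetsReduced h) {α : Fin 4 → ℕ}
    (H : IsReducedWeights w₁ → IsReducedWeights w₂ →
      HasExceptionalOrders w₁ (principalPart (ofExponents (fun i => A (![0, 1, 2] i))
        fun i => (![1, -1, 1, 1] : Fin 4 → ℂ) (![0, 1, 2] i))) ![α 0, α 1] ∧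
      HasExceptionalOrders w₂ (principalPart (ofExponents (fun i => A (![0, 2, 3] i))
        fun i => (![1, -1, 1, 1] : Fin 4 → ℂ) (![0, 2, 3] i))) ![α 2, α 3]) :
    IsReducedWeights w₁ ∧ HasDolgachevNumbers f h α := by
  have hc : ∀ i, (![1, -1, 1, 1] : Fin 4 → ℂ) i ≠ 0 := by simp [Fin.forall_fin_succ]
  rw [hh] at hred ⊢
  obtain ⟨hw₁, hw₂⟩ := D.isReducedWeights hc hred
  obtain ⟨h₁, h₂⟩ := H hw₁ hw₂
  exact ⟨hw₁, D.hasDolgachevNumbers hc (hf ▸ isWeights_ofExponents D.pos₂ hB) h₁ h₂⟩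

section

attribute [local simp] eval_ofExponents eval_pderiv_ofExponents Fin.sum_univ_three
  Fin.prod_univ_three Fin.forall_fin_succ

theorem hasDolgachev_IIA {j e : ℕ} (h : 3 * (e + 2) + (j + 2) < 2 * (e + 2) * (j + 2))
    (hred : FacetsReduced (VirtualType.IIA (j + 2) (e + 2)).h) :
    HasTypeDolgachev (.IIA (j + 2) (e + 2)) ![2 * (j + 1), 2, j + 2, e + 2] := by
  have D : IsBifacial ![![2, e + 2, 0], ![0, e + 3, 1], ![0, 0, j + 2], ![3, 0, 0]]
      ![j + e + 4, 2 * (j + 1), 2 * (e + 3)] ![(j + 2) * (e + 2), j + 2, 3 * (e + 2)]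
      (2 * (j + 2) * (e + 3)) (3 * (j + 2) * (e + 2)) := by
    refine ⟨?_, ?_, ?_, ?_, ?_, ?_, ?_, ?_,
      ![3 * (j + 2) * (e + 3), 3 * (e + 2) * (j + 2), 3 * (e + 2), 2 * (j + 2) * (e + 3)], ?_, ?_⟩
    all_goals simp [Matrix.det_fin_three]
    all_goals first | ring1 | constructorm* _ ∧ _ <;> ring1 | nlinarith
  refine (D.hasDolgachevNumbers_of ![![3, 0, 0], ![1, 2 * (e + 2), 0], ![0, 0, j + 2]] ?_ ?_ ?_ hred
    fun hw₁ hw₂ => ⟨?_, ?_⟩).2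
  · simp
    constructorm* _ ∧ _ <;> ring
  · simp [ofExponents_eq]
  · simp [ofExponents_eq, Fin.sum_univ_four]
    ring
  · rw [principalPart_of_not_containsHyperplane (T := {x | x 1 ≠ 0})
      ![![0, 0, 1], ![0, 0, 1], ![1, 1, 0]]]
    · refine hasExceptionalOrders_of_eval (u := 0) (k := 0) (m := e + 3) (j := j) (l := e + 2)
        (by simp) hw₁ (fun x => ?_) (by simp) (by simp) (by simp; ring)
      simp
      ring
    · simp
    · intro x hx h1
      by_contra! h0
      simp at hx h1 h0
      obtain ⟨h2, -, h3⟩ := h0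
      have hx0 := h2.resolve_right h1
      have : ((j : ℂ) + 1) * x 2 ^ (j + 2) = 0 := by
        rw [hx0] at hx
        linear_combination x 2 * h3 - hx
      simp [Nat.cast_add_one_ne_zero] at this
      simp [this, h1] at h3
    · intro x hx h1
      simp_all
  · have hcop : (3 : ℕ).Coprime (j + 2) := Nat.coprime_of_dvd' fun r _ h₁ h₂ => (hw₂.eq_one (by
      simp [h₁.mul_right, h₂, h₂.mul_right])).dvd
    rw [principalPart_of_not_containsHyperplane (T := {x | x 0 ≠ 0})
      ![![0, 0, 1], ![0, 0, 1], ![1, 0, 0]]]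
    · refine hasExceptionalOrders_of ![![-1, 1, 0], ![-1, 0, 1]] ?_ (by simp) ?_ (by simp) ?_
      · simp
        ring
      · simp
        refine ⟨fun r h => h.mul_right _, fun r => ?_⟩
        rw [← Nat.dvd_gcd_iff, Nat.gcd_mul_right, hcop.symm.gcd_eq_one, one_mul]
      · rintro y ⟨hy, hy0⟩ r hr hry
        simp at hy hy0 hry
        rw [Fin.exists_fin_two]
        by_cases hy1 : y 1 = 0
        · have hy2 : y 2 ≠ 0 := fun h2 => by simp [hy1, h2, hy0] at hy
          obtain ⟨t, ht, e₁, e₂⟩ := exists_pow_eq_and_pow_eq (e + 2) hcop (by simp)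
            (neg_ne_zero.2 hy0) hy2 (by simp [hy1] at hy; linear_combination -hy)
          exact .inr ⟨t, ht, by simp [e₁, e₂, hy1]⟩
        · have hy2 : y 2 = 0 := by
            by_contra hy2
            exact hr.one_lt.ne' (hw₂.eq_one (by simp [hry, hy0, hy1, hy2]))
          obtain ⟨t, ht, e₁⟩ := exists_pow_eq hy1 (k := j + 2) (by simp)
          refine .inl ⟨t, ht, ?_⟩
          have : y 0 ^ 2 * (y 0 + y 1 ^ (e + 2)) = 0 := by
            simp [hy2] at hy
            linear_combination hy
          simpa [pow_mul, e₁, hy2, hy0, eq_neg_iff_add_eq_zero] using this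
    · simp
    · intro x hx h1
      by_contra! h0
      simp at hx h1 h0
      obtain ⟨h2, -, h3⟩ := h0
      rcases h3 with h3 | h3
      · norm_cast at h3
      have : x 0 ^ 3 = 0 := by
        simp [h3] at hx
        linear_combination x 0 * h2 - 2 * hx
      simp [h1] at this
    · intro x hx h1
      simp_all

theorem hasDolgachev_III {j a : ℕ} (h : 3 * (a + 1) + 1 < 2 * (a + 1) * (j + 2))
    (hred : FacetsReduced (VirtualType.III (j + 2) (a + 1)).h) :
    a ≠ 0 ∧ HasTypeDolgachev (.III (j + 2) (a + 1)) ![2 * (j + 1), 2, j + 2, (a + 1) * (j + 2)] := by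
  have D : IsBifacial ![![2, a + 2, 0], ![0, a + 2, 1], ![0, 0, j + 2], ![3, 1, 0]]
      ![a + 2, 2 * (j + 1), 2 * (a + 2)] ![(a + 1) * (j + 2), j + 2, 3 * a + 4]
      (2 * (a + 2) * (j + 2)) ((j + 2) * (3 * a + 4)) := by
    refine ⟨?_, ?_, ?_, ?_, ?_, ?_, ?_, ?_,
      ![3 * (j + 2) * (a + 2), (j + 2) * (3 * a + 4), 3 * a + 4, 2 * (j + 2) * (a + 2)], ?_, ?_⟩
    all_goals simp [Matrix.det_fin_three]
    all_goals first | ring1 | constructorm* _ ∧ _ <;> ring1 | nlinarith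
  refine (D.hasDolgachevNumbers_of ![![3, 1, 0], ![1, 2 * (a + 1) + 1, 0], ![0, 0, j + 2]] ?_ ?_ ?_ hred
    fun hw₁ hw₂ => ⟨?_, ?_⟩).imp_left fun hw₁ => ?_
  · simp
    constructorm* _ ∧ _ <;> ring
  · simp [ofExponents_eq]
  · simp [ofExponents_eq, Fin.sum_univ_four]
    ring
  · rw [principalPart_of_not_containsHyperplane (T := {x | x 1 ≠ 0})
      ![![0, 0, 1], ![0, 0, 1], ![1, 1, 0]]]
    · refine hasExceptionalOrders_of_eval (u := 0) (k := 0) (m := a + 2) (j := j) (l := a + 2)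
        (by simp) hw₁ (fun x => ?_) (by simp) (by simp) (by simp; ring)
      simp
      ring
    · simp
    · intro x hx h1
      by_contra! h0
      simp at hx h1 h0
      obtain ⟨h2, -, h3⟩ := h0
      have hx0 := h2.resolve_right h1
      have : ((j : ℂ) + 1) * x 2 ^ (j + 2) = 0 := by
        rw [hx0] at hx
        linear_combination x 2 * h3 - hx
      simp [Nat.cast_add_one_ne_zero] at this
      simp [this, h1] at h3
    · intro x hx h1
      simp_all
  · rw [principalPart_of_not_containsHyperplane (T := {x | x 0 ≠ 0})
      ![![0, 0, 1], ![0, 0, 1], ![1, 1, 0]]]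
    · refine hasExceptionalOrders_of ![![-1, 1, 0], ![1, 0, 0]] ?_ ?_ ?_ (by simp) ?_
      · simp
        ring
      · simp
        nlinarith
      · simp
        exact fun r h => h.mul_left _
      · rintro y ⟨hy, hy0⟩ r hr hry
        simp at hy hy0 hry
        rw [Fin.exists_fin_two]
        by_cases hy1 : y 1 = 0
        · have hy2 : y 2 = 0 := by simpa [hy1] using hy
          obtain ⟨t, ht, e₁⟩ := exists_pow_eq hy0 (k := (a + 1) * (j + 2)) (by simp)
          exact .inr ⟨t, ht, by simp [e₁, hy1, hy2]⟩
        · have hy2 : y 2 = 0 := by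
            by_contra hy2
            exact hr.one_lt.ne' (hw₂.eq_one (by simp [hry, hy0, hy1, hy2]))
          obtain ⟨t, ht, e₁⟩ := exists_pow_eq hy1 (k := j + 2) (by simp)
          refine .inl ⟨t, ht, ?_⟩
          have : y 0 ^ 2 * y 1 * (y 0 + y 1 ^ (a + 1)) = 0 := by
            simp [hy2] at hy
            linear_combination hy
          simpa [mul_comm (a + 1), pow_mul, e₁, hy2, hy0, hy1, eq_neg_iff_add_eq_zero] using this
    · simp
    · intro x hx h1
      by_contra! h0
      simp at hx h1 h0
      obtain ⟨h2, h4, h3⟩ := h0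
      rcases h3 with h3 | h3
      · norm_cast at h3
      have : x 0 ^ 3 * x 1 = 0 := by
        simp [h3] at hx
        linear_combination x 0 * h2 - 2 * hx
      have hx1 : x 1 = 0 := by simpa [h1] using this
      simp [hx1, h1] at h4
    · intro x hx h1
      simp_all
  · rintro rfl
    exact absurd (hw₁.eq_one (r := 2) (by simp)) (by simp)

theorem hasDolgachev_IV1 {a j : ℕ}
    (h : 3 * (a + 1) + (j + 2) < 2 * (a + 1) * (j + 2) + 1)
    (hred : FacetsReduced (VirtualType.IV1 (a + 1) (j + 2)).h) :
    HasTypeDolgachev (.IV1 (a + 1) (j + 2)) ![2 * (j + 1), 2, j + 2, 3 * a + 2] := by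
  have D : IsBifacial ![![2, a + 1, 0], ![0, a + 2, 1], ![0, 1, j + 2], ![3, 0, 0]]
      ![a + j + 2, 2 * (j + 1), 2 * (a + 1)] ![(a + 1) * (j + 2), j + 2, 3 * a + 2]
      (2 * ((a + 2) * (j + 1) + a + 1)) (3 * (a + 1) * (j + 2)) := by
    refine ⟨?_, ?_, ?_, ?_, ?_, ?_, ?_, ?_,
      ![3 * ((a + 2) * (j + 1) + a + 1), 3 * (a + 1) * (j + 2), 3 * (a + 1),
        2 * ((a + 2) * (j + 1) + a + 1)], ?_, ?_⟩
    all_goals simp [Matrix.det_fin_three]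
    all_goals first | ring1 | constructorm* _ ∧ _ <;> ring1 | nlinarith
  refine (D.hasDolgachevNumbers_of ![![3, 0, 0], ![1, 2 * (a + 1), 0], ![0, 1, j + 2]] ?_ ?_ ?_ hred
    fun hw₁ hw₂ => ⟨?_, ?_⟩).2
  · simp
    constructorm* _ ∧ _ <;> ring
  · simp [ofExponents_eq]
  · simp [ofExponents_eq, Fin.sum_univ_four]
    ring
  · rw [principalPart_of_containsHyperplane 1]
    · refine hasExceptionalOrders_of_eval (u := 0) (k := 1) (m := a + 1) (j := j) (l := a + 1)
        (by simp) hw₁ (fun x => ?_) (by simp) (by simp) (by simp; ring)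
      simp
      ring
    · intro x hx
      simp [hx]
    · simp only [Fin.forall_fin_succ]
      exact ⟨fun _ => ⟨![0, 1, 2], by
        simp [neg_add_eq_zero]
        exact_mod_cast (Nat.pow_lt_pow_right one_lt_two (show 1 < j + 2 by omega)).ne⟩, by simp, fun _ => ⟨![1, 1, 0], by simp⟩, by simp⟩
  · rw [principalPart_of_not_containsHyperplane (T := {x | ¬(x 0 = 0 ∧ x 2 = 0)})
      ![![0, 1, 1], ![1, 0, 0], ![1, 0, 0]]]
    · refine hasExceptionalOrders_of ![![-1, 1, 0], ![0, 0, 1]] ?_ (by simp) ?_ (by simp) ?_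
      · simp
        ring
      · simp
        exact fun r h => h.mul_left _
      · rintro y ⟨hy, hy0⟩ r hr hry
        simp at hy hy0 hry
        rw [Fin.exists_fin_two]
        by_cases hx0 : y 0 = 0
        · have hy2 := hy0 hx0
          have hy1 : y 1 = 0 := by simpa [hx0, hy2] using hy
          obtain ⟨t, ht, e₁⟩ := exists_pow_eq hy2 (k := 3 * a + 2) (by simp)
          exact .inr ⟨t, ht, by simp [e₁, hy1, hx0]⟩
        · have hy1 : y 1 ≠ 0 := fun h1 => by simp [h1, hx0] at hy
          have hy2 : y 2 = 0 := by
            by_contra hy2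
            exact hr.one_lt.ne' (hw₂.eq_one (by simp [hry, hx0, hy1, hy2]))
          obtain ⟨t, ht, e₁⟩ := exists_pow_eq hy1 (k := j + 2) (by simp)
          refine .inl ⟨t, ht, ?_⟩
          have : y 0 ^ 2 * (y 0 + y 1 ^ (a + 1)) = 0 := by
            simp [hy2] at hy
            linear_combination hy
          simpa [mul_comm (a + 1), pow_mul, e₁, hy2, hx0, eq_neg_iff_add_eq_zero] using this
    · simp
    · intro x hx h1
      by_contra! h0
      simp at hx h1 h0
      obtain ⟨h2, h4, h3⟩ := h0
      rcases h3 with h3 | h3 | h3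
      · norm_cast at h3
      · have hx0 : x 0 = 0 := by simpa [h3] using hx
        simp [hx0, h1 hx0] at h4
      · have : x 0 ^ 3 = 0 := by
          simp [h3] at hx
          linear_combination x 0 * h2 - 2 * hx
        exact h1 (by simpa using this) h3
    · intro x hx h1
      simp_all

theorem hasDolgachev_IIB {a j : ℕ} (h : (a + 2) + (j + 2) < (a + 2) * (j + 2))
    (hred : FacetsReduced (VirtualType.IIB (a + 2) (j + 2)).h) :
    HasTypeDolgachev (.IIB (a + 2) (j + 2)) ![2 * (j + 1), 2, a + 2, a + 2] := by
  have D : IsBifacial ![![a + 2, 0, j + 2], ![a + 3, 0, 1], ![0, 2, 0], ![0, 1, j + 2]]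
      ![2 * (j + 1), (a + 2) * (j + 1) + j + 2, 2] ![j + 2, (a + 2) * (j + 2), a + 2]
      (2 * ((a + 2) * (j + 1) + j + 2)) (2 * (a + 2) * (j + 2)) := by
    refine ⟨?_, ?_, ?_, ?_, ?_, ?_, ?_, ?_,
      ![2 * (j + 2) * (a + 3), 2 * (a + 2) * (j + 2), (a + 2) * (j + 1) + j + 2,
        2 * ((a + 2) * (j + 1) + j + 2)], ?_, ?_⟩
    all_goals simp [Matrix.det_fin_three]
    all_goals first | ring1 | constructorm* _ ∧ _ <;> ring1 | exact .inl (by ring) | nlinarith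
  refine (D.hasDolgachevNumbers_of ![![2 * (a + 2), 0, 0], ![0, 2, 0], ![0, 1, j + 2]] ?_ ?_ ?_ hred
    fun hw₁ hw₂ => ⟨?_, ?_⟩).2
  · simp
    constructorm* _ ∧ _ <;> ring
  · simp [ofExponents_eq]
  · simp [ofExponents_eq, Fin.sum_univ_four]
    ring
  · rw [principalPart_of_not_containsHyperplane (T := {x | x 0 ≠ 0})
      ![![0, 1, 0], ![-1, 0, 1], ![0, 1, 0]]]
    · refine hasExceptionalOrders_of_eval (u := 1) (k := a + 2) (m := 1) (j := j) (l := 0)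
        (by simp) hw₁ (fun x => ?_) (by simp) (by simp) (by simp; ring)
      simp
      ring
    · simp [pow_succ, ← two_mul]
    · intro x hx h1
      by_contra! h0
      simp at hx h1 h0
      obtain ⟨-, h2, h3⟩ := h0
      have : ((j : ℂ) + 1) * (x 0 ^ (a + 2) * x 2 ^ (j + 2)) = 0 := by
        rw [h2] at hx
        linear_combination x 2 * h3 - hx
      simp [Nat.cast_add_one_ne_zero, h1] at this
      simp [this, h1] at h3
    · intro x hx h1
      simp_all
  · rw [principalPart_of_not_containsHyperplane (T := {x | ¬(x 1 = 0 ∧ x 2 = 0)})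
      ![![0, 1, 0], ![1, 0, 1], ![0, 1, 0]]]
    · refine hasExceptionalOrders_of ![![0, -1, 1], ![0, 0, 1]] (by simp) (by simp) ?_ (by simp) ?_
      · simp
        exact fun r h => h.mul_right _
      · rintro y ⟨hy, hy0⟩ r hr hry
        simp at hy hy0 hry
        rw [Fin.exists_fin_two]
        have hy2 : y 2 ≠ 0 := fun h2 => by
          simp [h2] at hy
          exact hy0 hy h2
        have hx0 : y 0 = 0 := by
          by_contra hx0
          exact hr.one_lt.ne' (hw₂.eq_one (by simp [hry, hx0, hy2, (hry.2.2 hy2).mul_right]))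
        obtain ⟨t, ht, e₁⟩ := exists_pow_eq hy2 (k := a + 2) (by simp)
        have : y 1 * (y 1 + y 2 ^ (j + 2)) = 0 := by
          simp [hx0] at hy
          linear_combination hy
        rcases mul_eq_zero.1 this with h1 | h1
        · exact .inr ⟨t, ht, by simp [e₁, h1, hx0]⟩
        · exact .inl ⟨t, ht, by simp [pow_mul, e₁, eq_neg_of_add_eq_zero_left h1, hx0]⟩
    · simp
    · intro x hx h1
      by_contra! h0
      simp at hx h1 h0
      obtain ⟨h2, h4, h3⟩ := h0
      rcases h2 with h2 | h2 | h2
      · norm_cast at h2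
      · have : x 1 ^ 2 = 0 := by
          simp [h2] at hx
          linear_combination x 1 * h4 - hx
        have hx1 : x 1 = 0 := by simpa using this
        exact h1 hx1 (by simpa [hx1] using h4)
      · exact h1 (by simpa [h2] using hx) h2
    · intro x hx h1
      simp_all

/-- Orbits of `y (z ^ (j + 2) + x ^ (r + 2)) - x ^ (s + 2) z`. -/
theorem hasExceptionalOrders_principalPart_of_eq {p : MvPolynomial (Fin 3) ℂ} {j r s : ℕ}
    {w : Fin 3 → ℕ} (h0 : w 0 = j + 2) (h2 : w 2 = r + 2)
    (h1 : ∀ m, m ∣ w 0 → m ∣ w 2 → m ∣ w 1) (hw : IsReducedWeights w)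
    (hp : p = X 1 * X 2 ^ (j + 2) - X 0 ^ (s + 2) * X 2 + X 0 ^ (r + 2) * X 1) :
    HasExceptionalOrders w (principalPart p) ![j + 2, r + 2] := by
  subst hp
  rw [principalPart_of_not_containsHyperplane (T := {x | ¬(x 0 = 0 ∧ x 2 = 0)})
    ![![0, 1, 1], ![1, 0, 1], ![1, 1, 0]]]
  · refine hasExceptionalOrders_of ![![1, 0, 0], ![0, 0, 1]] (by simp) (by simp) ?_ (by simp) ?_
    · simp [h0, h2]
    · rintro y ⟨hy, hy0⟩ m hm hmy
      simp at hy hy0 hmy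
      rw [Fin.exists_fin_two]
      by_cases hx0 : y 0 = 0
      · have hy1 : y 1 = 0 := by simpa [hx0, hy0 hx0] using hy
        obtain ⟨t, ht, e₁⟩ := exists_pow_eq (hy0 hx0) (k := w 2) (by simp [h2])
        exact .inr ⟨t, ht, by simp [e₁, hx0, hy1]⟩
      · have hy2 : y 2 = 0 := by
          by_contra hy2
          have h3 := h1 m (hmy.1 hx0) (hmy.2.2 hy2)
          exact hm.one_lt.ne' (hw.eq_one (by simp [hmy, hx0, h3, hy2]))
        have hy1 : y 1 = 0 := by simpa [hx0, hy2] using hy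
        obtain ⟨t, ht, e₁⟩ := exists_pow_eq hx0 (k := w 0) (by simp [h0])
        exact .inl ⟨t, ht, by simp [e₁, hy1, hy2]⟩
  · simp
  · intro x hx h1
    by_contra! h0
    have h3 := h0 1
    simp at hx h1 h3
    have : x 0 ^ (s + 2) * x 2 = 0 := by linear_combination x 1 * h3 - hx
    rcases mul_eq_zero.1 this with h | h
    · have hx0 : x 0 = 0 := by simpa using h
      exact h1 hx0 (by simpa [hx0] using h3)
    · exact h1 (by simpa [h] using h3) h
  · intro x hx h1
    simp_all

theorem hasDolgachev_IIBsharp {a j : ℕ}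
    (h : (a + 2) + (j + 2) < (a + 2) * (j + 2))
    (hred : FacetsReduced (VirtualType.IIBsharp (a + 2) (j + 2)).h) :
    HasTypeDolgachev (.IIBsharp (a + 2) (j + 2)) ![j + 2, a + 2, a + 2, j + 2] := by
  have D : IsBifacial ![![0, 1, j + 2], ![a + 3, 0, 1], ![a + 2, 1, 0], ![0, 2, 0]]
      ![j + 2, a + 2 + (j + 2), a + 2] ![j + 2, (a + 2) * (j + 2), a + 2]
      ((a + 2) * (j + 2) + (a + 2) + (j + 2)) (2 * (a + 2) * (j + 2)) := by
    refine ⟨?_, ?_, ?_, ?_, ?_, ?_, ?_, ?_,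
      ![2 * (a + 2), 2 * (a + 2) * (j + 2), 2 * (j + 2) * (a + 3),
        (a + 2) * (j + 2) + (a + 2) + (j + 2)], ?_, ?_⟩
    all_goals simp [Matrix.det_fin_three]
    all_goals first | ring1 | constructorm* _ ∧ _ <;> ring1 | nlinarith
  refine (D.hasDolgachevNumbers_of ![![2 * (a + 2), 0, 0], ![0, 2, 0], ![0, 1, j + 2]] ?_ ?_ ?_ hred
    fun hw₁ hw₂ => ⟨?_, ?_⟩).2
  · simp
    constructorm* _ ∧ _ <;> ring
  · simp [ofExponents_eq]
  · simp [ofExponents_eq, Fin.sum_univ_four]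
    ring
  · exact hasExceptionalOrders_principalPart_of_eq (r := a) (s := a + 1) rfl rfl
      (fun m h₁ h₂ => Nat.dvd_add h₂ h₁) hw₁ (by simp [ofExponents_eq]; ring)
  · rw [principalPart_of_containsHyperplane 1]
    · refine hasExceptionalOrders_of ![![0, -1, 1], ![1, -1, 0]] (by simp) (by simp) ?_ (by simp) ?_
      · simp
        exact ⟨fun r h => h.mul_right _, fun r h => h.mul_left _⟩
      · rintro y ⟨hy, hy0⟩ r hr hry
        simp at hy hy0 hry
        rw [Fin.exists_fin_two]
        have hy1 : y 1 = -(y 2 ^ (j + 2) + y 0 ^ (a + 2)) := by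
          refine mul_left_cancel₀ hy0 ?_
          linear_combination hy
        by_cases hx0 : y 0 = 0
        · have hy2 : y 2 ≠ 0 := fun h2 => hy0 (by simp [hy1, hx0, h2])
          obtain ⟨t, ht, e₁⟩ := exists_pow_eq hy2 (k := a + 2) (by simp)
          exact .inl ⟨t, ht, by simp [hy1, pow_mul, e₁, hx0]⟩
        · have hy2 : y 2 = 0 := by
            by_contra hy2
            exact hr.one_lt.ne' (hw₂.eq_one (by simp [hry, hx0, hy0, hy2]))
          obtain ⟨t, ht, e₁⟩ := exists_pow_eq hx0 (k := j + 2) (by simp)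
          exact .inr ⟨t, ht, by simp [hy1, mul_comm (a + 2), pow_mul, e₁, hy2]⟩
    · intro x hx
      simp [hx]
    · simp only [Fin.forall_fin_succ]
      exact ⟨fun _ => ⟨![0, 1, 1], by simp [one_add_one_eq_two]⟩, by simp, fun _ => ⟨![1, 1, 0], by simp [one_add_one_eq_two]⟩, by simp⟩

theorem hasDolgachev_IV2 {a j : ℕ} (h : a + 2 < (a + 1) * (j + 2))
    (hred : FacetsReduced (VirtualType.IV2 (a + 1) (j + 2)).h) :
    HasTypeDolgachev (.IV2 (a + 1) (j + 2)) ![2 * (j + 1), 2, (a + 1) * (j + 2), a + 2] := by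
  have D : IsBifacial ![![a + 1, 0, j + 2], ![a + 2, 0, 1], ![1, 2, 0], ![0, 1, j + 2]]
      ![2 * (j + 1), (a + 1) * (j + 1) + 1, 2] ![j + 2, (a + 1) * (j + 2), a + 2]
      (2 * ((a + 1) * (j + 1) + j + 2)) ((j + 2) * (2 * a + 3)) := by
    refine ⟨?_, ?_, ?_, ?_, ?_, ?_, ?_, ?_,
      ![2 * (j + 2) * (a + 2) + 1, (j + 2) * (2 * a + 3), (a + 1) * (j + 1) + j + 2,
        2 * ((a + 1) * (j + 1) + j + 2)], ?_, ?_⟩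
    all_goals simp [Matrix.det_fin_three]
    all_goals first | ring1 | constructorm* _ ∧ _ <;> ring1 | nlinarith
  refine (D.hasDolgachevNumbers_of ![![2 * (a + 1) + 1, 0, 0], ![1, 2, 0], ![0, 1, j + 2]] ?_ ?_ ?_ hred
    fun hw₁ hw₂ => ⟨?_, ?_⟩).2
  · simp
    constructorm* _ ∧ _ <;> ring
  · simp [ofExponents_eq]
  · simp [ofExponents_eq, Fin.sum_univ_four]
    ring
  · rw [principalPart_of_containsHyperplane 0]
    · refine hasExceptionalOrders_of_eval (u := 1) (k := a + 1) (m := 1) (j := j) (l := 1)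
        (by simp) hw₁ (fun x => ?_) (by simp) (by simp) (by simp; ring)
      simp
      ring
    · intro x hx
      simp [hx]
    · simp only [Fin.forall_fin_succ]
      exact ⟨by simp, fun _ => ⟨![-1, 0, 1], by simp [pow_succ, ← two_mul]⟩,
        fun _ => ⟨![1, 1, 0], by simp⟩, by simp⟩
  · rw [principalPart_of_not_containsHyperplane (T := {x | ¬(x 1 = 0 ∧ x 2 = 0)})
      ![![0, 1, 1], ![1, 0, 1], ![1, 1, 0]]]
    · refine hasExceptionalOrders_of ![![0, 1, 0], ![0, 0, 1]] (by simp) ?_ (by simp) (by simp) ?_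
      · simp
        nlinarith
      · rintro y ⟨hy, hy0⟩ r hr hry
        simp at hy hy0 hry
        rw [Fin.exists_fin_two]
        have hx0 : y 0 = 0 := by
          by_contra hx0
          have hy2 : y 2 ≠ 0 := fun h2 => hy0 (by simpa [h2, hx0] using hy) h2
          exact hr.one_lt.ne' (hw₂.eq_one (by simp [hry, hx0, hy2, (hry.1 hx0).mul_left]))
        by_cases hy2 : y 2 = 0
        · obtain ⟨t, ht, e₁⟩ := exists_pow_eq (fun h => hy0 h hy2) (k := (a + 1) * (j + 2)) (by simp)
          exact .inl ⟨t, ht, by simp [e₁, hx0, hy2]⟩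
        · have hy1 : y 1 = 0 := by simpa [hx0, hy2] using hy
          obtain ⟨t, ht, e₁⟩ := exists_pow_eq hy2 (k := a + 2) (by simp)
          exact .inr ⟨t, ht, by simp [e₁, hx0, hy1]⟩
    · simp
    · intro x hx h1
      by_contra! h0
      simp at hx h1 h0
      obtain ⟨h2, h4, h3⟩ := h0
      by_cases hz : x 2 = 0
      · exact h1 (by simpa [hz] using h2) hz
      have hj : (j : ℂ) + 2 ≠ 0 := by norm_cast
      have h5 : x 0 ^ (a + 1) + x 1 = 0 := by
        refine (mul_eq_zero.1 ?_).resolve_right (mul_ne_zero hj (pow_ne_zero (j + 1) hz))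
        linear_combination h3
      have h6 : x 0 * x 1 ^ 2 = 0 := by linear_combination hx - x 2 ^ (j + 2) * h5
      rcases mul_eq_zero.1 h6 with h | h
      · simp [h, hz] at h4
      · simp [pow_eq_zero_iff two_ne_zero |>.1 h, hz] at h4
    · intro x hx h1
      simp_all

theorem hasDolgachev_IV2sharp {a j : ℕ} (h : a + 2 < (a + 1) * (j + 2))
    (hred : FacetsReduced (VirtualType.IV2sharp (a + 1) (j + 2)).h) :
    HasTypeDolgachev (.IV2sharp (a + 1) (j + 2)) ![j + 2, a + 2, (a + 1) * (j + 2), j + 2] := by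
  have D : IsBifacial ![![0, 1, j + 2], ![a + 2, 0, 1], ![a + 2, 1, 0], ![1, 2, 0]]
      ![j + 2, a + 2, a + 2] ![j + 2, (a + 1) * (j + 2), a + 2]
      ((a + 2) * (j + 3)) ((j + 2) * (2 * a + 3)) := by
    refine ⟨?_, ?_, ?_, ?_, ?_, ?_, ?_, ?_,
      ![2 * a + 3, (j + 2) * (2 * a + 3), (j + 2) * (2 * a + 3) + (j + 3),
        (a + 2) * (j + 3)], ?_, ?_⟩
    all_goals simp [Matrix.det_fin_three]
    all_goals first | ring1 | constructorm* _ ∧ _ <;> ring1 | nlinarith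
  refine (D.hasDolgachevNumbers_of ![![2 * (a + 1) + 1, 0, 0], ![1, 2, 0], ![0, 1, j + 2]] ?_ ?_ ?_ hred
    fun hw₁ hw₂ => ⟨?_, ?_⟩).2
  · simp
    constructorm* _ ∧ _ <;> ring
  · simp [ofExponents_eq]
  · simp [ofExponents_eq, Fin.sum_univ_four]
    ring
  · exact hasExceptionalOrders_principalPart_of_eq (r := a) (s := a) rfl rfl
      (fun m h₁ h₂ => h₂) hw₁ (by simp [ofExponents_eq]; ring)
  · rw [principalPart_of_containsHyperplane 1]
    · refine hasExceptionalOrders_of ![![0, 1, 0], ![1, -1, 0]] (by simp) ?_ ?_ (by simp) ?_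
      · simp
        nlinarith
      · simp
        exact fun r h => h.mul_left _
      · rintro y ⟨hy, hy0⟩ r hr hry
        simp at hy hy0 hry
        rw [Fin.exists_fin_two]
        have hy1 : y 2 ^ (j + 2) + y 0 ^ (a + 2) + y 0 * y 1 = 0 := by
          refine (mul_eq_zero.1 ?_).resolve_left hy0
          linear_combination hy
        by_cases hx0 : y 0 = 0
        · have hy2 : y 2 = 0 := by simpa [hx0] using hy1
          obtain ⟨t, ht, e₁⟩ := exists_pow_eq hy0 (k := (a + 1) * (j + 2)) (by simp)
          exact .inl ⟨t, ht, by simp [e₁, hx0, hy2]⟩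
        · have hy2 : y 2 = 0 := by
            by_contra hy2
            exact hr.one_lt.ne' (hw₂.eq_one (by simp [hry, hx0, hy0, hy2]))
          obtain ⟨t, ht, e₁⟩ := exists_pow_eq hx0 (k := j + 2) (by simp)
          have : y 1 = -y 0 ^ (a + 1) := by
            refine mul_left_cancel₀ hx0 ?_
            simp [hy2] at hy1
            linear_combination hy1
          exact .inr ⟨t, ht, by simp [this, mul_comm (a + 1), pow_mul, e₁, hy2]⟩
    · intro x hx
      simp [hx]
    · simp only [Fin.forall_fin_succ]
      exact ⟨fun _ => ⟨![0, 1, 1], by simp⟩, by simp, fun _ => ⟨![1, 1, 0], by simp [one_add_one_eq_two]⟩, by simp⟩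

end

theorem IsWeights.sum_mul_eq {A : Fin 3 → Fin 3 → ℕ} {w : Fin 3 → ℕ} {d : ℕ}
    (h : IsWeights (ofExponents A 1) w d) (hA : Function.Injective A) (i : Fin 3) :
    A i 0 * w 0 + A i 1 * w 1 + A i 2 * w 2 = d := by
  rw [← h.2 (d := Finsupp.equivFunOnFinite.symm (A i)) (by simp [coeff_ofExponents hA]),
    Finsupp.weight_apply, Finsupp.sum_fintype _ _ (by simp), Fin.sum_univ_three]
  rfl

theorem VirtualType.IsAdmissible.exists_weights {c : VirtualType} (h : c.IsAdmissible)
    {A : Fin 3 → Fin 3 → ℕ} (hA : Function.Injective A) (hf : c.f = ofExponents A 1) :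
    ∃ w : Fin 3 → ℕ, (∀ i, 0 < w i) ∧ ∃ d, (∀ i, A i 0 * w 0 + A i 1 * w 1 + A i 2 * w 2 = d) ∧
      w 0 + w 1 + w 2 < d := by
  obtain ⟨-, w, d, -, hw, -, hd⟩ := h
  rw [hf] at hw
  exact ⟨w, hw.1, d, hw.sum_mul_eq hA, hd⟩

theorem lt_of_isAdmissible_IIA {p e : ℕ} (h : (VirtualType.IIA p e).IsAdmissible) :
    3 * e + p < 2 * e * p := by
  obtain ⟨w, hw, d, hs, hd⟩ := h.exists_weights (A := ![![3, 0, 0], ![1, 2 * e, 0], ![0, 0, p]])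
    (by
      intro i j h
      have h0 := congrFun h 0
      fin_cases i <;> fin_cases j <;> simp at h0 ⊢)
    (by simp [ofExponents_eq, Fin.sum_univ_three])
  have hp := h.1.1
  have he := h.1.2
  simp [Fin.forall_fin_succ] at hs
  obtain ⟨h0, h1, h2⟩ := hs
  refine Nat.lt_of_mul_lt_mul_right (a := d) ?_
  have h1 : 3 * e * w 1 = d := by nlinarith
  have : 3 * e * p * (w 0 + w 1 + w 2) < 3 * e * p * d := by gcongr
  zify at *
  linear_combination this - 3 * e * h2 - p * h1 - e * p * h0

theorem lt_of_isAdmissible_III {p e : ℕ} (h : (VirtualType.III p e).IsAdmissible) :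
    3 * e + 1 < 2 * e * p := by
  obtain ⟨w, hw, d, hs, hd⟩ := h.exists_weights
    (A := ![![3, 1, 0], ![1, 2 * e + 1, 0], ![0, 0, p]])
    (by
      intro i j h
      have h0 := congrFun h 0
      fin_cases i <;> fin_cases j <;> simp at h0 ⊢)
    (by simp [ofExponents_eq, Fin.sum_univ_three])
  have hp := h.1.1
  simp [Fin.forall_fin_succ] at hs
  obtain ⟨h0, h1, h2⟩ := hs
  refine Nat.lt_of_mul_lt_mul_right (a := w 1) ?_
  have h3 : w 0 = e * w 1 := by nlinarith
  have : p * (w 0 + w 1 + w 2) < p * d := by gcongr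
  rw [h3] at h0 this
  zify at *
  linear_combination this + (1 - p) * h0 - h2

theorem lt_of_isAdmissible_IV1 {e q : ℕ} (h : (VirtualType.IV1 e q).IsAdmissible) :
    3 * e + q < 2 * e * q + 1 := by
  obtain ⟨w, hw, d, hs, hd⟩ := h.exists_weights
    (A := ![![3, 0, 0], ![1, 2 * e, 0], ![0, 1, q]])
    (by
      intro i j h
      have h0 := congrFun h 0
      fin_cases i <;> fin_cases j <;> simp at h0 ⊢)
    (by simp [ofExponents_eq, Fin.sum_univ_three])
  have hq := h.1.2
  simp [Fin.forall_fin_succ] at hs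
  obtain ⟨h0, h1, h2⟩ := hs
  refine Nat.lt_of_mul_lt_mul_right (a := w 1) ?_
  have h3 : w 0 = e * w 1 := by nlinarith
  have : q * (w 0 + w 1 + w 2) < q * d := by gcongr
  rw [h3] at h0 this
  zify at *
  linear_combination this + (1 - q) * h0 - h2

theorem lt_of_isAdmissible_IIB {p q : ℕ} {c : VirtualType} (h : c.IsAdmissible) (hq : 1 ≤ q)
    (hc : c.f = X 0 ^ (2 * p) + X 1 ^ 2 + X 1 * X 2 ^ q) : p + q < p * q := by
  obtain ⟨w, hw, d, hs, hd⟩ := h.exists_weights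
    (A := ![![2 * p, 0, 0], ![0, 2, 0], ![0, 1, q]])
    (by
      intro i j h
      have h0 := congrFun h 0
      have h1 := congrFun h 1
      fin_cases i <;> fin_cases j <;> simp at h0 h1 ⊢)
    (by rw [hc]; simp [ofExponents_eq, Fin.sum_univ_three])
  simp [Fin.forall_fin_succ] at hs
  obtain ⟨h0, h1, h2⟩ := hs
  refine Nat.lt_of_mul_lt_mul_right (a := w 0) ?_
  have h3 : w 1 = p * w 0 := by nlinarith
  have : q * (w 0 + w 1 + w 2) < q * d := by gcongr
  rw [h3] at h1 h2 this
  zify at *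
  linear_combination this + (1 - q) * h1 - h2

theorem lt_of_isAdmissible_IV2 {e q : ℕ} {c : VirtualType} (h : c.IsAdmissible) (hq : 1 ≤ q)
    (hc : c.f = X 0 ^ (2 * e + 1) + X 0 * X 1 ^ 2 + X 1 * X 2 ^ q) : e + 1 < e * q := by
  obtain ⟨w, hw, d, hs, hd⟩ := h.exists_weights
    (A := ![![2 * e + 1, 0, 0], ![1, 2, 0], ![0, 1, q]])
    (by
      intro i j h
      have h0 := congrFun h 0
      have h1 := congrFun h 1
      fin_cases i <;> fin_cases j <;> simp at h0 h1 ⊢)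
    (by rw [hc]; simp [ofExponents_eq, Fin.sum_univ_three])
  simp [Fin.forall_fin_succ] at hs
  obtain ⟨h0, h1, h2⟩ := hs
  refine Nat.lt_of_mul_lt_mul_right (a := w 0) ?_
  have h3 : w 1 = e * w 0 := by nlinarith
  have : q * (w 0 + w 1 + w 2) < q * d := by gcongr
  rw [h3] at h1 h2 this
  zify at *
  linear_combination this + (1 - q) * h1 - h2

theorem exists_of_forall_eq {k : ℕ} {P Q : (Fin k → ℕ) → Prop} {α β : Fin k → ℕ} (hP : P α)
    (hQ : Q β) (h : ∀ i, β i = α i) : ∃ α, P α ∧ Q α :=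
  ⟨α, hP, funext h ▸ hQ⟩

/-- The claim of the main theorem for one type. -/
def NumbersCoincide (c : VirtualType) : Prop :=
  (IsReducedWeights c.dualWeights →
    ∃ α, HasTriGabrielov c α ∧ HasPairDolgachev c α) ∧
  (FacetsReduced c.h → ∃ α, HasPairGabrielov c α ∧ HasTypeDolgachev c α)

theorem numbersCoincide_IIA {p e : ℕ} (h : (VirtualType.IIA p e).IsAdmissible) :
    NumbersCoincide (.IIA p e) := by
  have hlt := lt_of_isAdmissible_IIA h
  have he := h.1.2
  obtain ⟨n, rfl⟩ := Nat.exists_eq_add_of_le' (show 2 ≤ p by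
    by_contra! hp
    interval_cases p <;> omega)
  rcases n with _ | n
  · obtain ⟨k, rfl⟩ := Nat.exists_eq_add_of_le' (show 3 ≤ e by omega)
    exact ⟨fun hr => exists_of_forall_eq hasGabrielov_IIA_two
        ((pairDolgachev_IIA (k := k + 1) le_rfl hr).perm (.swap 1 2))
        (by simp [Fin.forall_fin_succ, Equiv.swap_apply_def]; ring),
      fun hred => exists_of_forall_eq pairGabrielov_IIA_two
        (hasDolgachev_IIA (j := 0) (e := k + 1) hlt hred) (by simp)⟩
  · obtain ⟨k, rfl⟩ := Nat.exists_eq_add_of_le' he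
    refine ⟨fun hr => ?_, fun hred => exists_of_forall_eq pairGabrielov_IIA
      (hasDolgachev_IIA (j := n + 1) hlt hred) (by simp [Fin.forall_fin_succ]; ring)⟩
    rcases n with _ | n
    · exact absurd (hr.eq_one (r := 3) (by simp [VirtualType.dualWeights, Fin.forall_fin_succ]))
        (by simp)
    · exact exists_of_forall_eq hasGabrielov_IIA (pairDolgachev_IIA (by omega) hr)
        (by simp)

theorem numbersCoincide_III {p e : ℕ} (h : (VirtualType.III p e).IsAdmissible) :
    NumbersCoincide (.III p e) := by
  have hlt := lt_of_isAdmissible_III h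
  obtain ⟨k, rfl⟩ := Nat.exists_eq_add_of_le' h.1.2
  obtain ⟨n, rfl⟩ := Nat.exists_eq_add_of_le' (show 2 ≤ p by
    by_contra! hp
    interval_cases p <;> omega)
  rcases n with _ | n
  · obtain ⟨k, rfl⟩ := Nat.exists_eq_add_of_le' (show 1 ≤ k by omega)
    exact ⟨fun hr => exists_of_forall_eq hasGabrielov_III_two
        ((pairDolgachev_III le_rfl (by omega) hr).perm (.swap 1 2))
        (by simp [Fin.forall_fin_succ, Equiv.swap_apply_def]; ring),
      fun hred => exists_of_forall_eq pairGabrielov_III_two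
        (hasDolgachev_III (j := 0) hlt hred).2 (by simp [Fin.forall_fin_succ]; ring)⟩
  · refine ⟨fun hr => exists_of_forall_eq hasGabrielov_III
      (pairDolgachev_III (by omega) (by omega) hr) (by simp),
      fun hred => ?_⟩
    obtain ⟨hk, hD⟩ := hasDolgachev_III (j := n + 1) hlt hred
    obtain ⟨k, rfl⟩ := Nat.exists_eq_succ_of_ne_zero hk
    exact exists_of_forall_eq pairGabrielov_III hD (by simp [Fin.forall_fin_succ]; ring)

theorem numbersCoincide_IIB {p q : ℕ} (h : (VirtualType.IIB p q).IsAdmissible) :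
    NumbersCoincide (.IIB p q) := by
  have hlt := lt_of_isAdmissible_IIB h h.1.2 rfl
  obtain ⟨k, rfl⟩ := Nat.exists_eq_add_of_le' (show 2 ≤ q by
    by_contra! hq
    interval_cases q <;> omega)
  obtain ⟨n, rfl⟩ := Nat.exists_eq_add_of_le' (show 2 ≤ p by
    by_contra! hp
    interval_cases p <;> omega)
  rcases n with _ | n
  · obtain ⟨k, rfl⟩ := Nat.exists_eq_add_of_le' (show 1 ≤ k by omega)
    exact ⟨fun hr => exists_of_forall_eq hasGabrielov_IIB_two (pairDolgachev_IIB le_rfl hr)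
        (by simp),
      fun hred => exists_of_forall_eq pairGabrielov_IIB_two
        (hasDolgachev_IIB (a := 0) (j := k + 1) hlt hred) (by simp [Fin.forall_fin_succ]; ring)⟩
  · exact ⟨fun hr => exists_of_forall_eq hasGabrielov_IIB (pairDolgachev_IIB (by omega) hr)
        (by simp),
      fun hred => exists_of_forall_eq pairGabrielov_IIB
        (hasDolgachev_IIB (a := n + 1) hlt hred) (by simp [Fin.forall_fin_succ]; ring)⟩

theorem numbersCoincide_IIBsharp {p q : ℕ} (h : (VirtualType.IIBsharp p q).IsAdmissible) :
    NumbersCoincide (.IIBsharp p q) := by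
  have hlt := lt_of_isAdmissible_IIB h h.1.2 rfl
  obtain ⟨n, rfl⟩ := Nat.exists_eq_add_of_le' (show 2 ≤ p by
    by_contra! hq
    interval_cases p <;> omega)
  obtain ⟨k, rfl⟩ := Nat.exists_eq_add_of_le' (show 2 ≤ q by
    by_contra! hq
    interval_cases q <;> omega)
  refine ⟨fun hr => ?_, fun hred => ?_⟩
  · have hD := pairDolgachev_IIBsharp hr
    rcases n with _ | n <;> rcases k with _ | k
    · omega
    · exact exists_of_forall_eq hasGabrielov_IIBsharp_two_left hD
        (by simp [Fin.forall_fin_succ]; ring)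
    · exact exists_of_forall_eq hasGabrielov_IIBsharp_two_right hD
        (by simp [Fin.forall_fin_succ]; ring)
    · exact exists_of_forall_eq hasGabrielov_IIBsharp hD
        (by simp [Fin.forall_fin_succ]; constructor <;> ring)
  · have hD := hasDolgachev_IIBsharp hlt hred
    rcases n with _ | n <;> rcases k with _ | k
    · omega
    · exact exists_of_forall_eq pairGabrielov_IIBsharp_two_left hD (by simp)
    · exact exists_of_forall_eq pairGabrielov_IIBsharp_two_right hD (by simp)
    · exact exists_of_forall_eq pairGabrielov_IIBsharp hD (by simp)

theorem numbersCoincide_IV1 {e q : ℕ} (h : (VirtualType.IV1 e q).IsAdmissible) :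
    NumbersCoincide (.IV1 e q) := by
  have hlt := lt_of_isAdmissible_IV1 h
  obtain ⟨k, rfl⟩ := Nat.exists_eq_add_of_le' h.1.1
  obtain ⟨n, rfl⟩ := Nat.exists_eq_add_of_le' (show 2 ≤ q by
    have := h.1.2
    by_contra! hq
    interval_cases q <;> omega)
  refine ⟨fun hr => ?_, fun hred => ?_⟩
  · have hD := pairDolgachev_IV1 (by
      by_contra! h0
      obtain ⟨rfl, rfl⟩ : k = 0 ∧ n = 0 := by omega
      omega) hr
    rcases n with _ | n
    · obtain ⟨k, rfl⟩ := Nat.exists_eq_add_of_le' (show 1 ≤ k by omega)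
      exact exists_of_forall_eq hasGabrielov_IV1_two hD (by simp [Fin.forall_fin_succ]; ring)
    · exact exists_of_forall_eq hasGabrielov_IV1 hD (by simp)
  · have hD := hasDolgachev_IV1 hlt hred
    rcases n with _ | n
    · obtain ⟨k, rfl⟩ := Nat.exists_eq_add_of_le' (show 1 ≤ k by omega)
      exact exists_of_forall_eq pairGabrielov_IV1_two hD (by simp [Fin.forall_fin_succ]; ring)
    · rcases k with _ | k
      · exact exists_of_forall_eq pairGabrielov_IV1_one hD (by simp [Fin.forall_fin_succ]; ring)
      · exact exists_of_forall_eq pairGabrielov_IV1 hD (by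
          simp [Fin.forall_fin_succ]; constructor <;> ring)

theorem numbersCoincide_IV2 {e q : ℕ} (h : (VirtualType.IV2 e q).IsAdmissible) :
    NumbersCoincide (.IV2 e q) := by
  have hlt := lt_of_isAdmissible_IV2 h h.1.2 rfl
  obtain ⟨k, rfl⟩ := Nat.exists_eq_add_of_le' h.1.1
  obtain ⟨n, rfl⟩ := Nat.exists_eq_add_of_le' (show 2 ≤ q by
    by_contra! hq
    interval_cases q <;> omega)
  refine ⟨fun hr => ?_, fun hred => ?_⟩
  · have hD := pairDolgachev_IV2 (by omega) hr
    rcases n with _ | n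
    · obtain ⟨k, rfl⟩ := Nat.exists_eq_add_of_le' (show 1 ≤ k by omega)
      exact exists_of_forall_eq hasGabrielov_IV2_two hD (by simp [Fin.forall_fin_succ]; ring)
    · exact exists_of_forall_eq hasGabrielov_IV2 hD (by simp [Fin.forall_fin_succ]; ring)
  · have hD := hasDolgachev_IV2 hlt hred
    rcases n with _ | n
    · obtain ⟨k, rfl⟩ := Nat.exists_eq_add_of_le' (show 1 ≤ k by omega)
      exact exists_of_forall_eq pairGabrielov_IV2_two hD (by simp)
    · rcases k with _ | k
      · exact exists_of_forall_eq pairGabrielov_IV2_one hD (by simp [Fin.forall_fin_succ]; ring)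
      · exact exists_of_forall_eq pairGabrielov_IV2 hD (by simp [Fin.forall_fin_succ]; ring)

theorem numbersCoincide_IV2sharp {e q : ℕ} (h : (VirtualType.IV2sharp e q).IsAdmissible) :
    NumbersCoincide (.IV2sharp e q) := by
  have hlt := lt_of_isAdmissible_IV2 h h.1.2 rfl
  obtain ⟨k, rfl⟩ := Nat.exists_eq_add_of_le' h.1.1
  obtain ⟨n, rfl⟩ := Nat.exists_eq_add_of_le' (show 2 ≤ q by
    by_contra! hq
    interval_cases q <;> omega)
  refine ⟨fun hr => ?_, fun hred => ?_⟩
  · have hD := pairDolgachev_IV2sharp (by omega) hr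
    rcases n with _ | n
    · obtain ⟨k, rfl⟩ := Nat.exists_eq_add_of_le' (show 1 ≤ k by omega)
      exact exists_of_forall_eq hasGabrielov_IV2sharp_two hD
        (by simp [Fin.forall_fin_succ]; ring)
    · rcases k with _ | k
      · exact exists_of_forall_eq hasGabrielov_IV2sharp_one hD
          (by simp [Fin.forall_fin_succ]; ring)
      · exact exists_of_forall_eq hasGabrielov_IV2sharp hD (by simp [Fin.forall_fin_succ]; ring)
  · have hD := hasDolgachev_IV2sharp hlt hred
    rcases n with _ | n
    · obtain ⟨k, rfl⟩ := Nat.exists_eq_add_of_le' (show 1 ≤ k by omega)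
      exact exists_of_forall_eq pairGabrielov_IV2sharp_two hD (by simp [Fin.forall_fin_succ]; ring)
    · exact exists_of_forall_eq pairGabrielov_IV2sharp hD (by simp [Fin.forall_fin_succ])

end

theorem mainTheorem3 (c : VirtualType) (hc : c.IsAdmissible) :
    (IsReducedWeights c.dualWeights →
      ∃ α : Fin 3 → ℕ,
        HasGabrielovNumbers c.h α ∧ PairHasDolgachevNumbers c.dual₁ c.dual₂ α) ∧
    ((∀ (F : Set (Fin 3 → ℝ)) (w : Fin 3 → ℕ) (d : ℕ), IsOuterFacet c.h F →
        IsCanonicalWeights (facePart c.h F) w d → IsReducedWeights w) →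
      ∃ α : Fin 4 → ℕ,
        PairHasGabrielovNumbers c.dual₁ c.dual₂ α ∧ HasDolgachevNumbers c.f c.h α) := by
  cases c with
  | IIA p e => exact numbersCoincide_IIA hc
  | IIB p q => exact numbersCoincide_IIB hc
  | IIBsharp p q => exact numbersCoincide_IIBsharp hc
  | III p e => exact numbersCoincide_III hc
  | IV1 e q => exact numbersCoincide_IV1 hc
  | IV2 e q => exact numbersCoincide_IV2 hc
  | IV2sharp e q => exact numbersCoincide_IV2sharp hc
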